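/- Conventions. A para-Kähler–Einstein (pKE) structure on a smooth 4-manifold $M$ is a pair $(g,K)$, where $g$ is a smooth pseudo-Riemannian metric of signature $(2,2)$ and $K$ a smooth endomorphism field with $K^2=\mathrm{id}$ and $g(KX,KY)=-g(X,Y)$, such that both eigendistributions of $K$ are integrable, the 2-form $g(K\cdot,\cdot)$ is closed and $\mathrm{Ric}(g)=\Lambda g$ with $\Lambda$ constant. An adapted coframe $(\alpha^1,\alpha^2,\bar\alpha^1,\bar\alpha^2)=(\theta^1,\theta^2,\theta^3,\theta^4)$ is one with $g=2\alpha^1\bar\alpha^1+2\alpha^2\bar\alpha^2$ and $K=+1$ (resp. $-1$) on the vectors dual to $\alpha^1,\alpha^2$ (resp. $\bar\alpha^1,\bar\alpha^2$). In it the Weyl tensor has the components $\Psi_0=C_{1414}$, $\Psi_1=C_{2414}$, $\Psi_2=-C_{1423}$, $\Psi_3=C_{1323}$, $\Psi_4=C_{2323}$ (these form $Weyl^-$) and $\Psi_2'=C_{1234}$. The Petrov type of $Weyl^-$ is the root type of the binary quartic $\Psi_4\lambda^4+4\Psi_3\lambda^3+6\Psi_2\lambda^2+4\Psi_1\lambda+\Psi_0$;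 "special real" means here that the quartic is nonzero and has a repeated real root, i.e. the type is $II$ (one double real root and two simple roots, real or complex conjugate), $III$ (one triple root), $D$ (two double real roots) or $N$ (one quadruple root). Let $k\ge 2$ be the multiplicity of the repeated root, let $\mathcal F^7$ be the set of adapted coframes with $\Psi_0=\dots=\Psi_{k-1}=0\ne\Psi_k$, and let $\mathcal F^6\subset\mathcal F^7$ be the subset where moreover $\Psi_3=0$ (types $II$, $D$), $\Psi_4=0$ (type $III$), or $\Psi_{43}=0$ (type $N$); here $\Psi_{4a}=(\nabla_{a}C)_{2323}$, the index $a$ referring to the frame dual to $\theta^1,\dots,\theta^4$. Let $\mathbf T^2=\{\mathrm{diag}(a_{11},a_{22},a_{11}^{-1},a_{22}^{-1})\}\cong\mathbb R^\times\times\mathbb R^\times$. Theorem. $\mathbf T^2$ is a maximal (its own centralizer) torus in $\mathbf{SO}_{2,2}$, and $\mathfrak{so}_{2,2}\cong\mathfrak{sl}_2(\mathbb R)\oplus\mathfrak{sl}_2(\mathbb R)$ (block-diagonal $4\times4$ matrices) by an isomorphism that takes the Lie algebra of $\mathbf T^2$ to the diagonal matrices. Let $(M,g,K)$ be a pKE structure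 on a 4-manifold with $\Psi_2'=\mathrm{const}\neq0$ whose $Weyl^-$ has the same special real Petrov type at every point. (1) Around each point there is a smooth principal $\mathbf T^2$-bundle of adapted coframes, contained in $\mathcal F^7$ and, if the type is not $N$, in $\mathcal F^6$. If the type is $II$ or $III$, or if it is $N$ and $\Psi_{44}\neq0$ on $\mathcal F^7$, then $\mathcal F^6\to M$ itself is such a bundle, over all of $M$. (2) Let $\mathcal P\subset\mathcal F^7$ be any smooth principal $\mathbf T^2$-bundle of coframes over an open subset of $M$. There are 1-forms $\Gamma^A{}_B$ $(A,B=1,2)$ and smooth functions $J_1,\dots,J_6$ on $\mathcal P$ such that, for the tautological forms $\alpha^A,\bar\alpha^A$ on $\mathcal P$, $$\begin{aligned} &d\alpha^1=-\Gamma^1{}_1\wedge\alpha^1-\Gamma^1{}_2\wedge\alpha^2,\quad d\alpha^2=-\Gamma^2{}_1\wedge\alpha^1-\Gamma^2{}_2\wedge\alpha^2,\\ &d\bar\alpha^1=\Gamma^1{}_1\wedge\bar\alpha^1+\Gamma^2{}_1\wedge\bar\alpha^2,\quad d\bar\alpha^2=\Gamma^1{}_2\wedge\bar\alpha^1+\Gamma^2{}_2\wedge\bar\alpha^2,\\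 &d\Gamma^1{}_1=-\Gamma^1{}_2\wedge\Gamma^2{}_1+(-2\Psi_2'-\Psi_2)\alpha^1\wedge\bar\alpha^1+\Psi_1\alpha^1\wedge\bar\alpha^2-\Psi_3\alpha^2\wedge\bar\alpha^1+(\Psi_2-\Psi_2')\alpha^2\wedge\bar\alpha^2,\\ &d\Gamma^1{}_2=-\Gamma^1{}_1\wedge\Gamma^1{}_2-\Gamma^1{}_2\wedge\Gamma^2{}_2-\Psi_3\alpha^1\wedge\bar\alpha^1+(\Psi_2-\Psi_2')\alpha^1\wedge\bar\alpha^2-\Psi_4\alpha^2\wedge\bar\alpha^1+\Psi_3\alpha^2\wedge\bar\alpha^2,\\ &d\Gamma^2{}_1=\Gamma^1{}_1\wedge\Gamma^2{}_1+\Gamma^2{}_1\wedge\Gamma^2{}_2+\Psi_1\alpha^1\wedge\bar\alpha^1-\Psi_0\alpha^1\wedge\bar\alpha^2+(\Psi_2-\Psi_2')\alpha^2\wedge\bar\alpha^1-\Psi_1\alpha^2\wedge\bar\alpha^2,\\ &d\Gamma^2{}_2=\Gamma^1{}_2\wedge\Gamma^2{}_1+(\Psi_2-\Psi_2')\alpha^1\wedge\bar\alpha^1-\Psi_1\alpha^1\wedge\bar\alpha^2+\Psi_3\alpha^2\wedge\bar\alpha^1+(-2\Psi_2'-\Psi_2)\alpha^2\wedge\bar\alpha^2,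 \end{aligned}$$ and $$\Gamma^2{}_1=J_1\alpha^2+J_2\bar\alpha^1,\qquad \Gamma^1{}_2=-J_3\alpha^1+J_6\alpha^2+J_5\bar\alpha^1+J_4\bar\alpha^2 .$$ (In type $N$ one has $\Psi_{44}=J_2\Psi_4$.) For each sign $\sigma=\pm1$ the $\mathfrak{so}_{2,2}$-valued form $$\mathcal B_\sigma=\begin{pmatrix}\tfrac12\Gamma^1{}_1&s\,\alpha^1&0&0\\ \sigma s\,\bar\alpha^1&-\tfrac12\Gamma^1{}_1&0&0\\0&0&\tfrac12\Gamma^2{}_2&s\,\alpha^2\\0&0&\sigma s\,\bar\alpha^2&-\tfrac12\Gamma^2{}_2\end{pmatrix},\qquad s=\sqrt{\tfrac32|\Psi_2'|},$$ is a Cartan connection on $\mathcal P$, that is, $\mathcal P$ with $\mathcal B_\sigma$ is a Cartan geometry modelled on $(\mathfrak{so}_{2,2},\mathbf T^2)$: $\mathcal B_\sigma$ is an isomorphism $T_u\mathcal P\to\mathfrak{so}_{2,2}$ at each point, it reproduces the generators of the fundamental vector fields, the Lie algebra $\mathbb R^2$ of $\mathbf T^2$ being embedded by $(c_1,c_2)\mapsto\frac12\mathrm{diag}(c_1,-c_1,c_2,-c_2)$,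 and $R_h^*\mathcal B_\sigma=\mathrm{Ad}(h^{-1})\mathcal B_\sigma$, where $\mathrm{Ad}(h)$ is conjugation by $\mathrm{diag}(a_{11},1,a_{22},1)$. (3) For $\sigma=\mathrm{sign}\,\Psi_2'$, the geometry is flat, $d\mathcal B_\sigma+\mathcal B_\sigma\wedge\mathcal B_\sigma=0$, if and only if $J_1=\dots=J_6=\Psi_4=0$ and $\Psi_2=\Psi_2'$ on $\mathcal P$; and in that case $Weyl^-$ has Petrov type $D$ on the base of $\mathcal P$. -/

import Mathlib

open scoped Manifold ContDiff Matrix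

universe u

namespace PKE

/-! ### Differential forms on manifolds modelled on a normed space -/

/-- (Not necessarily smooth) real 1-forms on the manifold `N`. -/
abbrev Form1 (E : Type) [NormedAddCommGroup E] [NormedSpace ℝ E]
    (N : Type u) [TopologicalSpace N] [ChartedSpace E N] : Type u :=
  (p : N) → TangentSpace 𝓘(ℝ, E) p →L[ℝ] ℝ

/-- Smoothness of a 1-form, as a section of the cotangent bundle. -/
def SmoothForm {E : Type} [NormedAddCommGroup E] [NormedSpace ℝ E]
    {N : Type u} [TopologicalSpace N] [ChartedSpace E N] [IsManifold 𝓘(ℝ, E) ∞ N]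
    (β : Form1 E N) : Prop :=
  haveI : IsManifold 𝓘(ℝ, E) 1 N := IsManifold.of_le (n := ∞) (by simp)
  ContMDiff 𝓘(ℝ, E) (𝓘(ℝ, E).prod 𝓘(ℝ, E →L[ℝ] ℝ)) ∞
    (fun p => Bundle.TotalSpace.mk' (E →L[ℝ] ℝ)
      (E := fun q : N => TangentSpace 𝓘(ℝ, E) q →L[ℝ] ℝ) p (β p))

/-- The tangent vector, at the point whose coordinates in the preferred chart around `p` are `y`,
which has the components `v` in that chart. -/
noncomputable def chartVec {E : Type} [NormedAddCommGroup E] [NormedSpace ℝ E]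
    {N : Type u} [TopologicalSpace N] [ChartedSpace E N] (p : N) (y v : E) :
    TangentSpace 𝓘(ℝ, E) ((extChartAt 𝓘(ℝ, E) p).symm y) :=
  mfderiv 𝓘(ℝ, E) 𝓘(ℝ, E) (extChartAt 𝓘(ℝ, E) p).symm y v

/-- The components of a tangent vector at `p` in the preferred chart around `p`. -/
noncomputable def chartComp {E : Type} [NormedAddCommGroup E] [NormedSpace ℝ E]
    {N : Type u} [TopologicalSpace N] [ChartedSpace E N] (p : N)
    (v : TangentSpace 𝓘(ℝ, E) p) : E :=
  mfderiv 𝓘(ℝ, E) 𝓘(ℝ, E) (extChartAt 𝓘(ℝ, E) p) p v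

/-- The exterior derivative `(dβ)_p (v, w)` of a 1-form, computed in the preferred chart around `p`:
`∂_v (β w) - ∂_w (β v)` for the constant extensions of `v`, `w` in that chart. -/
noncomputable def extD {E : Type} [NormedAddCommGroup E] [NormedSpace ℝ E]
    {N : Type u} [TopologicalSpace N] [ChartedSpace E N] (β : Form1 E N) (p : N)
    (v w : TangentSpace 𝓘(ℝ, E) p) : ℝ :=
  fderiv ℝ (fun y : E => β ((extChartAt 𝓘(ℝ, E) p).symm y) (chartVec p y (chartComp p w)))
      (extChartAt 𝓘(ℝ, E) p p) (chartComp p v)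
    - fderiv ℝ (fun y : E => β ((extChartAt 𝓘(ℝ, E) p).symm y) (chartVec p y (chartComp p v)))
      (extChartAt 𝓘(ℝ, E) p p) (chartComp p w)

/-- The wedge product `(β ∧ γ)_p (v, w) = β v γ w - β w γ v` of two 1-forms. -/
noncomputable def wedge {E : Type} [NormedAddCommGroup E] [NormedSpace ℝ E]
    {N : Type u} [TopologicalSpace N] [ChartedSpace E N] (β γ : Form1 E N) (p : N)
    (v w : TangentSpace 𝓘(ℝ, E) p) : ℝ :=
  β p v * γ p w - β p w * γ p v

/-! ### Para-Kähler–Einstein structures on 4-manifolds -/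

/-- The model space `ℝ⁴`. -/
abbrev E4 : Type := EuclideanSpace ℝ (Fin 4)

/-- Fields of bilinear forms. -/
abbrev BilinField (M : Type u) [TopologicalSpace M] [ChartedSpace E4 M] : Type u :=
  (p : M) → TangentSpace (𝓡 4) p →L[ℝ] TangentSpace (𝓡 4) p →L[ℝ] ℝ

/-- Fields of endomorphisms. -/
abbrev EndField (M : Type u) [TopologicalSpace M] [ChartedSpace E4 M] : Type u :=
  (p : M) → TangentSpace (𝓡 4) p →L[ℝ] TangentSpace (𝓡 4) p

/-- The coordinate vector `∂_i` of the preferred chart around `p`, at the point with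
coordinates `y`. -/
noncomputable def coordVec {M : Type u} [TopologicalSpace M] [ChartedSpace E4 M]
    (p : M) (i : Fin 4) (y : E4) : TangentSpace (𝓡 4) ((extChartAt (𝓡 4) p).symm y) :=
  chartVec p y (EuclideanSpace.single i 1)

/-- The partial derivative `∂_i f` on `ℝ⁴`. -/
noncomputable def pd (i : Fin 4) (f : E4 → ℝ) (y : E4) : ℝ :=
  fderiv ℝ f y (EuclideanSpace.single i 1)

section Curvature

variable {M : Type u} [TopologicalSpace M] [ChartedSpace E4 M]

/-- The components `g_ij` of the metric in the preferred chart around `p`. -/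
noncomputable def gLow (g : BilinField M) (p : M) (i j : Fin 4) (y : E4) : ℝ :=
  g ((extChartAt (𝓡 4) p).symm y) (coordVec p i y) (coordVec p j y)

/-- The inverse matrix `g^ij`. -/
noncomputable def gUp (g : BilinField M) (p : M) (i j : Fin 4) (y : E4) : ℝ :=
  (Matrix.of fun k l => gLow g p k l y)⁻¹ i j

/-- The Christoffel symbols `Γ^k_ij` of the Levi-Civita connection. -/
noncomputable def christoffel (g : BilinField M) (p : M) (k i j : Fin 4) (y : E4) : ℝ :=
  (1 / 2) * ∑ l, gUp g p k l y *
    (pd i (gLow g p j l) y + pd j (gLow g p i l) y - pd l (gLow g p i j) y)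

/-- The Riemann tensor `R^k_lij`, i.e. `dΓ^k_l + Γ^k_m ∧ Γ^m_l = ½ R^k_lij dx^i ∧ dx^j`. -/
noncomputable def riemUp (g : BilinField M) (p : M) (k l i j : Fin 4) (y : E4) : ℝ :=
  pd i (christoffel g p k j l) y - pd j (christoffel g p k i l) y
    + ∑ m, (christoffel g p k i m y * christoffel g p m j l y
        - christoffel g p k j m y * christoffel g p m i l y)

/-- `R_abcd = g_ae R^e_bcd`. -/
noncomputable def riem (g : BilinField M) (p : M) (a b c d : Fin 4) (y : E4) : ℝ :=
  ∑ m, gLow g p a m y * riemUp g p m b c d y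

/-- The Ricci tensor `R_ab = R^c_acb`. -/
noncomputable def ricci (g : BilinField M) (p : M) (a b : Fin 4) (y : E4) : ℝ :=
  ∑ c, riemUp g p c a c b y

/-- The scalar curvature `R = g^ab R_ab`. -/
noncomputable def scal (g : BilinField M) (p : M) (y : E4) : ℝ :=
  ∑ a, ∑ b, gUp g p a b y * ricci g p a b y

/-- The Schouten tensor `P_ab = ½ R_ab - (1/12) R g_ab`. -/
noncomputable def schouten (g : BilinField M) (p : M) (a b : Fin 4) (y : E4) : ℝ :=
  (1 / 2) * ricci g p a b y - (1 / 12) * scal g p y * gLow g p a b y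

/-- The Weyl tensor `C_abcd`. -/
noncomputable def weyl (g : BilinField M) (p : M) (a b c d : Fin 4) (y : E4) : ℝ :=
  riem g p a b c d y
    + gLow g p a d y * schouten g p c b y - gLow g p a c y * schouten g p d b y
    + gLow g p b c y * schouten g p d a y - gLow g p b d y * schouten g p c a y

/-- The covariant derivative `∇_m C_abcd` of the Weyl tensor. -/
noncomputable def covWeyl (g : BilinField M) (p : M) (m a b c d : Fin 4) (y : E4) : ℝ :=
  pd m (weyl g p a b c d) y
    - ∑ n, (christoffel g p n m a y * weyl g p n b c d y
        + christoffel g p n m b y * weyl g p a n c d y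
        + christoffel g p n m c y * weyl g p a b n d y
        + christoffel g p n m d y * weyl g p a b c n y)

end Curvature

/-- `dβ = 0` for the 2-form `β`: at each point the cyclic sum of the derivatives of `β` along
constant vector fields in the preferred chart vanishes. -/
def IsClosed2 {M : Type u} [TopologicalSpace M] [ChartedSpace E4 M] (β : BilinField M) : Prop :=
  ∀ (p : M) (i j k : Fin 4),
    pd i (gLow β p j k) (extChartAt (𝓡 4) p p) + pd j (gLow β p k i) (extChartAt (𝓡 4) p p)
      + pd k (gLow β p i j) (extChartAt (𝓡 4) p p) = 0

/-- Smoothness of a vector field on a subset. -/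
def SmoothVecOn {M : Type u} [TopologicalSpace M] [ChartedSpace E4 M] [IsManifold (𝓡 4) ∞ M]
    (X : (p : M) → TangentSpace (𝓡 4) p) (V : Set M) : Prop :=
  haveI : IsManifold (𝓡 4) 1 M := IsManifold.of_le (n := ∞) (by simp)
  ContMDiffOn (𝓡 4) (𝓡 4).tangent ∞ (fun p => (⟨p, X p⟩ : TangentBundle (𝓡 4) M)) V

/-- Integrability of the distribution of the eigenspaces of `K` with eigenvalue `e`: it is closed
under Lie brackets of (local) sections. -/
def IntegrableEigen {M : Type u} [TopologicalSpace M] [ChartedSpace E4 M] [IsManifold (𝓡 4) ∞ M]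
    (K : EndField M) (e : ℝ) : Prop :=
  ∀ (V : Set M), IsOpen V → ∀ X Y : (p : M) → TangentSpace (𝓡 4) p,
    SmoothVecOn X V → SmoothVecOn Y V →
    (∀ p ∈ V, K p (X p) = e • X p) → (∀ p ∈ V, K p (Y p) = e • Y p) →
    ∀ p ∈ V, K p (VectorField.mlieBracket (𝓡 4) X Y p)
      = e • VectorField.mlieBracket (𝓡 4) X Y p

/-- Para-Kähler–Einstein structures. (Nondegeneracy and `K`-compatibility force both eigenspaces of
`K` to be null of rank 2, hence `g` to have signature `(2,2)`.) -/
structure IsParaKahlerEinstein {M : Type u} [TopologicalSpace M] [ChartedSpace E4 M]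
    [IsManifold (𝓡 4) ∞ M] (g : BilinField M) (K : EndField M) : Prop where
  symm : ∀ (p : M) (v w : TangentSpace (𝓡 4) p), g p v w = g p w v
  nondegenerate : ∀ (p : M) (v : TangentSpace (𝓡 4) p), (∀ w, g p v w = 0) → v = 0
  smooth_metric :
    haveI : IsManifold (𝓡 4) 1 M := IsManifold.of_le (n := ∞) (by simp)
    ContMDiff (𝓡 4) ((𝓡 4).prod 𝓘(ℝ, E4 →L[ℝ] E4 →L[ℝ] ℝ)) ∞
      (fun p => Bundle.TotalSpace.mk' (E4 →L[ℝ] E4 →L[ℝ] ℝ)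
        (E := fun q : M => TangentSpace (𝓡 4) q →L[ℝ] TangentSpace (𝓡 4) q →L[ℝ] ℝ) p (g p))
  smooth_K :
    haveI : IsManifold (𝓡 4) 1 M := IsManifold.of_le (n := ∞) (by simp)
    ContMDiff (𝓡 4) ((𝓡 4).prod 𝓘(ℝ, E4 →L[ℝ] E4)) ∞
      (fun p => Bundle.TotalSpace.mk' (E4 →L[ℝ] E4)
        (E := fun q : M => TangentSpace (𝓡 4) q →L[ℝ] TangentSpace (𝓡 4) q) p (K p))
  paracomplex : ∀ (p : M) (v : TangentSpace (𝓡 4) p), K p (K p v) = v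
  compatible : ∀ (p : M) (v w : TangentSpace (𝓡 4) p), g p (K p v) (K p w) = - g p v w
  integrable_plus : IntegrableEigen K 1
  integrable_minus : IntegrableEigen K (-1)
  closed : IsClosed2 (fun p => (g p).comp (K p))
  einstein : ∃ Λ : ℝ, ∀ (p : M) (a b : Fin 4),
    ricci g p a b (extChartAt (𝓡 4) p p) = Λ * gLow g p a b (extChartAt (𝓡 4) p p)

/-! ### Coframes and curvature components -/

/-- The coframe bundle: a point together with a linear coframe `(θ¹, θ², θ³, θ⁴)` (indexed from 0)
of the tangent space. -/
structure Coframe (M : Type u) [TopologicalSpace M] [ChartedSpace E4 M] where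
  pt : M
  form : TangentSpace (𝓡 4) pt ≃L[ℝ] (Fin 4 → ℝ)

/-- The group `T² = {diag(a₁₁, a₂₂)} ≅ ℝˣ × ℝˣ`. -/
abbrev T2 : Type := ℝˣ × ℝˣ

/-- The weights of `T(h) = diag(a₁₁, a₂₂, a₁₁⁻¹, a₂₂⁻¹)`. -/
def torusWeight (h : T2) : Fin 4 → ℝˣ := ![h.1, h.2, h.1⁻¹, h.2⁻¹]

section CoframeComponents

variable {M : Type u} [TopologicalSpace M] [ChartedSpace E4 M]

/-- Change of coframe `θ ↦ T(h) θ`. -/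
noncomputable def Coframe.scale (h : T2) (θ : Coframe M) : Coframe M where
  pt := θ.pt
  form := θ.form.trans (ContinuousLinearEquiv.piCongrRight
    fun a => ContinuousLinearEquiv.unitsEquivAut ℝ (torusWeight h a))

/-- Adapted coframes `(α¹, α², ᾱ¹, ᾱ²)`: `g = 2 α¹ ᾱ¹ + 2 α² ᾱ²` and `K` is `+1` on the first two
vectors of the dual frame, `-1` on the last two. -/
def Adapted (g : BilinField M) (K : EndField M) (θ : Coframe M) : Prop :=
  (∀ v w : TangentSpace (𝓡 4) θ.pt, g θ.pt v w =
      θ.form v 0 * θ.form w 2 + θ.form v 2 * θ.form w 0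
        + θ.form v 1 * θ.form w 3 + θ.form v 3 * θ.form w 1) ∧
  (∀ v : TangentSpace (𝓡 4) θ.pt,
      θ.form (K θ.pt v) = ![θ.form v 0, θ.form v 1, - θ.form v 2, - θ.form v 3])

/-- The coordinates `e_a^i` of the dual frame, in the preferred chart around the base point. -/
noncomputable def Coframe.dual (θ : Coframe M) (a i : Fin 4) : ℝ :=
  (chartComp θ.pt (θ.form.symm (Pi.single a 1)) : E4) i

/-- The components `C_abcd` of the Weyl tensor in a coframe. -/
noncomputable def weylComp (g : BilinField M) (θ : Coframe M) (a b c d : Fin 4) : ℝ :=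
  ∑ i, ∑ j, ∑ k, ∑ l, θ.dual a i * θ.dual b j * θ.dual c k * θ.dual d l
    * weyl g θ.pt i j k l (extChartAt (𝓡 4) θ.pt θ.pt)

/-- The components `(∇_{e_m} C)_abcd` in a coframe. -/
noncomputable def covWeylComp (g : BilinField M) (θ : Coframe M) (m a b c d : Fin 4) : ℝ :=
  ∑ n, ∑ i, ∑ j, ∑ k, ∑ l,
    θ.dual m n * θ.dual a i * θ.dual b j * θ.dual c k * θ.dual d l
      * covWeyl g θ.pt n i j k l (extChartAt (𝓡 4) θ.pt θ.pt)

/-- The components `(Ψ₀, …, Ψ₄) = (C₁₄₁₄, C₂₄₁₄, -C₁₄₂₃, C₁₃₂₃, C₂₃₂₃)` of `Weyl⁻`. -/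
noncomputable def psi (g : BilinField M) (θ : Coframe M) : Fin 5 → ℝ :=
  ![weylComp g θ 0 3 0 3, weylComp g θ 1 3 0 3, - weylComp g θ 0 3 1 2,
    weylComp g θ 0 2 1 2, weylComp g θ 1 2 1 2]

/-- `Ψ₂' = C₁₂₃₄`, the only nonzero component of `Weyl⁺` for these structures. -/
noncomputable def psi2' (g : BilinField M) (θ : Coframe M) : ℝ := weylComp g θ 0 1 2 3

/-- `Ψ₄₃`, the covariant coframe derivative of `Ψ₄` in the direction dual to `ᾱ¹ = θ³`. -/
noncomputable def psi43 (g : BilinField M) (θ : Coframe M) : ℝ := covWeylComp g θ 2 1 2 1 2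

/-- `Ψ₄₄`, the covariant coframe derivative of `Ψ₄` in the direction dual to `ᾱ² = θ⁴`. -/
noncomputable def psi44 (g : BilinField M) (θ : Coframe M) : ℝ := covWeylComp g θ 3 1 2 1 2

end CoframeComponents

/-! ### Petrov types -/

/-- The binary quartic of `Weyl⁻` in homogeneous coordinates `(ξ⁰, ξ¹) = (x, y)`. -/
def quartic (ψ : Fin 5 → ℝ) (x y : ℝ) : ℝ :=
  ψ 4 * y ^ 4 + 4 * ψ 3 * y ^ 3 * x + 6 * ψ 2 * y ^ 2 * x ^ 2 + 4 * ψ 1 * y * x ^ 3 + ψ 0 * x ^ 4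

/-- The types of nonzero real binary quartics with a repeated real root. -/
inductive PetrovType where
  | IIr
  | IIc
  | III
  | D
  | N

/-- The linear form with coefficients `a`. -/
def lin (a : ℝ × ℝ) (x y : ℝ) : ℝ := a.1 * x + a.2 * y

/-- Two linear forms have different roots. -/
def Indep (a b : ℝ × ℝ) : Prop := a.1 * b.2 - a.2 * b.1 ≠ 0

/-- The root type of a real binary quartic. -/
def RootType (ψ : Fin 5 → ℝ) : PetrovType → Prop
  | .IIr => ∃ a b c : ℝ × ℝ, Indep a b ∧ Indep a c ∧ Indep b c ∧
      ∀ x y, quartic ψ x y = lin a x y ^ 2 * lin b x y * lin c x y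
  | .IIc => ∃ (a : ℝ × ℝ) (p q r : ℝ), a ≠ 0 ∧ q ^ 2 - 4 * p * r < 0 ∧
      ∀ x y, quartic ψ x y = lin a x y ^ 2 * (p * x ^ 2 + q * x * y + r * y ^ 2)
  | .III => ∃ a b : ℝ × ℝ, Indep a b ∧ ∀ x y, quartic ψ x y = lin a x y ^ 3 * lin b x y
  | .D => ∃ (k : ℝ) (a b : ℝ × ℝ), k ≠ 0 ∧ Indep a b ∧
      ∀ x y, quartic ψ x y = k * lin a x y ^ 2 * lin b x y ^ 2
  | .N => ∃ (k : ℝ) (a : ℝ × ℝ), k ≠ 0 ∧ a ≠ 0 ∧ ∀ x y, quartic ψ x y = k * lin a x y ^ 4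

/-- `Weyl⁻` has Petrov type `t` at `p`. -/
def HasPetrovType {M : Type u} [TopologicalSpace M] [ChartedSpace E4 M]
    (g : BilinField M) (K : EndField M) (p : M) (t : PetrovType) : Prop :=
  ∃ θ : Coframe M, θ.pt = p ∧ Adapted g K θ ∧ RootType (psi g θ) t

/-- The adapted coframes for which the repeated root is translated to zero:
`Ψ₀ = … = Ψ_{k-1} = 0 ≠ Ψ_k`, where `k` is the multiplicity of the root. -/
def F7 {M : Type u} [TopologicalSpace M] [ChartedSpace E4 M]
    (g : BilinField M) (K : EndField M) (t : PetrovType) : Set (Coframe M) :=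
  {θ | Adapted g K θ ∧ psi g θ 0 = 0 ∧ psi g θ 1 = 0 ∧
    match t with
    | .III => psi g θ 2 = 0 ∧ psi g θ 3 ≠ 0
    | .N => psi g θ 2 = 0 ∧ psi g θ 3 = 0 ∧ psi g θ 4 ≠ 0
    | _ => psi g θ 2 ≠ 0}

/-- The further normalized coframes: `Ψ₃ = 0` for a double root, `Ψ₄ = 0` for a triple root and
`Ψ₄₃ = 0` for a quadruple root. -/
def F6 {M : Type u} [TopologicalSpace M] [ChartedSpace E4 M]
    (g : BilinField M) (K : EndField M) (t : PetrovType) : Set (Coframe M) :=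
  {θ | θ ∈ F7 g K t ∧
    match t with
    | .III => psi g θ 4 = 0
    | .N => psi43 g θ = 0
    | _ => psi g θ 3 = 0}

/-! ### Principal `T²`-bundles of coframes -/

/-- The model space of the 6-dimensional total spaces. -/
abbrev E6 : Type := E4 × (ℝ × ℝ)

/-- The model with corners of the Lie group `T²`. -/
noncomputable abbrev IT2 : ModelWithCorners ℝ (ℝ × ℝ) (ModelProd ℝ ℝ) := 𝓘(ℝ, ℝ).prod 𝓘(ℝ, ℝ)

/-- A set `F` of coframes on the 4-manifold `M` as the total space of a smooth principal
`T²`-bundle over an open subset of `M`, reducing the coframe bundle: a 6-manifold `P` with a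
bijection `frame : P → F`, such that the projection and the tautological forms are smooth, with the
right action `R_h θ = T(h)⁻¹ θ`, which is smooth and transitive on the fibres (it is free since
`T` is faithful, and satisfies the laws of an action since `frame` is injective) and with local
trivializations. -/
structure TorusReduction {M : Type u} [TopologicalSpace M] [ChartedSpace E4 M]
    [IsManifold (𝓡 4) ∞ M] (F : Set (Coframe M)) where
  P : Type u
  [top : TopologicalSpace P]
  [charted : ChartedSpace E6 P]
  [manifold : IsManifold 𝓘(ℝ, E6) ∞ P]
  frame : P → Coframe M
  frame_injective : Function.Injective frame
  range_frame : Set.range frame = F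
  smooth_proj : ContMDiff 𝓘(ℝ, E6) (𝓡 4) ∞ (fun u => (frame u).pt)
  smooth_taut : ∀ a : Fin 4, SmoothForm (E := E6) (N := P) (fun u =>
    (ContinuousLinearMap.proj (R := ℝ) (φ := fun _ : Fin 4 => ℝ) a).comp
      (((frame u).form : TangentSpace (𝓡 4) (frame u).pt →L[ℝ] (Fin 4 → ℝ)).comp
        (mfderiv 𝓘(ℝ, E6) (𝓡 4) (fun x => (frame x).pt) u)))
  act : P → T2 → P
  frame_act : ∀ u h, frame (act u h) = (frame u).scale h⁻¹
  smooth_act : ContMDiff (𝓘(ℝ, E6).prod IT2) 𝓘(ℝ, E6) ∞ (fun x : P × T2 => act x.1 x.2)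
  transitive : ∀ u u' : P, (frame u).pt = (frame u').pt → ∃ h, u' = act u h
  locally_trivial : ∀ u₀ : P, ∃ (V : Set M) (s : M → P) (τ : P → T2),
    IsOpen V ∧ (frame u₀).pt ∈ V ∧
    ContMDiffOn (𝓡 4) 𝓘(ℝ, E6) ∞ s V ∧ (∀ x ∈ V, (frame (s x)).pt = x) ∧
    ContMDiffOn 𝓘(ℝ, E6) IT2 ∞ τ {u | (frame u).pt ∈ V} ∧
    ∀ u, (frame u).pt ∈ V → u = act (s (frame u).pt) (τ u)

attribute [instance] TorusReduction.top TorusReduction.charted TorusReduction.manifold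

section Connection

variable {M : Type u} [TopologicalSpace M] [ChartedSpace E4 M] [IsManifold (𝓡 4) ∞ M]
  {F : Set (Coframe M)}

/-- The tautological forms `(α¹, α², ᾱ¹, ᾱ²)` on the total space. -/
noncomputable def TorusReduction.taut (R : TorusReduction F) (a : Fin 4) : Form1 E6 R.P :=
  fun u =>
    (ContinuousLinearMap.proj (R := ℝ) (φ := fun _ : Fin 4 => ℝ) a).comp
      (((R.frame u).form : TangentSpace (𝓡 4) (R.frame u).pt →L[ℝ] (Fin 4 → ℝ)).comp
        (mfderiv 𝓘(ℝ, E6) (𝓡 4) (fun x => (R.frame x).pt) u))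

/-- The structure equations of a para-Kähler–Einstein structure, pulled back to the bundle. The
first four of them determine the connection forms `Γ A B = Γ^{A+1}_{B+1}`. -/
structure TorusReduction.StructureEquations (R : TorusReduction F) (g : BilinField M)
    (Γ : Fin 2 → Fin 2 → Form1 E6 R.P) : Prop where
  dα1 : ∀ u v w, extD (R.taut 0) u v w =
    - wedge (Γ 0 0) (R.taut 0) u v w - wedge (Γ 0 1) (R.taut 1) u v w
  dα2 : ∀ u v w, extD (R.taut 1) u v w =
    - wedge (Γ 1 0) (R.taut 0) u v w - wedge (Γ 1 1) (R.taut 1) u v w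
  dα1bar : ∀ u v w, extD (R.taut 2) u v w =
    wedge (Γ 0 0) (R.taut 2) u v w + wedge (Γ 1 0) (R.taut 3) u v w
  dα2bar : ∀ u v w, extD (R.taut 3) u v w =
    wedge (Γ 0 1) (R.taut 2) u v w + wedge (Γ 1 1) (R.taut 3) u v w
  dΓ11 : ∀ u v w, extD (Γ 0 0) u v w =
    - wedge (Γ 0 1) (Γ 1 0) u v w
    + (-2 * psi2' g (R.frame u) - psi g (R.frame u) 2) * wedge (R.taut 0) (R.taut 2) u v w
    + psi g (R.frame u) 1 * wedge (R.taut 0) (R.taut 3) u v w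
    - psi g (R.frame u) 3 * wedge (R.taut 1) (R.taut 2) u v w
    + (psi g (R.frame u) 2 - psi2' g (R.frame u)) * wedge (R.taut 1) (R.taut 3) u v w
  dΓ12 : ∀ u v w, extD (Γ 0 1) u v w =
    - wedge (Γ 0 0) (Γ 0 1) u v w - wedge (Γ 0 1) (Γ 1 1) u v w
    - psi g (R.frame u) 3 * wedge (R.taut 0) (R.taut 2) u v w
    + (psi g (R.frame u) 2 - psi2' g (R.frame u)) * wedge (R.taut 0) (R.taut 3) u v w
    - psi g (R.frame u) 4 * wedge (R.taut 1) (R.taut 2) u v w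
    + psi g (R.frame u) 3 * wedge (R.taut 1) (R.taut 3) u v w
  dΓ21 : ∀ u v w, extD (Γ 1 0) u v w =
    wedge (Γ 0 0) (Γ 1 0) u v w + wedge (Γ 1 0) (Γ 1 1) u v w
    + psi g (R.frame u) 1 * wedge (R.taut 0) (R.taut 2) u v w
    - psi g (R.frame u) 0 * wedge (R.taut 0) (R.taut 3) u v w
    + (psi g (R.frame u) 2 - psi2' g (R.frame u)) * wedge (R.taut 1) (R.taut 2) u v w
    - psi g (R.frame u) 1 * wedge (R.taut 1) (R.taut 3) u v w
  dΓ22 : ∀ u v w, extD (Γ 1 1) u v w =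
    wedge (Γ 0 1) (Γ 1 0) u v w
    + (psi g (R.frame u) 2 - psi2' g (R.frame u)) * wedge (R.taut 0) (R.taut 2) u v w
    - psi g (R.frame u) 1 * wedge (R.taut 0) (R.taut 3) u v w
    + psi g (R.frame u) 3 * wedge (R.taut 1) (R.taut 2) u v w
    + (-2 * psi2' g (R.frame u) - psi g (R.frame u) 2) * wedge (R.taut 1) (R.taut 3) u v w

/-- `Γ²₁ = J₁ α² + J₂ ᾱ¹` and `Γ¹₂ = -J₃ α¹ + J₆ α² + J₅ ᾱ¹ + J₄ ᾱ²`
(with `J i` standing for `J_{i+1}`). -/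
def TorusReduction.ReducedForms (R : TorusReduction F) (Γ : Fin 2 → Fin 2 → Form1 E6 R.P)
    (J : Fin 6 → R.P → ℝ) : Prop :=
  ∀ u, Γ 1 0 u = J 0 u • R.taut 1 u + J 1 u • R.taut 2 u ∧
    Γ 0 1 u = - J 2 u • R.taut 0 u + J 5 u • R.taut 1 u + J 4 u • R.taut 2 u
      + J 3 u • R.taut 3 u

end Connection

/-! ### The Lie algebra `𝔰𝔬₂,₂` and Cartan connections of type `(𝔰𝔬₂,₂, T²)` -/

attribute [local instance] LieRing.ofAssociativeRing LieAlgebra.ofAssociativeAlgebra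

/-- The Lie algebra `𝔰𝔩₂ ⊕ 𝔰𝔩₂` of block-diagonal `4 × 4` matrices with traceless blocks. -/
def blockAlg : LieSubalgebra ℝ (Matrix (Fin 4) (Fin 4) ℝ) where
  carrier := {X | (∀ i j : Fin 4, (i < 2 ∧ 2 ≤ j ∨ 2 ≤ i ∧ j < 2) → X i j = 0) ∧
    X 0 0 + X 1 1 = 0 ∧ X 2 2 + X 3 3 = 0}
  add_mem' := by
    rintro X Y ⟨hX, hX1, hX2⟩ ⟨hY, hY1, hY2⟩
    refine ⟨fun i j h => by simp [hX i j h, hY i j h], ?_, ?_⟩ <;>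
      simp only [Matrix.add_apply] <;> linarith
  zero_mem' := by simp
  smul_mem' := by
    rintro c X ⟨hX, hX1, hX2⟩
    refine ⟨fun i j h => by simp [hX i j h], ?_, ?_⟩ <;>
      simp only [Matrix.smul_apply, smul_eq_mul, ← mul_add, hX1, hX2, mul_zero]
  lie_mem' := by
    rintro X Y ⟨hX, hX1, hX2⟩ ⟨hY, hY1, hY2⟩
    refine ⟨fun i j h => ?_, ?_, ?_⟩
    · have hs : ∀ m : Fin 4, X i m * Y m j = 0 ∧ Y i m * X m j = 0 := by
        intro m
        by_cases hm : m < 2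
        · rcases h with h | h
          · exact ⟨by rw [hY m j (Or.inl ⟨hm, h.2⟩), mul_zero],
              by rw [hX m j (Or.inl ⟨hm, h.2⟩), mul_zero]⟩
          · exact ⟨by rw [hX i m (Or.inr ⟨h.1, hm⟩), zero_mul],
              by rw [hY i m (Or.inr ⟨h.1, hm⟩), zero_mul]⟩
        · have hm' : 2 ≤ m := not_lt.mp hm
          rcases h with h | h
          · exact ⟨by rw [hX i m (Or.inl ⟨h.1, hm'⟩), zero_mul],
              by rw [hY i m (Or.inl ⟨h.1, hm'⟩), zero_mul]⟩
          · exact ⟨by rw [hY m j (Or.inr ⟨hm', h.2⟩), mul_zero],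
              by rw [hX m j (Or.inr ⟨hm', h.2⟩), mul_zero]⟩
      simp [Ring.lie_def, Matrix.mul_apply, (hs _).1, (hs _).2]
    · simp [Ring.lie_def, Matrix.mul_apply, Fin.sum_univ_four,
        hX 0 2 (by decide), hX 0 3 (by decide), hX 1 2 (by decide), hX 1 3 (by decide),
        hY 0 2 (by decide), hY 0 3 (by decide), hY 1 2 (by decide), hY 1 3 (by decide)]
      ring
    · simp [Ring.lie_def, Matrix.mul_apply, Fin.sum_univ_four,
        hX 2 0 (by decide), hX 2 1 (by decide), hX 3 0 (by decide), hX 3 1 (by decide),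
        hY 2 0 (by decide), hY 2 1 (by decide), hY 3 0 (by decide), hY 3 1 (by decide)]
      ring

/-- The Gram matrix of `2 θ¹ θ³ + 2 θ² θ⁴`, of signature `(2,2)`. -/
def splitMetric : Matrix (Fin 4) (Fin 4) ℝ :=
  !![0, 0, 1, 0; 0, 0, 0, 1; 1, 0, 0, 0; 0, 1, 0, 0]

/-- Membership in the group `SO₂,₂` of the split metric. -/
def InSO22 (X : Matrix (Fin 4) (Fin 4) ℝ) : Prop :=
  Xᵀ * splitMetric * X = splitMetric ∧ X.det = 1

/-- The matrix `T(h) = diag(a₁₁, a₂₂, a₁₁⁻¹, a₂₂⁻¹)`. -/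
def torusMatrix (h : T2) : Matrix (Fin 4) (Fin 4) ℝ :=
  Matrix.diagonal fun a => (torusWeight h a : ℝ)

/-- The action `Ad(h)` of `T²` on `blockAlg`: conjugation by `diag(a₁₁, 1) ⊕ diag(a₂₂, 1)`. -/
def torusAd (h : T2) (X : Matrix (Fin 4) (Fin 4) ℝ) : Matrix (Fin 4) (Fin 4) ℝ :=
  Matrix.diagonal ![(h.1 : ℝ), 1, (h.2 : ℝ), 1] * X *
    Matrix.diagonal ![((h.1⁻¹ : ℝˣ) : ℝ), 1, ((h.2⁻¹ : ℝˣ) : ℝ), 1]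

/-- The embedding of the Lie algebra `ℝ²` of `T²` in `blockAlg`. -/
noncomputable def torusLie (c : ℝ × ℝ) : Matrix (Fin 4) (Fin 4) ℝ :=
  Matrix.diagonal ![c.1 / 2, - c.1 / 2, c.2 / 2, - c.2 / 2]

/-- The exponential map of `T²`. -/
noncomputable def torusExp (c : ℝ × ℝ) : T2 :=
  (Units.mk0 (Real.exp c.1) (Real.exp_ne_zero _), Units.mk0 (Real.exp c.2) (Real.exp_ne_zero _))

/-- `T²` is (through `T`) a maximal torus in `SO₂,₂`: it is a subgroup that is its own centralizer,
and `blockAlg` is the Lie algebra `𝔰𝔬₂,₂`, with the diagonal subalgebra `torusLie (ℝ²)`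
corresponding to the Lie algebra of that torus. -/
def TorusModel : Prop :=
  (∀ h : T2, InSO22 (torusMatrix h)) ∧ Function.Injective torusMatrix ∧
  (∀ h h' : T2, torusMatrix (h * h') = torusMatrix h * torusMatrix h') ∧
  (∀ X, InSO22 X → (∀ h : T2, X * torusMatrix h = torusMatrix h * X) → ∃ h, X = torusMatrix h) ∧
  ∃ φ : blockAlg ≃ₗ⁅ℝ⁆ skewAdjointMatricesLieSubalgebra splitMetric, ∀ X : blockAlg,
    (∃ c, (X : Matrix (Fin 4) (Fin 4) ℝ) = torusLie c) ↔
      (φ X : Matrix (Fin 4) (Fin 4) ℝ).IsDiag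

section CartanConnection

variable {M : Type u} [TopologicalSpace M] [ChartedSpace E4 M] [IsManifold (𝓡 4) ∞ M]
  {F : Set (Coframe M)}

/-- The value at a tangent vector of a matrix of 1-forms. -/
noncomputable def matrixValue {P : Type u} [TopologicalSpace P] [ChartedSpace E6 P]
    (B : Matrix (Fin 4) (Fin 4) (Form1 E6 P)) (u : P) (v : TangentSpace 𝓘(ℝ, E6) u) :
    Matrix (Fin 4) (Fin 4) ℝ :=
  Matrix.of fun i j => B i j u v

/-- Cartan connections with values in `blockAlg` on a principal `T²`-bundle. -/
structure TorusReduction.IsCartanConnection (R : TorusReduction F)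
    (B : Matrix (Fin 4) (Fin 4) (Form1 E6 R.P)) : Prop where
  smooth : ∀ i j, SmoothForm (B i j)
  isomorphism : ∀ u, Set.BijOn (matrixValue B u) Set.univ
    (blockAlg : Set (Matrix (Fin 4) (Fin 4) ℝ))
  equivariant : ∀ (u : R.P) (h : T2) (v : TangentSpace 𝓘(ℝ, E6) u),
    matrixValue B (R.act u h) (mfderiv 𝓘(ℝ, E6) 𝓘(ℝ, E6) (fun x => R.act x h) u v)
      = torusAd h⁻¹ (matrixValue B u v)
  fundamental : ∀ (u : R.P) (c : ℝ × ℝ),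
    matrixValue B (R.act u (torusExp ((0 : ℝ) • c)))
      (mfderiv 𝓘(ℝ, ℝ) 𝓘(ℝ, E6) (fun s : ℝ => R.act u (torusExp (s • c))) 0 (1 : ℝ))
      = torusLie c

/-- The matrix `ℬ` of 1-forms, with `c = Ψ₂'` and a sign `σ` in front of `ᾱ¹`, `ᾱ²`. -/
noncomputable def TorusReduction.cartanB (R : TorusReduction F)
    (Γ : Fin 2 → Fin 2 → Form1 E6 R.P) (c σ : ℝ) : Matrix (Fin 4) (Fin 4) (Form1 E6 R.P) :=
  let r : ℝ := Real.sqrt (3 / 2 * |c|)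
  !![(1 / 2 : ℝ) • Γ 0 0, r • R.taut 0, 0, 0;
     (σ * r) • R.taut 2, (-1 / 2 : ℝ) • Γ 0 0, 0, 0;
     0, 0, (1 / 2 : ℝ) • Γ 1 1, r • R.taut 1;
     0, 0, (σ * r) • R.taut 3, (-1 / 2 : ℝ) • Γ 1 1]

/-- Flatness: the curvature `dB + B ∧ B` vanishes. -/
def Flat {P : Type u} [TopologicalSpace P] [ChartedSpace E6 P]
    (B : Matrix (Fin 4) (Fin 4) (Form1 E6 P)) : Prop :=
  ∀ (u : P) (v w : TangentSpace 𝓘(ℝ, E6) u) (i j : Fin 4),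
    extD (B i j) u v w + ∑ k, wedge (B i k) (B k j) u v w = 0

end CartanConnection

end PKE

set_option linter.unusedSectionVars false
set_option linter.unusedSimpArgs false

/-! The geometry is carried by structure equations in adapted coframes; once these are available,
the theorem is linear algebra on them together with `d² = 0`.

Structure equations. Let a `gl₂`-valued form `γ` act on the two eigenbundles of `K` by `diag(γ,
-γᵀ)`. Half of the torsion components can be made to vanish by the choice of `γ`; the others vanish
by integrability of the eigendistributions and by closedness of `g(K·,·)`
(`IsAdaptedField.firstStructure`). Such a connection is metric, hence Levi-Civita, and a Koszul
argument identifies its curvature with the Riemann tensor built from Christoffel symbols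
(`ChartConnection.mul_chrMat`, `ChartConnection.mul_riemMat`). The block form, the Einstein equation
and the first Bianchi identity leave only `Ψ₀, …, Ψ₄` and `Ψ₂'`, with `Λ = -3Ψ₂'`
(`curvature_table`).

Normalization. Adapted coframes at a point differ by `GL₂`, which acts on the `Ψᵢ` by substitution
in the binary quartic (`psi_change`). As long as the root type is constant, a repeated root is
locally a smooth function of the coefficients (`RootType.rootAtZero`), so it can be moved to zero
smoothly. A shear then removes `Ψ₃`, `Ψ₄` or `Ψ₄₃`. In types II and III, and in type N with `Ψ₄₄ ≠
0`, only diagonal changes of frame remain (`F6_unique`), so the normalized coframes form a torus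
bundle. In type D the two double roots can be interchanged, and in type N with `Ψ₄₄ = 0` the shear
is not fixed; there the torus orbits of a local section are used instead.

Reduction. Testing `d²Γ²₁ = 0`, or `d²Γ²₂ = 0` for type N, on suitable triples of frame vectors
gives `Ψ_k Γ²₁(e) = 0` for the first and the last frame vector, where `Ψ_k` is the first nonzero
component (`LocalStructure.reduced`). This uses only that the repeated root is at zero.

Cartan geometry. On a torus bundle `Γ¹₁` and `Γ²₂` are basic forms plus logarithmic differentials of
the fibre coordinates, while `Γ¹₂` and `Γ²₁` are horizontal. So `Γ¹₁`, `Γ²₂` and the four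
tautological forms are a coframe of the total space (`TorusReduction.bijective_forms`), and they are
the entries of `ℬ`. In the curvature of `ℬ` the off-diagonal entries are wedge products of `Γ¹₂` and
`Γ²₁` with tautological forms, so flatness kills all `Jᵢ`; then `dΓ¹₂ = 0` gives `Ψ₄ = 0`, and the
diagonal entries, where `σs² = 3Ψ₂'/2`, give `Ψ₂ = Ψ₂'` (`TorusReduction.cartan_curvature`,
`TorusReduction.flat_iff`). -/

namespace PKE

open Set Filter Topology

/-! ### One-forms and exterior derivatives in charts -/

section Forms

variable {E : Type} [NormedAddCommGroup E] [NormedSpace ℝ E]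
  {N : Type u} [TopologicalSpace N] [ChartedSpace E N]
  {E' : Type} [NormedAddCommGroup E'] [NormedSpace ℝ E']
  {N' : Type*} [TopologicalSpace N'] [ChartedSpace E' N']

/-- The preferred chart around `p`. -/
noncomputable abbrev ch (E : Type) [NormedAddCommGroup E] [NormedSpace ℝ E]
    {N : Type u} [TopologicalSpace N] [ChartedSpace E N] (p : N) : PartialEquiv N E :=
  extChartAt 𝓘(ℝ, E) p

/-- The derivative of a map of manifolds, with the tangent spaces identified with the models. -/
noncomputable def mder (E E' : Type) [NormedAddCommGroup E] [NormedSpace ℝ E]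
    [NormedAddCommGroup E'] [NormedSpace ℝ E'] {N : Type*} [TopologicalSpace N] [ChartedSpace E N]
    {N' : Type*} [TopologicalSpace N'] [ChartedSpace E' N'] (F : N → N') (x : N) : E →L[ℝ] E' :=
  mfderiv 𝓘(ℝ, E) 𝓘(ℝ, E') F x

/-- The exterior derivative, as a function on pairs of vectors of the model space. -/
noncomputable def xD (β : N → E →L[ℝ] ℝ) (p : N) (v w : E) : ℝ := extD (E := E) β p v w

/-- The components of a 1-form in the preferred chart around `p`. -/
noncomputable def rep (p : N) (β : N → E →L[ℝ] ℝ) (y : E) : E →L[ℝ] ℝ :=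
  (β ((ch E p).symm y)).comp (mder E E (ch E p).symm y)

/-- The exterior derivative of a 1-form on a normed space. -/
noncomputable def dAlt (f : E → E →L[ℝ] ℝ) (y v w : E) : ℝ :=
  fderiv ℝ f y v w - fderiv ℝ f y w v

/-- Smoothness of a 1-form at a point. -/
def SmoothFormAt (β : N → E →L[ℝ] ℝ) (p : N) : Prop :=
  ContDiffAt ℝ ∞ (rep p β) (ch E p p)

/-- The pullback of a 1-form. -/
noncomputable def pull (E : Type) [NormedAddCommGroup E] [NormedSpace ℝ E]
    {N : Type*} [TopologicalSpace N] [ChartedSpace E N] (F : N → N') (β : N' → E' →L[ℝ] ℝ) :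
    N → E →L[ℝ] ℝ :=
  fun x => (β (F x)).comp (mder E E' F x)

/-- The differential of a function. -/
noncomputable def dForm (E : Type) [NormedAddCommGroup E] [NormedSpace ℝ E]
    {N : Type u} [TopologicalSpace N] [ChartedSpace E N] (f : N → ℝ) : N → E →L[ℝ] ℝ :=
  fun x => mder E ℝ f x

/-- Smoothness of a function at a point. -/
abbrev SmoothAt (E : Type) [NormedAddCommGroup E] [NormedSpace ℝ E]
    {N : Type u} [TopologicalSpace N] [ChartedSpace E N] (f : N → ℝ) (p : N) : Prop :=
  ContMDiffAt 𝓘(ℝ, E) 𝓘(ℝ, ℝ) ∞ f p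

theorem mder_eq_fderiv (F : E → E') (x : E) : mder E E' F x = fderiv ℝ F x := mfderiv_eq_fderiv

theorem mder_id (x : N) : mder E E (id : N → N) x = ContinuousLinearMap.id ℝ E := mfderiv_id

theorem mder_const (c : N') (x : N) : mder E E' (fun _ : N => c) x = 0 := mfderiv_const

theorem mder_comp {E'' : Type} [NormedAddCommGroup E''] [NormedSpace ℝ E'']
    {N₀ N₁ N₂ : Type*} [TopologicalSpace N₀] [ChartedSpace E N₀] [TopologicalSpace N₁]
    [ChartedSpace E' N₁] [TopologicalSpace N₂] [ChartedSpace E'' N₂] {G : N₁ → N₂} {F : N₀ → N₁}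
    (x : N₀) (hG : MDifferentiableAt 𝓘(ℝ, E') 𝓘(ℝ, E'') G (F x))
    (hF : MDifferentiableAt 𝓘(ℝ, E) 𝓘(ℝ, E') F x) :
    mder E E'' (fun z => G (F z)) x = (mder E' E'' G (F x)).comp (mder E E' F x) :=
  mfderiv_comp x hG hF

theorem mder_congr {F G : N → N'} {x : N} (h : F =ᶠ[𝓝 x] G) : mder E E' F x = mder E E' G x :=
  h.mfderiv_eq

variable [IsManifold 𝓘(ℝ, E) ∞ N]

theorem mdiff_chart {p q : N} (hq : q ∈ (ch E p).source) :
    MDifferentiableAt 𝓘(ℝ, E) 𝓘(ℝ, E) (ch E p) q :=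
  mdifferentiableAt_extChartAt (by simpa using hq)

theorem mdiff_chart_symm {p : N} {y : E} (hy : y ∈ (ch E p).target) :
    MDifferentiableAt 𝓘(ℝ, E) 𝓘(ℝ, E) (ch E p).symm y := by
  have := mdifferentiableWithinAt_extChartAt_symm (I := 𝓘(ℝ, E)) hy
  rwa [ModelWithCorners.range_eq_univ, mdifferentiableWithinAt_univ] at this

theorem mder_chart_symm_chart {p q : N} (hq : q ∈ (ch E p).source) :
    (mder E E (ch E p).symm (ch E p q)).comp (mder E E (ch E p) q) = ContinuousLinearMap.id ℝ E := by
  rw [← mder_comp q (mdiff_chart_symm ((ch E p).map_source hq)) (mdiff_chart hq), ← mder_id q]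
  apply mder_congr
  filter_upwards [(isOpen_extChartAt_source (I := 𝓘(ℝ, E)) p).mem_nhds hq] with z hz
  exact (ch E p).left_inv hz

theorem mder_chart_chart_symm {p : N} {y : E} (hy : y ∈ (ch E p).target) :
    (mder E E (ch E p) ((ch E p).symm y)).comp (mder E E (ch E p).symm y)
      = ContinuousLinearMap.id ℝ E := by
  rw [← mder_comp y (mdiff_chart ((ch E p).map_target hy)) (mdiff_chart_symm hy), ← mder_id y]
  apply mder_congr
  filter_upwards [(isOpen_extChartAt_target (I := 𝓘(ℝ, E)) p).mem_nhds hy] with z hz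
  exact (ch E p).right_inv hz

theorem mder_chart_self (p : N) : mder E E (ch E p) p = ContinuousLinearMap.id ℝ E :=
  mfderiv_extChartAt_self

theorem mder_chart_symm_self (p : N) :
    mder E E (ch E p).symm (ch E p p) = ContinuousLinearMap.id ℝ E := by
  have := mder_chart_symm_chart (mem_extChartAt_source (I := 𝓘(ℝ, E)) p)
  rwa [mder_chart_self, ContinuousLinearMap.comp_id] at this

theorem rep_apply (p : N) (β : N → E →L[ℝ] ℝ) (y v : E) :
    rep p β y v = β ((ch E p).symm y) (mder E E (ch E p).symm y v) := rfl

theorem rep_chart {p q : N} (hq : q ∈ (ch E p).source) (β : N → E →L[ℝ] ℝ) (v : E) :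
    rep p β (ch E p q) (mder E E (ch E p) q v) = β q v := by
  rw [rep_apply, (ch E p).left_inv hq]
  have := congrArg (fun L => L v) (mder_chart_symm_chart hq)
  simp only [ContinuousLinearMap.comp_apply, ContinuousLinearMap.id_apply] at this
  rw [this]

theorem rep_self (p : N) (β : N → E →L[ℝ] ℝ) : rep p β (ch E p p) = β p := by
  ext v
  have := rep_chart (mem_extChartAt_source (I := 𝓘(ℝ, E)) p) β v
  rwa [mder_chart_self] at this

/-- The derivative of the preferred chart at its own centre is the identity, so the frozen
components of `v` and `w` are `v` and `w` themselves. Differentiability lets the evaluation at a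
fixed vector be taken out of `fderiv`. -/
theorem xD_eq_dAlt {β : N → E →L[ℝ] ℝ} {p : N}
    (hβ : DifferentiableAt ℝ (rep p β) (ch E p p)) (v w : E) :
    xD β p v w = dAlt (rep p β) (ch E p p) v w := by
  have h : ∀ v w : E, fderiv ℝ (fun y => rep p β y w) (ch E p p) v
      = fderiv ℝ (rep p β) (ch E p p) v w := by
    intro v w
    have := (hβ.hasFDerivAt.clm_apply (hasFDerivAt_const (w : E) _)).fderiv
    rw [this]; simp
  have hc : ∀ v : E, chartComp (E := E) p v = v := by
    intro v
    have := congrArg (fun L => L v) (mder_chart_self (E := E) p)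
    exact this
  have h0 : xD β p v w = fderiv ℝ (fun y => rep p β y (chartComp (E := E) p w)) (ch E p p)
      (chartComp (E := E) p v) - fderiv ℝ (fun y => rep p β y (chartComp (E := E) p v)) (ch E p p)
      (chartComp (E := E) p w) := rfl
  rw [h0, hc, hc, h, h]; rfl

theorem xD_swap (β : N → E →L[ℝ] ℝ) (p : N) (v w : E) : xD β p v w = - xD β p w v := by
  unfold xD extD; ring

end Forms

/-! ### Pullbacks and independence of the chart -/

section Pull

variable {E : Type} [NormedAddCommGroup E] [NormedSpace ℝ E]
  {N : Type u} [TopologicalSpace N] [ChartedSpace E N] [IsManifold 𝓘(ℝ, E) ∞ N]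
  {E' : Type} [NormedAddCommGroup E'] [NormedSpace ℝ E']
  {N' : Type*} [TopologicalSpace N'] [ChartedSpace E' N'] [IsManifold 𝓘(ℝ, E') ∞ N']

/-- The expression of a map in the preferred charts around `p` and `q`. -/
noncomputable def localMap (E E' : Type) [NormedAddCommGroup E] [NormedSpace ℝ E]
    [NormedAddCommGroup E'] [NormedSpace ℝ E'] {N : Type u} [TopologicalSpace N] [ChartedSpace E N]
    {N' : Type*} [TopologicalSpace N'] [ChartedSpace E' N']
    (F : N → N') (p : N) (q : N') (y : E) : E' :=
  ch E' q (F ((ch E p).symm y))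

theorem fderiv_localMap' {F : N → N'} {p : N} {q : N'} {y : E} (hy : y ∈ (ch E p).target)
    (hF : MDifferentiableAt 𝓘(ℝ, E) 𝓘(ℝ, E') F ((ch E p).symm y))
    (hq : F ((ch E p).symm y) ∈ (ch E' q).source) :
    fderiv ℝ (localMap E E' F p q) y = (mder E' E' (ch E' q) (F ((ch E p).symm y))).comp
      ((mder E E' F ((ch E p).symm y)).comp (mder E E (ch E p).symm y)) := by
  have h1 := mdiff_chart_symm (N := N) hy
  have h2 := mdiff_chart hq
  rw [← mder_comp y hF h1]
  rw [← mder_comp (F := fun y => F ((ch E p).symm y)) y h2 (hF.comp y h1), ← mder_eq_fderiv]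
  rfl

theorem fderiv_localMap {F : N → N'} {p x : N} {q : N'} (hp : x ∈ (ch E p).source)
    (hF : MDifferentiableAt 𝓘(ℝ, E) 𝓘(ℝ, E') F x) (hq : F x ∈ (ch E' q).source) :
    (fderiv ℝ (localMap E E' F p q) (ch E p x)).comp (mder E E (ch E p) x) =
      (mder E' E' (ch E' q) (F x)).comp (mder E E' F x) := by
  have e := (ch E p).left_inv hp
  rw [fderiv_localMap' ((ch E p).map_source hp) (by rwa [e]) (by rwa [e]), e]
  rw [ContinuousLinearMap.comp_assoc, ContinuousLinearMap.comp_assoc, mder_chart_symm_chart hp,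
    ContinuousLinearMap.comp_id]

theorem rep_pull {F : N → N'} {p : N} {q : N'} {y : E} (β : N' → E' →L[ℝ] ℝ)
    (hy : y ∈ (ch E p).target)
    (hF : MDifferentiableAt 𝓘(ℝ, E) 𝓘(ℝ, E') F ((ch E p).symm y))
    (hq : F ((ch E p).symm y) ∈ (ch E' q).source) :
    rep p (pull E F β) y = (rep q β (localMap E E' F p q y)).comp
      (fderiv ℝ (localMap E E' F p q) y) := by
  ext v
  rw [fderiv_localMap' hy hF hq]
  exact (rep_chart hq β _).symm

theorem contMDiffAt_chart {p x : N} (hp : x ∈ (ch E p).source) :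
    ContMDiffAt 𝓘(ℝ, E) 𝓘(ℝ, E) ∞ (ch E p) x :=
  contMDiffAt_extChartAt' (by simpa using hp)

theorem contMDiffAt_chart_symm {p : N} {y : E} (hy : y ∈ (ch E p).target) :
    ContMDiffAt 𝓘(ℝ, E) 𝓘(ℝ, E) ∞ (ch E p).symm y :=
  (contMDiffOn_extChartAt_symm p).contMDiffAt ((isOpen_extChartAt_target p).mem_nhds hy)

theorem contDiffAt_localMap {F : N → N'} {p : N} {q : N'} {x : N}
    (hp : x ∈ (ch E p).source)
    (hF : ContMDiffAt 𝓘(ℝ, E) 𝓘(ℝ, E') ∞ F x) (hq : F x ∈ (ch E' q).source) :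
    ContDiffAt ℝ ∞ (localMap E E' F p q) (ch E p x) := by
  have h1 := contMDiffAt_chart_symm ((ch E p).map_source hp)
  have h2 := contMDiffAt_chart hq
  have e := (ch E p).left_inv hp
  rw [← contMDiffAt_iff_contDiffAt]
  have hF' : ContMDiffAt 𝓘(ℝ, E) 𝓘(ℝ, E') ∞ F ((ch E p).symm (ch E p x)) := by rwa [e]
  have h3 : ContMDiffAt 𝓘(ℝ, E) 𝓘(ℝ, E') ∞ (fun y => F ((ch E p).symm y)) (ch E p x) :=
    hF'.comp _ h1
  have h2' : ContMDiffAt 𝓘(ℝ, E') 𝓘(ℝ, E') ∞ (ch E' q) (F ((ch E p).symm (ch E p x))) := by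
    rwa [e]
  exact ContMDiffAt.comp (g := ch E' q) (f := fun y => F ((ch E p).symm y)) _ h2' h3

theorem dAlt_congr {f g : E → E →L[ℝ] ℝ} {y : E} (h : f =ᶠ[𝓝 y] g) (v w : E) :
    dAlt f y v w = dAlt g y v w := by
  unfold dAlt; rw [h.fderiv_eq]

/-- The term with the second derivative of `G` is symmetric and cancels on antisymmetrization. -/
theorem dAlt_pull {f : E' → E' →L[ℝ] ℝ} {G : E → E'} {y : E} (hf : DifferentiableAt ℝ f (G y))
    (hG : ContDiffAt ℝ ∞ G y) (v w : E) :
    dAlt (fun z => (f (G z)).comp (fderiv ℝ G z)) y v w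
      = dAlt f (G y) (fderiv ℝ G y v) (fderiv ℝ G y w) := by
  have hG1 : DifferentiableAt ℝ G y := hG.differentiableAt (by simp)
  have hG2 : DifferentiableAt ℝ (fderiv ℝ G) y :=
    (hG.fderiv_right (m := ∞) (by simp)).differentiableAt (by simp)
  have h := HasFDerivAt.clm_comp (hf.hasFDerivAt.comp y hG1.hasFDerivAt) hG2.hasFDerivAt
  have hs : IsSymmSndFDerivAt ℝ G y := hG.isSymmSndFDerivAt (by
    simp only [minSmoothness_of_isRCLikeNormedField]; exact WithTop.coe_le_coe.2 (le_top : (2 : ℕ∞) ≤ ⊤))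
  unfold dAlt
  have h' : fderiv ℝ (fun z => (f (G z)).comp (fderiv ℝ G z)) y = _ := h.fderiv
  rw [h']
  simp [hs.eq v w]

theorem eventually_chart {p x : N} (hp : x ∈ (ch E p).source) {U : Set N}
    (hU : U ∈ 𝓝 x) :
    ∀ᶠ y in 𝓝 (ch E p x), y ∈ (ch E p).target ∧ (ch E p).symm y ∈ U := by
  have h1 := extChartAt_target_mem_nhds' (I := 𝓘(ℝ, E)) ((ch E p).map_source hp)
  have h2 : ContinuousAt (ch E p).symm (ch E p x) := continuousAt_extChartAt_symm' hp
  have h3 := h2.preimage_mem_nhds (t := U) (by rwa [(ch E p).left_inv hp])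
  filter_upwards [h1, h3] with y a b using ⟨a, b⟩

theorem localMap_chart {F : N → N'} {p x : N} {q : N'} (hp : x ∈ (ch E p).source) :
    localMap E E' F p q (ch E p x) = ch E' q (F x) := by
  unfold localMap; rw [(ch E p).left_inv hp]

theorem rep_pull_eventuallyEq {F : N → N'} {p x : N} {q : N'} (β : N' → E' →L[ℝ] ℝ)
    (hp : x ∈ (ch E p).source) (hF : ContMDiffAt 𝓘(ℝ, E) 𝓘(ℝ, E') ∞ F x)
    (hq : F x ∈ (ch E' q).source) :
    rep p (pull E F β) =ᶠ[𝓝 (ch E p x)]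
      fun y => (rep q β (localMap E E' F p q y)).comp (fderiv ℝ (localMap E E' F p q) y) := by
  have h1 : ∀ᶠ z in 𝓝 x, MDifferentiableAt 𝓘(ℝ, E) 𝓘(ℝ, E') F z := by
    have h : ContMDiffAt 𝓘(ℝ, E) 𝓘(ℝ, E') 1 F x := hF.of_le (by simp)
    have h' := (contMDiffAt_iff_contMDiffAt_nhds (by simp)).1 h
    filter_upwards [h'] with z hz using hz.mdifferentiableAt (by simp)
  have h2 : ∀ᶠ z in 𝓝 x, F z ∈ (ch E' q).source :=
    hF.continuousAt.preimage_mem_nhds ((isOpen_extChartAt_source q).mem_nhds hq)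
  filter_upwards [eventually_chart hp (h1.and h2)] with y hy
  exact rep_pull β hy.1 hy.2.1 hy.2.2

theorem pull_id (β : N → E →L[ℝ] ℝ) : pull E (id : N → N) β = β := by
  funext x; unfold pull; rw [mder_id]; rfl

theorem contDiffAt_rep_pull {F : N → N'} {p x : N} {q : N'} {β : N' → E' →L[ℝ] ℝ}
    (hp : x ∈ (ch E p).source) (hF : ContMDiffAt 𝓘(ℝ, E) 𝓘(ℝ, E') ∞ F x)
    (hq : F x ∈ (ch E' q).source) (h : ContDiffAt ℝ ∞ (rep q β) (ch E' q (F x))) :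
    ContDiffAt ℝ ∞ (rep p (pull E F β)) (ch E p x) := by
  refine ContDiffAt.congr_of_eventuallyEq ?_ (rep_pull_eventuallyEq β hp hF hq)
  have hG := contDiffAt_localMap hp hF hq
  have h' : ContDiffAt ℝ ∞ (rep q β) (localMap E E' F p q (ch E p x)) := by
    rwa [localMap_chart hp]
  exact ContDiffAt.clm_comp (h'.comp _ hG) (hG.fderiv_right (m := ∞) (by simp))

/-- Changing the chart is pulling back along the identity, read in two different charts. -/
theorem smoothFormAt_iff {p q : N} {β : N → E →L[ℝ] ℝ} (hp : q ∈ (ch E p).source) :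
    SmoothFormAt β q ↔ ContDiffAt ℝ ∞ (rep p β) (ch E p q) := by
  constructor
  · intro h
    have := contDiffAt_rep_pull (E := E) (E' := E) (F := (id : N → N)) hp contMDiffAt_id
      (mem_extChartAt_source (I := 𝓘(ℝ, E)) q) h
    rwa [pull_id] at this
  · intro h
    have := contDiffAt_rep_pull (E := E) (E' := E) (F := (id : N → N))
      (mem_extChartAt_source (I := 𝓘(ℝ, E)) q) contMDiffAt_id hp h
    rwa [pull_id] at this

theorem SmoothFormAt.pullback {F : N → N'} {x : N} {β : N' → E' →L[ℝ] ℝ}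
    (hβ : SmoothFormAt β (F x)) (hF : ContMDiffAt 𝓘(ℝ, E) 𝓘(ℝ, E') ∞ F x) :
    SmoothFormAt (pull E F β) x :=
  contDiffAt_rep_pull (mem_extChartAt_source (I := 𝓘(ℝ, E)) x) hF
    (mem_extChartAt_source (I := 𝓘(ℝ, E')) (F x)) hβ

/-- The exterior derivative of a pullback, computed in a chart of the target. -/
theorem xD_pull_chart {F : N → N'} {x : N} {q : N'} {β : N' → E' →L[ℝ] ℝ}
    (hβ : SmoothFormAt β (F x)) (hF : ContMDiffAt 𝓘(ℝ, E) 𝓘(ℝ, E') ∞ F x)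
    (hq : F x ∈ (ch E' q).source) (v w : E) :
    xD (pull E F β) x v w = dAlt (rep q β) (ch E' q (F x))
      (mder E' E' (ch E' q) (F x) (mder E E' F x v))
      (mder E' E' (ch E' q) (F x) (mder E E' F x w)) := by
  have hp := mem_extChartAt_source (I := 𝓘(ℝ, E)) x
  have hs : SmoothFormAt (pull E F β) x := hβ.pullback hF
  have key : ∀ v : E, fderiv ℝ (localMap E E' F x q) (ch E x x) v =
        mder E' E' (ch E' q) (F x) (mder E E' F x v) := by
    intro v
    have := congrArg (fun L => L v) (fderiv_localMap hp (hF.mdifferentiableAt (by simp)) hq)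
    rw [mder_chart_self] at this
    exact this
  rw [xD_eq_dAlt (ContDiffAt.differentiableAt hs (by simp)),
    dAlt_congr (rep_pull_eventuallyEq β hp hF hq), dAlt_pull, localMap_chart hp, key, key]
  · rw [localMap_chart hp]
    exact ((smoothFormAt_iff hq).1 hβ).differentiableAt (by simp)
  · exact contDiffAt_localMap hp hF hq

/-- The exterior derivative can be computed in any chart. -/
theorem xD_chart {β : N → E →L[ℝ] ℝ} {p q : N} (hp : q ∈ (ch E p).source)
    (hβ : SmoothFormAt β q) (v w : E) :
    xD β q v w = dAlt (rep p β) (ch E p q) (mder E E (ch E p) q v) (mder E E (ch E p) q w) := by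
  have := xD_pull_chart (F := (id : N → N)) (x := q) hβ contMDiffAt_id hp v w
  rw [pull_id, mder_id] at this
  exact this

/-- The exterior derivative commutes with pullbacks. -/
theorem xD_pull {F : N → N'} {x : N} {β : N' → E' →L[ℝ] ℝ} (hβ : SmoothFormAt β (F x))
    (hF : ContMDiffAt 𝓘(ℝ, E) 𝓘(ℝ, E') ∞ F x) (v w : E) :
    xD (pull E F β) x v w = xD β (F x) (mder E E' F x v) (mder E E' F x w) := by
  rw [xD_pull_chart hβ hF (mem_extChartAt_source (I := 𝓘(ℝ, E')) (F x)),
    xD_eq_dAlt (ContDiffAt.differentiableAt hβ (by simp)), mder_chart_self]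
  rfl

theorem contMDiffAt_iff_chart {F : Type*} [NormedAddCommGroup F] [NormedSpace ℝ F] {f : N → F}
    {p x : N} (hp : x ∈ (ch E p).source) :
    ContMDiffAt 𝓘(ℝ, E) 𝓘(ℝ, F) ∞ f x ↔
      ContDiffAt ℝ ∞ (fun y => f ((ch E p).symm y)) (ch E p x) := by
  have e := (ch E p).left_inv hp
  rw [← contMDiffAt_iff_contDiffAt]
  constructor
  · intro h
    have h' : ContMDiffAt 𝓘(ℝ, E) 𝓘(ℝ, F) ∞ f ((ch E p).symm (ch E p x)) := by rwa [e]
    exact h'.comp _ (contMDiffAt_chart_symm ((ch E p).map_source hp))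
  · intro h
    have h' := h.comp x (contMDiffAt_chart hp)
    refine h'.congr_of_eventuallyEq ?_
    filter_upwards [(isOpen_extChartAt_source (I := 𝓘(ℝ, E)) p).mem_nhds hp] with z hz
    simp only [Function.comp, (ch E p).left_inv hz]

/-- The trivialization of the cotangent bundle at `p` composes a form with the derivative of the
inverse chart, and this is `rep p`. -/
theorem smoothForm_iff {β : N → E →L[ℝ] ℝ} :
    SmoothForm (E := E) (N := N) β ↔ ∀ p, SmoothFormAt β p := by
  unfold SmoothForm
  refine forall_congr' fun p => ?_
  rw [contMDiffAt_hom_bundle]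
  have hp := mem_extChartAt_source (I := 𝓘(ℝ, E)) p
  have key : ∀ q ∈ (ch E p).source,
      ContinuousLinearMap.inCoordinates E (TangentSpace 𝓘(ℝ, E)) ℝ (Bundle.Trivial N ℝ) p q p q (β q)
       = rep p β (ch E p q) := by
    intro q hq
    have h1 : q ∈ (chartAt E p).source := by simpa using hq
    unfold ContinuousLinearMap.inCoordinates
    rw [TangentBundle.symmL_trivializationAt h1, ModelWithCorners.range_eq_univ, mfderivWithin_univ]
    ext v
    rw [rep_apply, (ch E p).left_inv hq]
    simp
    rfl
  have h2 : ∀ᶠ q in 𝓝 p, ContinuousLinearMap.inCoordinates E (TangentSpace 𝓘(ℝ, E)) ℝ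
      (Bundle.Trivial N ℝ) p q p q (β q) = rep p β (ch E p q) := by
    filter_upwards [(isOpen_extChartAt_source (I := 𝓘(ℝ, E)) p).mem_nhds hp] with q hq
    exact key q hq
  have h3 : ContMDiffAt 𝓘(ℝ, E) 𝓘(ℝ, E →L[ℝ] ℝ) ∞ (fun q => rep p β (ch E p q)) p ↔
      SmoothFormAt β p := by
    rw [contMDiffAt_iff_chart hp]
    have : (fun y => rep p β (ch E p ((ch E p).symm y))) =ᶠ[𝓝 (ch E p p)] rep p β := ?_
    · exact ⟨fun h => h.congr_of_eventuallyEq this.symm, fun h => h.congr_of_eventuallyEq this⟩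
    filter_upwards [(isOpen_extChartAt_target (I := 𝓘(ℝ, E)) p).mem_nhds
      ((ch E p).map_source hp)] with y hy
    rw [(ch E p).right_inv hy]
  constructor
  · rintro ⟨-, h⟩
    exact h3.1 (h.congr_of_eventuallyEq (h2.mono fun _ h => h.symm))
  · intro h
    exact ⟨contMDiffAt_id, (h3.2 h).congr_of_eventuallyEq h2⟩

end Pull

/-! ### Exterior calculus of one-forms -/

section Calculus

variable {E : Type} [NormedAddCommGroup E] [NormedSpace ℝ E]
  {N : Type u} [TopologicalSpace N] [ChartedSpace E N] [IsManifold 𝓘(ℝ, E) ∞ N]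

/-- The wedge product of two 1-forms. -/
def wdg (β γ : N → E →L[ℝ] ℝ) (p : N) (v w : E) : ℝ := β p v * γ p w - β p w * γ p v

theorem SmoothAt.chart {f : N → ℝ} {p x : N} (hf : SmoothAt E f x) (hp : x ∈ (ch E p).source) :
    ContDiffAt ℝ ∞ (fun y => f ((ch E p).symm y)) (ch E p x) :=
  (contMDiffAt_iff_chart hp).1 hf

theorem SmoothFormAt.congr {β γ : N → E →L[ℝ] ℝ} {p : N} (hβ : SmoothFormAt β p)
    (h : γ =ᶠ[𝓝 p] β) : SmoothFormAt γ p := by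
  refine ContDiffAt.congr_of_eventuallyEq hβ ?_
  filter_upwards [eventually_chart (mem_extChartAt_source (I := 𝓘(ℝ, E)) p) h] with y hy
  unfold rep; rw [show γ _ = β _ from hy.2]

theorem xD_congr {β γ : N → E →L[ℝ] ℝ} {p : N} (hβ : SmoothFormAt β p)
    (h : γ =ᶠ[𝓝 p] β) (v w : E) : xD γ p v w = xD β p v w := by
  rw [xD_eq_dAlt ((hβ.congr h).differentiableAt (by simp)),
    xD_eq_dAlt (ContDiffAt.differentiableAt hβ (by simp))]
  apply dAlt_congr
  filter_upwards [eventually_chart (mem_extChartAt_source (I := 𝓘(ℝ, E)) p) h] with y hy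
  unfold rep; rw [show γ _ = β _ from hy.2]

theorem SmoothFormAt.add {β γ : N → E →L[ℝ] ℝ} {p : N} (hβ : SmoothFormAt β p)
    (hγ : SmoothFormAt γ p) : SmoothFormAt (fun q => β q + γ q) p := ContDiffAt.add hβ hγ

theorem SmoothFormAt.sub {β γ : N → E →L[ℝ] ℝ} {p : N} (hβ : SmoothFormAt β p)
    (hγ : SmoothFormAt γ p) : SmoothFormAt (fun q => β q - γ q) p := by
  refine (ContDiffAt.sub hβ hγ).congr_of_eventuallyEq (Eventually.of_forall fun y => ?_)
  ext v; simp [rep]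

theorem SmoothFormAt.neg {β : N → E →L[ℝ] ℝ} {p : N} (hβ : SmoothFormAt β p) :
    SmoothFormAt (fun q => - β q) p := by
  refine (ContDiffAt.neg hβ).congr_of_eventuallyEq (Eventually.of_forall fun y => ?_)
  ext v; simp [rep]

theorem SmoothFormAt.zero {p : N} : SmoothFormAt (E := E) (fun _ => 0) p := by
  refine (contDiffAt_const (c := (0 : E →L[ℝ] ℝ))).congr_of_eventuallyEq
    (Eventually.of_forall fun y => ?_)
  ext v; simp [rep]

theorem SmoothFormAt.smul {f : N → ℝ} {β : N → E →L[ℝ] ℝ} {p : N} (hf : SmoothAt E f p)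
    (hβ : SmoothFormAt β p) : SmoothFormAt (fun q => f q • β q) p := by
  refine (ContDiffAt.smul (hf.chart (mem_extChartAt_source p)) hβ).congr_of_eventuallyEq
    (Eventually.of_forall fun y => ?_)
  ext v; simp [rep]

theorem SmoothFormAt.sum {ι : Type*} {s : Finset ι} {β : ι → N → E →L[ℝ] ℝ} {p : N}
    (hβ : ∀ i ∈ s, SmoothFormAt (β i) p) : SmoothFormAt (fun q => ∑ i ∈ s, β i q) p := by
  refine (ContDiffAt.sum hβ).congr_of_eventuallyEq (Eventually.of_forall fun y => ?_)
  ext v; simp [rep]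

theorem xD_add {β γ : N → E →L[ℝ] ℝ} {p : N} (hβ : SmoothFormAt β p)
    (hγ : SmoothFormAt γ p) (v w : E) :
    xD (fun q => β q + γ q) p v w = xD β p v w + xD γ p v w := by
  have h1 := ContDiffAt.differentiableAt hβ (by simp)
  have h2 := ContDiffAt.differentiableAt hγ (by simp)
  rw [xD_eq_dAlt ((hβ.add hγ).differentiableAt (by simp)), xD_eq_dAlt h1, xD_eq_dAlt h2]
  unfold dAlt
  rw [show rep p (fun q => β q + γ q) = fun y => rep p β y + rep p γ y from rfl,
    fderiv_fun_add h1 h2]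
  simp; ring

theorem mder_apply_chart {f : N → ℝ} {p x : N} (hf : SmoothAt E f x) (hp : x ∈ (ch E p).source)
    (v : E) : fderiv ℝ (fun y => f ((ch E p).symm y)) (ch E p x) (mder E E (ch E p) x v)
      = dForm E f x v := by
  have e := (ch E p).left_inv hp
  have hf' : MDifferentiableAt 𝓘(ℝ, E) 𝓘(ℝ, ℝ) f ((ch E p).symm (ch E p x)) := by
    rw [e]; exact hf.mdifferentiableAt (by simp)
  rw [← mder_eq_fderiv, mder_comp _ hf' (mdiff_chart_symm ((ch E p).map_source hp)), e]
  have := congrArg (fun L => L v) (mder_chart_symm_chart hp)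
  simp only [ContinuousLinearMap.comp_apply] at this ⊢
  rw [this]; rfl

theorem xD_smul {f : N → ℝ} {β : N → E →L[ℝ] ℝ} {p : N} (hf : SmoothAt E f p)
    (hβ : SmoothFormAt β p) (v w : E) :
    xD (fun q => f q • β q) p v w = wdg (dForm E f) β p v w + f p * xD β p v w := by
  have hp := mem_extChartAt_source (I := 𝓘(ℝ, E)) p
  have h1 := ContDiffAt.differentiableAt (hf.chart hp) (by simp)
  have h2 := ContDiffAt.differentiableAt hβ (by simp)
  rw [xD_eq_dAlt ((SmoothFormAt.smul hf hβ).differentiableAt (by simp)), xD_eq_dAlt h2]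
  unfold dAlt wdg
  have h3 : rep p (fun q => f q • β q) = fun y => f ((ch E p).symm y) • rep p β y := by
    funext y; ext v; simp [rep]
  have h4 : ∀ v, fderiv ℝ (fun y => f ((ch E p).symm y)) (ch E p p) v = dForm E f p v := by
    intro v; rw [← mder_apply_chart hf hp, mder_chart_self]; rfl
  have h5 := fderiv_fun_smul h1 h2
  rw [h3, h5, (ch E p).left_inv hp]
  simp only [_root_.add_apply, _root_.smul_apply, smul_eq_mul,
    ContinuousLinearMap.smulRight_apply, h4, rep_self]
  ring

theorem rep_dForm {f : N → ℝ} {p x : N} (hf : SmoothAt E f x) (hp : x ∈ (ch E p).source) :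
    rep p (dForm E f) =ᶠ[𝓝 (ch E p x)] fderiv ℝ (fun y => f ((ch E p).symm y)) := by
  have h1 : ∀ᶠ z in 𝓝 x, MDifferentiableAt 𝓘(ℝ, E) 𝓘(ℝ, ℝ) f z := by
    have h : ContMDiffAt 𝓘(ℝ, E) 𝓘(ℝ, ℝ) 1 f x := hf.of_le (by simp)
    have h' := (contMDiffAt_iff_contMDiffAt_nhds (by simp)).1 h
    filter_upwards [h'] with z hz using hz.mdifferentiableAt (by simp)
  filter_upwards [eventually_chart hp h1] with y hy
  rw [← mder_eq_fderiv, mder_comp y hy.2 (mdiff_chart_symm hy.1)]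
  rfl

theorem SmoothAt.dForm {f : N → ℝ} {p : N} (hf : SmoothAt E f p) :
    SmoothFormAt (PKE.dForm E f) p := by
  have hp := mem_extChartAt_source (I := 𝓘(ℝ, E)) p
  exact ((hf.chart hp).fderiv_right (m := ∞) (by simp)).congr_of_eventuallyEq (rep_dForm hf hp)

theorem xD_dForm {f : N → ℝ} {p : N} (hf : SmoothAt E f p) (v w : E) :
    xD (dForm E f) p v w = 0 := by
  have hp := mem_extChartAt_source (I := 𝓘(ℝ, E)) p
  rw [xD_eq_dAlt (ContDiffAt.differentiableAt hf.dForm (by simp)), dAlt_congr (rep_dForm hf hp)]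
  have hs : IsSymmSndFDerivAt ℝ (fun y => f ((ch E p).symm y)) (ch E p p) :=
    (hf.chart hp).isSymmSndFDerivAt (by
      simp only [minSmoothness_of_isRCLikeNormedField]
      exact WithTop.coe_le_coe.2 (le_top : (2 : ℕ∞) ≤ ⊤))
  unfold dAlt
  rw [hs.eq v w, sub_self]

/-- The value at three vectors of the exterior derivative of `∑ βᵢ ∧ γᵢ`. -/
noncomputable def dWdg (β γ : N → E →L[ℝ] ℝ) (p : N) (u v w : E) : ℝ :=
  (xD β p u v * γ p w + xD β p v w * γ p u + xD β p w u * γ p v)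
    - (β p u * xD γ p v w + β p v * xD γ p w u + β p w * xD γ p u v)

/-- `d² = 0`, for a 1-form whose exterior derivative is a sum of products of 1-forms. -/
theorem sum_dWdg_eq_zero {ι : Type*} {s : Finset ι} {α : N → E →L[ℝ] ℝ}
    {β γ : ι → N → E →L[ℝ] ℝ} {V : Set N} (hV : IsOpen V) (hα : ∀ q ∈ V, SmoothFormAt α q)
    (hβ : ∀ i ∈ s, ∀ q ∈ V, SmoothFormAt (β i) q) (hγ : ∀ i ∈ s, ∀ q ∈ V, SmoothFormAt (γ i) q)
    (h : ∀ q ∈ V, ∀ v w, xD α q v w = ∑ i ∈ s, wdg (β i) (γ i) q v w) {p : N} (hp : p ∈ V)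
    (u v w : E) : ∑ i ∈ s, dWdg (β i) (γ i) p u v w = 0 := by
  have hps := mem_extChartAt_source (I := 𝓘(ℝ, E)) p
  set y₀ := ch E p p
  have ha : ContDiffAt ℝ ∞ (rep p α) y₀ := hα p hp
  -- The hypothesis is transported to a full neighbourhood in the one chart around `p`, so that it
  -- can be differentiated there.
  have hd : ∀ᶠ y in 𝓝 y₀, ∀ v w : E, fderiv ℝ (rep p α) y v w - fderiv ℝ (rep p α) y w v
      = ∑ i ∈ s, (rep p (β i) y v * rep p (γ i) y w - rep p (β i) y w * rep p (γ i) y v) := by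
    filter_upwards [eventually_chart hps (Filter.inter_mem (hV.mem_nhds hp)
      ((isOpen_extChartAt_source (I := 𝓘(ℝ, E)) p).mem_nhds hps))] with y hy v w
    have h1 := xD_chart (β := α) hy.2.2 (hα _ hy.2.1) (mder E E (ch E p).symm y v)
      (mder E E (ch E p).symm y w)
    rw [h _ hy.2.1] at h1
    have h2 : ∀ v, mder E E (ch E p) ((ch E p).symm y) (mder E E (ch E p).symm y v) = v :=
      fun v => congrArg (fun L => L v) (mder_chart_chart_symm hy.1)
    rw [h2, h2, (ch E p).right_inv hy.1] at h1
    exact h1.symm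
  have hfd : DifferentiableAt ℝ (fderiv ℝ (rep p α)) y₀ :=
    (ha.fderiv_right (m := ∞) (by simp)).differentiableAt (by simp)
  have hs : IsSymmSndFDerivAt ℝ (rep p α) y₀ :=
    ha.isSymmSndFDerivAt (by
      simp only [minSmoothness_of_isRCLikeNormedField]
      exact WithTop.coe_le_coe.2 (le_top : (2 : ℕ∞) ≤ ⊤))
  have hev : ∀ (f : E → E →L[ℝ] ℝ) (_ : DifferentiableAt ℝ f y₀) (v : E),
      HasFDerivAt (fun y => f y v) ((fderiv ℝ f y₀).flip v) y₀ := by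
    intro f hf v
    have := hf.hasFDerivAt.clm_apply (hasFDerivAt_const v y₀)
    refine this.congr_fderiv ?_
    ext; simp
  have hdiff : ∀ u v w : E, fderiv ℝ (fderiv ℝ (rep p α)) y₀ u v w
      - fderiv ℝ (fderiv ℝ (rep p α)) y₀ u w v = ∑ i ∈ s,
      (fderiv ℝ (rep p (β i)) y₀ u v * γ i p w + β i p v * fderiv ℝ (rep p (γ i)) y₀ u w
       - fderiv ℝ (rep p (β i)) y₀ u w * γ i p v - β i p w * fderiv ℝ (rep p (γ i)) y₀ u v) := by
    intro u v w
    have hL : ∀ v w : E, HasFDerivAt (fun y => fderiv ℝ (rep p α) y v w)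
        (((fderiv ℝ (fderiv ℝ (rep p α)) y₀).flip v).flip w) y₀ := by
      intro v w
      have h1 := hfd.hasFDerivAt.clm_apply (hasFDerivAt_const v y₀)
      have h2 := h1.clm_apply (hasFDerivAt_const w y₀)
      refine h2.congr_fderiv ?_
      ext; simp
    have hR : HasFDerivAt (fun y => ∑ i ∈ s, (rep p (β i) y v * rep p (γ i) y w
        - rep p (β i) y w * rep p (γ i) y v)) (∑ i ∈ s,
        ((rep p (β i) y₀ v • (fderiv ℝ (rep p (γ i)) y₀).flip w
          + rep p (γ i) y₀ w • (fderiv ℝ (rep p (β i)) y₀).flip v)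
         - (rep p (β i) y₀ w • (fderiv ℝ (rep p (γ i)) y₀).flip v
          + rep p (γ i) y₀ v • (fderiv ℝ (rep p (β i)) y₀).flip w))) y₀ := by
      refine HasFDerivAt.fun_sum fun i hi => ?_
      have hb := ContDiffAt.differentiableAt (hβ i hi p hp) (by simp)
      have hg := ContDiffAt.differentiableAt (hγ i hi p hp) (by simp)
      exact ((hev _ hb v).mul (hev _ hg w)).sub ((hev _ hb w).mul (hev _ hg v))
    have hE : (fun y => fderiv ℝ (rep p α) y v w - fderiv ℝ (rep p α) y w v) =ᶠ[𝓝 y₀]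
        fun y => ∑ i ∈ s, (rep p (β i) y v * rep p (γ i) y w
        - rep p (β i) y w * rep p (γ i) y v) := hd.mono fun y hy => hy v w
    have := ((hL v w).sub (hL w v)).unique (hR.congr_of_eventuallyEq hE)
    have := congrArg (fun L => L u) this
    simp only [_root_.sub_apply, ContinuousLinearMap.flip_apply,
      _root_.sum_apply, _root_.add_apply, _root_.smul_apply,
      smul_eq_mul, y₀, rep_self] at this
    rw [this]
    refine Finset.sum_congr rfl fun i _ => ?_
    ring
  have e1 := hdiff u v w
  have e2 := hdiff v w u
  have e3 := hdiff w u v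
  -- In the cyclic sum of the differentiated identities the second derivatives of `α` cancel in
  -- pairs by symmetry.
  have s1 := congrArg (fun L => L w) (hs.eq u v)
  have s2 := congrArg (fun L => L u) (hs.eq v w)
  have s3 := congrArg (fun L => L v) (hs.eq w u)
  have tot : (0 : ℝ) = _ := (by linarith : (0 : ℝ) = _ + _ + _).trans
    (congrArg₂ (· + ·) (congrArg₂ (· + ·) e1 e2) e3)
  rw [← Finset.sum_add_distrib, ← Finset.sum_add_distrib] at tot
  rw [tot]
  refine Finset.sum_congr rfl fun i hi => ?_
  unfold dWdg
  have hb := fun v w => xD_eq_dAlt (ContDiffAt.differentiableAt (hβ i hi p hp) (by simp)) v w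
  have hg := fun v w => xD_eq_dAlt (ContDiffAt.differentiableAt (hγ i hi p hp) (by simp)) v w
  simp only [hb, hg, dAlt]
  ring

end Calculus

/-! ### Calculus of matrix-valued functions on `ℝ⁴` -/

section MatrixCalculus

/-- Entrywise partial derivatives of a matrix-valued function. -/
noncomputable def mpd (i : Fin 4) (A : E4 → Matrix (Fin 4) (Fin 4) ℝ) (y : E4) :
    Matrix (Fin 4) (Fin 4) ℝ :=
  Matrix.of fun a b => pd i (fun z => A z a b) y

/-- Smoothness of the entries of a matrix-valued function. -/
def MSmooth (A : E4 → Matrix (Fin 4) (Fin 4) ℝ) (y : E4) : Prop :=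
  ∀ a b, ContDiffAt ℝ ∞ (fun z => A z a b) y

theorem pd_congr {i : Fin 4} {f h : E4 → ℝ} {y : E4} (H : f =ᶠ[𝓝 y] h) : pd i f y = pd i h y := by
  unfold pd; rw [H.fderiv_eq]

theorem pd_add {i : Fin 4} {f h : E4 → ℝ} {y : E4} (hf : DifferentiableAt ℝ f y)
    (hh : DifferentiableAt ℝ h y) : pd i (fun z => f z + h z) y = pd i f y + pd i h y := by
  unfold pd; rw [fderiv_fun_add hf hh]; rfl

theorem pd_mul {i : Fin 4} {f h : E4 → ℝ} {y : E4} (hf : DifferentiableAt ℝ f y)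
    (hh : DifferentiableAt ℝ h y) :
    pd i (fun z => f z * h z) y = pd i f y * h y + f y * pd i h y := by
  unfold pd; rw [fderiv_fun_mul hf hh]; simp; ring

theorem pd_sum {ι : Type*} {s : Finset ι} {i : Fin 4} {f : ι → E4 → ℝ} {y : E4}
    (hf : ∀ k ∈ s, DifferentiableAt ℝ (f k) y) :
    pd i (fun z => ∑ k ∈ s, f k z) y = ∑ k ∈ s, pd i (f k) y := by
  unfold pd; rw [fderiv_fun_sum hf]; simp

theorem pd_comm {f : E4 → ℝ} {y : E4} (hf : ContDiffAt ℝ ∞ f y) (i j : Fin 4) :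
    pd i (pd j f) y = pd j (pd i f) y := by
  have hs : IsSymmSndFDerivAt ℝ f y := hf.isSymmSndFDerivAt (by
      simp only [minSmoothness_of_isRCLikeNormedField]
      exact WithTop.coe_le_coe.2 (le_top : (2 : ℕ∞) ≤ ⊤))
  have hd : DifferentiableAt ℝ (fderiv ℝ f) y :=
    (hf.fderiv_right (m := ∞) (by simp)).differentiableAt (by simp)
  have key : ∀ i j, pd i (pd j f) y
      = fderiv ℝ (fderiv ℝ f) y (EuclideanSpace.single i 1) (EuclideanSpace.single j 1) := by
    intro i j
    unfold pd
    have := (hd.hasFDerivAt.clm_apply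
      (hasFDerivAt_const (EuclideanSpace.single j (1 : ℝ) : E4) y)).fderiv
    rw [this]; simp
  rw [key, key, hs.eq]

theorem contDiffAt_pd {f : E4 → ℝ} {y : E4} (hf : ContDiffAt ℝ ∞ f y) (i : Fin 4) :
    ContDiffAt ℝ ∞ (pd i f) y :=
  (hf.fderiv_right (m := ∞) (by simp)).clm_apply contDiffAt_const

theorem MSmooth.mul {A B : E4 → Matrix (Fin 4) (Fin 4) ℝ} {y : E4} (hA : MSmooth A y)
    (hB : MSmooth B y) : MSmooth (fun z => A z * B z) y := by
  intro a b
  simp only [Matrix.mul_apply]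
  exact ContDiffAt.sum fun k _ => (hA a k).mul (hB k b)

theorem MSmooth.add {A B : E4 → Matrix (Fin 4) (Fin 4) ℝ} {y : E4} (hA : MSmooth A y)
    (hB : MSmooth B y) : MSmooth (fun z => A z + B z) y := fun a b => (hA a b).add (hB a b)

theorem MSmooth.mpd {A : E4 → Matrix (Fin 4) (Fin 4) ℝ} {y : E4} (hA : MSmooth A y) (i : Fin 4) :
    MSmooth (PKE.mpd i A) y := fun a b => contDiffAt_pd (hA a b) i

theorem MSmooth.congr {A B : E4 → Matrix (Fin 4) (Fin 4) ℝ} {y : E4} (hA : MSmooth A y)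
    (h : B =ᶠ[𝓝 y] A) : MSmooth B y := fun a b =>
  (hA a b).congr_of_eventuallyEq (h.mono fun z hz => by simp only [hz])

theorem mpd_congr {A B : E4 → Matrix (Fin 4) (Fin 4) ℝ} {y : E4} (h : A =ᶠ[𝓝 y] B) (i : Fin 4) :
    mpd i A y = mpd i B y := by
  ext a b; exact pd_congr (h.mono fun z hz => by simp only [hz])

theorem mpd_mul {A B : E4 → Matrix (Fin 4) (Fin 4) ℝ} {y : E4} (hA : MSmooth A y)
    (hB : MSmooth B y) (i : Fin 4) :
    mpd i (fun z => A z * B z) y = mpd i A y * B y + A y * mpd i B y := by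
  have d : ∀ {f : E4 → ℝ}, ContDiffAt ℝ ∞ f y → DifferentiableAt ℝ f y :=
    fun h => h.differentiableAt (by simp)
  ext a b
  simp only [mpd, Matrix.of_apply, Matrix.add_apply, Matrix.mul_apply]
  rw [← Finset.sum_add_distrib]
  refine (pd_sum (f := fun k z => A z a k * B z k b)
    fun k _ => (d (hA a k)).mul (d (hB k b))).trans ?_
  exact Finset.sum_congr rfl fun k _ => pd_mul (d (hA a k)) (d (hB k b))

theorem mpd_add {A B : E4 → Matrix (Fin 4) (Fin 4) ℝ} {y : E4} (hA : MSmooth A y)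
    (hB : MSmooth B y) (i : Fin 4) :
    mpd i (fun z => A z + B z) y = mpd i A y + mpd i B y := by
  ext a b
  exact pd_add ((hA a b).differentiableAt (by simp)) ((hB a b).differentiableAt (by simp))

theorem mpd_transpose (A : E4 → Matrix (Fin 4) (Fin 4) ℝ) (y : E4) (i : Fin 4) :
    mpd i (fun z => (A z)ᵀ) y = (mpd i A y)ᵀ := rfl

theorem mpd_const_mul {A : E4 → Matrix (Fin 4) (Fin 4) ℝ} {y : E4} (hA : MSmooth A y)
    (B : Matrix (Fin 4) (Fin 4) ℝ) (i : Fin 4) :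
    mpd i (fun z => B * A z) y = B * mpd i A y := by
  have hB : MSmooth (fun _ => B) y := fun a b => contDiffAt_const
  rw [mpd_mul hB hA]
  have : mpd i (fun _ => B) y = 0 := by ext a b; simp [mpd, pd]
  rw [this]; simp

theorem mpd_comm {A : E4 → Matrix (Fin 4) (Fin 4) ℝ} {y : E4} (hA : MSmooth A y) (i j : Fin 4) :
    mpd i (mpd j A) y = mpd j (mpd i A) y := by
  ext a b; exact pd_comm (hA a b) i j

theorem splitMetric_transpose : splitMetricᵀ = splitMetric := by
  ext i j; fin_cases i <;> fin_cases j <;> rfl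

theorem splitMetric_mul_self : splitMetric * splitMetric = 1 := by
  ext i j; fin_cases i <;> fin_cases j <;>
    simp [splitMetric, Matrix.mul_apply, Fin.sum_univ_four]

end MatrixCalculus

/-! ### Christoffel symbols and curvature from a moving coframe -/

section ChartCurvature

variable {M : Type u} [TopologicalSpace M] [ChartedSpace E4 M]

/-- The Christoffel symbols as a matrix-valued 1-form. -/
noncomputable def chrMat (g : BilinField M) (p : M) (i : Fin 4) (y : E4) :
    Matrix (Fin 4) (Fin 4) ℝ :=
  Matrix.of fun k j => christoffel g p k i j y

/-- The curvature as a matrix-valued 2-form. -/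
noncomputable def riemMat (g : BilinField M) (p : M) (i j : Fin 4) (y : E4) :
    Matrix (Fin 4) (Fin 4) ℝ :=
  Matrix.of fun k l => riemUp g p k l i j y

/-- A coframe `S` and connection forms `W`, in a chart, for which `g = Sᵀ η S`, the connection is
metric and the torsion vanishes. -/
structure ChartConnection (g : BilinField M) (p : M) (O : Set E4)
    (S : E4 → Matrix (Fin 4) (Fin 4) ℝ) (W : Fin 4 → E4 → Matrix (Fin 4) (Fin 4) ℝ) : Prop where
  isOpen : IsOpen O
  smooth_S : ∀ y ∈ O, MSmooth S y
  smooth_W : ∀ y ∈ O, ∀ i, MSmooth (W i) y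
  inv : ∀ y ∈ O, IsUnit (S y).det
  metric : ∀ y ∈ O, (Matrix.of fun i j => gLow g p i j y) = (S y)ᵀ * splitMetric * S y
  skew : ∀ y ∈ O, ∀ i, (W i y)ᵀ * splitMetric + splitMetric * W i y = 0
  torsion : ∀ y ∈ O, ∀ i j a,
    (mpd i S y + W i y * S y) a j = (mpd j S y + W j y * S y) a i

variable {g : BilinField M} {p : M} {O : Set E4} {S : E4 → Matrix (Fin 4) (Fin 4) ℝ}
  {W : Fin 4 → E4 → Matrix (Fin 4) (Fin 4) ℝ}

/-- The Koszul argument. With `D i = ∂ᵢS + Wᵢ S` and `L i = Sᵀ η D i`, metricity gives `∂ᵢ g = L i +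
(L i)ᵀ` and vanishing torsion makes `L` symmetric in the direction and the last index. The
alternating sum of derivatives of `g` therefore collapses to `2 L`, and multiplying by `g⁻¹ = S⁻¹ η
S⁻ᵀ` leaves `S⁻¹ D`. The result says that the Christoffel symbols are the gauge transform of `W` by
`S`. -/
theorem ChartConnection.mul_chrMat (h : ChartConnection g p O S W) {y : E4} (hy : y ∈ O)
    (i : Fin 4) : S y * chrMat g p i y = mpd i S y + W i y * S y := by
  set D : Fin 4 → Matrix (Fin 4) (Fin 4) ℝ := fun i => mpd i S y + W i y * S y with hD
  set L : Fin 4 → Matrix (Fin 4) (Fin 4) ℝ := fun i => (S y)ᵀ * splitMetric * D i with hL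
  set G : E4 → Matrix (Fin 4) (Fin 4) ℝ := fun y => Matrix.of fun i j => gLow g p i j y with hG
  have hS := h.smooth_S y hy
  -- The terms with `W` may be added for free, since `W` is skew for `η`.
  have hGd : ∀ i, mpd i G y = L i + (L i)ᵀ := by
    intro i
    have h1 : G =ᶠ[𝓝 y] fun z => (S z)ᵀ * (splitMetric * S z) := by
      filter_upwards [h.isOpen.mem_nhds hy] with z hz
      rw [hG]; simp only; rw [h.metric z hz, Matrix.mul_assoc]
    have hB : MSmooth (fun _ : E4 => splitMetric) y := fun a b => contDiffAt_const
    have hT : MSmooth (fun z => (S z)ᵀ) y := fun a b => hS b a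
    rw [mpd_congr h1, mpd_mul hT (hB.mul hS), mpd_const_mul hS, mpd_transpose]
    have hs := congrArg (fun X => (S y)ᵀ * X * S y) (h.skew y hy i)
    simp only [Matrix.mul_zero, Matrix.zero_mul] at hs
    simp only [hL, hD, Matrix.transpose_mul, Matrix.transpose_add, splitMetric_transpose,
      Matrix.transpose_transpose]
    have : (S y)ᵀ * ((W i y)ᵀ * splitMetric + splitMetric * W i y) * S y
      = (S y)ᵀ * (W i y)ᵀ * splitMetric * S y + (S y)ᵀ * splitMetric * (W i y * S y) := by
      noncomm_ring
    rw [this] at hs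
    have e2 : (S y)ᵀ * splitMetric * (mpd i S y + W i y * S y)
      + ((mpd i S y)ᵀ + (S y)ᵀ * (W i y)ᵀ) * (splitMetric * S y)
      = ((mpd i S y)ᵀ * (splitMetric * S y) + (S y)ᵀ * (splitMetric * mpd i S y)) +
      ((S y)ᵀ * (W i y)ᵀ * splitMetric * S y + (S y)ᵀ * splitMetric * (W i y * S y)) := by
      noncomm_ring
    rw [e2, hs, add_zero]
  have hsym : ∀ i j l, L i l j = L j l i := by
    intro i j l
    simp only [hL, Matrix.mul_apply (M := (S y)ᵀ * splitMetric)]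
    exact Finset.sum_congr rfl fun a _ => congrArg _ (h.torsion y hy i j a)
  have hinv : G y * ((S y)⁻¹ * splitMetric * ((S y)ᵀ)⁻¹) = 1 := by
    have hT : IsUnit ((S y)ᵀ).det := by rw [Matrix.det_transpose]; exact h.inv y hy
    calc G y * ((S y)⁻¹ * splitMetric * ((S y)ᵀ)⁻¹)
        = (S y)ᵀ * splitMetric * (S y * (S y)⁻¹) * splitMetric * ((S y)ᵀ)⁻¹ := by
          rw [hG]; simp only; rw [h.metric y hy]; noncomm_ring
      _ = 1 := by
          rw [Matrix.mul_nonsing_inv _ (h.inv y hy), Matrix.mul_one,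
            Matrix.mul_assoc (S y)ᵀ, splitMetric_mul_self, Matrix.mul_one,
            Matrix.mul_nonsing_inv _ hT]
  have hchr : chrMat g p i y = (G y)⁻¹ * L i := by
    ext k j
    simp only [chrMat, Matrix.of_apply, christoffel, Matrix.mul_apply]
    rw [Finset.mul_sum]
    refine Finset.sum_congr rfl fun l _ => ?_
    have e : ∀ i j l, pd i (gLow g p j l) y = L i j l + L i l j := by
      intro i j l
      exact congrFun (congrFun (hGd i) j) l
    rw [e, e, e]
    have e1 : L i j l + L i l j + (L j i l + L j l i) - (L l i j + L l j i) = 2 * L i l j := by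
      have := hsym i j l
      have := hsym j l i
      have := hsym i l j
      linarith
    rw [e1]
    change 1 / 2 * ((G y)⁻¹ k l * (2 * L i l j)) = (G y)⁻¹ k l * L i l j
    ring
  rw [hchr, Matrix.inv_eq_right_inv hinv]
  have hT : IsUnit ((S y)ᵀ).det := by rw [Matrix.det_transpose]; exact h.inv y hy
  calc S y * ((S y)⁻¹ * splitMetric * ((S y)ᵀ)⁻¹ * L i)
      = (S y * (S y)⁻¹) * splitMetric * (((S y)ᵀ)⁻¹ * (S y)ᵀ) * splitMetric * D i := by
        simp only [hL]; noncomm_ring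
    _ = D i := by
        rw [Matrix.mul_nonsing_inv _ (h.inv y hy), Matrix.nonsing_inv_mul _ hT, Matrix.mul_one,
          Matrix.one_mul, splitMetric_mul_self, Matrix.one_mul]

theorem contDiffAt_matrix_inv {y : E4} {S : E4 → Matrix (Fin 4) (Fin 4) ℝ}
    (hS : MSmooth S y) (hi : IsUnit (S y).det) : MSmooth (fun z => (S z)⁻¹) y := by
  have hdet : ContDiffAt ℝ ∞ (fun z => (S z).det) y := by
    simp only [Matrix.det_apply]
    refine ContDiffAt.sum fun σ _ => ContDiffAt.const_smul _ ?_
    exact contDiffAt_prod fun k _ => hS _ _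
  intro a b
  simp only [Matrix.inv_def, Matrix.smul_apply, smul_eq_mul, Ring.inverse_eq_inv']
  refine (hdet.inv hi.ne_zero).mul ?_
  simp only [Matrix.adjugate_apply, Matrix.det_apply]
  refine ContDiffAt.sum fun σ _ => ContDiffAt.const_smul _ ?_
  refine contDiffAt_prod fun k _ => ?_
  by_cases hk : σ k = b
  · simp [Matrix.updateRow_apply, hk, contDiffAt_const]
  · simp only [Matrix.updateRow_apply, hk, if_false]; exact hS _ _

theorem ChartConnection.smooth_chrMat (h : ChartConnection g p O S W) {y : E4} (hy : y ∈ O)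
    (i : Fin 4) : MSmooth (chrMat g p i) y := by
  have h1 := contDiffAt_matrix_inv (h.smooth_S y hy) (h.inv y hy)
  have h2 := h1.mul (((h.smooth_S y hy).mpd i).add ((h.smooth_W y hy i).mul (h.smooth_S y hy)))
  refine h2.congr ?_
  filter_upwards [h.isOpen.mem_nhds hy] with z hz
  rw [← h.mul_chrMat hz, ← Matrix.mul_assoc, Matrix.nonsing_inv_mul _ (h.inv z hz), Matrix.one_mul]

/-- Curvature is gauge covariant: differentiate `S Γⱼ = ∂ⱼS + Wⱼ S` in direction `i`, antisymmetrize
so that the mixed second derivatives of `S` drop out, and eliminate the first derivatives by the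
same identity. -/
theorem ChartConnection.mul_riemMat (h : ChartConnection g p O S W) {y : E4} (hy : y ∈ O)
    (i j : Fin 4) : S y * riemMat g p i j y =
      (mpd i (W j) y - mpd j (W i) y + (W i y * W j y - W j y * W i y)) * S y := by
  have hS := h.smooth_S y hy
  have hW := h.smooth_W y hy
  have hC := fun i => h.smooth_chrMat hy i
  have hR : riemMat g p i j y = mpd i (chrMat g p j) y - mpd j (chrMat g p i) y
      + (chrMat g p i y * chrMat g p j y - chrMat g p j y * chrMat g p i y) := by
    ext k l
    simp only [riemMat, riemUp, Matrix.of_apply, Matrix.add_apply, Matrix.sub_apply,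
      Matrix.mul_apply, Finset.sum_sub_distrib, chrMat, mpd]
  have key : ∀ i j, mpd i S y * chrMat g p j y + S y * mpd i (chrMat g p j) y
      = mpd i (mpd j S) y + (mpd i (W j) y * S y + W j y * mpd i S y) := by
    intro i j
    rw [← mpd_mul hS (hC j), ← mpd_mul (hW j) hS, ← mpd_add (hS.mpd j) ((hW j).mul hS)]
    apply mpd_congr
    filter_upwards [h.isOpen.mem_nhds hy] with z hz
    exact h.mul_chrMat hz j
  have e1 := key i j
  have e2 := key j i
  rw [mpd_comm hS j i] at e2
  have c1 : mpd i S y = S y * chrMat g p i y - W i y * S y := by rw [h.mul_chrMat hy]; abel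
  have c2 : mpd j S y = S y * chrMat g p j y - W j y * S y := by rw [h.mul_chrMat hy]; abel
  have e3 : S y * (mpd i (chrMat g p j) y) = mpd i (mpd j S) y
      + (mpd i (W j) y * S y + W j y * mpd i S y) - mpd i S y * chrMat g p j y := by
    rw [← e1]; abel
  have e4 : S y * (mpd j (chrMat g p i) y) = mpd i (mpd j S) y
      + (mpd j (W i) y * S y + W i y * mpd j S y) - mpd j S y * chrMat g p i y := by
    rw [← e2]; abel
  rw [hR, Matrix.mul_add, Matrix.mul_sub, e3, e4, c1, c2]
  noncomm_ring

end ChartCurvature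

/-! ### Four-index arrays under a change of frame -/

section Slots

/-- 4-index arrays. -/
abbrev Arr4 : Type := Fin 4 → Fin 4 → Fin 4 → Fin 4 → ℝ

/-- Contraction of a matrix with the first slot. -/
def sl1 (A : Matrix (Fin 4) (Fin 4) ℝ) (T : Arr4) : Arr4 := fun i j k l => ∑ n, A n i * T n j k l

/-- Contraction of a matrix with the second slot. -/
def sl2 (A : Matrix (Fin 4) (Fin 4) ℝ) (T : Arr4) : Arr4 := fun i j k l => ∑ n, A n j * T i n k l

/-- Contraction of a matrix with the third slot. -/
def sl3 (A : Matrix (Fin 4) (Fin 4) ℝ) (T : Arr4) : Arr4 := fun i j k l => ∑ n, A n k * T i j n l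

/-- Contraction of a matrix with the fourth slot. -/
def sl4 (A : Matrix (Fin 4) (Fin 4) ℝ) (T : Arr4) : Arr4 := fun i j k l => ∑ n, A n l * T i j k n

/-- Contraction of a matrix with every slot. -/
def push (A : Matrix (Fin 4) (Fin 4) ℝ) (T : Arr4) : Arr4 := sl1 A (sl2 A (sl3 A (sl4 A T)))

theorem sl2_sl1 (A B : Matrix (Fin 4) (Fin 4) ℝ) (T : Arr4) :
    sl2 A (sl1 B T) = sl1 B (sl2 A T) := by
  funext i j k l
  simp only [sl1, sl2, Finset.mul_sum]
  rw [Finset.sum_comm]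
  exact Finset.sum_congr rfl fun _ _ => Finset.sum_congr rfl fun _ _ => by ring

theorem sl3_sl1 (A B : Matrix (Fin 4) (Fin 4) ℝ) (T : Arr4) :
    sl3 A (sl1 B T) = sl1 B (sl3 A T) := by
  funext i j k l
  simp only [sl1, sl3, Finset.mul_sum]
  rw [Finset.sum_comm]
  exact Finset.sum_congr rfl fun _ _ => Finset.sum_congr rfl fun _ _ => by ring

theorem sl4_sl1 (A B : Matrix (Fin 4) (Fin 4) ℝ) (T : Arr4) :
    sl4 A (sl1 B T) = sl1 B (sl4 A T) := by
  funext i j k l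
  simp only [sl1, sl4, Finset.mul_sum]
  rw [Finset.sum_comm]
  exact Finset.sum_congr rfl fun _ _ => Finset.sum_congr rfl fun _ _ => by ring

theorem sl3_sl2 (A B : Matrix (Fin 4) (Fin 4) ℝ) (T : Arr4) :
    sl3 A (sl2 B T) = sl2 B (sl3 A T) := by
  funext i j k l
  simp only [sl2, sl3, Finset.mul_sum]
  rw [Finset.sum_comm]
  exact Finset.sum_congr rfl fun _ _ => Finset.sum_congr rfl fun _ _ => by ring

theorem sl4_sl2 (A B : Matrix (Fin 4) (Fin 4) ℝ) (T : Arr4) :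
    sl4 A (sl2 B T) = sl2 B (sl4 A T) := by
  funext i j k l
  simp only [sl2, sl4, Finset.mul_sum]
  rw [Finset.sum_comm]
  exact Finset.sum_congr rfl fun _ _ => Finset.sum_congr rfl fun _ _ => by ring

theorem sl4_sl3 (A B : Matrix (Fin 4) (Fin 4) ℝ) (T : Arr4) :
    sl4 A (sl3 B T) = sl3 B (sl4 A T) := by
  funext i j k l
  simp only [sl3, sl4, Finset.mul_sum]
  rw [Finset.sum_comm]
  exact Finset.sum_congr rfl fun _ _ => Finset.sum_congr rfl fun _ _ => by ring

theorem sl1_mul (A B : Matrix (Fin 4) (Fin 4) ℝ) (T : Arr4) :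
    sl1 (A * B) T = sl1 B (sl1 A T) := by
  funext i j k l
  simp only [sl1, Matrix.mul_apply, Finset.mul_sum, Finset.sum_mul]
  rw [Finset.sum_comm]
  exact Finset.sum_congr rfl fun _ _ => Finset.sum_congr rfl fun _ _ => by ring

theorem sl2_mul (A B : Matrix (Fin 4) (Fin 4) ℝ) (T : Arr4) :
    sl2 (A * B) T = sl2 B (sl2 A T) := by
  funext i j k l
  simp only [sl2, Matrix.mul_apply, Finset.mul_sum, Finset.sum_mul]
  rw [Finset.sum_comm]
  exact Finset.sum_congr rfl fun _ _ => Finset.sum_congr rfl fun _ _ => by ring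

theorem sl3_mul (A B : Matrix (Fin 4) (Fin 4) ℝ) (T : Arr4) :
    sl3 (A * B) T = sl3 B (sl3 A T) := by
  funext i j k l
  simp only [sl3, Matrix.mul_apply, Finset.mul_sum, Finset.sum_mul]
  rw [Finset.sum_comm]
  exact Finset.sum_congr rfl fun _ _ => Finset.sum_congr rfl fun _ _ => by ring

theorem sl4_mul (A B : Matrix (Fin 4) (Fin 4) ℝ) (T : Arr4) :
    sl4 (A * B) T = sl4 B (sl4 A T) := by
  funext i j k l
  simp only [sl4, Matrix.mul_apply, Finset.mul_sum, Finset.sum_mul]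
  rw [Finset.sum_comm]
  exact Finset.sum_congr rfl fun _ _ => Finset.sum_congr rfl fun _ _ => by ring

theorem sl1_sub (A B : Matrix (Fin 4) (Fin 4) ℝ) (T : Arr4) :
    sl1 (A - B) T = sl1 A T - sl1 B T := by
  funext i j k l; simp [sl1, sub_mul, Finset.sum_sub_distrib]

theorem sl2_sub (A B : Matrix (Fin 4) (Fin 4) ℝ) (T : Arr4) :
    sl2 (A - B) T = sl2 A T - sl2 B T := by
  funext i j k l; simp [sl2, sub_mul, Finset.sum_sub_distrib]

theorem sl3_sub (A B : Matrix (Fin 4) (Fin 4) ℝ) (T : Arr4) :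
    sl3 (A - B) T = sl3 A T - sl3 B T := by
  funext i j k l; simp [sl3, sub_mul, Finset.sum_sub_distrib]

theorem sl4_sub (A B : Matrix (Fin 4) (Fin 4) ℝ) (T : Arr4) :
    sl4 (A - B) T = sl4 A T - sl4 B T := by
  funext i j k l; simp [sl4, sub_mul, Finset.sum_sub_distrib]

theorem sl1_sub' (A : Matrix (Fin 4) (Fin 4) ℝ) (T U : Arr4) :
    sl1 A (T - U) = sl1 A T - sl1 A U := by
  funext i j k l; simp [sl1, mul_sub, Finset.sum_sub_distrib]

theorem sl2_sub' (A : Matrix (Fin 4) (Fin 4) ℝ) (T U : Arr4) :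
    sl2 A (T - U) = sl2 A T - sl2 A U := by
  funext i j k l; simp [sl2, mul_sub, Finset.sum_sub_distrib]

theorem sl3_sub' (A : Matrix (Fin 4) (Fin 4) ℝ) (T U : Arr4) :
    sl3 A (T - U) = sl3 A T - sl3 A U := by
  funext i j k l; simp [sl3, mul_sub, Finset.sum_sub_distrib]

theorem sl4_sub' (A : Matrix (Fin 4) (Fin 4) ℝ) (T U : Arr4) :
    sl4 A (T - U) = sl4 A T - sl4 A U := by
  funext i j k l; simp [sl4, mul_sub, Finset.sum_sub_distrib]

/-- Contractions in different slots commute, so both sides can be sorted by slot and then agree by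
the product rule in each slot. -/
theorem push_push (A B : Matrix (Fin 4) (Fin 4) ℝ) (T : Arr4) :
    push A (push B T) = push (B * A) T := by
  simp only [push, sl1_mul, sl2_mul, sl3_mul, sl4_mul, sl2_sl1, sl3_sl1, sl4_sl1, sl3_sl2, sl4_sl2,
    sl4_sl3]

theorem push_one (T : Arr4) : push 1 T = T := by
  funext i j k l
  simp [push, sl1, sl2, sl3, sl4, Matrix.one_apply]

theorem push_sub (A : Matrix (Fin 4) (Fin 4) ℝ) (T U : Arr4) :
    push A (T - U) = push A T - push A U := by
  simp only [push, sl1_sub', sl2_sub', sl3_sub', sl4_sub']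

theorem push_add (A : Matrix (Fin 4) (Fin 4) ℝ) (T U : Arr4) :
    push A (T + U) = push A T + push A U := by
  funext i j k l
  simp only [push, sl1, sl2, sl3, sl4, Pi.add_apply, mul_add, Finset.sum_add_distrib]

theorem push_smul (A : Matrix (Fin 4) (Fin 4) ℝ) (c : ℝ) (T : Arr4) :
    push A (c • T) = c • push A T := by
  funext i j k l
  simp only [push, sl1, sl2, sl3, sl4, Pi.smul_apply, smul_eq_mul, Finset.mul_sum]
  exact Finset.sum_congr rfl fun _ _ => Finset.sum_congr rfl fun _ _ =>
    Finset.sum_congr rfl fun _ _ => Finset.sum_congr rfl fun _ _ => by ring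

theorem push_apply (A : Matrix (Fin 4) (Fin 4) ℝ) (T : Arr4) (a b c d : Fin 4) :
    push A T a b c d = ∑ i, ∑ j, ∑ k, ∑ l, A i a * A j b * A k c * A l d * T i j k l := by
  simp only [push, sl1, sl2, sl3, sl4, Finset.mul_sum, mul_assoc]

@[simp] theorem eta00 : splitMetric 0 0 = 0 := rfl
@[simp] theorem eta01 : splitMetric 0 1 = 0 := rfl
@[simp] theorem eta02 : splitMetric 0 2 = 1 := rfl
@[simp] theorem eta03 : splitMetric 0 3 = 0 := rfl
@[simp] theorem eta10 : splitMetric 1 0 = 0 := rfl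
@[simp] theorem eta11 : splitMetric 1 1 = 0 := rfl
@[simp] theorem eta12 : splitMetric 1 2 = 0 := rfl
@[simp] theorem eta13 : splitMetric 1 3 = 1 := rfl
@[simp] theorem eta20 : splitMetric 2 0 = 1 := rfl
@[simp] theorem eta21 : splitMetric 2 1 = 0 := rfl
@[simp] theorem eta22 : splitMetric 2 2 = 0 := rfl
@[simp] theorem eta23 : splitMetric 2 3 = 0 := rfl
@[simp] theorem eta30 : splitMetric 3 0 = 0 := rfl
@[simp] theorem eta31 : splitMetric 3 1 = 1 := rfl
@[simp] theorem eta32 : splitMetric 3 2 = 0 := rfl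
@[simp] theorem eta33 : splitMetric 3 3 = 0 := rfl

/-- The algebraic curvature tensor of constant curvature for the split metric. -/
def etaArr : Arr4 := fun a b c d =>
  splitMetric a d * splitMetric b c - splitMetric a c * splitMetric b d

theorem gram_apply (S : Matrix (Fin 4) (Fin 4) ℝ) (i j : Fin 4) :
    (Sᵀ * splitMetric * S) i j = S 0 i * S 2 j + S 2 i * S 0 j + S 1 i * S 3 j + S 3 i * S 1 j := by
  simp [Matrix.mul_apply, Fin.sum_univ_four]; ring

theorem push_etaArr (S : Matrix (Fin 4) (Fin 4) ℝ) (i j k l : Fin 4) :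
    push S etaArr i j k l = (Sᵀ * splitMetric * S) i l * (Sᵀ * splitMetric * S) j k
      - (Sᵀ * splitMetric * S) i k * (Sᵀ * splitMetric * S) j l := by
  simp only [gram_apply]
  simp [push, sl1, sl2, sl3, sl4, etaArr, Fin.sum_univ_four]
  ring

end Slots

/-! ### Coframe fields and their curvature components -/

section Fields

variable {M : Type u} [TopologicalSpace M] [ChartedSpace E4 M] [IsManifold (𝓡 4) ∞ M]

/-- Fields of linear coframes. -/
abbrev CoframeField (M : Type u) : Type u := M → E4 ≃L[ℝ] (Fin 4 → ℝ)

/-- The value of a field of coframes as a point of the coframe bundle. -/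
def toCoframe (e : CoframeField M) (q : M) : Coframe M := ⟨q, e q⟩

/-- The 1-forms of a field of coframes. -/
noncomputable def frm (e : CoframeField M) (a : Fin 4) : M → E4 →L[ℝ] ℝ := fun q =>
  (ContinuousLinearMap.proj (R := ℝ) (φ := fun _ : Fin 4 => ℝ) a).comp
    (e q : E4 →L[ℝ] (Fin 4 → ℝ))

/-- The vector fields dual to a field of coframes. -/
noncomputable def vec (e : CoframeField M) (a : Fin 4) (q : M) : E4 := (e q).symm (Pi.single a 1)

theorem frm_apply (e : CoframeField M) (a : Fin 4) (q : M) (v : E4) : frm e a q v = e q v a := rfl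

theorem frm_vec (e : CoframeField M) (a b : Fin 4) (q : M) :
    frm e a q (vec e b q) = if a = b then 1 else 0 := by
  simp [frm_apply, vec, Pi.single_apply]

theorem sum_frm_smul_vec (e : CoframeField M) (q : M) (v : E4) :
    ∑ a, frm e a q v • vec e a q = v := by
  apply (e q).injective
  rw [map_sum]
  funext b
  simp [vec, frm_apply, Pi.single_apply]

/-- The coordinate vectors of the preferred chart around `p`. -/
noncomputable def cvec (p : M) (i : Fin 4) (y : E4) : E4 :=
  mder E4 E4 (ch E4 p).symm y (EuclideanSpace.single i 1)

/-- The components of a coframe in the preferred chart around `p`. -/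
noncomputable def Smat (e : CoframeField M) (p : M) (y : E4) : Matrix (Fin 4) (Fin 4) ℝ :=
  Matrix.of fun a i => rep p (frm e a) y (EuclideanSpace.single i 1)

/-- The components of connection forms in the preferred chart around `p`. -/
noncomputable def Wmat (κ : Fin 4 → Fin 4 → M → E4 →L[ℝ] ℝ) (p : M) (i : Fin 4) (y : E4) :
    Matrix (Fin 4) (Fin 4) ℝ :=
  Matrix.of fun a b => rep p (κ a b) y (EuclideanSpace.single i 1)

/-- The components of the dual frame in the preferred chart around `p`. -/
noncomputable def Emat (e : CoframeField M) (p : M) (y : E4) : Matrix (Fin 4) (Fin 4) ℝ :=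
  Matrix.of fun i a => (mder E4 E4 (ch E4 p) ((ch E4 p).symm y) (vec e a ((ch E4 p).symm y))) i

theorem sum_single (x : E4) : ∑ i, x i • (EuclideanSpace.single i (1 : ℝ) : E4) = x := by
  ext j
  simp [Pi.single_apply]

theorem Smat_mul_Emat (e : CoframeField M) {p : M} {y : E4} (hy : y ∈ (ch E4 p).target) :
    Smat e p y * Emat e p y = 1 := by
  ext a b
  set x := mder E4 E4 (ch E4 p) ((ch E4 p).symm y) (vec e b ((ch E4 p).symm y)) with hx
  have h1 : (Smat e p y * Emat e p y) a b = rep p (frm e a) y x := by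
    conv_rhs => rw [← sum_single x]
    rw [map_sum, Matrix.mul_apply]
    refine Finset.sum_congr rfl fun i _ => ?_
    rw [map_smul, smul_eq_mul, mul_comm]
    rfl
  have h2 := rep_chart ((ch E4 p).map_target hy) (frm e a) (vec e b ((ch E4 p).symm y))
  rw [(ch E4 p).right_inv hy, ← hx, frm_vec] at h2
  rw [h1, h2, Matrix.one_apply]

theorem Emat_mul_Smat (e : CoframeField M) {p : M} {y : E4} (hy : y ∈ (ch E4 p).target) :
    Emat e p y * Smat e p y = 1 := mul_eq_one_comm.1 (Smat_mul_Emat e hy)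

theorem cvec_eq_sum (e : CoframeField M) (p : M) (i : Fin 4) (y : E4) :
    cvec p i y = ∑ a, Smat e p y a i • vec e a ((ch E4 p).symm y) :=
  (sum_frm_smul_vec e ((ch E4 p).symm y) (cvec p i y)).symm

theorem vec_eq_sum (e : CoframeField M) {p : M} {y : E4} (hy : y ∈ (ch E4 p).target) (a : Fin 4) :
    vec e a ((ch E4 p).symm y) = ∑ i, Emat e p y i a • cvec p i y := by
  have h : ∑ i, Emat e p y i a • cvec p i y = ∑ b, (∑ i, Smat e p y b i * Emat e p y i a) •
      vec e b ((ch E4 p).symm y) := by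
    simp only [cvec_eq_sum e, Finset.smul_sum, Finset.sum_smul, smul_smul]
    rw [Finset.sum_comm]
    exact Finset.sum_congr rfl fun _ _ => Finset.sum_congr rfl fun _ _ => by rw [mul_comm]
  rw [h]
  have := Smat_mul_Emat e hy
  have h2 : ∀ b, ∑ i, Smat e p y b i * Emat e p y i a = if b = a then 1 else 0 := by
    intro b
    have := congrFun (congrFun this b) a
    rwa [Matrix.mul_apply, Matrix.one_apply] at this
  simp [h2]

theorem exists_bilin_xD {E : Type} [NormedAddCommGroup E] [NormedSpace ℝ E]
    {N : Type u} [TopologicalSpace N] [ChartedSpace E N] [IsManifold 𝓘(ℝ, E) ∞ N]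
    {β : N → E →L[ℝ] ℝ} {q : N} (hβ : SmoothFormAt β q) :
    ∃ B : E →L[ℝ] E →L[ℝ] ℝ, ∀ v w, xD β q v w = B v w := by
  refine ⟨fderiv ℝ (rep q β) (ch E q q) - (fderiv ℝ (rep q β) (ch E q q)).flip, fun v w => ?_⟩
  rw [xD_eq_dAlt (ContDiffAt.differentiableAt hβ (by simp))]
  simp [dAlt]

/-- The curvature forms. -/
noncomputable def Om (κ : Fin 4 → Fin 4 → M → E4 →L[ℝ] ℝ) (a b : Fin 4) (q : M) (v w : E4) : ℝ :=
  xD (κ a b) q v w + ∑ c, wdg (κ a c) (κ c b) q v w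

theorem exists_bilin_Om {κ : Fin 4 → Fin 4 → M → E4 →L[ℝ] ℝ} {q : M}
    (hκ : ∀ a b, SmoothFormAt (κ a b) q) (a b : Fin 4) :
    ∃ B : E4 →L[ℝ] E4 →L[ℝ] ℝ, ∀ v w, Om κ a b q v w = B v w := by
  obtain ⟨B, hB⟩ := exists_bilin_xD (hκ a b)
  refine ⟨B + ∑ c, ((κ a c q).smulRight (κ c b q) - (κ c b q).smulRight (κ a c q)), fun v w => ?_⟩
  simp only [Om, hB, wdg, add_apply, sum_apply, sub_apply, ContinuousLinearMap.smulRight_apply,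
    smul_apply, smul_eq_mul]
  congr 1
  exact Finset.sum_congr rfl fun c _ => by ring

/-- A field of coframes, on `V`, in which `g` has constant components, with its Levi-Civita
connection forms. -/
structure IsLeviCivita (g : BilinField M) (e : CoframeField M)
    (κ : Fin 4 → Fin 4 → M → E4 →L[ℝ] ℝ) (V : Set M) : Prop where
  isOpen : IsOpen V
  smooth_e : ∀ q ∈ V, ∀ a, SmoothFormAt (frm e a) q
  smooth_κ : ∀ q ∈ V, ∀ a b, SmoothFormAt (κ a b) q
  metric : ∀ q ∈ V, ∀ v w : E4, (g q : E4 →L[ℝ] E4 →L[ℝ] ℝ) v w =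
    frm e 0 q v * frm e 2 q w + frm e 2 q v * frm e 0 q w
      + frm e 1 q v * frm e 3 q w + frm e 3 q v * frm e 1 q w
  skew : ∀ q ∈ V, ∀ v a b,
    ∑ c, κ c a q v * splitMetric c b + ∑ c, splitMetric a c * κ c b q v = 0
  torsion : ∀ q ∈ V, ∀ a v w, xD (frm e a) q v w = - ∑ b, wdg (κ a b) (frm e b) q v w

/-- The part of the chart domain around `p` that lies over `V`. -/
def chSet (p : M) (V : Set M) : Set E4 := {y | y ∈ (ch E4 p).target ∧ (ch E4 p).symm y ∈ V}

theorem isOpen_chSet (p : M) {V : Set M} (hV : IsOpen V) : IsOpen (chSet p V) :=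
  (continuousOn_extChartAt_symm p).isOpen_inter_preimage (isOpen_extChartAt_target p) hV

theorem smooth_Smat {e : CoframeField M} {p : M} {y : E4} (hy : y ∈ (ch E4 p).target)
    (he : ∀ a, SmoothFormAt (frm e a) ((ch E4 p).symm y)) : MSmooth (Smat e p) y := by
  intro a i
  have := (smoothFormAt_iff ((ch E4 p).map_target hy)).1 (he a)
  rw [(ch E4 p).right_inv hy] at this
  exact this.clm_apply contDiffAt_const

theorem fderiv_apply_const {f : E4 → E4 →L[ℝ] ℝ} {y : E4} (hf : DifferentiableAt ℝ f y) (w : E4)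
    (i : Fin 4) : pd i (fun z => f z w) y = fderiv ℝ f y (EuclideanSpace.single i 1) w := by
  unfold pd
  have := (hf.hasFDerivAt.clm_apply (hasFDerivAt_const w y)).fderiv
  rw [this]; simp

/-- Coordinate vectors have constant components in the chart, so no bracket term occurs. -/
theorem pd_rep_sub {β : M → E4 →L[ℝ] ℝ} {p : M} {y : E4} (hy : y ∈ (ch E4 p).target)
    (hβ : SmoothFormAt β ((ch E4 p).symm y)) (i j : Fin 4) :
    pd i (fun z => rep p β z (EuclideanSpace.single j 1)) y
      - pd j (fun z => rep p β z (EuclideanSpace.single i 1)) y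
      = xD β ((ch E4 p).symm y) (cvec p i y) (cvec p j y) := by
  have hs := (smoothFormAt_iff ((ch E4 p).map_target hy)).1 hβ
  rw [(ch E4 p).right_inv hy] at hs
  have hd := hs.differentiableAt (by simp)
  have h1 : ∀ v, mder E4 E4 (ch E4 p) ((ch E4 p).symm y) (mder E4 E4 (ch E4 p).symm y v) = v :=
    fun v => congrArg (fun L => L v) (mder_chart_chart_symm hy)
  rw [xD_chart ((ch E4 p).map_target hy) hβ, (ch E4 p).right_inv hy, fderiv_apply_const hd,
    fderiv_apply_const hd]
  unfold cvec
  rw [h1, h1]; rfl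

variable {g : BilinField M} {e : CoframeField M} {κ : Fin 4 → Fin 4 → M → E4 →L[ℝ] ℝ} {V : Set M}

theorem IsLeviCivita.chart (h : IsLeviCivita g e κ V) (p : M) :
    ChartConnection g p (chSet p V) (Smat e p) (Wmat κ p) where
  isOpen := isOpen_chSet p h.isOpen
  smooth_S y hy := smooth_Smat hy.1 (h.smooth_e _ hy.2)
  smooth_W y hy i a b := by
    have := (smoothFormAt_iff ((ch E4 p).map_target hy.1)).1 (h.smooth_κ _ hy.2 a b)
    rw [(ch E4 p).right_inv hy.1] at this
    exact this.clm_apply contDiffAt_const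
  inv y hy := by
    have := congrArg Matrix.det (Smat_mul_Emat e hy.1)
    rw [Matrix.det_mul, Matrix.det_one] at this
    exact IsUnit.of_mul_eq_one _ this
  metric y hy := by
    ext i j
    rw [gram_apply]
    exact h.metric _ hy.2 (cvec p i y) (cvec p j y)
  skew y hy i := by
    ext a b
    exact h.skew _ hy.2 (cvec p i y) a b
  torsion y hy i j a := by
    have h1 := h.torsion _ hy.2 a (cvec p i y) (cvec p j y)
    rw [← pd_rep_sub hy.1 (h.smooth_e _ hy.2 a)] at h1
    have h2 : ∑ b, wdg (κ a b) (frm e b) ((ch E4 p).symm y) (cvec p i y) (cvec p j y)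
        = (Wmat κ p i y * Smat e p y) a j - (Wmat κ p j y * Smat e p y) a i := by
      rw [Matrix.mul_apply, Matrix.mul_apply, ← Finset.sum_sub_distrib]; rfl
    rw [h2] at h1
    simp only [Matrix.add_apply]
    have h3 : ∀ i j, mpd i (Smat e p) y a j
      = pd i (fun z => rep p (frm e a) z (EuclideanSpace.single j 1)) y := fun _ _ => rfl
    rw [h3, h3]
    linarith

theorem IsLeviCivita.curv (h : IsLeviCivita g e κ V) {p : M} {y : E4} (hy : y ∈ chSet p V)
    (i j a b : Fin 4) :
    (mpd i (Wmat κ p j) y - mpd j (Wmat κ p i) y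
      + (Wmat κ p i y * Wmat κ p j y - Wmat κ p j y * Wmat κ p i y)) a b
      = Om κ a b ((ch E4 p).symm y) (cvec p i y) (cvec p j y) := by
  unfold Om
  rw [← pd_rep_sub hy.1 (h.smooth_κ _ hy.2 a b)]
  simp only [Matrix.add_apply, Matrix.sub_apply, Matrix.mul_apply, ← Finset.sum_sub_distrib]
  rfl

/-- The components of the Riemann tensor in a coframe. -/
noncomputable def Rf (e : CoframeField M) (κ : Fin 4 → Fin 4 → M → E4 →L[ℝ] ℝ) (q : M) : Arr4 :=
  fun a b c d => ∑ a', splitMetric a a' * Om κ a' b q (vec e c q) (vec e d q)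

theorem IsLeviCivita.Om_cvec (h : IsLeviCivita g e κ V) {p : M} {y : E4} (hy : y ∈ chSet p V)
    (a b k l : Fin 4) :
    Om κ a b ((ch E4 p).symm y) (cvec p k y) (cvec p l y) = ∑ c, Smat e p y c k * ∑ d,
      Smat e p y d l * Om κ a b ((ch E4 p).symm y) (vec e c ((ch E4 p).symm y))
        (vec e d ((ch E4 p).symm y)) := by
  obtain ⟨B, hB⟩ := exists_bilin_Om (h.smooth_κ _ hy.2) a b
  simp only [hB, cvec_eq_sum e, map_sum, map_smul, sum_apply, smul_apply, smul_eq_mul]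
  simp only [Finset.mul_sum]
  rw [Finset.sum_comm]
  exact Finset.sum_congr rfl fun _ _ => Finset.sum_congr rfl fun _ _ => by ring

/-- Lowering an index with `g = Sᵀ η S` turns the gauge covariance of the curvature into `Sᵀ (η F)
S` for the curvature matrix `F` of the coframe, which accounts for the first two slots. The
bilinearity of the curvature forms accounts for the other two. -/
theorem IsLeviCivita.riem_eq (h : IsLeviCivita g e κ V) {p : M} {y : E4} (hy : y ∈ chSet p V)
    (i j k l : Fin 4) :
    riem g p i j k l y = push (Smat e p y) (Rf e κ ((ch E4 p).symm y)) i j k l := by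
  set S := Smat e p y
  set F : Matrix (Fin 4) (Fin 4) ℝ := mpd k (Wmat κ p l) y - mpd l (Wmat κ p k) y
      + (Wmat κ p k y * Wmat κ p l y - Wmat κ p l y * Wmat κ p k y) with hF
  have h1 : riem g p i j k l y
      = ((Matrix.of fun i j => gLow g p i j y) * riemMat g p k l y) i j := rfl
  have h2 : (splitMetric * F) = Matrix.of fun a b => ∑ c, S c k * ∑ d, S d l *
      Rf e κ ((ch E4 p).symm y) a b c d := by
    ext a b
    rw [Matrix.mul_apply]
    simp only [Matrix.of_apply, Rf, hF]
    simp only [h.curv hy, h.Om_cvec hy, Finset.mul_sum]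
    rw [Finset.sum_comm]
    refine Finset.sum_congr rfl fun c _ => ?_
    rw [Finset.sum_comm]
    exact Finset.sum_congr rfl fun _ _ => Finset.sum_congr rfl fun _ _ => by ring
  rw [h1, (h.chart p).metric y hy, Matrix.mul_assoc, (h.chart p).mul_riemMat hy, ← hF,
    Matrix.mul_assoc, ← Matrix.mul_assoc splitMetric, h2]
  simp only [push, sl1, sl2, sl3, sl4, Matrix.mul_apply, Matrix.transpose_apply, Matrix.of_apply]
  refine Finset.sum_congr rfl fun a _ => ?_
  congr 1
  exact Finset.sum_congr rfl fun b _ => mul_comm _ _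

/-- The components of the Ricci tensor in a coframe. -/
noncomputable def Ricf (e : CoframeField M) (κ : Fin 4 → Fin 4 → M → E4 →L[ℝ] ℝ) (q : M)
    (b d : Fin 4) : ℝ := ∑ a, Om κ a b q (vec e a q) (vec e d q)

/-- The contraction over coordinates becomes a contraction over the frame because the dual frame
matrix `Emat` is inverse to `Smat`. -/
theorem IsLeviCivita.ricci_eq (h : IsLeviCivita g e κ V) {p : M} {y : E4} (hy : y ∈ chSet p V)
    (i j : Fin 4) :
    ricci g p i j y = ((Smat e p y)ᵀ * Matrix.of (Ricf e κ ((ch E4 p).symm y)) * Smat e p y) i j := by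
  set S := Smat e p y
  set q := (ch E4 p).symm y
  have hE := Emat_mul_Smat e hy.1
  have h0 : ∀ c, riemMat g p c j y = Emat e p y * ((mpd c (Wmat κ p j) y - mpd j (Wmat κ p c) y
      + (Wmat κ p c y * Wmat κ p j y - Wmat κ p j y * Wmat κ p c y)) * S) := by
    intro c
    rw [← (h.chart p).mul_riemMat hy, ← Matrix.mul_assoc, hE, Matrix.one_mul]
  have h1 : ricci g p i j y = ∑ c, ∑ a, Emat e p y c a * ∑ b,
      Om κ a b q (cvec p c y) (cvec p j y) * S b i := by
    unfold ricci
    refine Finset.sum_congr rfl fun c _ => ?_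
    have := congrFun (congrFun (h0 c) c) i
    rw [Matrix.mul_apply] at this
    refine this.trans (Finset.sum_congr rfl fun a _ => ?_)
    rw [Matrix.mul_apply]
    exact congrArg _ (Finset.sum_congr rfl fun b _ => by rw [h.curv hy])
  have h2 : ∀ a b, ∑ c, Emat e p y c a * Om κ a b q (cvec p c y) (cvec p j y)
      = ∑ d, S d j * Om κ a b q (vec e a q) (vec e d q) := by
    intro a b
    obtain ⟨B, hB⟩ := exists_bilin_Om (h.smooth_κ _ hy.2) a b
    have e1 : ∑ c, Emat e p y c a * Om κ a b q (cvec p c y) (cvec p j y)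
        = B (∑ c, Emat e p y c a • cvec p c y) (cvec p j y) := by
      simp only [map_sum, map_smul, sum_apply, smul_apply, smul_eq_mul, ← hB]; rfl
    rw [e1, ← vec_eq_sum e hy.1]
    have e2 : cvec p j y = ∑ d, S d j • vec e d q := cvec_eq_sum e p j y
    have hB' : ∀ v w, Om κ a b q v w = B v w := hB
    rw [e2]
    simp only [map_sum, map_smul, smul_eq_mul, hB']
    rfl
  rw [h1]
  calc _ = ∑ a, ∑ b, (∑ c, Emat e p y c a * Om κ a b q (cvec p c y) (cvec p j y)) * S b i := by
        rw [Finset.sum_comm]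
        refine Finset.sum_congr rfl fun a _ => ?_
        simp only [Finset.mul_sum, Finset.sum_mul]
        rw [Finset.sum_comm]
        exact Finset.sum_congr rfl fun _ _ => Finset.sum_congr rfl fun _ _ => by ring
    _ = _ := by
        simp only [h2, Matrix.mul_apply, Matrix.transpose_apply, Matrix.of_apply, Ricf,
          Finset.mul_sum, Finset.sum_mul]
        rw [Finset.sum_comm]
        conv_rhs => rw [Finset.sum_comm]
        refine Finset.sum_congr rfl fun b _ => ?_
        rw [Finset.sum_comm]
        exact Finset.sum_congr rfl fun _ _ => Finset.sum_congr rfl fun _ _ => by ring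

end Fields

/-! ### Smoothness of dual frames and of frame components -/

section FrameSmooth

variable {M : Type u} [TopologicalSpace M] [ChartedSpace E4 M] [IsManifold (𝓡 4) ∞ M]
  {e : CoframeField M} {V : Set M}

/-- The coordinate expression of a dual frame vector. -/
noncomputable def evec (e : CoframeField M) (p : M) (a : Fin 4) (y : E4) : E4 :=
  mder E4 E4 (ch E4 p) ((ch E4 p).symm y) (vec e a ((ch E4 p).symm y))

theorem Emat_eq_inv {p : M} {y : E4} (hy : y ∈ (ch E4 p).target) :
    Emat e p y = (Smat e p y)⁻¹ := (Matrix.inv_eq_right_inv (Smat_mul_Emat e hy)).symm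

theorem isUnit_det_Smat {p : M} {y : E4} (hy : y ∈ (ch E4 p).target) :
    IsUnit (Smat e p y).det := by
  have := congrArg Matrix.det (Smat_mul_Emat e hy)
  rw [Matrix.det_mul, Matrix.det_one] at this
  exact IsUnit.of_mul_eq_one _ this

theorem smooth_Emat {p : M} {y : E4} (hy : y ∈ (ch E4 p).target)
    (he : ∀ a, SmoothFormAt (frm e a) ((ch E4 p).symm y)) : MSmooth (Emat e p) y := by
  refine (contDiffAt_matrix_inv (smooth_Smat hy he) (isUnit_det_Smat hy)).congr ?_
  filter_upwards [(isOpen_extChartAt_target (I := 𝓘(ℝ, E4)) p).mem_nhds hy] with z hz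
  exact Emat_eq_inv hz

theorem smooth_evec {p : M} {y : E4} (hy : y ∈ (ch E4 p).target)
    (he : ∀ a, SmoothFormAt (frm e a) ((ch E4 p).symm y)) (a : Fin 4) :
    ContDiffAt ℝ ∞ (evec e p a) y := by
  rw [contDiffAt_euclidean]
  exact fun i => smooth_Emat hy he i a

theorem smoothAt_apply_vec {β : M → E4 →L[ℝ] ℝ} {q : M} (hβ : SmoothFormAt β q)
    (he : ∀ a, SmoothFormAt (frm e a) q) (a : Fin 4) :
    SmoothAt E4 (fun x => β x (vec e a x)) q := by
  have hq := mem_extChartAt_source (I := 𝓘(ℝ, E4)) q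
  rw [SmoothAt, contMDiffAt_iff_chart hq]
  have h1 : ContDiffAt ℝ ∞ (evec e q a) (ch E4 q q) :=
    smooth_evec ((ch E4 q).map_source hq) (by rwa [(ch E4 q).left_inv hq]) a
  refine (ContDiffAt.clm_apply hβ h1).congr_of_eventuallyEq ?_
  filter_upwards [(isOpen_extChartAt_target (I := 𝓘(ℝ, E4)) q).mem_nhds
    ((ch E4 q).map_source hq)] with y hy
  have := rep_chart ((ch E4 q).map_target hy) β (vec e a ((ch E4 q).symm y))
  rw [(ch E4 q).right_inv hy] at this
  exact this.symm

theorem smoothAt_xD_vec {β : M → E4 →L[ℝ] ℝ} {q : M} (hV : IsOpen V) (hq : q ∈ V)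
    (hβ : ∀ x ∈ V, SmoothFormAt β x) (he : ∀ a, SmoothFormAt (frm e a) q) (a b : Fin 4) :
    SmoothAt E4 (fun x => xD β x (vec e a x) (vec e b x)) q := by
  have hqs := mem_extChartAt_source (I := 𝓘(ℝ, E4)) q
  rw [SmoothAt, contMDiffAt_iff_chart hqs]
  have h1 : ∀ a, ContDiffAt ℝ ∞ (evec e q a) (ch E4 q q) := fun a =>
    smooth_evec ((ch E4 q).map_source hqs) (by rwa [(ch E4 q).left_inv hqs]) a
  have h2 : ContDiffAt ℝ ∞ (fderiv ℝ (rep q β)) (ch E4 q q) :=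
    ContDiffAt.fderiv_right (n := ∞) (hβ q hq) (by simp)
  refine (((h2.clm_apply (h1 a)).clm_apply (h1 b)).sub
    ((h2.clm_apply (h1 b)).clm_apply (h1 a))).congr_of_eventuallyEq ?_
  filter_upwards [(isOpen_chSet q hV).mem_nhds
    (show ch E4 q q ∈ chSet q V from ⟨(ch E4 q).map_source hqs, by rwa [(ch E4 q).left_inv hqs]⟩)]
    with y hy
  rw [xD_chart ((ch E4 q).map_target hy.1) (hβ _ hy.2), (ch E4 q).right_inv hy.1]
  rfl

end FrameSmooth

/-! ### The Weyl tensor of an Einstein metric and its covariant derivative -/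

section Weyl

variable {M : Type u} [TopologicalSpace M] [ChartedSpace E4 M] [IsManifold (𝓡 4) ∞ M]
  {g : BilinField M} {e : CoframeField M} {κ : Fin 4 → Fin 4 → M → E4 →L[ℝ] ℝ} {V : Set M} {Λ : ℝ}

/-- The components of the Weyl tensor in a coframe, for an Einstein metric. -/
noncomputable def Cf (e : CoframeField M) (κ : Fin 4 → Fin 4 → M → E4 →L[ℝ] ℝ) (Λ : ℝ) (q : M) :
    Arr4 := Rf e κ q + (Λ / 3) • etaArr

/-- The Einstein equation is available only at the centre of the preferred chart of each point. Read
in the chart of `q` and conjugated with the dual frame, it becomes an equation between frame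
components, in which no chart is left. -/
theorem IsLeviCivita.Ricf_eq (h : IsLeviCivita g e κ V)
    (hE : ∀ (p : M) (a b : Fin 4), ricci g p a b (ch E4 p p) = Λ * gLow g p a b (ch E4 p p))
    {q : M} (hq : q ∈ V) (b d : Fin 4) : Ricf e κ q b d = Λ * splitMetric b d := by
  have hqs := mem_extChartAt_source (I := 𝓘(ℝ, E4)) q
  have hy : ch E4 q q ∈ chSet q V :=
    ⟨(ch E4 q).map_source hqs, by rwa [(ch E4 q).left_inv hqs]⟩
  set S := Smat e q (ch E4 q q)
  have h1 : Sᵀ * Matrix.of (Ricf e κ q) * S = Λ • (Sᵀ * splitMetric * S) := by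
    ext i j
    have := h.ricci_eq hy i j
    rw [hE, (ch E4 q).left_inv hqs] at this
    rw [← this, ← (h.chart q).metric _ hy]; rfl
  have hS := Smat_mul_Emat e hy.1
  have hST : (Emat e q (ch E4 q q))ᵀ * Sᵀ = 1 := by
    rw [← Matrix.transpose_mul, hS, Matrix.transpose_one]
  have h2 : Matrix.of (Ricf e κ q) = Λ • splitMetric := by
    have h3 := congrArg (fun X => (Emat e q (ch E4 q q))ᵀ * X * Emat e q (ch E4 q q)) h1
    simp only [Matrix.mul_smul, Matrix.smul_mul] at h3
    have h4 : ∀ X, (Emat e q (ch E4 q q))ᵀ * (Sᵀ * X * S) * Emat e q (ch E4 q q) = X := by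
      intro X
      calc _ = ((Emat e q (ch E4 q q))ᵀ * Sᵀ) * X * (S * Emat e q (ch E4 q q)) := by
            simp only [Matrix.mul_assoc]
        _ = X := by rw [hST, hS, Matrix.one_mul, Matrix.mul_one]
    rwa [h4, h4] at h3
  exact congrFun (congrFun h2 b) d

/-- Going back from frame components gives the Einstein equation at all points of a fixed chart over
`V`, as is needed before the Weyl tensor can be differentiated there. -/
theorem IsLeviCivita.ricci_einstein (h : IsLeviCivita g e κ V)
    (hE : ∀ (p : M) (a b : Fin 4), ricci g p a b (ch E4 p p) = Λ * gLow g p a b (ch E4 p p))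
    {p : M} {y : E4} (hy : y ∈ chSet p V) (i j : Fin 4) :
    ricci g p i j y = Λ * gLow g p i j y := by
  have h2 : Matrix.of (Ricf e κ ((ch E4 p).symm y)) = Λ • splitMetric := by
    ext b d; exact h.Ricf_eq hE hy.2 b d
  have h3 := congrFun (congrFun ((h.chart p).metric y hy) i) j
  simp only [Matrix.of_apply] at h3
  rw [h.ricci_eq hy, h2, h3, Matrix.mul_smul, Matrix.smul_mul]; rfl

/-- The scalar curvature is `4Λ`, so the Schouten tensor is `(Λ/6) g`. The correction terms then
double up to `Λ/3` times the constant curvature tensor. -/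
theorem IsLeviCivita.weyl_eq (h : IsLeviCivita g e κ V)
    (hE : ∀ (p : M) (a b : Fin 4), ricci g p a b (ch E4 p p) = Λ * gLow g p a b (ch E4 p p))
    {p : M} {y : E4} (hy : y ∈ chSet p V) (i j k l : Fin 4) :
    weyl g p i j k l y = push (Smat e p y) (Cf e κ Λ ((ch E4 p).symm y)) i j k l := by
  set S := Smat e p y with hS
  have hG := (h.chart p).metric y hy
  have hG' : ∀ i j, gLow g p i j y = (Sᵀ * splitMetric * S) i j :=
    fun i j => congrFun (congrFun hG i) j
  have hsym : ∀ i j, gLow g p i j y = gLow g p j i y := by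
    intro i j; rw [hG', hG', gram_apply, gram_apply]; ring
  have hdet : IsUnit (Sᵀ * splitMetric * S).det := by
    have h1 := isUnit_det_Smat (e := e) hy.1
    rw [Matrix.det_mul, Matrix.det_mul, Matrix.det_transpose]
    have h2 : IsUnit splitMetric.det := by
      have := congrArg Matrix.det splitMetric_mul_self
      rw [Matrix.det_mul, Matrix.det_one] at this
      exact IsUnit.of_mul_eq_one _ this
    exact (h1.mul h2).mul h1
  have hscal : scal g p y = 4 * Λ := by
    have h1 : ∀ a, ∑ b, gUp g p a b y * ricci g p a b y = Λ := by
      intro a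
      have h2 : ((Sᵀ * splitMetric * S)⁻¹ * (Sᵀ * splitMetric * S)) a a = 1 := by
        rw [Matrix.nonsing_inv_mul _ hdet, Matrix.one_apply_eq]
      rw [Matrix.mul_apply, ← hG] at h2
      calc _ = Λ * ∑ b, gUp g p a b y * gLow g p b a y := by
            rw [Finset.mul_sum]
            refine Finset.sum_congr rfl fun b _ => ?_
            rw [h.ricci_einstein hE hy, hsym a b]; ring
        _ = Λ := by
            have : ∑ b, gUp g p a b y * gLow g p b a y = 1 := h2
            rw [this, mul_one]
    unfold scal
    simp only [h1]
    simp
  have hsch : ∀ a b, schouten g p a b y = Λ / 6 * gLow g p a b y := by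
    intro a b
    unfold schouten
    rw [hscal, h.ricci_einstein hE hy]; ring
  unfold weyl
  rw [h.riem_eq hy, Cf, push_add, push_smul, hsch, hsch, hsch, hsch]
  simp only [Pi.add_apply, Pi.smul_apply, smul_eq_mul]
  rw [push_etaArr, ← hG', ← hG', ← hG', ← hG', hsym k j, hsym l j, hsym l i, hsym k i]
  ring

theorem dual_toCoframe (e : CoframeField M) (q : M) (a i : Fin 4) :
    (toCoframe e q).dual a i = Emat e q (ch E4 q q) i a := by
  have hqs := mem_extChartAt_source (I := 𝓘(ℝ, E4)) q
  have h1 : (toCoframe e q).dual a i = (mder E4 E4 (ch E4 q) q (vec e a q)) i := rfl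
  rw [h1]
  unfold Emat
  rw [Matrix.of_apply, (ch E4 q).left_inv hqs]

theorem weylComp_toCoframe (q : M) (a b c d : Fin 4) :
    weylComp g (toCoframe e q) a b c d = push (Emat e q (ch E4 q q))
      (fun i j k l => weyl g q i j k l (ch E4 q q)) a b c d := by
  rw [push_apply]
  unfold weylComp
  simp only [dual_toCoframe]
  rfl

theorem IsLeviCivita.weylComp_eq (h : IsLeviCivita g e κ V)
    (hE : ∀ (p : M) (a b : Fin 4), ricci g p a b (ch E4 p p) = Λ * gLow g p a b (ch E4 p p))
    {q : M} (hq : q ∈ V) (a b c d : Fin 4) :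
    weylComp g (toCoframe e q) a b c d = Cf e κ Λ q a b c d := by
  have hqs := mem_extChartAt_source (I := 𝓘(ℝ, E4)) q
  have hy : ch E4 q q ∈ chSet q V :=
    ⟨(ch E4 q).map_source hqs, by rwa [(ch E4 q).left_inv hqs]⟩
  rw [weylComp_toCoframe]
  have : (fun i j k l => weyl g q i j k l (ch E4 q q))
      = push (Smat e q (ch E4 q q)) (Cf e κ Λ q) := by
    funext i j k l
    rw [h.weyl_eq hE hy, (ch E4 q).left_inv hqs]
  rw [this, push_push, Smat_mul_Emat e hy.1, push_one]

theorem IsLeviCivita.smooth_Cf (h : IsLeviCivita g e κ V) {q : M} (hq : q ∈ V) (a b c d : Fin 4) :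
    SmoothAt E4 (fun x => Cf e κ Λ x a b c d) q := by
  have he := h.smooth_e q hq
  have hκ := h.smooth_κ q hq
  have hv : ∀ a b c, SmoothAt E4 (fun x => κ a b x (vec e c x)) q :=
    fun a b c => smoothAt_apply_vec (hκ a b) he c
  have hOm : ∀ a', SmoothAt E4 (fun x => Om κ a' b x (vec e c x) (vec e d x)) q := by
    intro a'
    refine ContMDiffAt.add (smoothAt_xD_vec h.isOpen hq (fun x hx => h.smooth_κ x hx a' b) he c d) ?_
    refine ContMDiffAt.sum fun n _ => ?_
    exact ContMDiffAt.sub ((hv a' n c).mul (hv n b d)) ((hv a' n d).mul (hv n b c))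
  refine ContMDiffAt.add (ContMDiffAt.sum fun a' _ => ?_) contMDiffAt_const
  exact contMDiffAt_const.mul (hOm a')

/-- Smoothness of the entries of an array-valued function. -/
def TSmooth (T : E4 → Arr4) (y : E4) : Prop := ∀ i j k l, ContDiffAt ℝ ∞ (fun z => T z i j k l) y

/-- Entrywise partial derivatives of an array-valued function. -/
noncomputable def pdT (m : Fin 4) (T : E4 → Arr4) (y : E4) : Arr4 :=
  fun i j k l => pd m (fun z => T z i j k l) y

theorem pd_sum_mul {A T : Fin 4 → E4 → ℝ} {y : E4} (hA : ∀ n, ContDiffAt ℝ ∞ (A n) y)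
    (hT : ∀ n, ContDiffAt ℝ ∞ (T n) y) (m : Fin 4) :
    pd m (fun z => ∑ n, A n z * T n z) y
      = ∑ n, pd m (A n) y * T n y + ∑ n, A n y * pd m (T n) y := by
  rw [← Finset.sum_add_distrib]
  refine (pd_sum (f := fun n z => A n z * T n z) fun n _ =>
    ((hA n).mul (hT n)).differentiableAt (by simp)).trans (Finset.sum_congr rfl fun n _ => ?_)
  exact pd_mul ((hA n).differentiableAt (by simp)) ((hT n).differentiableAt (by simp))

theorem smooth_sum_mul {A T : Fin 4 → E4 → ℝ} {y : E4} (hA : ∀ n, ContDiffAt ℝ ∞ (A n) y)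
    (hT : ∀ n, ContDiffAt ℝ ∞ (T n) y) : ContDiffAt ℝ ∞ (fun z => ∑ n, A n z * T n z) y :=
  ContDiffAt.sum fun n _ => (hA n).mul (hT n)

/-- The Leibniz rule, with one term for each of the four copies of `S` and one for `T`. -/
theorem pdT_push {S : E4 → Matrix (Fin 4) (Fin 4) ℝ} {T : E4 → Arr4} {y : E4} (hS : MSmooth S y)
    (hT : TSmooth T y) (m : Fin 4) : pdT m (fun z => push (S z) (T z)) y =
      sl1 (mpd m S y) (sl2 (S y) (sl3 (S y) (sl4 (S y) (T y))))
      + sl1 (S y) (sl2 (mpd m S y) (sl3 (S y) (sl4 (S y) (T y))))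
      + sl1 (S y) (sl2 (S y) (sl3 (mpd m S y) (sl4 (S y) (T y))))
      + sl1 (S y) (sl2 (S y) (sl3 (S y) (sl4 (mpd m S y) (T y))))
      + push (S y) (pdT m T y) := by
  have s4 : TSmooth (fun z => sl4 (S z) (T z)) y := fun i j k l =>
    smooth_sum_mul (fun n => hS n l) (fun n => hT i j k n)
  have s3 : TSmooth (fun z => sl3 (S z) (sl4 (S z) (T z))) y := fun i j k l =>
    smooth_sum_mul (fun n => hS n k) (fun n => s4 i j n l)
  have s2 : TSmooth (fun z => sl2 (S z) (sl3 (S z) (sl4 (S z) (T z)))) y := fun i j k l =>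
    smooth_sum_mul (fun n => hS n j) (fun n => s3 i n k l)
  have d4 : pdT m (fun z => sl4 (S z) (T z)) y
      = sl4 (mpd m S y) (T y) + sl4 (S y) (pdT m T y) := by
    funext i j k l
    exact pd_sum_mul (fun n => hS n l) (fun n => hT i j k n) m
  have d3 : pdT m (fun z => sl3 (S z) (sl4 (S z) (T z))) y = sl3 (mpd m S y) (sl4 (S y) (T y))
      + sl3 (S y) (pdT m (fun z => sl4 (S z) (T z)) y) := by
    funext i j k l
    exact pd_sum_mul (fun n => hS n k) (fun n => s4 i j n l) m
  have d2 : pdT m (fun z => sl2 (S z) (sl3 (S z) (sl4 (S z) (T z)))) y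
      = sl2 (mpd m S y) (sl3 (S y) (sl4 (S y) (T y)))
      + sl2 (S y) (pdT m (fun z => sl3 (S z) (sl4 (S z) (T z))) y) := by
    funext i j k l
    exact pd_sum_mul (fun n => hS n j) (fun n => s3 i n k l) m
  have d1 : pdT m (fun z => push (S z) (T z)) y
      = sl1 (mpd m S y) (sl2 (S y) (sl3 (S y) (sl4 (S y) (T y))))
      + sl1 (S y) (pdT m (fun z => sl2 (S z) (sl3 (S z) (sl4 (S z) (T z)))) y) := by
    funext i j k l
    exact pd_sum_mul (fun n => hS n i) (fun n => s2 n j k l) m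
  have a1 : ∀ A (X Y : Arr4), sl1 A (X + Y) = sl1 A X + sl1 A Y := by
    intro A X Y; funext i j k l; simp [sl1, mul_add, Finset.sum_add_distrib]
  have a2 : ∀ A (X Y : Arr4), sl2 A (X + Y) = sl2 A X + sl2 A Y := by
    intro A X Y; funext i j k l; simp [sl2, mul_add, Finset.sum_add_distrib]
  have a3 : ∀ A (X Y : Arr4), sl3 A (X + Y) = sl3 A X + sl3 A Y := by
    intro A X Y; funext i j k l; simp [sl3, mul_add, Finset.sum_add_distrib]
  rw [d1, d2, d3, d4, a3, a2, a2, a1, a1, a1]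
  simp only [push]
  abel

/-- The covariant derivative of an array of functions, in the direction of a frame vector. -/
noncomputable def covArr (e : CoframeField M) (κ : Fin 4 → Fin 4 → M → E4 →L[ℝ] ℝ)
    (C : M → Arr4) (q : M) (m : Fin 4) : Arr4 := fun a b c d =>
  dForm E4 (fun x => C x a b c d) q (vec e m q)
    - ∑ n, (κ n a q (vec e m q) * C q n b c d + κ n b q (vec e m q) * C q a n c d
      + κ n c q (vec e m q) * C q a b n d + κ n d q (vec e m q) * C q a b c n)

/-- Inserting `∂S = S Γ - W S` in the Leibniz rule for the transformed array, the terms with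
Christoffel symbols cancel those in the covariant derivative. What remains is the derivative of the
frame components corrected by the connection forms. -/
theorem IsLeviCivita.covWeylComp_eq (h : IsLeviCivita g e κ V)
    (hE : ∀ (p : M) (a b : Fin 4), ricci g p a b (ch E4 p p) = Λ * gLow g p a b (ch E4 p p))
    {q : M} (hq : q ∈ V) (m a b c d : Fin 4) :
    covWeylComp g (toCoframe e q) m a b c d = covArr e κ (Cf e κ Λ) q m a b c d := by
  have hqs := mem_extChartAt_source (I := 𝓘(ℝ, E4)) q
  set y := ch E4 q q with hydef
  have hy : y ∈ chSet q V :=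
    ⟨(ch E4 q).map_source hqs, by rwa [(ch E4 q).left_inv hqs]⟩
  have hlq : (ch E4 q).symm y = q := (ch E4 q).left_inv hqs
  set S := Smat e q
  set W := Wmat κ q
  set C : E4 → Arr4 := fun z => Cf e κ Λ ((ch E4 q).symm z) with hC
  have hSs := (h.chart q).smooth_S y hy
  have hCs : TSmooth C y := fun i j k l => (h.smooth_Cf hq i j k l).chart hqs
  have hcov : ∀ n, (fun i j k l => covWeyl g q n i j k l y) = push (S y) (pdT n C y
      - sl1 (W n y) (C y) - sl2 (W n y) (C y) - sl3 (W n y) (C y) - sl4 (W n y) (C y)) := by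
    intro n
    have h1 : (fun i j k l => covWeyl g q n i j k l y)
        = pdT n (fun z => push (S z) (C z)) y
          - sl1 (chrMat g q n y) (push (S y) (C y)) - sl2 (chrMat g q n y) (push (S y) (C y))
          - sl3 (chrMat g q n y) (push (S y) (C y)) - sl4 (chrMat g q n y) (push (S y) (C y)) := by
      funext i j k l
      unfold covWeyl
      have e1 : pd n (weyl g q i j k l) y = pdT n (fun z => push (S z) (C z)) y i j k l := by
        apply pd_congr
        filter_upwards [(h.chart q).isOpen.mem_nhds hy] with z hz
        exact h.weyl_eq hE hz i j k l
      have e2 : ∀ i j k l, weyl g q i j k l y = push (S y) (C y) i j k l :=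
        fun i j k l => h.weyl_eq hE hy i j k l
      rw [e1]
      simp only [e2, Finset.sum_add_distrib, Pi.sub_apply, sl1, sl2, sl3, sl4, chrMat,
        Matrix.of_apply]
      ring
    -- This single substitution exchanges Christoffel symbols for connection forms in every slot.
    have hD : mpd n S y = S y * chrMat g q n y - W n y * S y := by
      rw [(h.chart q).mul_chrMat hy]; abel
    rw [h1, pdT_push hSs hCs, hD]
    simp only [push_sub]
    simp only [push, sl1_sub, sl2_sub, sl3_sub, sl4_sub, sl1_sub', sl2_sub', sl3_sub', sl1_mul,
      sl2_mul, sl3_mul, sl4_mul, sl2_sl1, sl3_sl1, sl4_sl1, sl3_sl2, sl4_sl2, sl4_sl3]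
    abel
  have h0 : covWeylComp g (toCoframe e q) m a b c d = ∑ n, Emat e q y n m *
      push (Emat e q y) (fun i j k l => covWeyl g q n i j k l y) a b c d := by
    unfold covWeylComp
    refine Finset.sum_congr rfl fun n _ => ?_
    rw [push_apply]
    simp only [dual_toCoframe, Finset.mul_sum]
    exact Finset.sum_congr rfl fun _ _ => Finset.sum_congr rfl fun _ _ =>
      Finset.sum_congr rfl fun _ _ => Finset.sum_congr rfl fun _ _ => by
        simp only [hydef, toCoframe]; ring
  have hvec : vec e m q = ∑ n, Emat e q y n m • (EuclideanSpace.single n (1 : ℝ) : E4) := by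
    have h1 := vec_eq_sum e hy.1 m
    rw [hlq] at h1
    rw [h1]
    refine Finset.sum_congr rfl fun n _ => ?_
    unfold cvec
    rw [hydef, mder_chart_symm_self]; rfl
  have hκ : ∀ a b, κ a b q (vec e m q) = ∑ n, Emat e q y n m * W n y a b := by
    intro a b
    rw [hvec, map_sum]
    refine Finset.sum_congr rfl fun n _ => ?_
    rw [map_smul, smul_eq_mul]
    congr 1
    change _ = rep q (κ a b) y _
    rw [hydef, rep_self]
  have hd : dForm E4 (fun x => Cf e κ Λ x a b c d) q (vec e m q)
      = ∑ n, Emat e q y n m * pdT n C y a b c d := by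
    have h1 : ∀ v, dForm E4 (fun x => Cf e κ Λ x a b c d) q v
        = fderiv ℝ (fun z => C z a b c d) y v := by
      intro v
      rw [← mder_apply_chart (h.smooth_Cf hq a b c d) hqs, mder_chart_self]; rfl
    rw [h1, hvec, map_sum]
    refine Finset.sum_congr rfl fun n _ => ?_
    rw [map_smul, smul_eq_mul]; rfl
  have hCy : C y = Cf e κ Λ q := by simp only [hC, hlq]
  rw [h0]
  simp only [hcov, push_push, S, Smat_mul_Emat e hy.1, push_one]
  unfold covArr
  simp only [hd, hκ, Pi.sub_apply, sl1, sl2, sl3, sl4, hCy, mul_sub, Finset.sum_sub_distrib,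
    Finset.sum_add_distrib, Finset.mul_sum, Finset.sum_mul]
  have comm : ∀ f : Fin 4 → Fin 4 → ℝ, ∑ n, ∑ k, f n k = ∑ k, ∑ n, f n k :=
    fun f => Finset.sum_comm
  rw [comm (fun n k => Emat e q y k m * W k y n a * _),
    comm (fun n k => Emat e q y k m * W k y n b * _),
    comm (fun n k => Emat e q y k m * W k y n c * _),
    comm (fun n k => Emat e q y k m * W k y n d * _)]
  simp only [mul_assoc]
  ring

end Weyl

/-! ### Smooth tensor fields and Lie brackets in charts -/

section Tensors

variable {M : Type u} [TopologicalSpace M] [ChartedSpace E4 M] [IsManifold (𝓡 4) ∞ M]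

/-- The components of a field of bilinear forms in the preferred chart around `p`. -/
noncomputable def repB (p : M) (g : M → E4 →L[ℝ] E4 →L[ℝ] ℝ) (y : E4) : E4 →L[ℝ] E4 →L[ℝ] ℝ :=
  (g ((ch E4 p).symm y)).bilinearComp (mder E4 E4 (ch E4 p).symm y) (mder E4 E4 (ch E4 p).symm y)

/-- The components of a field of endomorphisms in the preferred chart around `p`. -/
noncomputable def repK (p : M) (K : M → E4 →L[ℝ] E4) (y : E4) : E4 →L[ℝ] E4 :=
  (mder E4 E4 (ch E4 p) ((ch E4 p).symm y)).comp
    ((K ((ch E4 p).symm y)).comp (mder E4 E4 (ch E4 p).symm y))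

-- Smoothness as a bundle section is smoothness in the trivialization at `p`. That trivialization
-- precomposes both arguments with the derivative of the inverse chart, so it produces `repB`; for
-- endomorphisms the values are also composed with the derivative of the chart.
set_option synthInstance.maxHeartbeats 400000 in
set_option maxHeartbeats 1000000 in
theorem smooth_repB {g : BilinField M} {K : EndField M} (h : IsParaKahlerEinstein g K) {p : M}
    {y : E4} (hy : y ∈ (ch E4 p).target) : ContDiffAt ℝ ∞ (repB p g) y := by
  have : IsManifold (𝓡 4) 1 M := IsManifold.of_le (n := ∞) (by simp)
  have hq := (ch E4 p).map_target hy
  set q := (ch E4 p).symm y with hqdef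
  have hqc : q ∈ (chartAt E4 p).source := by simpa using hq
  have h0 := h.smooth_metric q
  rw [Bundle.Trivialization.contMDiffAt_section_iff (trivializationAt (E4 →L[ℝ] E4 →L[ℝ] ℝ)
    (fun q : M => TangentSpace (𝓡 4) q →L[ℝ] TangentSpace (𝓡 4) q →L[ℝ] ℝ) p) (by
      simp; exact hqc)] at h0
  have h1 : (fun x => (trivializationAt (E4 →L[ℝ] E4 →L[ℝ] ℝ)
    (fun q : M => TangentSpace (𝓡 4) q →L[ℝ] TangentSpace (𝓡 4) q →L[ℝ] ℝ) p ⟨x, g x⟩).2)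
      =ᶠ[𝓝 q] fun x => repB p g (ch E4 p x) := by
    filter_upwards [(isOpen_extChartAt_source (I := 𝓘(ℝ, E4)) p).mem_nhds hq] with x hx
    have hx1 : x ∈ (chartAt E4 p).source := by simpa using hx
    rw [hom_trivializationAt_apply]
    ext v w
    have := inCoordinates_apply_eq₂ (F₁ := E4) (F₂ := E4) (F₃ := ℝ)
      (E₁ := fun q : M => TangentSpace (𝓡 4) q) (E₂ := fun q : M => TangentSpace (𝓡 4) q)
      (E₃ := Bundle.Trivial M ℝ) (x₀ := p) (x := x) (ϕ := g x) (v := v) (w := w)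
      (by simpa using hx1) (by simpa using hx1) (by simp)
    refine this.trans ?_
    have hs : ∀ v : E4, (trivializationAt E4 (TangentSpace (𝓡 4)) p).symm x v
        = mder E4 E4 (ch E4 p).symm (ch E4 p x) v := by
      intro v
      have h2 := congrArg (fun L => L v) (TangentBundle.symmL_trivializationAt (I := 𝓡 4) hx1)
      rw [ModelWithCorners.range_eq_univ, mfderivWithin_univ] at h2
      exact (Bundle.Trivialization.symmL_apply (R := ℝ) (hb := by simpa using hx1) ..).symm.trans h2
    unfold repB
    rw [(ch E4 p).left_inv hx]
    have h3 := hs v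
    have h4 := hs w
    refine Eq.trans ?_ (congrArg₂ (fun a b => (g x : E4 →L[ℝ] E4 →L[ℝ] ℝ) a b) h3 h4)
    exact Bundle.Trivialization.linearMapAt_apply .. |>.trans (by simp)
  have h2 := h0.congr_of_eventuallyEq h1.symm
  have h3 := (contMDiffAt_iff_chart hq).1 h2
  rw [hqdef, (ch E4 p).right_inv hy] at h3
  refine h3.congr_of_eventuallyEq ?_
  filter_upwards [(isOpen_extChartAt_target (I := 𝓘(ℝ, E4)) p).mem_nhds hy] with z hz
  rw [(ch E4 p).right_inv hz]

set_option synthInstance.maxHeartbeats 400000 in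
set_option maxHeartbeats 1000000 in
theorem smooth_repK {g : BilinField M} {K : EndField M} (h : IsParaKahlerEinstein g K) {p : M}
    {y : E4} (hy : y ∈ (ch E4 p).target) : ContDiffAt ℝ ∞ (repK p K) y := by
  have : IsManifold (𝓡 4) 1 M := IsManifold.of_le (n := ∞) (by simp)
  have hq := (ch E4 p).map_target hy
  set q := (ch E4 p).symm y with hqdef
  have hqc : q ∈ (chartAt E4 p).source := by simpa using hq
  have h0 := h.smooth_K q
  rw [Bundle.Trivialization.contMDiffAt_section_iff (trivializationAt (E4 →L[ℝ] E4)
    (fun q : M => TangentSpace (𝓡 4) q →L[ℝ] TangentSpace (𝓡 4) q) p) (by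
      simp; exact hqc)] at h0
  have h1 : (fun x => (trivializationAt (E4 →L[ℝ] E4)
    (fun q : M => TangentSpace (𝓡 4) q →L[ℝ] TangentSpace (𝓡 4) q) p ⟨x, K x⟩).2)
      =ᶠ[𝓝 q] fun x => repK p K (ch E4 p x) := by
    filter_upwards [(isOpen_extChartAt_source (I := 𝓘(ℝ, E4)) p).mem_nhds hq] with x hx
    have hx1 : x ∈ (chartAt E4 p).source := by simpa using hx
    rw [hom_trivializationAt_apply]
    unfold repK ContinuousLinearMap.inCoordinates
    rw [TangentBundle.symmL_trivializationAt hx1, ModelWithCorners.range_eq_univ,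
      mfderivWithin_univ, TangentBundle.continuousLinearMapAt_trivializationAt hx1,
      (ch E4 p).left_inv hx]
    rfl
  have h2 := h0.congr_of_eventuallyEq h1.symm
  have h3 := (contMDiffAt_iff_chart hq).1 h2
  rw [hqdef, (ch E4 p).right_inv hy] at h3
  refine h3.congr_of_eventuallyEq ?_
  filter_upwards [(isOpen_extChartAt_target (I := 𝓘(ℝ, E4)) p).mem_nhds hy] with z hz
  rw [(ch E4 p).right_inv hz]

/-- Smooth coframes have smooth dual frames. -/
theorem smoothVecOn_vec {e : CoframeField M} {V : Set M}
    (he : ∀ q ∈ V, ∀ a, SmoothFormAt (frm e a) q) (a : Fin 4) :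
    SmoothVecOn (M := M) (fun q => vec e a q) V := by
  have : IsManifold (𝓡 4) 1 M := IsManifold.of_le (n := ∞) (by simp)
  intro q hq
  refine ContMDiffAt.contMDiffWithinAt ?_
  have hqs := mem_extChartAt_source (I := 𝓘(ℝ, E4)) q
  refine (Bundle.contMDiffAt_section (E := fun q : M => TangentSpace (𝓡 4) q)
    (s := fun q => vec e a q) q).2 ?_
  have h1 : (fun x => (trivializationAt E4 (TangentSpace (𝓡 4)) q ⟨x, vec e a x⟩).2)
      =ᶠ[𝓝 q] fun x => evec e q a (ch E4 q x) := by
    filter_upwards [(isOpen_extChartAt_source (I := 𝓘(ℝ, E4)) q).mem_nhds hqs] with x hx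
    have hx1 : x ∈ (chartAt E4 q).source := by simpa using hx
    have h2 := congrArg (fun L => L (vec e a x))
      (TangentBundle.continuousLinearMapAt_trivializationAt (I := 𝓡 4) hx1)
    unfold evec
    rw [(ch E4 q).left_inv hx]
    refine Eq.trans ?_ h2
    have h3 : x ∈ (trivializationAt E4 (TangentSpace (𝓡 4)) q).baseSet := by simpa using hx1
    exact (congrFun (Bundle.Trivialization.coe_linearMapAt_of_mem (R := ℝ)
      (trivializationAt E4 (TangentSpace (𝓡 4)) q) h3) (vec e a x)).symm
  refine ContMDiffAt.congr_of_eventuallyEq ?_ h1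
  have h3 : ContDiffAt ℝ ∞ (evec e q a) (ch E4 q q) :=
    smooth_evec ((ch E4 q).map_source hqs) (by rw [(ch E4 q).left_inv hqs]; exact he q hq) a
  exact (contMDiffAt_iff_contDiffAt.2 h3).comp q (contMDiffAt_chart hqs)

/-- The Lie bracket of vector fields. -/
noncomputable def brk (X Y : M → E4) (q : M) : E4 :=
  VectorField.mlieBracket (M := M) (𝓡 4) X Y q

theorem brk_eq (X Y : M → E4) (q : M) : brk X Y q = VectorField.lieBracket ℝ
    (fun y => mder E4 E4 (ch E4 q) ((ch E4 q).symm y) (X ((ch E4 q).symm y)))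
    (fun y => mder E4 E4 (ch E4 q) ((ch E4 q).symm y) (Y ((ch E4 q).symm y))) (ch E4 q q) := by
  have hqs := mem_extChartAt_source (I := 𝓘(ℝ, E4)) q
  have hy := (ch E4 q).map_source hqs
  have h0 : brk X Y q = (mder E4 E4 (ch E4 q) q).inverse
      (VectorField.lieBracketWithin ℝ
        (fun y => ((mfderivWithin 𝓘(ℝ, E4) (𝓡 4) (ch E4 q).symm (range (𝓡 4)) y
          : E4 →L[ℝ] E4)).inverse (X ((ch E4 q).symm y)))
        (fun y => ((mfderivWithin 𝓘(ℝ, E4) (𝓡 4) (ch E4 q).symm (range (𝓡 4)) y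
          : E4 →L[ℝ] E4)).inverse (Y ((ch E4 q).symm y)))
        ((ch E4 q).symm ⁻¹' univ ∩ range (𝓡 4)) (ch E4 q q)) := rfl
  have hpb : ∀ X : M → E4, (fun y => ((mfderivWithin 𝓘(ℝ, E4) (𝓡 4) (ch E4 q).symm
      (range (𝓡 4)) y : E4 →L[ℝ] E4)).inverse (X ((ch E4 q).symm y))) =ᶠ[𝓝 (ch E4 q q)]
      fun y => mder E4 E4 (ch E4 q) ((ch E4 q).symm y) (X ((ch E4 q).symm y)) := by
    intro X
    filter_upwards [(isOpen_extChartAt_target (I := 𝓘(ℝ, E4)) q).mem_nhds hy] with y hy'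
    have h1 : (mder E4 E4 (ch E4 q).symm y).inverse = mder E4 E4 (ch E4 q) ((ch E4 q).symm y) := by
      have h2 := mder_chart_symm_chart ((ch E4 q).map_target hy')
      rw [(ch E4 q).right_inv hy'] at h2
      exact ContinuousLinearMap.inverse_eq h2 (mder_chart_chart_symm hy')
    have h4 : (mfderivWithin 𝓘(ℝ, E4) (𝓡 4) (ch E4 q).symm (range (𝓡 4)) y : E4 →L[ℝ] E4)
        = mder E4 E4 (ch E4 q).symm y := by
      rw [ModelWithCorners.range_eq_univ, mfderivWithin_univ]; rfl
    exact congrArg (fun L : E4 →L[ℝ] E4 => L (X ((ch E4 q).symm y)))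
      ((congrArg ContinuousLinearMap.inverse h4).trans h1)
  rw [h0, mder_chart_self, ContinuousLinearMap.inverse_id, preimage_univ, univ_inter]
  have h5 : ∀ P Q : E4 → E4, VectorField.lieBracketWithin ℝ P Q (range (𝓡 4))
      = VectorField.lieBracket ℝ P Q := by
    intro P Q
    rw [ModelWithCorners.range_eq_univ, VectorField.lieBracketWithin_univ]
  exact (congrFun (h5 _ _) _).trans
    (Filter.EventuallyEq.lieBracket_vectorField_eq (hpb X) (hpb Y))

/-- A form of the coframe is constant on the dual frame vectors. Differentiating these constants
leaves only the bracket term of the Cartan formula. -/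
theorem xD_vec_eq_neg_brk {e : CoframeField M} {q : M}
    (he : ∀ a, SmoothFormAt (frm e a) q) (a b c : Fin 4) :
    xD (frm e a) q (vec e b q) (vec e c q) = - frm e a q (brk (vec e b) (vec e c) q) := by
  have hqs := mem_extChartAt_source (I := 𝓘(ℝ, E4)) q
  have hy := (ch E4 q).map_source hqs
  have hX : ∀ a, DifferentiableAt ℝ (evec e q a) (ch E4 q q) := fun a =>
    (smooth_evec hy (by rwa [(ch E4 q).left_inv hqs]) a).differentiableAt (by simp)
  have hr : DifferentiableAt ℝ (rep q (frm e a)) (ch E4 q q) :=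
    ContDiffAt.differentiableAt (he a) (by simp)
  have h0 : ∀ b, evec e q b (ch E4 q q) = vec e b q := by
    intro b; unfold evec; rw [(ch E4 q).left_inv hqs, mder_chart_self]; rfl
  have key : ∀ b v, fderiv ℝ (rep q (frm e a)) (ch E4 q q) v (vec e b q)
      = - frm e a q (fderiv ℝ (evec e q b) (ch E4 q q) v) := by
    intro b v
    have h1 : (fun y => rep q (frm e a) y (evec e q b y)) =ᶠ[𝓝 (ch E4 q q)]
        fun _ => if a = b then 1 else 0 := by
      filter_upwards [(isOpen_extChartAt_target (I := 𝓘(ℝ, E4)) q).mem_nhds hy] with y hy'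
      have := rep_chart ((ch E4 q).map_target hy') (frm e a) (vec e b ((ch E4 q).symm y))
      rw [(ch E4 q).right_inv hy', frm_vec] at this
      exact this
    have h2 := congrArg (fun L => L v) ((hr.hasFDerivAt.clm_apply (hX b).hasFDerivAt).fderiv.symm.trans
      (h1.fderiv_eq.trans (fderiv_const_apply _)))
    simp only [_root_.add_apply, ContinuousLinearMap.comp_apply,
      ContinuousLinearMap.flip_apply, rep_self, h0, _root_.zero_apply] at h2
    linarith
  rw [xD_eq_dAlt hr, brk_eq]
  unfold dAlt VectorField.lieBracket
  rw [key, key, map_sub]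
  have e0 : ∀ b, (fun y => mder E4 E4 (ch E4 q) ((ch E4 q).symm y) (vec e b ((ch E4 q).symm y)))
    = evec e q b := fun b => rfl
  rw [e0, e0, h0, h0]
  ring

end Tensors

/-! ### Adapted coframes of a single tangent space -/

section AdaptedLinear

/-- Adaptedness of a coframe of one tangent space. -/
def AdaptedAt (G : E4 →L[ℝ] E4 →L[ℝ] ℝ) (K : E4 →L[ℝ] E4) (f : E4 ≃L[ℝ] (Fin 4 → ℝ)) : Prop :=
  (∀ v w, G v w = f v 0 * f w 2 + f v 2 * f w 0 + f v 1 * f w 3 + f v 3 * f w 1) ∧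
  ∀ v, f (K v) = ![f v 0, f v 1, - f v 2, - f v 3]

theorem AdaptedAt.apply_vec {G : E4 →L[ℝ] E4 →L[ℝ] ℝ} {K : E4 →L[ℝ] E4} {f : E4 ≃L[ℝ] (Fin 4 → ℝ)}
    (h : AdaptedAt G K f) :
    K (f.symm (Pi.single 0 1)) = f.symm (Pi.single 0 1) ∧
    K (f.symm (Pi.single 1 1)) = f.symm (Pi.single 1 1) ∧
    K (f.symm (Pi.single 2 1)) = - f.symm (Pi.single 2 1) ∧
    K (f.symm (Pi.single 3 1)) = - f.symm (Pi.single 3 1) := by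
  refine ⟨?_, ?_, ?_, ?_⟩ <;>
  · apply f.injective
    rw [h.2]
    ext i
    fin_cases i <;> simp

/-- The projection on the eigenspace of an involution. -/
noncomputable def eigP (s : ℝ) (K : E4 →L[ℝ] E4) (v : E4) : E4 := (1 / 2 : ℝ) • (v + s • K v)

/-- The linear forms that a basis of vectors, projected on the eigenspaces of `K`, determines. -/
noncomputable def adForm (G : E4 →L[ℝ] E4 →L[ℝ] ℝ) (K : E4 →L[ℝ] E4) (X : Fin 4 → E4) :
    Fin 4 → E4 →L[ℝ] ℝ :=
  let f0 := eigP 1 K (X 0)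
  let f1 := eigP 1 K (X 1)
  let h0 := eigP (-1) K (X 2)
  let h1 := eigP (-1) K (X 3)
  let d := G f0 h0 * G f1 h1 - G f0 h1 * G f1 h0
  ![d⁻¹ • (G f1 h1 • G h0 - G f1 h0 • G h1), d⁻¹ • (G f0 h0 • G h1 - G f0 h1 • G h0), G f0, G f1]

/-- The determinant that occurs in `adForm`. -/
noncomputable def adDet (G : E4 →L[ℝ] E4 →L[ℝ] ℝ) (K : E4 →L[ℝ] E4) (X : Fin 4 → E4) : ℝ :=
  G (eigP 1 K (X 0)) (eigP (-1) K (X 2)) * G (eigP 1 K (X 1)) (eigP (-1) K (X 3))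
    - G (eigP 1 K (X 0)) (eigP (-1) K (X 3)) * G (eigP 1 K (X 1)) (eigP (-1) K (X 2))

/-- Two vectors `f0, f1` of the `+1` eigenspace give the barred forms by contraction with `G`. The
unbarred forms are the contractions with vectors `h0, h1` of the `-1` eigenspace, corrected by the
inverse of the pairing matrix `G(fᵢ, hⱼ)`, whose determinant is `adDet`. With this correction `f0,
f1` are the first two dual vectors. The construction is rational in `G` and `K`, hence smooth in
parameters. -/
theorem adaptedAt_of_adForm {G : E4 →L[ℝ] E4 →L[ℝ] ℝ} {K : E4 →L[ℝ] E4} {X : Fin 4 → E4}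
    (hs : ∀ v w, G v w = G w v) (hK : ∀ v, K (K v) = v) (hc : ∀ v w, G (K v) (K w) = - G v w)
    (hd : adDet G K X ≠ 0) {f : E4 ≃L[ℝ] (Fin 4 → ℝ)} (hf : ∀ v a, f v a = adForm G K X a v) :
    AdaptedAt G K f := by
  obtain ⟨f0, hf0⟩ : ∃ f0, f0 = eigP 1 K (X 0) := ⟨_, rfl⟩
  obtain ⟨f1, hf1⟩ : ∃ f1, f1 = eigP 1 K (X 1) := ⟨_, rfl⟩
  obtain ⟨h0, hh0⟩ : ∃ h0, h0 = eigP (-1) K (X 2) := ⟨_, rfl⟩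
  obtain ⟨h1, hh1⟩ : ∃ h1, h1 = eigP (-1) K (X 3) := ⟨_, rfl⟩
  have kf0 : K f0 = f0 := by rw [hf0]; simp [eigP, hK, add_comm]
  have kf1 : K f1 = f1 := by rw [hf1]; simp [eigP, hK, add_comm]
  have kh0 : K h0 = - h0 := by rw [hh0]; simp only [eigP, map_smul, map_add, hK]; module
  have kh1 : K h1 = - h1 := by rw [hh1]; simp only [eigP, map_smul, map_add, hK]; module
  obtain ⟨d, hdd⟩ : ∃ d, d = G f0 h0 * G f1 h1 - G f0 h1 * G f1 h0 := ⟨_, rfl⟩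
  have hd0 : d ≠ 0 := by rw [hdd, hf0, hf1, hh0, hh1]; exact hd
  have e0 : ∀ v, f v 0 = d⁻¹ * (G f1 h1 * G h0 v - G f1 h0 * G h1 v) := by
    intro v; rw [hf, hdd, hf0, hf1, hh0, hh1]; rfl
  have e1 : ∀ v, f v 1 = d⁻¹ * (G f0 h0 * G h1 v - G f0 h1 * G h0 v) := by
    intro v; rw [hf, hdd, hf0, hf1, hh0, hh1]; rfl
  have e2 : ∀ v, f v 2 = G f0 v := by intro v; rw [hf, hf0]; rfl
  have e3 : ∀ v, f v 3 = G f1 v := by intro v; rw [hf, hf1]; rfl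
  have gf0 : ∀ v, G f0 (K v) = - G f0 v := by intro v; rw [← hc, kf0]
  have gf1 : ∀ v, G f1 (K v) = - G f1 v := by intro v; rw [← hc, kf1]
  have gh0 : ∀ v, G h0 (K v) = G h0 v := by
    intro v; have := hc h0 v; rw [kh0] at this; simpa using this
  have gh1 : ∀ v, G h1 (K v) = G h1 v := by
    intro v; have := hc h1 v; rw [kh1] at this; simpa using this
  have hKf : ∀ v, f (K v) = ![f v 0, f v 1, - f v 2, - f v 3] := by
    intro v
    ext i
    fin_cases i
    · simp [e0, gh0, gh1]
    · simp [e1, gh0, gh1]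
    · simp [e2, gf0]
    · simp [e3, gf1]
  -- `K` reverses the sign of `G`, so both of its eigenspaces are null.
  have plus : ∀ v w, K v = v → K w = w → G v w = 0 := by
    intro v w hv hw; have := hc v w; rw [hv, hw] at this; linarith
  have minus : ∀ v w, K v = -v → K w = -w → G v w = 0 := by
    intro v w hv hw; have := hc v w; rw [hv, hw] at this; simp at this; linarith
  have ek : K (f.symm (Pi.single 2 1)) = - f.symm (Pi.single 2 1) ∧
      K (f.symm (Pi.single 3 1)) = - f.symm (Pi.single 3 1) := by
    constructor <;>
    · apply f.injective
      rw [hKf]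
      ext i
      fin_cases i <;> simp
  have E0 : f.symm (Pi.single 0 1) = f0 := by
    apply f.injective
    ext i
    fin_cases i
    · simp only [ContinuousLinearEquiv.apply_symm_apply, Fin.zero_eta, Pi.single_eq_same]
      rw [e0, hs h0, hs h1]; field_simp; linarith
    · simp; rw [e1, hs h0, hs h1]; ring
    · simp; rw [e2, plus _ _ kf0 kf0]
    · simp; rw [e3, plus _ _ kf1 kf0]
  have E1 : f.symm (Pi.single 1 1) = f1 := by
    apply f.injective
    ext i
    fin_cases i
    · simp; rw [e0, hs h0, hs h1]; ring
    · simp only [ContinuousLinearEquiv.apply_symm_apply, Fin.mk_one, Pi.single_eq_same]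
      rw [e1, hs h0, hs h1]; field_simp; linarith
    · simp; rw [e2, plus _ _ kf0 kf1]
    · simp; rw [e3, plus _ _ kf1 kf1]
  have ex : ∀ v, v = f v 0 • f0 + f v 1 • f1 + f v 2 • f.symm (Pi.single 2 1)
      + f v 3 • f.symm (Pi.single 3 1) := by
    intro v
    rw [← E0, ← E1]
    apply f.injective
    ext i
    simp only [map_add, map_smul, ContinuousLinearEquiv.apply_symm_apply]
    fin_cases i <;> simp
  refine ⟨fun v w => ?_, hKf⟩
  have g2 : G (f.symm (Pi.single 2 1)) w = f w 0 := by
    rw [hs]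
    conv_lhs => rw [ex w]
    simp only [map_add, map_smul, _root_.add_apply, _root_.smul_apply, smul_eq_mul]
    rw [← e2, ← e3, minus _ _ ek.1 ek.1, minus _ _ ek.2 ek.1]
    simp
  have g3 : G (f.symm (Pi.single 3 1)) w = f w 1 := by
    rw [hs]
    conv_lhs => rw [ex w]
    simp only [map_add, map_smul, _root_.add_apply, _root_.smul_apply, smul_eq_mul]
    rw [← e2, ← e3, minus _ _ ek.1 ek.2, minus _ _ ek.2 ek.2]
    simp
  conv_lhs => rw [ex v]
  simp only [map_add, map_smul, _root_.add_apply, _root_.smul_apply, smul_eq_mul]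
  rw [g2, g3, ← e2, ← e3]
  ring

/-- The construction has adapted coframes as fixed points, which gives it prescribed values at one
point. -/
theorem AdaptedAt.adForm_eq {G : E4 →L[ℝ] E4 →L[ℝ] ℝ} {K : E4 →L[ℝ] E4}
    {f : E4 ≃L[ℝ] (Fin 4 → ℝ)} (h : AdaptedAt G K f) :
    adDet G K (fun a => f.symm (Pi.single a 1)) = 1 ∧
      ∀ v a, adForm G K (fun a => f.symm (Pi.single a 1)) a v = f v a := by
  obtain ⟨k0, k1, k2, k3⟩ := h.apply_vec
  have p0 : eigP 1 K (f.symm (Pi.single 0 1)) = f.symm (Pi.single 0 1) := by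
    unfold eigP; rw [k0]; module
  have p1 : eigP 1 K (f.symm (Pi.single 1 1)) = f.symm (Pi.single 1 1) := by
    unfold eigP; rw [k1]; module
  have p2 : eigP (-1) K (f.symm (Pi.single 2 1)) = f.symm (Pi.single 2 1) := by
    unfold eigP; rw [k2]; module
  have p3 : eigP (-1) K (f.symm (Pi.single 3 1)) = f.symm (Pi.single 3 1) := by
    unfold eigP; rw [k3]; module
  constructor
  · unfold adDet
    simp only [p0, p1, p2, p3, h.1]
    simp
  · intro v a
    fin_cases a <;> simp [adForm, p0, p1, p2, p3, h.1]

/-- Naturality under linear maps lets the construction be carried out on chart components and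
transferred to tangent spaces. -/
theorem adForm_map {G G' : E4 →L[ℝ] E4 →L[ℝ] ℝ} {K K' A : E4 →L[ℝ] E4}
    (hK : ∀ s v, A (eigP s K' v) = eigP s K (A v)) (hG : ∀ v w, G' v w = G (A v) (A w))
    (u : Fin 4 → E4) (a : Fin 4) (v : E4) :
    adForm G' K' u a v = adForm G K (fun a => A (u a)) a (A v) := by
  fin_cases a <;> simp [adForm, hK, hG]

end AdaptedLinear

/-! ### Local fields of adapted coframes -/

section AdaptedField

variable {M : Type u} [TopologicalSpace M] [ChartedSpace E4 M] [IsManifold (𝓡 4) ∞ M]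
  {g : BilinField M} {K : EndField M}

/-- A smooth adapted coframe field on an open set. -/
structure IsAdaptedField (g : BilinField M) (K : EndField M) (e : CoframeField M) (V : Set M) :
    Prop where
  isOpen : IsOpen V
  smooth_e : ∀ q ∈ V, ∀ a, SmoothFormAt (frm e a) q
  adapted : ∀ q ∈ V, AdaptedAt (g q) (K q) (e q)

theorem contDiffAt_eigP {s : ℝ} {K : E4 → E4 →L[ℝ] E4} {y : E4} (hK : ContDiffAt ℝ ∞ K y) (v : E4) :
    ContDiffAt ℝ ∞ (fun z => eigP s (K z) v) y :=
  ((contDiffAt_const (c := v)).add ((hK.clm_apply contDiffAt_const).const_smul s)).const_smul _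

theorem contDiffAt_adDet {G : E4 → E4 →L[ℝ] E4 →L[ℝ] ℝ} {K : E4 → E4 →L[ℝ] E4} {y : E4}
    (hG : ContDiffAt ℝ ∞ G y) (hK : ContDiffAt ℝ ∞ K y) (X : Fin 4 → E4) :
    ContDiffAt ℝ ∞ (fun z => adDet (G z) (K z) X) y := by
  have h : ∀ s t v w, ContDiffAt ℝ ∞ (fun z => G z (eigP s (K z) v) (eigP t (K z) w)) y :=
    fun s t v w => (hG.clm_apply (contDiffAt_eigP hK v)).clm_apply (contDiffAt_eigP hK w)
  exact ((h _ _ _ _).mul (h _ _ _ _)).sub ((h _ _ _ _).mul (h _ _ _ _))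

theorem contDiffAt_adForm {G : E4 → E4 →L[ℝ] E4 →L[ℝ] ℝ} {K : E4 → E4 →L[ℝ] E4} {y : E4}
    (hG : ContDiffAt ℝ ∞ G y) (hK : ContDiffAt ℝ ∞ K y) (X : Fin 4 → E4)
    (hd : adDet (G y) (K y) X ≠ 0) (a : Fin 4) :
    ContDiffAt ℝ ∞ (fun z => adForm (G z) (K z) X a) y := by
  have h : ∀ s t v w, ContDiffAt ℝ ∞ (fun z => G z (eigP s (K z) v) (eigP t (K z) w)) y :=
    fun s t v w => (hG.clm_apply (contDiffAt_eigP hK v)).clm_apply (contDiffAt_eigP hK w)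
  have h' : ∀ s v, ContDiffAt ℝ ∞ (fun z => G z (eigP s (K z) v)) y :=
    fun s v => hG.clm_apply (contDiffAt_eigP hK v)
  have hi := (contDiffAt_adDet hG hK X).inv hd
  fin_cases a
  · exact hi.smul (((h _ _ _ _).smul (h' _ _)).sub ((h _ _ _ _).smul (h' _ _)))
  · exact hi.smul (((h _ _ _ _).smul (h' _ _)).sub ((h _ _ _ _).smul (h' _ _)))
  · exact h' _ _
  · exact h' _ _

open Classical in
/-- The field of coframes given by a family of linear isomorphisms in a chart. -/
noncomputable def chartField (p : M) (Θ : E4 → E4 →L[ℝ] (Fin 4 → ℝ)) (f₀ : E4 ≃L[ℝ] (Fin 4 → ℝ)) :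
    CoframeField M := fun q =>
  if h : ∃ f : E4 ≃L[ℝ] (Fin 4 → ℝ), (f : E4 →L[ℝ] (Fin 4 → ℝ))
    = (Θ (ch E4 p q)).comp (mder E4 E4 (ch E4 p) q) then h.choose else f₀

theorem chartField_eq {p : M} {Θ : E4 → E4 →L[ℝ] (Fin 4 → ℝ)} {f₀ : E4 ≃L[ℝ] (Fin 4 → ℝ)} {q : M}
    (hq : q ∈ (ch E4 p).source)
    (h : Θ (ch E4 p q) ∈ range ((↑) : (E4 ≃L[ℝ] (Fin 4 → ℝ)) → E4 →L[ℝ] (Fin 4 → ℝ))) :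
    (chartField p Θ f₀ q : E4 →L[ℝ] (Fin 4 → ℝ))
      = (Θ (ch E4 p q)).comp (mder E4 E4 (ch E4 p) q) := by
  have h2 : ∃ f : E4 ≃L[ℝ] (Fin 4 → ℝ), (f : E4 →L[ℝ] (Fin 4 → ℝ))
      = (Θ (ch E4 p q)).comp (mder E4 E4 (ch E4 p) q) := by
    obtain ⟨f, hf⟩ := h
    have a1 := mder_chart_symm_chart hq
    have a2 := mder_chart_chart_symm ((ch E4 p).map_source hq)
    rw [(ch E4 p).left_inv hq] at a2
    refine ⟨(ContinuousLinearEquiv.equivOfInverse (mder E4 E4 (ch E4 p) q)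
      (mder E4 E4 (ch E4 p).symm (ch E4 p q)) (fun v => congrArg (fun L => L v) a1)
      (fun v => congrArg (fun L => L v) a2)).trans f, ?_⟩
    ext v : 1
    rw [← hf]; rfl
  unfold chartField
  rw [dif_pos h2]
  exact h2.choose_spec

/-- The dual frame of `f₀` is extended with constant components in the chart around `p`, and
`adForm` makes a coframe of it with the varying `g` and `K`. At `p` this returns `f₀`. Nearby the
determinant stays nonzero and the forms stay independent, since linear isomorphisms are an open set.
-/
theorem exists_adaptedField (h : IsParaKahlerEinstein g K) {p : M} {f₀ : E4 ≃L[ℝ] (Fin 4 → ℝ)}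
    (hf : AdaptedAt (g p) (K p) f₀) :
    ∃ (e : CoframeField M) (V : Set M), IsAdaptedField g K e V ∧ p ∈ V ∧ e p = f₀ := by
  have hps := mem_extChartAt_source (I := 𝓘(ℝ, E4)) p
  have hy0 := (ch E4 p).map_source hps
  set u : Fin 4 → E4 := fun a => f₀.symm (Pi.single a 1) with hu
  have hG : ∀ y ∈ (ch E4 p).target, ContDiffAt ℝ ∞ (repB p g) y := fun y hy => smooth_repB h hy
  have hK : ∀ y ∈ (ch E4 p).target, ContDiffAt ℝ ∞ (repK p K) y := fun y hy => smooth_repK h hy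
  have G0 : repB p g (ch E4 p p) = g p := by
    unfold repB; rw [mder_chart_symm_self, (ch E4 p).left_inv hps]; rfl
  have K0 : repK p K (ch E4 p p) = K p := by
    unfold repK; rw [mder_chart_symm_self, (ch E4 p).left_inv hps, mder_chart_self]; rfl
  have hd0 : adDet (repB p g (ch E4 p p)) (repK p K (ch E4 p p)) u = 1 := by
    rw [G0, K0]; exact hf.adForm_eq.1
  have hd0' : adDet (repB p g (ch E4 p p)) (repK p K (ch E4 p p)) u ≠ 0 := by
    rw [hd0]; exact one_ne_zero
  set Θ : E4 → E4 →L[ℝ] (Fin 4 → ℝ) := fun y =>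
    ContinuousLinearMap.pi (adForm (repB p g y) (repK p K y) u) with hΘ
  have hΘc : ContinuousAt Θ (ch E4 p p) := by
    have h1 : ContDiffAt ℝ ∞ (fun y => adForm (repB p g y) (repK p K y) u) (ch E4 p p) :=
      contDiffAt_pi.2 fun a => contDiffAt_adForm (hG _ hy0) (hK _ hy0) u hd0' a
    exact (ContinuousLinearMap.piEquivL ℝ E4 (fun _ : Fin 4 => ℝ)).continuous.continuousAt.comp
      h1.continuousAt
  have hΘ0 : Θ (ch E4 p p) = (f₀ : E4 →L[ℝ] (Fin 4 → ℝ)) := by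
    ext v a
    rw [hΘ]
    simp only [G0, K0]
    exact hf.adForm_eq.2 v a
  have hev : ∀ᶠ y in 𝓝 (ch E4 p p), y ∈ (ch E4 p).target ∧
      Θ y ∈ range ((↑) : (E4 ≃L[ℝ] (Fin 4 → ℝ)) → E4 →L[ℝ] (Fin 4 → ℝ)) ∧
      adDet (repB p g y) (repK p K y) u ≠ 0 := by
    refine Eventually.and ((isOpen_extChartAt_target (I := 𝓘(ℝ, E4)) p).mem_nhds hy0)
      (Eventually.and ?_ ?_)
    · exact hΘc.preimage_mem_nhds (by rw [hΘ0]; exact f₀.nhds)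
    · exact (contDiffAt_adDet (hG _ hy0) (hK _ hy0) u).continuousAt.eventually_ne hd0'
  obtain ⟨O, hO, hOo, hpO⟩ := eventually_nhds_iff.1 hev
  set V := (ch E4 p).source ∩ ch E4 p ⁻¹' O with hV
  have hVo : IsOpen V :=
    (continuousOn_extChartAt p).isOpen_inter_preimage (isOpen_extChartAt_source p) hOo
  have heq : ∀ q ∈ V, (chartField p Θ f₀ q : E4 →L[ℝ] (Fin 4 → ℝ))
      = (Θ (ch E4 p q)).comp (mder E4 E4 (ch E4 p) q) := fun q hq =>
    chartField_eq hq.1 (hO _ hq.2).2.1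
  refine ⟨chartField p Θ f₀, V, ⟨hVo, fun q hq a => ?_, fun q hq => ?_⟩, ⟨hps, hpO⟩, ?_⟩
  · rw [smoothFormAt_iff hq.1]
    refine (contDiffAt_adForm (hG _ ((ch E4 p).map_source hq.1)) (hK _ ((ch E4 p).map_source hq.1)) u
      (hO _ hq.2).2.2 a).congr_of_eventuallyEq ?_
    filter_upwards [eventually_chart hq.1 (hVo.mem_nhds hq)] with y hy
    ext v
    rw [rep_apply, frm_apply, ← ContinuousLinearEquiv.coe_coe, heq _ hy.2]
    simp only [ContinuousLinearMap.comp_apply]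
    have := congrArg (fun L => L v) (mder_chart_chart_symm hy.1)
    simp only [ContinuousLinearMap.comp_apply] at this
    rw [this, (ch E4 p).right_inv hy.1]
    rfl
  · set X : Fin 4 → E4 := fun a => mder E4 E4 (ch E4 p).symm (ch E4 p q) (u a) with hX
    have c1 : ∀ v, mder E4 E4 (ch E4 p).symm (ch E4 p q) (mder E4 E4 (ch E4 p) q v) = v :=
      fun v => congrArg (fun L => L v) (mder_chart_symm_chart hq.1)
    have c2 : ∀ s v, mder E4 E4 (ch E4 p).symm (ch E4 p q) (eigP s (repK p K (ch E4 p q)) v)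
        = eigP s (K q) (mder E4 E4 (ch E4 p).symm (ch E4 p q) v) := by
      intro s v
      unfold eigP repK
      rw [(ch E4 p).left_inv hq.1]
      simp only [map_smul, map_add, ContinuousLinearMap.comp_apply, c1]
      rfl
    have c3 : ∀ v w, repB p g (ch E4 p q) v w = (g q : E4 →L[ℝ] E4 →L[ℝ] ℝ)
        (mder E4 E4 (ch E4 p).symm (ch E4 p q) v) (mder E4 E4 (ch E4 p).symm (ch E4 p q) w) := by
      intro v w
      unfold repB
      rw [(ch E4 p).left_inv hq.1]; rfl
    have c4 : adDet (repB p g (ch E4 p q)) (repK p K (ch E4 p q)) u = adDet (g q) (K q) X := by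
      unfold adDet; simp only [c3, c2]; rfl
    refine adaptedAt_of_adForm (h.symm q) (h.paracomplex q) (h.compatible q) (X := X) ?_ ?_
    · rw [← c4]; exact (hO _ hq.2).2.2
    · intro v a
      rw [← ContinuousLinearEquiv.coe_coe, heq q hq]
      change adForm (repB p g (ch E4 p q)) (repK p K (ch E4 p q)) u a (mder E4 E4 (ch E4 p) q v) = _
      rw [adForm_map c2 c3, c1]
  · refine ContinuousLinearEquiv.ext (funext fun v => ?_)
    have := congrArg (fun L => L v) (heq p ⟨hps, hpO⟩)
    rw [hΘ0, mder_chart_self] at this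
    exact this

end AdaptedField

/-! ### Alternating bilinear forms on a frame -/

section Alternating

variable {E : Type} [NormedAddCommGroup E] [NormedSpace ℝ E]

/-- Alternating bilinear forms. -/
def IsAlt (D : E → E → ℝ) : Prop := ∃ B : E →L[ℝ] E →L[ℝ] ℝ, ∀ v w, D v w = B v w - B w v

theorem IsAlt.add {D D' : E → E → ℝ} (h : IsAlt D) (h' : IsAlt D') :
    IsAlt fun v w => D v w + D' v w := by
  obtain ⟨B, hB⟩ := h
  obtain ⟨B', hB'⟩ := h'
  exact ⟨B + B', fun v w => by simp [hB, hB']; ring⟩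

theorem IsAlt.const_mul {D : E → E → ℝ} (h : IsAlt D) (c : ℝ) : IsAlt fun v w => c * D v w := by
  obtain ⟨B, hB⟩ := h
  exact ⟨c • B, fun v w => by simp [hB]; ring⟩

theorem IsAlt.neg {D : E → E → ℝ} (h : IsAlt D) : IsAlt fun v w => - D v w := by
  obtain ⟨B, hB⟩ := h
  exact ⟨-B, fun v w => by simp [hB]; ring⟩

theorem IsAlt.sub {D D' : E → E → ℝ} (h : IsAlt D) (h' : IsAlt D') :
    IsAlt fun v w => D v w - D' v w := by
  obtain ⟨B, hB⟩ := h
  obtain ⟨B', hB'⟩ := h'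
  exact ⟨B - B', fun v w => by simp [hB, hB']; ring⟩

theorem IsAlt.sum {ι : Type*} {s : Finset ι} {D : ι → E → E → ℝ} (h : ∀ i, IsAlt (D i)) :
    IsAlt fun v w => ∑ i ∈ s, D i v w := by
  choose B hB using h
  exact ⟨∑ i ∈ s, B i, fun v w => by simp [hB, _root_.sum_apply, Finset.sum_sub_distrib]⟩

variable {N : Type u} [TopologicalSpace N] [ChartedSpace E N] [IsManifold 𝓘(ℝ, E) ∞ N]

theorem isAlt_wdg (β γ : N → E →L[ℝ] ℝ) (q : N) : IsAlt (wdg β γ q) :=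
  ⟨(β q).smulRight (γ q), fun v w => by simp [wdg]⟩

theorem isAlt_xD {β : N → E →L[ℝ] ℝ} {q : N} (hβ : SmoothFormAt β q) : IsAlt (xD β q) :=
  ⟨fderiv ℝ (rep q β) (ch E q q), fun v w =>
    xD_eq_dAlt (ContDiffAt.differentiableAt hβ (by simp)) v w⟩

theorem IsAlt.swap {D : E → E → ℝ} (h : IsAlt D) (v w : E) : D v w = - D w v := by
  obtain ⟨B, hB⟩ := h
  rw [hB, hB]; ring

variable {M : Type u} [TopologicalSpace M] [ChartedSpace E4 M] [IsManifold (𝓡 4) ∞ M]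

theorem IsAlt.ext {D D' : E4 → E4 → ℝ} (h : IsAlt D) (h' : IsAlt D') (e : CoframeField M) (q : M)
    (h01 : D (vec e 0 q) (vec e 1 q) = D' (vec e 0 q) (vec e 1 q))
    (h02 : D (vec e 0 q) (vec e 2 q) = D' (vec e 0 q) (vec e 2 q))
    (h03 : D (vec e 0 q) (vec e 3 q) = D' (vec e 0 q) (vec e 3 q))
    (h12 : D (vec e 1 q) (vec e 2 q) = D' (vec e 1 q) (vec e 2 q))
    (h13 : D (vec e 1 q) (vec e 3 q) = D' (vec e 1 q) (vec e 3 q))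
    (h23 : D (vec e 2 q) (vec e 3 q) = D' (vec e 2 q) (vec e 3 q)) (v w : E4) :
    D v w = D' v w := by
  obtain ⟨B, hB⟩ := h
  obtain ⟨B', hB'⟩ := h'
  rw [hB, hB'] at h01 h02 h03 h12 h13 h23
  rw [hB, hB', ← sum_frm_smul_vec e q v, ← sum_frm_smul_vec e q w]
  simp only [Fin.sum_univ_four, map_add, map_smul, _root_.add_apply, _root_.smul_apply, smul_eq_mul]
  linear_combination (frm e 0 q v * frm e 1 q w - frm e 1 q v * frm e 0 q w) * h01
    + (frm e 0 q v * frm e 2 q w - frm e 2 q v * frm e 0 q w) * h02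
    + (frm e 0 q v * frm e 3 q w - frm e 3 q v * frm e 0 q w) * h03
    + (frm e 1 q v * frm e 2 q w - frm e 2 q v * frm e 1 q w) * h12
    + (frm e 1 q v * frm e 3 q w - frm e 3 q v * frm e 1 q w) * h13
    + (frm e 2 q v * frm e 3 q w - frm e 3 q v * frm e 2 q w) * h23

theorem linear_eq_zero {f : E4 → ℝ} (hf : IsLinearMap ℝ f)
    (h : ∀ i, f (EuclideanSpace.single i 1) = 0) (v : E4) : f v = 0 := by
  have h1 : (hf.mk' f) (∑ i, v i • (EuclideanSpace.single i (1 : ℝ) : E4)) = 0 := by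
    rw [map_sum]
    refine Finset.sum_eq_zero fun i _ => ?_
    rw [map_smul]
    change v i • f _ = 0
    rw [h, smul_zero]
  rwa [sum_single] at h1

theorem trilinear_eq_zero {T : E4 → E4 → E4 → ℝ} (h1 : ∀ v w, IsLinearMap ℝ fun u => T u v w)
    (h2 : ∀ u w, IsLinearMap ℝ fun v => T u v w) (h3 : ∀ u v, IsLinearMap ℝ fun w => T u v w)
    (h : ∀ i j k, T (EuclideanSpace.single i 1) (EuclideanSpace.single j 1)
      (EuclideanSpace.single k 1) = 0) (u v w : E4) : T u v w = 0 :=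
  linear_eq_zero (h1 v w) (fun i => linear_eq_zero (h2 _ w) (fun j =>
    linear_eq_zero (h3 _ _) (fun k => h i j k) w) v) u

end Alternating

/-! ### The torsion-free connection of an adapted coframe -/

section Torsion

variable {M : Type u} [TopologicalSpace M] [ChartedSpace E4 M] [IsManifold (𝓡 4) ∞ M]
  {g : BilinField M} {K : EndField M} {e : CoframeField M} {V : Set M}

theorem isLinearMap_dWdg {β γ : M → E4 →L[ℝ] ℝ} {q : M} (hβ : SmoothFormAt β q)
    (hγ : SmoothFormAt γ q) : (∀ v w, IsLinearMap ℝ fun u => dWdg β γ q u v w) ∧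
    (∀ u w, IsLinearMap ℝ fun v => dWdg β γ q u v w) ∧
    (∀ u v, IsLinearMap ℝ fun w => dWdg β γ q u v w) := by
  obtain ⟨B, hB⟩ := exists_bilin_xD hβ
  obtain ⟨C, hC⟩ := exists_bilin_xD hγ
  simp only [dWdg, hB, hC]
  refine ⟨fun v w => ⟨fun x y => ?_, fun c x => ?_⟩, fun v w => ⟨fun x y => ?_, fun c x => ?_⟩,
    fun v w => ⟨fun x y => ?_, fun c x => ?_⟩⟩ <;>
  · simp only [map_add, map_smul, _root_.add_apply, _root_.smul_apply, smul_eq_mul]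
    ring

theorem AdaptedAt.apply_K_left {G : E4 →L[ℝ] E4 →L[ℝ] ℝ} {K : E4 →L[ℝ] E4}
    {f : E4 ≃L[ℝ] (Fin 4 → ℝ)} (h : AdaptedAt G K f) (v w : E4) :
    G (K v) w = f v 0 * f w 2 - f v 2 * f w 0 + f v 1 * f w 3 - f v 3 * f w 1 := by
  rw [h.1, h.2]
  simp only [Matrix.cons_val]
  ring

/-- In an adapted coframe `g(K·,·)` is `α¹ ∧ ᾱ¹ + α² ∧ ᾱ²`. Closedness is given on coordinate
vectors at the centre of a chart, and trilinearity extends it to all triples. -/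
theorem IsAdaptedField.closed (h : IsParaKahlerEinstein g K) (he : IsAdaptedField g K e V) {q : M}
    (hq : q ∈ V) (u v w : E4) :
    dWdg (frm e 0) (frm e 2) q u v w + dWdg (frm e 1) (frm e 3) q u v w = 0 := by
  have hqs := mem_extChartAt_source (I := 𝓘(ℝ, E4)) q
  have hy : ch E4 q q ∈ chSet q V :=
    ⟨(ch E4 q).map_source hqs, by rwa [(ch E4 q).left_inv hqs]⟩
  obtain ⟨a1, a2, a3⟩ := isLinearMap_dWdg (he.smooth_e q hq 0) (he.smooth_e q hq 2)
  obtain ⟨b1, b2, b3⟩ := isLinearMap_dWdg (he.smooth_e q hq 1) (he.smooth_e q hq 3)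
  have hadd : ∀ f f' : E4 → ℝ, IsLinearMap ℝ f → IsLinearMap ℝ f' →
      IsLinearMap ℝ fun x => f x + f' x := fun f f' hf hf' =>
    ⟨fun x y => by rw [hf.map_add, hf'.map_add]; ring,
      fun c x => by rw [hf.map_smul, hf'.map_smul]; simp only [smul_eq_mul]; ring⟩
  refine trilinear_eq_zero (T := fun u v w => dWdg (frm e 0) (frm e 2) q u v w
    + dWdg (frm e 1) (frm e 3) q u v w) (fun v w => hadd _ _ (a1 v w) (b1 v w))
    (fun v w => hadd _ _ (a2 v w) (b2 v w)) (fun v w => hadd _ _ (a3 v w) (b3 v w)) ?_ u v w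
  intro i j k
  have hd : ∀ a, DifferentiableAt ℝ (rep q (frm e a)) (ch E4 q q) := fun a =>
    ContDiffAt.differentiableAt (he.smooth_e q hq a) (by simp)
  have hlow : ∀ i j, gLow (fun p => (g p).comp (K p)) q i j =ᶠ[𝓝 (ch E4 q q)] fun y =>
      rep q (frm e 0) y (EuclideanSpace.single i 1) * rep q (frm e 2) y (EuclideanSpace.single j 1)
      - rep q (frm e 2) y (EuclideanSpace.single i 1) * rep q (frm e 0) y (EuclideanSpace.single j 1)
      + rep q (frm e 1) y (EuclideanSpace.single i 1) * rep q (frm e 3) y (EuclideanSpace.single j 1)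
      - rep q (frm e 3) y (EuclideanSpace.single i 1)
        * rep q (frm e 1) y (EuclideanSpace.single j 1) := by
    intro i j
    filter_upwards [(isOpen_chSet q he.isOpen).mem_nhds hy] with y hy'
    have h1 := he.adapted _ hy'.2
    have h2 : gLow (fun p => (g p).comp (K p)) q i j y =
      (g ((ch E4 q).symm y) : E4 →L[ℝ] E4 →L[ℝ] ℝ) ((K ((ch E4 q).symm y) : E4 →L[ℝ] E4)
        (cvec q i y)) (cvec q j y) := rfl
    exact h2.trans (h1.apply_K_left _ _)
  have hev : ∀ a (x : E4), HasFDerivAt (fun y => rep q (frm e a) y x)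
      ((fderiv ℝ (rep q (frm e a)) (ch E4 q q)).flip x) (ch E4 q q) := by
    intro a x
    have := (hd a).hasFDerivAt.clm_apply (hasFDerivAt_const x (ch E4 q q))
    refine this.congr_fderiv ?_
    ext; simp
  have hpd : ∀ i j k, pd i (gLow (fun p => (g p).comp (K p)) q j k) (ch E4 q q) = _ :=
    fun i j k => (pd_congr (hlow j k)).trans (congrArg (fun L => L (EuclideanSpace.single i 1))
      ((((((hev 0 (EuclideanSpace.single j 1)).mul (hev 2 (EuclideanSpace.single k 1))).sub
        ((hev 2 (EuclideanSpace.single j 1)).mul (hev 0 (EuclideanSpace.single k 1)))).add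
        ((hev 1 (EuclideanSpace.single j 1)).mul (hev 3 (EuclideanSpace.single k 1)))).sub
        ((hev 3 (EuclideanSpace.single j 1)).mul (hev 1 (EuclideanSpace.single k 1)))).fderiv))
  have hcl := h.closed q i j k
  have hch : extChartAt (𝓡 4) q q = ch E4 q q := rfl
  rw [hch, hpd, hpd, hpd] at hcl
  simp only [_root_.add_apply, _root_.sub_apply, _root_.smul_apply, smul_eq_mul,
    ContinuousLinearMap.flip_apply, rep_self] at hcl
  simp only [dWdg, xD_eq_dAlt (hd _), dAlt]
  linear_combination hcl

/-- The bracket of the first two frame vectors stays in the `+1` eigenspace, where both barred forms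
vanish. -/
theorem IsAdaptedField.xD_plus (h : IsParaKahlerEinstein g K) (he : IsAdaptedField g K e V) {q : M}
    (hq : q ∈ V) : xD (frm e 2) q (vec e 0 q) (vec e 1 q) = 0 ∧
      xD (frm e 3) q (vec e 0 q) (vec e 1 q) = 0 := by
  have k0 : ∀ p ∈ V, (K p : E4 →L[ℝ] E4) (vec e 0 p) = (1 : ℝ) • vec e 0 p := fun p hp => by
    rw [one_smul]; exact (he.adapted p hp).apply_vec.1
  have k1 : ∀ p ∈ V, (K p : E4 →L[ℝ] E4) (vec e 1 p) = (1 : ℝ) • vec e 1 p := fun p hp => by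
    rw [one_smul]; exact (he.adapted p hp).apply_vec.2.1
  have h1 : (K q : E4 →L[ℝ] E4) (brk (vec e 0) (vec e 1) q) = (1 : ℝ) • brk (vec e 0) (vec e 1) q :=
    h.integrable_plus V he.isOpen _ _ (smoothVecOn_vec he.smooth_e 0)
      (smoothVecOn_vec he.smooth_e 1) k0 k1 q hq
  have h2 := (congrArg (e q) h1).symm.trans ((he.adapted q hq).2 (brk (vec e 0) (vec e 1) q))
  rw [one_smul] at h2
  have h3 := congrFun h2 2
  have h4 := congrFun h2 3
  simp only [Matrix.cons_val] at h3 h4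
  rw [xD_vec_eq_neg_brk (he.smooth_e q hq), xD_vec_eq_neg_brk (he.smooth_e q hq), frm_apply,
    frm_apply]
  constructor <;> linarith

theorem IsAdaptedField.xD_minus (h : IsParaKahlerEinstein g K) (he : IsAdaptedField g K e V) {q : M}
    (hq : q ∈ V) : xD (frm e 0) q (vec e 2 q) (vec e 3 q) = 0 ∧
      xD (frm e 1) q (vec e 2 q) (vec e 3 q) = 0 := by
  have k0 : ∀ p ∈ V, (K p : E4 →L[ℝ] E4) (vec e 2 p) = (-1 : ℝ) • vec e 2 p := fun p hp => by
    rw [neg_one_smul]; exact (he.adapted p hp).apply_vec.2.2.1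
  have k1 : ∀ p ∈ V, (K p : E4 →L[ℝ] E4) (vec e 3 p) = (-1 : ℝ) • vec e 3 p := fun p hp => by
    rw [neg_one_smul]; exact (he.adapted p hp).apply_vec.2.2.2
  have h1 : (K q : E4 →L[ℝ] E4) (brk (vec e 2) (vec e 3) q)
      = (-1 : ℝ) • brk (vec e 2) (vec e 3) q :=
    h.integrable_minus V he.isOpen _ _ (smoothVecOn_vec he.smooth_e 2)
      (smoothVecOn_vec he.smooth_e 3) k0 k1 q hq
  have h2 := (congrArg (e q) h1).symm.trans ((he.adapted q hq).2 (brk (vec e 2) (vec e 3) q))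
  rw [map_smul] at h2
  have h3 := congrFun h2 0
  have h4 := congrFun h2 1
  simp only [Matrix.cons_val, Pi.smul_apply, smul_eq_mul] at h3 h4
  rw [xD_vec_eq_neg_brk (he.smooth_e q hq), xD_vec_eq_neg_brk (he.smooth_e q hq), frm_apply,
    frm_apply]
  constructor <;> linarith

/-- The indices of the first half of a coframe. -/
def lo : Fin 2 → Fin 4 := ![0, 1]

/-- The indices of the second half of a coframe. -/
def hi : Fin 2 → Fin 4 := ![2, 3]

@[simp] theorem lo_zero : lo 0 = 0 := rfl
@[simp] theorem lo_one : lo 1 = 1 := rfl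
@[simp] theorem hi_zero : hi 0 = 2 := rfl
@[simp] theorem hi_one : hi 1 = 3 := rfl

/-- The connection forms of an adapted coframe field. -/
noncomputable def conn (e : CoframeField M) (A B : Fin 2) (q : M) : E4 →L[ℝ] ℝ :=
  ∑ C, (xD (frm e (hi B)) q (vec e (lo C) q) (vec e (hi A) q) • frm e (lo C) q
    - xD (frm e (lo A)) q (vec e (hi C) q) (vec e (lo B) q) • frm e (hi C) q)

theorem conn_lo (e : CoframeField M) (A B C : Fin 2) (q : M) : conn e A B q (vec e (lo C) q)
    = xD (frm e (hi B)) q (vec e (lo C) q) (vec e (hi A) q) := by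
  fin_cases C <;> simp [conn, frm_vec]

theorem conn_hi (e : CoframeField M) (A B C : Fin 2) (q : M) : conn e A B q (vec e (hi C) q)
    = - xD (frm e (lo A)) q (vec e (hi C) q) (vec e (lo B) q) := by
  fin_cases C <;> simp [conn, frm_vec]

/-- The first structure equations. -/
structure FirstStructure (e : CoframeField M) (γ : Fin 2 → Fin 2 → M → E4 →L[ℝ] ℝ) (q : M) :
    Prop where
  d0 : ∀ v w, xD (frm e 0) q v w = - wdg (γ 0 0) (frm e 0) q v w - wdg (γ 0 1) (frm e 1) q v w
  d1 : ∀ v w, xD (frm e 1) q v w = - wdg (γ 1 0) (frm e 0) q v w - wdg (γ 1 1) (frm e 1) q v w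
  d2 : ∀ v w, xD (frm e 2) q v w = wdg (γ 0 0) (frm e 2) q v w + wdg (γ 1 0) (frm e 3) q v w
  d3 : ∀ v w, xD (frm e 3) q v w = wdg (γ 0 1) (frm e 2) q v w + wdg (γ 1 1) (frm e 3) q v w

/-- `conn` is chosen so that the components of `dᾱ` on one unbarred and one barred vector hold
through its values on unbarred vectors, and those of `dα` through its values on barred vectors. The
components of `dᾱ` on two unbarred vectors and of `dα` on two barred ones vanish by integrability.
The remaining components are the closedness of `g(K·,·)` on the four triples `c1, …, c4`. -/
theorem IsAdaptedField.firstStructure (h : IsParaKahlerEinstein g K) (he : IsAdaptedField g K e V)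
    {q : M} (hq : q ∈ V) : FirstStructure e (conn e) q := by
  have hs := he.smooth_e q hq
  obtain ⟨p2, p3⟩ := he.xD_plus h hq
  obtain ⟨m0, m1⟩ := he.xD_minus h hq
  have c1 := he.closed h hq (vec e 0 q) (vec e 1 q) (vec e 2 q)
  have c2 := he.closed h hq (vec e 0 q) (vec e 1 q) (vec e 3 q)
  have c3 := he.closed h hq (vec e 0 q) (vec e 2 q) (vec e 3 q)
  have c4 := he.closed h hq (vec e 1 q) (vec e 2 q) (vec e 3 q)
  simp [dWdg, frm_vec] at c1 c2 c3 c4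
  have l := fun A B => conn_lo e A B 0 q
  have l' := fun A B => conn_lo e A B 1 q
  have r := fun A B => conn_hi e A B 0 q
  have r' := fun A B => conn_hi e A B 1 q
  simp only [lo_zero, lo_one, hi_zero, hi_one] at l l' r r'
  have sw := fun a v w => xD_swap (frm e a) q v w
  have sw' : ∀ a : Fin 4, xD (frm e a) q (vec e 2 q) (vec e 0 q) = - xD (frm e a) q (vec e 0 q) (vec e 2 q) ∧
      xD (frm e a) q (vec e 2 q) (vec e 1 q) = - xD (frm e a) q (vec e 1 q) (vec e 2 q) ∧
      xD (frm e a) q (vec e 3 q) (vec e 0 q) = - xD (frm e a) q (vec e 0 q) (vec e 3 q) ∧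
      xD (frm e a) q (vec e 3 q) (vec e 1 q) = - xD (frm e a) q (vec e 1 q) (vec e 3 q) :=
    fun a => ⟨sw _ _ _, sw _ _ _, sw _ _ _, sw _ _ _⟩
  simp only [(sw' _).1, (sw' _).2.1, (sw' _).2.2.1, (sw' _).2.2.2] at c1 c2 c3 c4 r r'
  constructor
  · refine (isAlt_xD (hs 0)).ext (((isAlt_wdg _ _ q).neg).sub (isAlt_wdg _ _ q)) e q ?_ ?_ ?_ ?_ ?_ ?_ <;>
      simp only [wdg, frm_vec, l, l', r, r', lo_zero, lo_one, hi_zero,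
        hi_one, (sw' _).1, (sw' _).2.1, (sw' _).2.2.1, (sw' _).2.2.2, Fin.reduceEq, if_true,
        if_false] <;> linarith
  · refine (isAlt_xD (hs 1)).ext (((isAlt_wdg _ _ q).neg).sub (isAlt_wdg _ _ q)) e q ?_ ?_ ?_ ?_ ?_ ?_ <;>
      simp only [wdg, frm_vec, l, l', r, r', lo_zero, lo_one, hi_zero,
        hi_one, (sw' _).1, (sw' _).2.1, (sw' _).2.2.1, (sw' _).2.2.2, Fin.reduceEq, if_true,
        if_false] <;> linarith
  · refine (isAlt_xD (hs 2)).ext ((isAlt_wdg _ _ q).add (isAlt_wdg _ _ q)) e q ?_ ?_ ?_ ?_ ?_ ?_ <;>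
      simp only [wdg, frm_vec, l, l', r, r', lo_zero, lo_one, hi_zero,
        hi_one, (sw' _).1, (sw' _).2.1, (sw' _).2.2.1, (sw' _).2.2.2, Fin.reduceEq, if_true,
        if_false] <;> linarith
  · refine (isAlt_xD (hs 3)).ext ((isAlt_wdg _ _ q).add (isAlt_wdg _ _ q)) e q ?_ ?_ ?_ ?_ ?_ ?_ <;>
      simp only [wdg, frm_vec, l, l', r, r', lo_zero, lo_one, hi_zero,
        hi_one, (sw' _).1, (sw' _).2.1, (sw' _).2.2.1, (sw' _).2.2.2, Fin.reduceEq, if_true,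
        if_false] <;> linarith

theorem smoothFormAt_conn (he : IsAdaptedField g K e V) {q : M} (hq : q ∈ V) (A B : Fin 2) :
    SmoothFormAt (conn e A B) q := by
  have hs := he.smooth_e q hq
  refine SmoothFormAt.sum fun C _ => SmoothFormAt.sub ?_ ?_
  · exact SmoothFormAt.smul (smoothAt_xD_vec he.isOpen hq (fun x hx => he.smooth_e x hx _) hs _ _) (hs _)
  · exact SmoothFormAt.smul (smoothAt_xD_vec he.isOpen hq (fun x hx => he.smooth_e x hx _) hs _ _) (hs _)

/-- The connection forms `diag(γ, -γᵀ)` of the tangent bundle. -/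
def kap (γ : Fin 2 → Fin 2 → M → E4 →L[ℝ] ℝ) : Fin 4 → Fin 4 → M → E4 →L[ℝ] ℝ :=
  ![![γ 0 0, γ 0 1, fun _ => 0, fun _ => 0], ![γ 1 0, γ 1 1, fun _ => 0, fun _ => 0],
    ![fun _ => 0, fun _ => 0, fun q => - γ 0 0 q, fun q => - γ 1 0 q],
    ![fun _ => 0, fun _ => 0, fun q => - γ 0 1 q, fun q => - γ 1 1 q]]

theorem IsAdaptedField.isLeviCivita (h : IsParaKahlerEinstein g K) (he : IsAdaptedField g K e V) :
    IsLeviCivita g e (kap (conn e)) V where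
  isOpen := he.isOpen
  smooth_e := he.smooth_e
  smooth_κ q hq a b := by
    have h1 := fun A B => smoothFormAt_conn he hq A B
    have h2 := fun A B => (smoothFormAt_conn he hq A B).neg
    have h3 : SmoothFormAt (fun _ : M => (0 : E4 →L[ℝ] ℝ)) q := SmoothFormAt.zero
    fin_cases a <;> fin_cases b <;> first | exact h1 _ _ | exact h2 _ _ | exact h3
  metric q hq v w := by
    refine ((he.adapted q hq).1 v w).trans ?_
    simp only [frm_apply]
  skew q hq v a b := by
    fin_cases a <;> fin_cases b <;> simp [kap, Fin.sum_univ_four]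
  torsion q hq a v w := by
    have h1 := he.firstStructure h hq
    fin_cases a
    · refine (h1.d0 v w).trans ?_
      simp [kap, Fin.sum_univ_four, wdg]; ring
    · refine (h1.d1 v w).trans ?_
      simp [kap, Fin.sum_univ_four, wdg]; ring
    · refine (h1.d2 v w).trans ?_
      simp [kap, Fin.sum_univ_four, wdg]; ring
    · refine (h1.d3 v w).trans ?_
      simp [kap, Fin.sum_univ_four, wdg]; ring

end Torsion

/-! ### Signs and zero in exterior derivatives -/

section Forms

variable {E : Type} [NormedAddCommGroup E] [NormedSpace ℝ E] [FiniteDimensional ℝ E]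
  {N : Type u} [TopologicalSpace N] [ChartedSpace E N] [IsManifold 𝓘(ℝ, E) ∞ N]

theorem xD_neg {β : N → E →L[ℝ] ℝ} {q : N} (hβ : SmoothFormAt β q) (v w : E) :
    xD (fun x => - β x) q v w = - xD β q v w := by
  have h1 : SmoothAt E (fun _ : N => (-1 : ℝ)) q := contMDiffAt_const
  have h2 := xD_smul h1 hβ v w
  have h3 : dForm E (fun _ : N => (-1 : ℝ)) = fun _ => 0 :=
    funext fun x => by unfold dForm; exact mder_const (E := E) (E' := ℝ) (-1 : ℝ) x
  have h4 : (fun x => (-1 : ℝ) • β x) = fun x => - β x := funext fun x => neg_one_smul ℝ (β x)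
  rw [h4, h3] at h2
  rw [h2]
  simp [wdg]

theorem xD_zero (q : N) (v w : E) : xD (fun _ : N => (0 : E →L[ℝ] ℝ)) q v w = 0 := by
  have h2 := xD_neg (SmoothFormAt.zero (E := E) (p := q)) v w
  simp only [neg_zero] at h2
  linarith

end Forms

/-! ### Bianchi identity and second structure equations -/

section Curvature

variable {M : Type u} [TopologicalSpace M] [ChartedSpace E4 M] [IsManifold (𝓡 4) ∞ M]
  {g : BilinField M} {K : EndField M} {e : CoframeField M} {V : Set M}
  {κ : Fin 4 → Fin 4 → M → E4 →L[ℝ] ℝ} {γ : Fin 2 → Fin 2 → M → E4 →L[ℝ] ℝ} {Λ c : ℝ}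

/-- This is `d² = 0` for a form of the coframe: substituting the torsion equation once more
completes the derivatives of the connection forms to curvature forms. -/
theorem IsLeviCivita.bianchi (h : IsLeviCivita g e κ V) {q : M} (hq : q ∈ V) (a : Fin 4)
    (u v w : E4) : ∑ b, (Om κ a b q u v * frm e b q w + Om κ a b q v w * frm e b q u
      + Om κ a b q w u * frm e b q v) = 0 := by
  have h1 := sum_dWdg_eq_zero (s := Finset.univ) (α := frm e a) (β := fun b => frm e b)
    (γ := fun b => κ a b) h.isOpen (fun q hq => h.smooth_e q hq a)
    (fun b _ q hq => h.smooth_e q hq b) (fun b _ q hq => h.smooth_κ q hq a b)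
    (fun q hq v w => by
      rw [h.torsion q hq a v w, ← Finset.sum_neg_distrib]
      exact Finset.sum_congr rfl fun b _ => by unfold wdg; ring) hq u v w
  simp only [dWdg, h.torsion q hq, Fin.sum_univ_four, wdg] at h1
  simp only [Om, Fin.sum_univ_four, wdg]
  linear_combination -h1

theorem IsLeviCivita.bianchi_vec (h : IsLeviCivita g e κ V) {q : M} (hq : q ∈ V)
    (a b c d : Fin 4) : Om κ a d q (vec e b q) (vec e c q) + Om κ a b q (vec e c q) (vec e d q)
      + Om κ a c q (vec e d q) (vec e b q) = 0 := by
  have h1 := h.bianchi hq a (vec e b q) (vec e c q) (vec e d q)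
  simpa [frm_vec, Finset.sum_add_distrib] using h1

theorem Om_kap_lo (γ : Fin 2 → Fin 2 → M → E4 →L[ℝ] ℝ) (A B : Fin 2) (q : M) (v w : E4) :
    Om (kap γ) (lo A) (lo B) q v w
      = xD (γ A B) q v w + wdg (γ A 0) (γ 0 B) q v w + wdg (γ A 1) (γ 1 B) q v w := by
  fin_cases A <;> fin_cases B <;> simp [Om, kap, Fin.sum_univ_four, wdg] <;> ring

theorem Om_kap_hi {q : M} (hγ : ∀ A B, SmoothFormAt (γ A B) q) (A B : Fin 2) (v w : E4) :
    Om (kap γ) (hi A) (hi B) q v w = - Om (kap γ) (lo B) (lo A) q v w := by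
  fin_cases A <;> fin_cases B <;> simp [Om, kap, Fin.sum_univ_four, wdg, xD_neg (hγ _ _)] <;> ring

theorem Om_kap_lo_hi (γ : Fin 2 → Fin 2 → M → E4 →L[ℝ] ℝ) (A B : Fin 2) (q : M) (v w : E4) :
    Om (kap γ) (lo A) (hi B) q v w = 0 := by
  fin_cases A <;> fin_cases B <;> simp [Om, kap, Fin.sum_univ_four, wdg, xD_zero]

theorem Om_kap_hi_lo (γ : Fin 2 → Fin 2 → M → E4 →L[ℝ] ℝ) (A B : Fin 2) (q : M) (v w : E4) :
    Om (kap γ) (hi A) (lo B) q v w = 0 := by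
  fin_cases A <;> fin_cases B <;> simp [Om, kap, Fin.sum_univ_four, wdg, xD_zero]

/-- The second structure equations, in terms of the components of the Weyl tensor. -/
structure SecondStructure (e : CoframeField M) (γ : Fin 2 → Fin 2 → M → E4 →L[ℝ] ℝ) (c : ℝ)
    (ψ : Fin 5 → ℝ) (q : M) : Prop where
  d00 : ∀ v w, xD (γ 0 0) q v w = - wdg (γ 0 1) (γ 1 0) q v w
    + (-2 * c - ψ 2) * wdg (frm e 0) (frm e 2) q v w + ψ 1 * wdg (frm e 0) (frm e 3) q v w
    - ψ 3 * wdg (frm e 1) (frm e 2) q v w + (ψ 2 - c) * wdg (frm e 1) (frm e 3) q v w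
  d01 : ∀ v w, xD (γ 0 1) q v w = - wdg (γ 0 0) (γ 0 1) q v w - wdg (γ 0 1) (γ 1 1) q v w
    - ψ 3 * wdg (frm e 0) (frm e 2) q v w + (ψ 2 - c) * wdg (frm e 0) (frm e 3) q v w
    - ψ 4 * wdg (frm e 1) (frm e 2) q v w + ψ 3 * wdg (frm e 1) (frm e 3) q v w
  d10 : ∀ v w, xD (γ 1 0) q v w = wdg (γ 0 0) (γ 1 0) q v w + wdg (γ 1 0) (γ 1 1) q v w
    + ψ 1 * wdg (frm e 0) (frm e 2) q v w - ψ 0 * wdg (frm e 0) (frm e 3) q v w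
    + (ψ 2 - c) * wdg (frm e 1) (frm e 2) q v w - ψ 1 * wdg (frm e 1) (frm e 3) q v w
  d11 : ∀ v w, xD (γ 1 1) q v w = wdg (γ 0 1) (γ 1 0) q v w
    + (ψ 2 - c) * wdg (frm e 0) (frm e 2) q v w - ψ 1 * wdg (frm e 0) (frm e 3) q v w
    + ψ 3 * wdg (frm e 1) (frm e 2) q v w + (-2 * c - ψ 2) * wdg (frm e 1) (frm e 3) q v w

/-- A smooth adapted coframe field together with its connection forms and its structure
equations. -/
structure LocalStructure (g : BilinField M) (K : EndField M) (c : ℝ) (e : CoframeField M)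
    (γ : Fin 2 → Fin 2 → M → E4 →L[ℝ] ℝ) (V : Set M) : Prop extends IsAdaptedField g K e V where
  smooth_γ : ∀ q ∈ V, ∀ A B, SmoothFormAt (γ A B) q
  first : ∀ q ∈ V, FirstStructure e γ q
  second : ∀ q ∈ V, SecondStructure e γ c (psi g (toCoframe e q)) q
  smooth_psi : ∀ q ∈ V, ∀ i, SmoothAt E4 (fun x => psi g (toCoframe e x) i) q
  cov : ∀ q ∈ V, ∀ m, covWeylComp g (toCoframe e q) m 1 2 1 2 =
    dForm E4 (fun x => psi g (toCoframe e x) 4) q (vec e m q)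
      - 4 * γ 0 1 q (vec e m q) * psi g (toCoframe e q) 3
      - 2 * (γ 1 1 q (vec e m q) - γ 0 0 q (vec e m q)) * psi g (toCoframe e q) 4

/-- The curvature components of an adapted coframe field. -/
theorem curvature_table (h : IsLeviCivita g e (kap γ) V)
    (hE : ∀ (p : M) (a b : Fin 4), ricci g p a b (ch E4 p p) = Λ * gLow g p a b (ch E4 p p))
    {q : M} (hq : q ∈ V) (hγ : ∀ A B, SmoothFormAt (γ A B) q)
    (hc : psi2' g (toCoframe e q) = c) (ψ : Fin 5 → ℝ) (hψ : ψ = psi g (toCoframe e q)) :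
    Λ = -3 * c ∧ ∀ A B : Fin 2, ∀ v w, Om (kap γ) (lo A) (lo B) q v w =
      (![![-2 * c - ψ 2, - ψ 3], ![ψ 1, ψ 2 - c]] A B) * wdg (frm e 0) (frm e 2) q v w
      + (![![ψ 1, ψ 2 - c], ![- ψ 0, - ψ 1]] A B) * wdg (frm e 0) (frm e 3) q v w
      + (![![- ψ 3, - ψ 4], ![ψ 2 - c, ψ 3]] A B) * wdg (frm e 1) (frm e 2) q v w
      + (![![ψ 2 - c, ψ 3], ![- ψ 1, - 2 * c - ψ 2]] A B) * wdg (frm e 1) (frm e 3) q v w := by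
  have hW := h.weylComp_eq hE hq
  have z1 := fun A B v w => Om_kap_lo_hi γ A B q v w
  have z2 := fun A B v w => Om_kap_hi_lo γ A B q v w
  have z3 := fun A B v w => Om_kap_hi hγ A B v w
  have z02 := z1 0 0; have z03 := z1 0 1; have z12 := z1 1 0; have z13 := z1 1 1
  have z20 := z2 0 0; have z21 := z2 0 1; have z30 := z2 1 0; have z31 := z2 1 1
  have z22 := z3 0 0; have z23 := z3 0 1; have z32 := z3 1 0; have z33 := z3 1 1
  simp only [lo_zero, lo_one, hi_zero, hi_one] at z02 z03 z12 z13 z20 z21 z30 z31 z22 z23 z32 z33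
  have hR : ∀ a b, IsAlt (Om (kap γ) a b q) := fun a b =>
    (isAlt_xD (h.smooth_κ q hq a b)).add (IsAlt.sum fun d => isAlt_wdg _ _ q)
  have sw := fun a b v w => (hR a b).swap v w
  have b0 := h.bianchi_vec hq 0
  have b1 := h.bianchi_vec hq 1
  have b2 := h.bianchi_vec hq 2
  have b3 := h.bianchi_vec hq 3
  have sw' : ∀ a b i j : Fin 4, j < i → Om (kap γ) a b q (vec e i q) (vec e j q)
      = - Om (kap γ) a b q (vec e j q) (vec e i q) := fun a b i j _ => sw a b _ _
  have p0 : ψ 0 = Cf e (kap γ) Λ q 0 3 0 3 := by rw [hψ]; exact hW 0 3 0 3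
  have p1 : ψ 1 = Cf e (kap γ) Λ q 1 3 0 3 := by rw [hψ]; exact hW 1 3 0 3
  have p2 : ψ 2 = - Cf e (kap γ) Λ q 0 3 1 2 := by rw [hψ]; exact congrArg Neg.neg (hW 0 3 1 2)
  have p3 : ψ 3 = Cf e (kap γ) Λ q 0 2 1 2 := by rw [hψ]; exact hW 0 2 1 2
  have p4 : ψ 4 = Cf e (kap γ) Λ q 1 2 1 2 := by rw [hψ]; exact hW 1 2 1 2
  have pc : c = Cf e (kap γ) Λ q 0 1 2 3 := by rw [← hc]; exact hW 0 1 2 3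
  simp [Cf, Rf, etaArr, Fin.sum_univ_four, z02, z03, z12, z13, z20, z21, z30, z31, z22, z23, z32,
    z33] at p0 p1 p2 p3 p4 pc
  -- The connection preserves the two eigenbundles, so the Riemann part of `C₁₂₃₄` vanishes and only
  -- the constant curvature term `-Λ/3` is left.
  have hL : Λ = -3 * c := by linarith
  have r0 := h.Ricf_eq hE hq 0 2
  have r1 := h.Ricf_eq hE hq 0 3
  have r2 := h.Ricf_eq hE hq 1 2
  have r3 := h.Ricf_eq hE hq 1 3
  simp [Ricf, Fin.sum_univ_four, z02, z03, z12, z13, z20, z21, z30, z31] at r0 r1 r2 r3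
  -- Together with the mixed Ricci components, these Bianchi relations are linear equations that
  -- express every curvature coefficient through the five `Ψᵢ` and `c`.
  have b012 := b0 0 1 2
  have b013 := b0 0 1 3
  have b023 := b0 0 2 3
  have b0123 := b0 1 2 3
  have b112 := b1 0 1 2
  have b113 := b1 0 1 3
  have b123 := b1 0 2 3
  have b1123 := b1 1 2 3
  have b212 := b2 0 1 2
  have b213 := b2 0 1 3
  have b223 := b2 0 2 3
  have b2123 := b2 1 2 3
  have b312 := b3 0 1 2
  have b313 := b3 0 1 3
  have b323 := b3 0 2 3
  have b3123 := b3 1 2 3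
  have s20 := fun a b => sw' a b 2 0 (by decide)
  have s30 := fun a b => sw' a b 3 0 (by decide)
  have s21 := fun a b => sw' a b 2 1 (by decide)
  have s31 := fun a b => sw' a b 3 1 (by decide)
  have s32 := fun a b => sw' a b 3 2 (by decide)
  have s10 := fun a b => sw' a b 1 0 (by decide)
  simp only [z02, z03, z12, z13, z20, z21, z30, z31, z22, z23, z32, z33, s20, s30, s21, s31, s32,
    s10] at b012 b013 b023 b0123 b112 b113 b123 b1123 b212 b213 b223 b2123 b312 b313 b323 b3123 p0 p1 p2 p3 p4 r0 r1 r2 r3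
  refine ⟨hL, fun A B => ?_⟩
  have hI : ∀ x₁ x₂ x₃ x₄ : ℝ, IsAlt fun v w => x₁ * wdg (frm e 0) (frm e 2) q v w
      + x₂ * wdg (frm e 0) (frm e 3) q v w + x₃ * wdg (frm e 1) (frm e 2) q v w
      + x₄ * wdg (frm e 1) (frm e 3) q v w := fun x₁ x₂ x₃ x₄ =>
    ((((isAlt_wdg _ _ q).const_mul x₁).add ((isAlt_wdg _ _ q).const_mul x₂)).add
      ((isAlt_wdg _ _ q).const_mul x₃)).add ((isAlt_wdg _ _ q).const_mul x₄)
  refine (hR _ _).ext (hI _ _ _ _) e q ?_ ?_ ?_ ?_ ?_ ?_ <;>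
  · fin_cases A <;> fin_cases B <;> simp [wdg, frm_vec] <;> linarith

/-- The second structure equations are the curvature table with the quadratic terms moved to the
other side. The formula for `∇Ψ₄` is the covariant derivative of `C₂₃₂₃`: since the connection is
block diagonal, it couples this component only to itself and to components equal to `±Ψ₃`. -/
theorem IsAdaptedField.localStructure (h : IsParaKahlerEinstein g K)
    (hc : ∀ θ : Coframe M, Adapted g K θ → psi2' g θ = c) (he : IsAdaptedField g K e V) :
    LocalStructure g K c e (conn e) V := by
  have hL := he.isLeviCivita h
  obtain ⟨Λ, hE⟩ := h.einstein
  have hγ : ∀ q ∈ V, ∀ A B, SmoothFormAt (conn e A B) q := fun q hq A B => smoothFormAt_conn he hq A B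
  have hW := fun q (hq : q ∈ V) => hL.weylComp_eq hE hq
  have tab := fun q (hq : q ∈ V) =>
    (curvature_table hL hE hq (hγ q hq) (hc _ (he.adapted q hq)) _ rfl).2
  refine ⟨he, hγ, fun q hq => he.firstStructure h hq, fun q hq => ?_, fun q hq i => ?_,
    fun q hq m => ?_⟩
  · have t := fun A B v w => (Om_kap_lo (conn e) A B q v w).symm.trans (tab q hq A B v w)
    have t00 := t 0 0
    have t01 := t 0 1
    have t10 := t 1 0
    have t11 := t 1 1
    simp only [Matrix.cons_val] at t00 t01 t10 t11
    constructor <;> intro v w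
    · have := t00 v w
      unfold wdg at *
      linear_combination this
    · have := t01 v w
      unfold wdg at *
      linear_combination this
    · have := t10 v w
      unfold wdg at *
      linear_combination this
    · have := t11 v w
      unfold wdg at *
      linear_combination this
  · have h1 : ∀ a b c d, SmoothAt E4 (fun x => weylComp g (toCoframe e x) a b c d) q := by
      intro a b c d
      refine (hL.smooth_Cf (Λ := Λ) hq a b c d).congr_of_eventuallyEq ?_
      filter_upwards [he.isOpen.mem_nhds hq] with x hx using hW x hx a b c d
    fin_cases i
    · exact h1 0 3 0 3
    · exact h1 1 3 0 3
    · exact (h1 0 3 1 2).neg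
    · exact h1 0 2 1 2
    · exact h1 1 2 1 2
  · rw [hL.covWeylComp_eq hE hq]
    have hd : mder E4 ℝ (fun x => Cf e (kap (conn e)) Λ x 1 2 1 2) q
        = mder E4 ℝ (fun x => psi g (toCoframe e x) 4) q := by
      apply mder_congr
      filter_upwards [he.isOpen.mem_nhds hq] with x hx using (hW x hx 1 2 1 2).symm
    have p3 : psi g (toCoframe e q) 3 = Cf e (kap (conn e)) Λ q 0 2 1 2 := hW q hq 0 2 1 2
    have p4 : psi g (toCoframe e q) 4 = Cf e (kap (conn e)) Λ q 1 2 1 2 := hW q hq 1 2 1 2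
    have z22 := Om_kap_hi (hγ q hq) 0 0
    have z32 := Om_kap_hi (hγ q hq) 1 0
    have z33 := Om_kap_hi (hγ q hq) 1 1
    have t01 := tab q hq 0 1
    have t11 := tab q hq 1 1
    simp only [hi_zero, hi_one, lo_zero, lo_one, Matrix.cons_val] at z22 z32 z33 t01 t11
    -- These are the neighbours of `C₂₃₂₃` reached by replacing one index within its eigenbundle;
    -- their signs make the four contributions of `Ψ₃` add up.
    have c1 : Cf e (kap (conn e)) Λ q 1 2 0 2 = psi g (toCoframe e q) 3 := by
      simp [Cf, Rf, etaArr, Fin.sum_univ_four, z32, t01, wdg, frm_vec]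
    have c2 : Cf e (kap (conn e)) Λ q 1 3 1 2 = - psi g (toCoframe e q) 3 := by
      simp [Cf, Rf, etaArr, Fin.sum_univ_four, z33, t11, wdg, frm_vec]
    have c3 : Cf e (kap (conn e)) Λ q 1 2 1 3 = - psi g (toCoframe e q) 3 := by
      simp [Cf, Rf, etaArr, Fin.sum_univ_four, z32, t01, wdg, frm_vec]
    unfold covArr dForm
    rw [hd]
    simp only [Fin.sum_univ_four, c1, c2, c3, ← p3, ← p4]
    simp [kap]
    ring

end Curvature

/-! ### Binary quartics under linear substitutions -/

section QuarticAlgebra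

/-- The components of `Weyl⁻` after the change `e₀' = p e₀ + q e₁`, `e₁' = r e₀ + s e₁` of the
frame, up to the factor `(ps - qr)⁻²`. -/
def quarticAct (ψ : Fin 5 → ℝ) (p q r s : ℝ) : Fin 5 → ℝ :=
  ![ψ 4 * q ^ 4 + 4 * ψ 3 * q ^ 3 * p + 6 * ψ 2 * q ^ 2 * p ^ 2 + 4 * ψ 1 * q * p ^ 3
      + ψ 0 * p ^ 4,
    ψ 4 * q ^ 3 * s + ψ 3 * (q ^ 3 * r + 3 * q ^ 2 * p * s)
      + 3 * ψ 2 * (q ^ 2 * p * r + q * p ^ 2 * s) + ψ 1 * (p ^ 3 * s + 3 * p ^ 2 * q * r)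
      + ψ 0 * p ^ 3 * r,
    ψ 4 * q ^ 2 * s ^ 2 + 2 * ψ 3 * (q ^ 2 * s * r + q * p * s ^ 2)
      + ψ 2 * (q ^ 2 * r ^ 2 + 4 * p * q * r * s + p ^ 2 * s ^ 2)
      + 2 * ψ 1 * (p * q * r ^ 2 + p ^ 2 * r * s) + ψ 0 * p ^ 2 * r ^ 2,
    ψ 4 * q * s ^ 3 + ψ 3 * (s ^ 3 * p + 3 * s ^ 2 * r * q)
      + 3 * ψ 2 * (s ^ 2 * r * p + s * r ^ 2 * q) + ψ 1 * (r ^ 3 * q + 3 * r ^ 2 * p * s)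
      + ψ 0 * r ^ 3 * p,
    ψ 4 * s ^ 4 + 4 * ψ 3 * s ^ 3 * r + 6 * ψ 2 * s ^ 2 * r ^ 2 + 4 * ψ 1 * s * r ^ 3
      + ψ 0 * r ^ 4]

theorem quartic_quarticAct (ψ : Fin 5 → ℝ) (p q r s x y : ℝ) :
    quartic (quarticAct ψ p q r s) x y = quartic ψ (x * p + y * r) (x * q + y * s) := by
  simp only [quartic, quarticAct, Matrix.cons_val]
  ring

theorem quartic_smul (k : ℝ) (ψ : Fin 5 → ℝ) (x y : ℝ) :
    quartic (k • ψ) x y = k * quartic ψ x y := by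
  simp only [quartic, Pi.smul_apply, smul_eq_mul]; ring

/-- The coefficients of a quartic are determined by its values. -/
theorem quartic_coeff {ψ : Fin 5 → ℝ} {a₀ a₁ a₂ a₃ a₄ : ℝ}
    (h : ∀ x y, quartic ψ x y = a₄ * y ^ 4 + a₃ * y ^ 3 * x + a₂ * y ^ 2 * x ^ 2 + a₁ * y * x ^ 3
      + a₀ * x ^ 4) :
    ψ 0 = a₀ ∧ 4 * ψ 1 = a₁ ∧ 6 * ψ 2 = a₂ ∧ 4 * ψ 3 = a₃ ∧ ψ 4 = a₄ := by
  have h1 := h 1 0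
  have h2 := h 0 1
  have h3 := h 1 1
  have h4 := h 1 (-1)
  have h5 := h 1 2
  simp only [quartic] at h1 h2 h3 h4 h5
  refine ⟨?_, ?_, ?_, ?_, ?_⟩ <;> linarith

/-- An invertible substitution carries linear factors to linear factors and preserves their
independence. The scalar `k` goes into the free constant for types D and N, into a simple factor for
real type II and type III, and into the quadratic factor for complex type II, whose discriminant
gets multiplied by a positive square. -/
theorem RootType.change {ψ : Fin 5 → ℝ} {t : PetrovType} (h : RootType ψ t) {p q r s k : ℝ}
    (hD : p * s - q * r ≠ 0) (hk : k ≠ 0) : RootType (k • quarticAct ψ p q r s) t := by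
  have hI : ∀ a b : ℝ × ℝ, Indep a b →
      Indep (a.1 * p + a.2 * q, a.1 * r + a.2 * s) (b.1 * p + b.2 * q, b.1 * r + b.2 * s) := by
    intro a b hab
    have : (a.1 * p + a.2 * q) * (b.1 * r + b.2 * s) - (a.1 * r + a.2 * s) * (b.1 * p + b.2 * q)
        = (a.1 * b.2 - a.2 * b.1) * (p * s - q * r) := by ring
    unfold Indep
    rw [this]
    exact mul_ne_zero hab hD
  have hIs : ∀ a b : ℝ × ℝ, Indep a b → Indep a (k * b.1, k * b.2) := by
    intro a b hab
    have : a.1 * (k * b.2) - a.2 * (k * b.1) = k * (a.1 * b.2 - a.2 * b.1) := by ring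
    unfold Indep
    rw [this]
    exact mul_ne_zero hk hab
  have h0 : ∀ a : ℝ × ℝ, a ≠ 0 → (a.1 * p + a.2 * q, a.1 * r + a.2 * s) ≠ (0 : ℝ × ℝ) := by
    intro a ha h
    rw [Prod.mk_eq_zero] at h
    apply ha
    have e1 : a.1 * (p * s - q * r) = 0 := by linear_combination s * h.1 - q * h.2
    have e2 : a.2 * (p * s - q * r) = 0 := by linear_combination p * h.2 - r * h.1
    exact Prod.ext ((mul_eq_zero.1 e1).resolve_right hD) ((mul_eq_zero.1 e2).resolve_right hD)
  cases t with
  | IIr =>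
    obtain ⟨a, b, c, hab, hac, hbc, H⟩ := h
    refine ⟨_, _, _, hI a b hab, hIs _ _ (hI a c hac), hIs _ _ (hI b c hbc), fun x y => ?_⟩
    rw [quartic_smul, quartic_quarticAct, H]
    simp only [lin]; ring
  | IIc =>
    obtain ⟨a, l, m, n, ha, hlm, H⟩ := h
    refine ⟨_, k * (l * p ^ 2 + m * p * q + n * q ^ 2),
      k * (2 * l * p * r + m * (p * s + q * r) + 2 * n * q * s),
      k * (l * r ^ 2 + m * r * s + n * s ^ 2), h0 a ha, ?_, fun x y => ?_⟩
    · have : (k * (2 * l * p * r + m * (p * s + q * r) + 2 * n * q * s)) ^ 2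
          - 4 * (k * (l * p ^ 2 + m * p * q + n * q ^ 2)) * (k * (l * r ^ 2 + m * r * s + n * s ^ 2))
          = (m ^ 2 - 4 * l * n) * (k * (p * s - q * r)) ^ 2 := by ring
      rw [this]
      exact mul_neg_of_neg_of_pos hlm (by have := mul_ne_zero hk hD; positivity)
    · rw [quartic_smul, quartic_quarticAct, H]
      simp only [lin]; ring
  | III =>
    obtain ⟨a, b, hab, H⟩ := h
    refine ⟨_, _, hIs _ _ (hI a b hab), fun x y => ?_⟩
    rw [quartic_smul, quartic_quarticAct, H]
    simp only [lin]; ring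
  | D =>
    obtain ⟨l, a, b, hl, hab, H⟩ := h
    refine ⟨k * l, _, _, mul_ne_zero hk hl, hI a b hab, fun x y => ?_⟩
    rw [quartic_smul, quartic_quarticAct, H]
    simp only [lin]; ring
  | N =>
    obtain ⟨l, a, hl, ha, H⟩ := h
    refine ⟨k * l, _, mul_ne_zero hk hl, h0 a ha, fun x y => ?_⟩
    rw [quartic_smul, quartic_quarticAct, H]
    simp only [lin]; ring

end QuarticAlgebra

/-! ### Dependence of the Weyl components on the adapted frame -/

section PointwiseWeyl

variable {M : Type u} [TopologicalSpace M] [ChartedSpace E4 M] [IsManifold (𝓡 4) ∞ M]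
  {g : BilinField M} {K : EndField M} {c : ℝ}

/-- The vectors dual to a linear coframe. -/
noncomputable def fvec (f : E4 ≃L[ℝ] (Fin 4 → ℝ)) (a : Fin 4) : E4 := f.symm (Pi.single a 1)

theorem apply_fvec (f : E4 ≃L[ℝ] (Fin 4 → ℝ)) (a b : Fin 4) :
    f (fvec f a) b = if b = a then 1 else 0 := by
  simp [fvec, Pi.single_apply]

theorem sum_smul_fvec (f : E4 ≃L[ℝ] (Fin 4 → ℝ)) (v : E4) : ∑ a, f v a • fvec f a = v := by
  apply f.injective
  rw [map_sum]
  funext b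
  simp [fvec, Pi.single_apply]

/-- The Weyl tensor at a point, as a quadrilinear form. -/
noncomputable def cw (g : BilinField M) (q : M) (v₁ v₂ v₃ v₄ : E4) : ℝ :=
  ∑ i, ∑ j, ∑ k, ∑ l, v₁ i * v₂ j * v₃ k * v₄ l * weyl g q i j k l (ch E4 q q)

theorem dual_mk (q : M) (f : E4 ≃L[ℝ] (Fin 4 → ℝ)) (a i : Fin 4) :
    (⟨q, f⟩ : Coframe M).dual a i = fvec f a i := by
  have h1 : (⟨q, f⟩ : Coframe M).dual a i = (mder E4 E4 (ch E4 q) q (fvec f a)) i := rfl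
  rw [h1, mder_chart_self]; rfl

theorem weylComp_mk (q : M) (f : E4 ≃L[ℝ] (Fin 4 → ℝ)) (a b c d : Fin 4) :
    weylComp g ⟨q, f⟩ a b c d = cw g q (fvec f a) (fvec f b) (fvec f c) (fvec f d) := by
  unfold weylComp cw
  simp only [dual_mk]

theorem cw_lin₁ (q : M) (a b : ℝ) (u v x y z : E4) :
    cw g q (a • u + b • v) x y z = a * cw g q u x y z + b * cw g q v x y z := by
  simp only [cw, Finset.mul_sum, ← Finset.sum_add_distrib]
  refine Finset.sum_congr rfl fun i _ => Finset.sum_congr rfl fun j _ =>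
    Finset.sum_congr rfl fun k _ => Finset.sum_congr rfl fun l _ => ?_
  simp only [PiLp.add_apply, PiLp.smul_apply, smul_eq_mul]; ring

theorem cw_lin₂ (q : M) (a b : ℝ) (u v x y z : E4) :
    cw g q x (a • u + b • v) y z = a * cw g q x u y z + b * cw g q x v y z := by
  simp only [cw, Finset.mul_sum, ← Finset.sum_add_distrib]
  refine Finset.sum_congr rfl fun i _ => Finset.sum_congr rfl fun j _ =>
    Finset.sum_congr rfl fun k _ => Finset.sum_congr rfl fun l _ => ?_
  simp only [PiLp.add_apply, PiLp.smul_apply, smul_eq_mul]; ring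

theorem cw_lin₃ (q : M) (a b : ℝ) (u v x y z : E4) :
    cw g q x y (a • u + b • v) z = a * cw g q x y u z + b * cw g q x y v z := by
  simp only [cw, Finset.mul_sum, ← Finset.sum_add_distrib]
  refine Finset.sum_congr rfl fun i _ => Finset.sum_congr rfl fun j _ =>
    Finset.sum_congr rfl fun k _ => Finset.sum_congr rfl fun l _ => ?_
  simp only [PiLp.add_apply, PiLp.smul_apply, smul_eq_mul]; ring

theorem cw_lin₄ (q : M) (a b : ℝ) (u v x y z : E4) :
    cw g q x y z (a • u + b • v) = a * cw g q x y z u + b * cw g q x y z v := by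
  simp only [cw, Finset.mul_sum, ← Finset.sum_add_distrib]
  refine Finset.sum_congr rfl fun i _ => Finset.sum_congr rfl fun j _ =>
    Finset.sum_congr rfl fun k _ => Finset.sum_congr rfl fun l _ => ?_
  simp only [PiLp.add_apply, PiLp.smul_apply, smul_eq_mul]; ring

/-- All components of the Weyl tensor with alternating types of indices. -/
theorem weylComp_table (h : IsParaKahlerEinstein g K)
    (hc : ∀ θ : Coframe M, Adapted g K θ → psi2' g θ = c) {q : M} {f : E4 ≃L[ℝ] (Fin 4 → ℝ)}
    (hf : AdaptedAt (g q) (K q) f) (ψ : Fin 5 → ℝ) (hψ : ψ = psi g ⟨q, f⟩) (A B C D : Fin 2) :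
    weylComp g ⟨q, f⟩ (lo A) (hi B) (lo C) (hi D) =
      ![![![![ψ 2 + c, - ψ 1], ![ψ 3, c - ψ 2]], ![![- ψ 1, ψ 0], ![- ψ 2, ψ 1]]],
        ![![![ψ 3, - ψ 2], ![ψ 4, - ψ 3]], ![![c - ψ 2, ψ 1], ![- ψ 3, ψ 2 + c]]]] A B C D := by
  obtain ⟨e, V, he, hq, rfl⟩ := exists_adaptedField h hf
  have hL := he.isLeviCivita h
  obtain ⟨Λ, hE⟩ := h.einstein
  have hγ : ∀ A B, SmoothFormAt (conn e A B) q := fun A B => smoothFormAt_conn he hq A B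
  obtain ⟨hΛ, tab⟩ := curvature_table hL hE hq hγ (hc _ (he.adapted q hq)) ψ hψ
  have hW := hL.weylComp_eq hE hq
  have z := Om_kap_hi hγ
  have z22 := z 0 0; have z23 := z 0 1; have z32 := z 1 0; have z33 := z 1 1
  have t00 := tab 0 0; have t01 := tab 0 1; have t10 := tab 1 0; have t11 := tab 1 1
  simp only [hi_zero, hi_one, lo_zero, lo_one, Matrix.cons_val] at z22 z23 z32 z33 t00 t01 t10 t11
  refine (hW _ _ _ _).trans ?_
  fin_cases A <;> fin_cases B <;> fin_cases C <;> fin_cases D <;>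
    simp [Cf, Rf, etaArr, Fin.sum_univ_four, z22, z23, z32, z33, t00, t01, t10, t11, wdg, frm_vec,
      hΛ] <;> ring

/-- Two adapted coframes at a point differ by an element of `GL₂`. -/
theorem AdaptedAt.exists_change {G : E4 →L[ℝ] E4 →L[ℝ] ℝ} {L : E4 →L[ℝ] E4}
    {f f' : E4 ≃L[ℝ] (Fin 4 → ℝ)} (hf : AdaptedAt G L f) (hf' : AdaptedAt G L f') :
    ∃ p q r s : ℝ, p * s - q * r ≠ 0 ∧ fvec f' 0 = p • fvec f 0 + q • fvec f 1 ∧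
      fvec f' 1 = r • fvec f 0 + s • fvec f 1 ∧
      fvec f' 2 = (s / (p * s - q * r)) • fvec f 2 + (- r / (p * s - q * r)) • fvec f 3 ∧
      fvec f' 3 = (- q / (p * s - q * r)) • fvec f 2 + (p / (p * s - q * r)) • fvec f 3 := by
  obtain ⟨k0, k1, k2, k3⟩ := hf'.apply_vec
  have hv : ∀ v, v = f v 0 • fvec f 0 + f v 1 • fvec f 1 + f v 2 • fvec f 2 + f v 3 • fvec f 3 := by
    intro v
    have := sum_smul_fvec f v
    rw [Fin.sum_univ_four] at this
    exact this.symm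
  have hp : ∀ v, L v = v → f v 2 = 0 ∧ f v 3 = 0 := by
    intro v h
    have h1 := hf.2 v
    rw [h] at h1
    have h2 := congrFun h1 2
    have h3 := congrFun h1 3
    simp only [Matrix.cons_val] at h2 h3
    constructor <;> linarith
  have hm : ∀ v, L v = - v → f v 0 = 0 ∧ f v 1 = 0 := by
    intro v h
    have h1 := hf.2 v
    rw [h, map_neg] at h1
    have h2 := congrFun h1 0
    have h3 := congrFun h1 1
    simp only [Matrix.cons_val, Pi.neg_apply] at h2 h3
    constructor <;> linarith
  have a0 := hp (fvec f' 0) k0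
  have a1 := hp (fvec f' 1) k1
  have a2 := hm (fvec f' 2) k2
  have a3 := hm (fvec f' 3) k3
  have G02 := (hf.1 (fvec f' 0) (fvec f' 2)).symm.trans (hf'.1 _ _)
  have G03 := (hf.1 (fvec f' 0) (fvec f' 3)).symm.trans (hf'.1 _ _)
  have G12 := (hf.1 (fvec f' 1) (fvec f' 2)).symm.trans (hf'.1 _ _)
  have G13 := (hf.1 (fvec f' 1) (fvec f' 3)).symm.trans (hf'.1 _ _)
  simp [apply_fvec, a0, a1, a2, a3] at G02 G03 G12 G13
  have e0 := hv (fvec f' 0)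
  have e1 := hv (fvec f' 1)
  have e2 := hv (fvec f' 2)
  have e3 := hv (fvec f' 3)
  rw [a0.1, a0.2] at e0
  rw [a1.1, a1.2] at e1
  rw [a2.1, a2.2] at e2
  rw [a3.1, a3.2] at e3
  generalize f (fvec f' 0) 0 = p at *
  generalize f (fvec f' 0) 1 = q at *
  generalize f (fvec f' 1) 0 = r at *
  generalize f (fvec f' 1) 1 = s at *
  generalize f (fvec f' 2) 2 = x at *
  generalize f (fvec f' 2) 3 = y at *
  generalize f (fvec f' 3) 2 = z at *
  generalize f (fvec f' 3) 3 = w at *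
  have hD : (p * s - q * r) * (x * w - y * z) = 1 := by
    linear_combination (r * z + s * w) * G02 + G13 - (p * z + q * w) * G12
  have hD0 : p * s - q * r ≠ 0 := left_ne_zero_of_mul_eq_one hD
  refine ⟨p, q, r, s, hD0, ?_, ?_, ?_, ?_⟩
  · rw [e0]; simp
  · rw [e1]; simp
  · have h1 : x = s / (p * s - q * r) := by
      rw [eq_div_iff hD0]; linear_combination s * G02 - q * G12
    have h2 : y = - r / (p * s - q * r) := by
      rw [eq_div_iff hD0]; linear_combination p * G12 - r * G02
    rw [e2, ← h1, ← h2]; simp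
  · have h1 : z = - q / (p * s - q * r) := by
      rw [eq_div_iff hD0]; linear_combination s * G03 - q * G13
    have h2 : w = p / (p * s - q * r) := by
      rw [eq_div_iff hD0]; linear_combination p * G13 - r * G03
    rw [e3, ← h1, ← h2]; simp

/-- Expand multilinearly and insert the table of components. Each `Ψᵢ` has two unbarred and two
barred slots; the barred vectors transform by the inverse transpose, and their denominators produce
the factor `(ps - qr)⁻²`. The contributions of `c` cancel. -/
theorem psi_change (h : IsParaKahlerEinstein g K)
    (hc : ∀ θ : Coframe M, Adapted g K θ → psi2' g θ = c) {x : M} {f f' : E4 ≃L[ℝ] (Fin 4 → ℝ)}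
    (hf : AdaptedAt (g x) (K x) f) {p q r s : ℝ} (hD : p * s - q * r ≠ 0)
    (h0 : fvec f' 0 = p • fvec f 0 + q • fvec f 1) (h1 : fvec f' 1 = r • fvec f 0 + s • fvec f 1)
    (h2 : fvec f' 2 = (s / (p * s - q * r)) • fvec f 2 + (- r / (p * s - q * r)) • fvec f 3)
    (h3 : fvec f' 3 = (- q / (p * s - q * r)) • fvec f 2 + (p / (p * s - q * r)) • fvec f 3) :
    psi g ⟨x, f'⟩ = ((p * s - q * r) ^ 2)⁻¹ • quarticAct (psi g ⟨x, f⟩) p q r s := by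
  obtain ⟨ψ, hψ⟩ : ∃ ψ, ψ = psi g ⟨x, f⟩ := ⟨_, rfl⟩
  have tab := fun A B C D => (weylComp_mk (g := g) x f _ _ _ _).symm.trans
    (weylComp_table h hc hf ψ hψ A B C D)
  rw [← hψ]
  have t1 := tab 0 0; have t2 := tab 0 1; have t3 := tab 1 0; have t4 := tab 1 1
  have t10 := t1 0; have t11 := t1 1; have t20 := t2 0; have t21 := t2 1
  have t30 := t3 0; have t31 := t3 1; have t40 := t4 0; have t41 := t4 1
  clear t1 t2 t3 t4 tab
  have t100 := t10 0; have t101 := t10 1; have t110 := t11 0; have t111 := t11 1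
  have t200 := t20 0; have t201 := t20 1; have t210 := t21 0; have t211 := t21 1
  have t300 := t30 0; have t301 := t30 1; have t310 := t31 0; have t311 := t31 1
  have t400 := t40 0; have t401 := t40 1; have t410 := t41 0; have t411 := t41 1
  simp only [hi_zero, hi_one, lo_zero, lo_one, Matrix.cons_val] at t100 t101 t110 t111 t200 t201 t210 t211 t300 t301 t310 t311 t400 t401 t410 t411
  funext i
  fin_cases i
  all_goals
    simp only [psi, weylComp_mk, h0, h1, h2, h3, cw_lin₁, cw_lin₂, cw_lin₃, cw_lin₄, t100, t101,
      t110, t111, t200, t201, t210, t211, t300, t301, t310, t311, t400, t401, t410, t411,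
      quarticAct, Pi.smul_apply, smul_eq_mul, Fin.zero_eta, Fin.mk_one, Fin.reduceFinMk,
      Matrix.cons_val]
    generalize p * s - q * r = D at hD
    field_simp
    try ring

end PointwiseWeyl

/-! ### Smooth choice of a repeated root -/

section Normalization

/-- `Ψ₀ = … = Ψ_{k-1} = 0 ≠ Ψ_k`. -/
def RootAtZero (t : PetrovType) (ψ : Fin 5 → ℝ) : Prop :=
  ψ 0 = 0 ∧ ψ 1 = 0 ∧
    match t with
    | .III => ψ 2 = 0 ∧ ψ 3 ≠ 0
    | .N => ψ 2 = 0 ∧ ψ 3 = 0 ∧ ψ 4 ≠ 0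
    | _ => ψ 2 ≠ 0

/-- Quartics `(a₁x + a₂y)² (px² + qxy + ry²)` with exactly one double root. -/
def OneDouble (ψ : Fin 5 → ℝ) : Prop :=
  ∃ a₁ a₂ p q r : ℝ, (a₁ ≠ 0 ∨ a₂ ≠ 0) ∧ q ^ 2 - 4 * p * r ≠ 0 ∧
    p * a₂ ^ 2 - q * a₁ * a₂ + r * a₁ ^ 2 ≠ 0 ∧ ψ 0 = a₁ ^ 2 * p ∧
    4 * ψ 1 = a₁ ^ 2 * q + 2 * a₁ * a₂ * p ∧
    6 * ψ 2 = a₁ ^ 2 * r + 2 * a₁ * a₂ * q + a₂ ^ 2 * p ∧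
    4 * ψ 3 = 2 * a₁ * a₂ * r + a₂ ^ 2 * q ∧ ψ 4 = a₂ ^ 2 * r

theorem RootType.oneDouble_real {ψ : Fin 5 → ℝ} (h : RootType ψ .IIr) : OneDouble ψ := by
  obtain ⟨a, b, c, hab, hac, hbc, H⟩ := h
  have ha : a.1 ≠ 0 ∨ a.2 ≠ 0 := by
    by_contra! h0
    exact hab (by rw [h0.1, h0.2]; ring)
  have hd : (b.1 * c.2 + b.2 * c.1) ^ 2 - 4 * (b.1 * c.1) * (b.2 * c.2) ≠ 0 := by
    have : (b.1 * c.2 + b.2 * c.1) ^ 2 - 4 * (b.1 * c.1) * (b.2 * c.2)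
        = (b.1 * c.2 - b.2 * c.1) ^ 2 := by ring
    rw [this]
    exact pow_ne_zero 2 hbc
  have hr : b.1 * c.1 * a.2 ^ 2 - (b.1 * c.2 + b.2 * c.1) * a.1 * a.2 + b.2 * c.2 * a.1 ^ 2 ≠ 0 := by
    have : b.1 * c.1 * a.2 ^ 2 - (b.1 * c.2 + b.2 * c.1) * a.1 * a.2 + b.2 * c.2 * a.1 ^ 2
        = (a.1 * b.2 - a.2 * b.1) * (a.1 * c.2 - a.2 * c.1) := by ring
    rw [this]
    exact mul_ne_zero hab hac
  exact ⟨a.1, a.2, b.1 * c.1, b.1 * c.2 + b.2 * c.1, b.2 * c.2, ha, hd, hr,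
    quartic_coeff fun x y => by rw [H]; simp only [lin]; ring⟩

theorem RootType.oneDouble_complex {ψ : Fin 5 → ℝ} (h : RootType ψ .IIc) : OneDouble ψ := by
  obtain ⟨a, p, q, r, ha, hd, H⟩ := h
  have ha' : a.1 ≠ 0 ∨ a.2 ≠ 0 := by
    by_contra! h0
    exact ha (Prod.ext h0.1 h0.2)
  have hr : p * a.2 ^ 2 - q * a.1 * a.2 + r * a.1 ^ 2 ≠ 0 := by
    intro h0
    rcases ha' with h1 | h1
    · have h2 := mul_neg_of_neg_of_pos hd (sq_pos_of_ne_zero h1)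
      have h3 : (2 * p * a.2 - q * a.1) ^ 2 = (q ^ 2 - 4 * p * r) * a.1 ^ 2 := by
        linear_combination 4 * p * h0
      linarith [sq_nonneg (2 * p * a.2 - q * a.1)]
    · have h2 := mul_neg_of_neg_of_pos hd (sq_pos_of_ne_zero h1)
      have h3 : (2 * r * a.1 - q * a.2) ^ 2 = (q ^ 2 - 4 * p * r) * a.2 ^ 2 := by
        linear_combination 4 * r * h0
      linarith [sq_nonneg (2 * r * a.1 - q * a.2)]
  exact ⟨a.1, a.2, p, q, r, ha', hd.ne, hr,
    quartic_coeff fun x y => by rw [H]; simp only [lin]; ring⟩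

/-- The coefficients of `y⁴`, `y³x` and `x⁴` in the covariant of a quartic that is proportional to
the fourth power of a double root. -/
def dblCov (ψ : Fin 5 → ℝ) : ℝ × ℝ × ℝ :=
  let I := ψ 0 * ψ 4 - 4 * ψ 1 * ψ 3 + 3 * ψ 2 ^ 2
  let J := ψ 0 * ψ 2 * ψ 4 + 2 * ψ 1 * ψ 2 * ψ 3 - ψ 2 ^ 3 - ψ 0 * ψ 3 ^ 2 - ψ 1 ^ 2 * ψ 4
  (2 * I * (ψ 2 * ψ 4 - ψ 3 ^ 2) - 3 * J * ψ 4,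
    4 * I * (ψ 1 * ψ 4 - ψ 2 * ψ 3) - 12 * J * ψ 3,
    2 * I * (ψ 0 * ψ 2 - ψ 1 ^ 2) - 3 * J * ψ 0)

/-- The covariant is `2I` times the Hessian minus `3J` times the quartic. For `ℓ² Q` with `ℓ` linear
and `Q` quadratic it is a multiple of `ℓ⁴`, the factor being, up to a constant, the discriminant of
`Q` times the squared value of `Q` at the root of `ℓ`. Both are nonzero exactly when `ℓ²` is the
only repeated factor. This recovers the double root rationally from the coefficients. -/
theorem OneDouble.dblCov {ψ : Fin 5 → ℝ} {a₁ a₂ p q r : ℝ} (h0 : ψ 0 = a₁ ^ 2 * p)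
    (h1 : 4 * ψ 1 = a₁ ^ 2 * q + 2 * a₁ * a₂ * p)
    (h2 : 6 * ψ 2 = a₁ ^ 2 * r + 2 * a₁ * a₂ * q + a₂ ^ 2 * p)
    (h3 : 4 * ψ 3 = 2 * a₁ * a₂ * r + a₂ ^ 2 * q) (h4 : ψ 4 = a₂ ^ 2 * r) :
    let k := -(1 / 96) * (q ^ 2 - 4 * p * r) * (p * a₂ ^ 2 - q * a₁ * a₂ + r * a₁ ^ 2) ^ 2
    (dblCov ψ).1 = k * a₂ ^ 4 ∧ (dblCov ψ).2.1 = 4 * k * a₁ * a₂ ^ 3 ∧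
      (dblCov ψ).2.2 = k * a₁ ^ 4 := by
  have e1 : ψ 1 = (a₁ ^ 2 * q + 2 * a₁ * a₂ * p) / 4 := by linarith
  have e2 : ψ 2 = (a₁ ^ 2 * r + 2 * a₁ * a₂ * q + a₂ ^ 2 * p) / 6 := by linarith
  have e3 : ψ 3 = (2 * a₁ * a₂ * r + a₂ ^ 2 * q) / 4 := by linarith
  refine ⟨?_, ?_, ?_⟩ <;>
  · simp only [PKE.dblCov, h0, e1, e2, e3, h4]
    ring

/-- The radicands in the formula for a root of type `D`. -/
noncomputable def radD (ψ : Fin 5 → ℝ) : ℝ := 9 * ψ 2 ^ 2 - 8 * ψ 1 * ψ 3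

/-- The square of the middle coefficient of the quadratic form underlying a quartic of type `D`. -/
noncomputable def midD (ε : ℝ) (ψ : Fin 5 → ℝ) : ℝ := 3 * ε * ψ 2 + √(radD ψ)

/-- The repeated root `(1, ρ)`, as a function of the coefficients, locally. -/
noncomputable def rootFun (t : PetrovType) (ε : ℝ) (ψ : Fin 5 → ℝ) : ℝ :=
  match t with
  | .III => -(ψ 1 * ψ 4 - ψ 2 * ψ 3) / (2 * (ψ 2 * ψ 4 - ψ 3 ^ 2))
  | .N => - ψ 3 / ψ 4
  | .D => -(4 * ε * ψ 1 / midD ε ψ) / (1 + √(1 - 16 * ψ 1 * ψ 3 / midD ε ψ ^ 2))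
  | _ => - (dblCov ψ).2.1 / (4 * (dblCov ψ).1)

/-- The domain of `rootFun`. -/
def rootDom (t : PetrovType) (ε : ℝ) : Set (Fin 5 → ℝ) :=
  match t with
  | .III => {ψ | ψ 2 * ψ 4 - ψ 3 ^ 2 ≠ 0}
  | .N => {ψ | ψ 4 ≠ 0}
  | .D => {ψ | 0 < ε * ψ 2 ∧ ψ 0 * ψ 4 < ψ 2 ^ 2 ∧ 0 < radD ψ ∧ 16 * ψ 1 * ψ 3 < midD ε ψ ^ 2}
  | _ => {ψ | (dblCov ψ).1 ≠ 0}

theorem isOpen_rootDom (t : PetrovType) (ε : ℝ) : IsOpen (rootDom t ε) := by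
  cases t with
  | III => exact isOpen_ne_fun (by fun_prop) continuous_const
  | N => exact isOpen_ne_fun (by fun_prop) continuous_const
  | D =>
    have h1 : IsOpen {ψ : Fin 5 → ℝ | 0 < ε * ψ 2} := isOpen_lt (by fun_prop) (by fun_prop)
    have h2 : IsOpen {ψ : Fin 5 → ℝ | ψ 0 * ψ 4 < ψ 2 ^ 2} :=
      isOpen_lt (by fun_prop) (by fun_prop)
    have h3 : IsOpen {ψ : Fin 5 → ℝ | 0 < radD ψ} :=
      isOpen_lt (by fun_prop) (by unfold radD; fun_prop)
    have h4 : IsOpen {ψ : Fin 5 → ℝ | 16 * ψ 1 * ψ 3 < midD ε ψ ^ 2} :=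
      isOpen_lt (by fun_prop) (by unfold midD radD; fun_prop)
    exact h1.inter (h2.inter (h3.inter h4))
  | IIr => exact isOpen_ne_fun (by unfold dblCov; fun_prop) continuous_const
  | IIc => exact isOpen_ne_fun (by unfold dblCov; fun_prop) continuous_const

theorem contDiffAt_coord (ψ : Fin 5 → ℝ) (i : Fin 5) :
    ContDiffAt ℝ ∞ (fun φ : Fin 5 → ℝ => φ i) ψ :=
  (contDiff_apply ℝ ℝ i).contDiffAt

theorem contDiffAt_rootFun {t : PetrovType} {ε : ℝ} {ψ : Fin 5 → ℝ} (h : ψ ∈ rootDom t ε) :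
    ContDiffAt ℝ ∞ (rootFun t ε) ψ := by
  have hc := contDiffAt_coord ψ
  have hd : (dblCov ψ).1 ≠ 0 → ContDiffAt ℝ ∞
      (fun ψ => - (dblCov ψ).2.1 / (4 * (dblCov ψ).1)) ψ := by
    intro h
    refine ContDiffAt.div ?_ ?_ (mul_ne_zero four_ne_zero h) <;> unfold dblCov <;> fun_prop
  cases t with
  | III =>
    exact ContDiffAt.div (by fun_prop) (by fun_prop) (mul_ne_zero two_ne_zero h)
  | N => exact ContDiffAt.div (by fun_prop) (by fun_prop) h
  | D =>
    obtain ⟨h1, h2, h3, h4⟩ := h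
    have hm : 0 < midD ε ψ := by
      unfold midD
      have := Real.sqrt_nonneg (radD ψ)
      linarith
    have hr : ContDiffAt ℝ ∞ radD ψ := by unfold radD; fun_prop
    have hmid : ContDiffAt ℝ ∞ (midD ε) ψ :=
      ContDiffAt.add (by fun_prop) (hr.sqrt h3.ne')
    have hs : 0 < 1 - 16 * ψ 1 * ψ 3 / midD ε ψ ^ 2 := by
      rw [sub_pos, div_lt_one (by positivity)]; exact h4
    have hq : ContDiffAt ℝ ∞ (fun ψ => 16 * ψ 1 * ψ 3 / midD ε ψ ^ 2) ψ :=
      ContDiffAt.div (by fun_prop) (hmid.pow 2) (by positivity)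
    refine ContDiffAt.div (ContDiffAt.neg (ContDiffAt.div (by fun_prop) hmid hm.ne'))
      (contDiffAt_const.add ((contDiffAt_const.sub hq).sqrt hs.ne')) ?_
    have := Real.sqrt_nonneg (1 - 16 * ψ 1 * ψ 3 / midD ε ψ ^ 2)
    positivity
  | IIr => exact hd h
  | IIc => exact hd h

/-- The covariant is proportional to `(a₁x + a₂y)⁴`, so the ratio of its first two coefficients
yields the root `-a₁/a₂`. The new third component is one sixth of the value of the quadratic factor
at that root. -/
theorem OneDouble.rootAtZero {ψ : Fin 5 → ℝ} (h : OneDouble ψ) (hd : (PKE.dblCov ψ).1 ≠ 0) :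
    let φ := quarticAct ψ 1 (- (PKE.dblCov ψ).2.1 / (4 * (PKE.dblCov ψ).1)) 0 1
    φ 0 = 0 ∧ φ 1 = 0 ∧ φ 2 ≠ 0 := by
  obtain ⟨a₁, a₂, p, q, r, -, -, hr, h0, h1, h2, h3, h4⟩ := h
  obtain ⟨c1, c2, -⟩ := OneDouble.dblCov h0 h1 h2 h3 h4
  rw [c1] at hd
  have ha : a₂ ≠ 0 := by rintro rfl; exact hd (by ring)
  have hρ : - (PKE.dblCov ψ).2.1 / (4 * (PKE.dblCov ψ).1) = - a₁ / a₂ := by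
    have hk := left_ne_zero_of_mul hd
    rw [c1, c2, div_eq_div_iff (mul_ne_zero four_ne_zero hd) ha]
    ring
  have e1 : ψ 1 = (a₁ ^ 2 * q + 2 * a₁ * a₂ * p) / 4 := by linarith
  have e2 : ψ 2 = (a₁ ^ 2 * r + 2 * a₁ * a₂ * q + a₂ ^ 2 * p) / 6 := by linarith
  have e3 : ψ 3 = (2 * a₁ * a₂ * r + a₂ ^ 2 * q) / 4 := by linarith
  simp only [hρ, quarticAct, Matrix.cons_val]
  refine ⟨?_, ?_, ?_⟩
  · rw [h0, e1, e2, e3, h4]; field_simp; ring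
  · rw [e1, e2, e3, h4]; field_simp; ring
  · have : ψ 4 * (-a₁ / a₂) ^ 2 * 1 ^ 2
        + 2 * ψ 3 * ((-a₁ / a₂) ^ 2 * 1 * 0 + -a₁ / a₂ * 1 * 1 ^ 2)
        + ψ 2 * ((-a₁ / a₂) ^ 2 * 0 ^ 2 + 4 * 1 * (-a₁ / a₂) * 0 * 1 + 1 ^ 2 * 1 ^ 2)
        + 2 * ψ 1 * (1 * (-a₁ / a₂) * 0 ^ 2 + 1 ^ 2 * 0 * 1) + ψ 0 * 1 ^ 2 * 0 ^ 2
        = (p * a₂ ^ 2 - q * a₁ * a₂ + r * a₁ ^ 2) / 6 := by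
      rw [h0, e1, e2, e3, h4]; field_simp; ring
    rw [this]
    exact div_ne_zero hr (by norm_num)

/-- The function `rootFun` moves the repeated root to zero. -/
theorem RootType.rootAtZero {t : PetrovType} {ε : ℝ} (hε : ε = 1 ∨ ε = -1) {ψ : Fin 5 → ℝ}
    (h : RootType ψ t) (hd : ψ ∈ rootDom t ε) :
    RootAtZero t (quarticAct ψ 1 (rootFun t ε ψ) 0 1) := by
  cases t with
  | IIr => exact h.oneDouble_real.rootAtZero hd
  | IIc => exact h.oneDouble_complex.rootAtZero hd
  | N =>
    obtain ⟨k, a, hk, ha, H⟩ := h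
    obtain ⟨h0, h1, h2, h3, h4⟩ := quartic_coeff (ψ := ψ) (a₀ := k * a.1 ^ 4)
      (a₁ := 4 * k * a.1 ^ 3 * a.2) (a₂ := 6 * k * a.1 ^ 2 * a.2 ^ 2) (a₃ := 4 * k * a.1 * a.2 ^ 3)
      (a₄ := k * a.2 ^ 4) fun x y => by rw [H]; simp only [lin]; ring
    have hd' : ψ 4 ≠ 0 := hd
    have ha2 : a.2 ≠ 0 := by intro h; apply hd'; rw [h4, h]; ring
    have e1 : ψ 1 = k * a.1 ^ 3 * a.2 := by linarith
    have e2 : ψ 2 = k * a.1 ^ 2 * a.2 ^ 2 := by linarith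
    have e3 : ψ 3 = k * a.1 * a.2 ^ 3 := by linarith
    have hρ : rootFun .N ε ψ = - a.1 / a.2 := by
      show - ψ 3 / ψ 4 = _
      rw [e3, h4]; field_simp
    rw [hρ]
    simp only [RootAtZero, quarticAct, Matrix.cons_val]
    rw [h0, e1, e2, e3, h4]
    refine ⟨?_, ?_, ?_, ?_, ?_⟩
    · field_simp; ring
    · field_simp; ring
    · field_simp; ring
    · field_simp; ring
    · simpa using ⟨hk, ha2⟩
  | III =>
    obtain ⟨a, b, hab, H⟩ := h
    obtain ⟨h0, h1, h2, h3, h4⟩ := quartic_coeff (ψ := ψ) (a₀ := a.1 ^ 3 * b.1)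
      (a₁ := a.1 ^ 3 * b.2 + 3 * a.1 ^ 2 * a.2 * b.1)
      (a₂ := 3 * a.1 ^ 2 * a.2 * b.2 + 3 * a.1 * a.2 ^ 2 * b.1)
      (a₃ := 3 * a.1 * a.2 ^ 2 * b.2 + a.2 ^ 3 * b.1)
      (a₄ := a.2 ^ 3 * b.2) fun x y => by rw [H]; simp only [lin]; ring
    have e1 : ψ 1 = (a.1 ^ 3 * b.2 + 3 * a.1 ^ 2 * a.2 * b.1) / 4 := by linarith
    have e2 : ψ 2 = (a.1 ^ 2 * a.2 * b.2 + a.1 * a.2 ^ 2 * b.1) / 2 := by linarith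
    have e3 : ψ 3 = (3 * a.1 * a.2 ^ 2 * b.2 + a.2 ^ 3 * b.1) / 4 := by linarith
    -- The Hessian of a quartic with a triple root is a multiple of the fourth power of the repeated
    -- factor, so two of its coefficients determine the root.
    have c1 : ψ 2 * ψ 4 - ψ 3 ^ 2 = - (a.1 * b.2 - a.2 * b.1) ^ 2 / 16 * a.2 ^ 4 := by
      rw [e2, e3, h4]; ring
    have c2 : ψ 1 * ψ 4 - ψ 2 * ψ 3 = - (a.1 * b.2 - a.2 * b.1) ^ 2 / 8 * (a.1 * a.2 ^ 3) := by
      rw [e1, e2, e3, h4]; ring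
    have hd' : ψ 2 * ψ 4 - ψ 3 ^ 2 ≠ 0 := hd
    have ha2 : a.2 ≠ 0 := by intro h; apply hd'; rw [c1, h]; ring
    have hab' : a.1 * b.2 - a.2 * b.1 ≠ 0 := hab
    have hρ : rootFun .III ε ψ = - a.1 / a.2 := by
      show -(ψ 1 * ψ 4 - ψ 2 * ψ 3) / (2 * (ψ 2 * ψ 4 - ψ 3 ^ 2)) = _
      rw [div_eq_div_iff (mul_ne_zero two_ne_zero hd') ha2, c1, c2]
      ring
    rw [hρ]
    simp only [RootAtZero, quarticAct, Matrix.cons_val]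
    refine ⟨?_, ?_, ?_, ?_⟩
    · rw [h0, e1, e2, e3, h4]; field_simp; ring
    · rw [h0, e1, e2, e3, h4]; field_simp; ring
    · rw [h0, e1, e2, e3, h4]; field_simp; ring
    · have : ψ 4 * (-a.1 / a.2) * 1 ^ 3 + ψ 3 * (1 ^ 3 * 1 + 3 * 1 ^ 2 * 0 * (-a.1 / a.2))
          + 3 * ψ 2 * (1 ^ 2 * 0 * 1 + 1 * 0 ^ 2 * (-a.1 / a.2))
          + ψ 1 * (0 ^ 3 * (-a.1 / a.2) + 3 * 0 ^ 2 * 1 * 1) + ψ 0 * 0 ^ 3 * 1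
          = - (a.2 ^ 2 * (a.1 * b.2 - a.2 * b.1)) / 4 := by
        rw [h0, e1, e2, e3, h4]; field_simp; ring
      rw [this]
      exact div_ne_zero (neg_ne_zero.2 (mul_ne_zero (pow_ne_zero 2 ha2) hab')) (by norm_num)
  | D =>
    obtain ⟨k, a, b, hk, hab, H⟩ := h
    obtain ⟨h1, h2, h3, h4⟩ := hd
    -- The quartic is `k (Ax² + Bxy + Cy²)²`. The task is to express a root of the quadratic form
    -- smoothly through the coefficients of its square.
    obtain ⟨A, hA⟩ : ∃ A, A = a.1 * b.1 := ⟨_, rfl⟩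
    obtain ⟨B, hB⟩ : ∃ B, B = a.1 * b.2 + a.2 * b.1 := ⟨_, rfl⟩
    obtain ⟨C, hC⟩ : ∃ C, C = a.2 * b.2 := ⟨_, rfl⟩
    obtain ⟨s0, s1, s2, s3, s4⟩ := quartic_coeff (ψ := ψ) (a₀ := k * A ^ 2)
      (a₁ := 2 * k * A * B) (a₂ := k * (B ^ 2 + 2 * A * C)) (a₃ := 2 * k * B * C)
      (a₄ := k * C ^ 2) fun x y => by rw [H]; simp only [lin, hA, hB, hC]; ring
    have hdisc : 0 < B ^ 2 - 4 * A * C := by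
      have : B ^ 2 - 4 * A * C = (a.1 * b.2 - a.2 * b.1) ^ 2 := by rw [hA, hB, hC]; ring
      rw [this]; exact sq_pos_of_ne_zero hab
    have e1 : ψ 1 = k * A * B / 2 := by linarith
    have e2 : ψ 2 = k * (B ^ 2 + 2 * A * C) / 6 := by linarith
    have e3 : ψ 3 = k * B * C / 2 := by linarith
    have hε2 : ε * ε = 1 := by rcases hε with rfl | rfl <;> norm_num
    have hk2 : 0 < k ^ 2 := sq_pos_of_ne_zero hk
    -- The condition `Ψ₀Ψ₄ < Ψ₂²` keeps the quadratic form near `Bxy`: it forces `B ≠ 0` and `εk >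
    -- 0`, and thereby fixes the branch of each square root below.
    have hAC : (6 * (A * C)) ^ 2 < (B ^ 2 + 2 * A * C) ^ 2 := by
      rw [s0, s4, e2] at h2
      have : k ^ 2 * ((6 * (A * C)) ^ 2) < k ^ 2 * (B ^ 2 + 2 * A * C) ^ 2 := by linarith
      exact lt_of_mul_lt_mul_left this hk2.le
    have hpos : 0 < B ^ 2 + 2 * A * C := by
      by_contra! hn
      have h5 := abs_lt_of_sq_lt_sq' (by rwa [← neg_sq (B ^ 2 + 2 * A * C)] at hAC) (by linarith)
      nlinarith [sq_nonneg B]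
    have h5 := abs_lt_of_sq_lt_sq' hAC hpos.le
    have hB2 : 0 < B ^ 2 := by nlinarith [sq_nonneg B]
    have hB0 : B ≠ 0 := by rintro rfl; simp at hB2
    obtain ⟨κ, hκ⟩ : ∃ κ, κ = ε * k := ⟨_, rfl⟩
    have hκ0 : 0 < κ := by
      rw [e2] at h1
      have : 0 < κ * (B ^ 2 + 2 * A * C) := by rw [hκ]; linarith
      exact (pos_iff_pos_of_mul_pos this).2 hpos
    have hsq : √(radD ψ) = κ * (B ^ 2 - 2 * A * C) / 2 := by
      rw [Real.sqrt_eq_iff_mul_self_eq h3.le]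
      · rw [radD, e1, e2, e3, hκ]
        linear_combination (-k ^ 2 * (B ^ 2 - 2 * A * C) ^ 2 / 4) * hε2
      · have : 0 < B ^ 2 - 2 * A * C := by nlinarith
        positivity
    have hmid : midD ε ψ = κ * B ^ 2 := by
      rw [midD, hsq, e2, hκ]; ring
    obtain ⟨w, hw⟩ : ∃ w, w = √(1 - 16 * ψ 1 * ψ 3 / midD ε ψ ^ 2) := ⟨_, rfl⟩
    have hw0 : 0 ≤ w := hw ▸ Real.sqrt_nonneg _
    have hw2 : w ^ 2 = 1 - 4 * A * C / B ^ 2 := by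
      have : 1 - 16 * ψ 1 * ψ 3 / midD ε ψ ^ 2 = 1 - 4 * A * C / B ^ 2 := by
        have hk' : k ^ 2 = κ ^ 2 := by rw [hκ]; linear_combination - k ^ 2 * hε2
        rw [hmid, e1, e3]
        field_simp
        linear_combination - 16 * A * C * hk'
      rw [hw, this, Real.sq_sqrt]
      rw [sub_nonneg, div_le_one hB2]; linarith
    have hw2' : w ^ 2 * B ^ 2 = B ^ 2 - 4 * A * C := by
      rw [hw2]; field_simp
    obtain ⟨ρ, hρ⟩ : ∃ ρ, ρ = rootFun .D ε ψ := ⟨_, rfl⟩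
    -- The quadratic formula with rationalized numerator. It picks the root that is zero when `A =
    -- 0`, and its denominator cannot vanish because `w ≥ 0`.
    have hρB : ρ * (B * (1 + w)) = -(2 * A) := by
      rw [hρ, rootFun, ← hw, hmid, e1]
      have hεk : ε * k = κ := hκ.symm
      field_simp
      linear_combination (-4 * A) * hεk
    have hroot : A + B * ρ + C * ρ ^ 2 = 0 := by
      have hne : (B * (1 + w)) ^ 2 ≠ 0 := by positivity
      have : (A + B * ρ + C * ρ ^ 2) * (B * (1 + w)) ^ 2 = 0 := by
        have e : (A + B * ρ + C * ρ ^ 2) * (B * (1 + w)) ^ 2 = A * (B * (1 + w)) ^ 2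
          + B * (ρ * (B * (1 + w))) * (B * (1 + w)) + C * (ρ * (B * (1 + w))) ^ 2 := by ring
        rw [e, hρB]
        linear_combination A * hw2'
      exact (mul_eq_zero.1 this).resolve_right hne
    rw [← hρ]
    simp only [RootAtZero, quarticAct, Matrix.cons_val]
    rw [s0, e1, e2, e3, s4]
    have hAr : A = - (B * ρ + C * ρ ^ 2) := by linarith
    refine ⟨?_, ?_, ?_⟩
    · rw [hAr]; ring
    · rw [hAr]; ring
    · have : k * C ^ 2 * ρ ^ 2 * 1 ^ 2 + 2 * (k * B * C / 2) * (ρ ^ 2 * 1 * 0 + ρ * 1 * 1 ^ 2)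
          + k * (B ^ 2 + 2 * A * C) / 6 * (ρ ^ 2 * 0 ^ 2 + 4 * 1 * ρ * 0 * 1 + 1 ^ 2 * 1 ^ 2)
          + 2 * (k * A * B / 2) * (1 * ρ * 0 ^ 2 + 1 ^ 2 * 0 * 1) + k * A ^ 2 * 1 ^ 2 * 0 ^ 2
          = k * (B ^ 2 - 4 * A * C) / 6 := by rw [hAr]; ring
      rw [this]
      exact div_ne_zero (mul_ne_zero hk hdisc.ne') (by norm_num)

/-- A suitable frame brings a quartic into the domain of `rootFun`. -/
theorem RootType.exists_mem_rootDom {t : PetrovType} {ψ : Fin 5 → ℝ} (h : RootType ψ t) :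
    ∃ p q r s ε : ℝ, p * s - q * r = 1 ∧ (ε = 1 ∨ ε = -1) ∧
      quarticAct ψ p q r s ∈ rootDom t ε := by
  -- A substitution of determinant one that turns `a₁x + a₂y` into `y`: its first row is the root
  -- `(a₂, -a₁)` and its second row is a point where the form takes the value one.
  have key : ∀ a₁ a₂ : ℝ, (a₁ ≠ 0 ∨ a₂ ≠ 0) →
      a₂ * (a₂ / (a₁ ^ 2 + a₂ ^ 2)) - (-a₁) * (a₁ / (a₁ ^ 2 + a₂ ^ 2)) = 1 := by
    intro a₁ a₂ h
    have : a₁ ^ 2 + a₂ ^ 2 ≠ 0 := by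
      rcases h with h | h
      · have := sq_pos_of_ne_zero h; positivity
      · have := sq_pos_of_ne_zero h; positivity
    field_simp
    ring
  have dbl : OneDouble ψ → ∃ p q r s ε : ℝ, p * s - q * r = 1 ∧ (ε = 1 ∨ ε = -1) ∧
      (dblCov (quarticAct ψ p q r s)).1 ≠ 0 := by
    rintro ⟨a₁, a₂, l, m, n, ha, hd, hr, h0, h1, h2, h3, h4⟩
    obtain ⟨u, hu⟩ : ∃ u, u = a₁ / (a₁ ^ 2 + a₂ ^ 2) := ⟨_, rfl⟩
    obtain ⟨v, hv⟩ : ∃ v, v = a₂ / (a₁ ^ 2 + a₂ ^ 2) := ⟨_, rfl⟩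
    have hk := key a₁ a₂ ha
    rw [← hu, ← hv] at hk
    refine ⟨a₂, -a₁, u, v, 1, hk, Or.inl rfl, ?_⟩
    have hQ : ∀ x y, quartic (quarticAct ψ a₂ (-a₁) u v) x y
        = y ^ 2 * ((l * a₂ ^ 2 - m * a₁ * a₂ + n * a₁ ^ 2) * x ^ 2
          + (2 * l * a₂ * u + m * (a₂ * v - a₁ * u) - 2 * n * a₁ * v) * x * y
          + (l * u ^ 2 + m * u * v + n * v ^ 2) * y ^ 2) := by
      intro x y
      have hq : ∀ x y, quartic ψ x y = (a₁ * x + a₂ * y) ^ 2 * (l * x ^ 2 + m * x * y + n * y ^ 2) := by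
        intro x y
        unfold quartic
        linear_combination y ^ 4 * h4 + y ^ 3 * x * h3 + y ^ 2 * x ^ 2 * h2 + y * x ^ 3 * h1
          + x ^ 4 * h0
      rw [quartic_quarticAct, hq]
      have : a₁ * (x * a₂ + y * u) + a₂ * (x * -a₁ + y * v) = y := by linear_combination y * hk
      rw [this]
      ring
    obtain ⟨c0, c1, c2, c3, c4⟩ := quartic_coeff (a₀ := 0) (a₁ := 0)
      (a₂ := l * a₂ ^ 2 - m * a₁ * a₂ + n * a₁ ^ 2)
      (a₃ := 2 * l * a₂ * u + m * (a₂ * v - a₁ * u) - 2 * n * a₁ * v)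
      (a₄ := l * u ^ 2 + m * u * v + n * v ^ 2) fun x y => (hQ x y).trans (by ring)
    have := (OneDouble.dblCov (ψ := quarticAct ψ a₂ (-a₁) u v) (a₁ := 0) (a₂ := 1)
      (p := l * a₂ ^ 2 - m * a₁ * a₂ + n * a₁ ^ 2)
      (q := 2 * l * a₂ * u + m * (a₂ * v - a₁ * u) - 2 * n * a₁ * v)
      (r := l * u ^ 2 + m * u * v + n * v ^ 2)
      (by linarith) (by linarith) (by linarith) (by linarith) (by linarith)).1
    rw [this]
    have hdisc : (2 * l * a₂ * u + m * (a₂ * v - a₁ * u) - 2 * n * a₁ * v) ^ 2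
        - 4 * (l * a₂ ^ 2 - m * a₁ * a₂ + n * a₁ ^ 2) * (l * u ^ 2 + m * u * v + n * v ^ 2)
        = (m ^ 2 - 4 * l * n) * (a₂ * v - -a₁ * u) ^ 2 := by ring
    rw [hdisc, hk]
    simp [hd, hr]
  cases t with
  | IIr => exact dbl h.oneDouble_real
  | IIc => exact dbl h.oneDouble_complex
  | N =>
    obtain ⟨k, a, hk, ha, H⟩ := h
    have ha' : a.1 ≠ 0 ∨ a.2 ≠ 0 := by
      by_contra! h0
      exact ha (Prod.ext h0.1 h0.2)
    have hk1 := key a.1 a.2 ha'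
    refine ⟨_, _, _, _, 1, hk1, Or.inl rfl, ?_⟩
    show quarticAct ψ _ _ _ _ 4 ≠ 0
    have h1 : quarticAct ψ a.2 (-a.1) (a.1 / (a.1 ^ 2 + a.2 ^ 2)) (a.2 / (a.1 ^ 2 + a.2 ^ 2)) 4
        = quartic ψ (a.1 / (a.1 ^ 2 + a.2 ^ 2)) (a.2 / (a.1 ^ 2 + a.2 ^ 2)) := by
      simp only [quarticAct, quartic, Matrix.cons_val]
    have h2 : lin a (a.1 / (a.1 ^ 2 + a.2 ^ 2)) (a.2 / (a.1 ^ 2 + a.2 ^ 2)) = 1 := by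
      unfold lin; linear_combination hk1
    rw [h1, H, h2]
    simpa using hk
  | III =>
    obtain ⟨a, b, hab, H⟩ := h
    have ha' : a.1 ≠ 0 ∨ a.2 ≠ 0 := by
      by_contra! h0
      exact hab (by rw [h0.1, h0.2]; ring)
    have hk1 := key a.1 a.2 ha'
    refine ⟨_, _, _, _, 1, hk1, Or.inl rfl, ?_⟩
    obtain ⟨u, hu⟩ : ∃ u, u = a.1 / (a.1 ^ 2 + a.2 ^ 2) := ⟨_, rfl⟩
    obtain ⟨v, hv⟩ : ∃ v, v = a.2 / (a.1 ^ 2 + a.2 ^ 2) := ⟨_, rfl⟩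
    rw [← hu, ← hv] at hk1 ⊢
    obtain ⟨c0, c1, c2, c3, c4⟩ := quartic_coeff (ψ := quarticAct ψ a.2 (-a.1) u v) (a₀ := 0)
      (a₁ := 0) (a₂ := 0) (a₃ := b.1 * a.2 - b.2 * a.1) (a₄ := b.1 * u + b.2 * v) fun x y => by
        rw [quartic_quarticAct, H]
        have : lin a (x * a.2 + y * u) (x * -a.1 + y * v) = y := by
          unfold lin; linear_combination y * hk1
        rw [this]
        unfold lin
        ring
    show _ ≠ _
    have e2 : quarticAct ψ a.2 (-a.1) u v 2 = 0 := by linarith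
    have e3 : quarticAct ψ a.2 (-a.1) u v 3 = - (a.1 * b.2 - a.2 * b.1) / 4 := by linarith
    have hab' : a.1 * b.2 - a.2 * b.1 ≠ 0 := hab
    rw [e2, e3]
    have := sq_pos_of_ne_zero hab'
    intro h0
    linarith
  | D =>
    obtain ⟨k, a, b, hk, hab, H⟩ := h
    have hab' : a.1 * b.2 - a.2 * b.1 ≠ 0 := hab
    obtain ⟨ε, hε, hεk⟩ : ∃ ε : ℝ, (ε = 1 ∨ ε = -1) ∧ 0 < ε * k := by
      rcases lt_or_gt_of_ne hk with h | h
      · exact ⟨-1, Or.inr rfl, by linarith⟩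
      · exact ⟨1, Or.inl rfl, by linarith⟩
    obtain ⟨j, hj⟩ : ∃ j, j = (a.1 * b.2 - a.2 * b.1)⁻¹ := ⟨_, rfl⟩
    have hj1 : j * (a.1 * b.2 - a.2 * b.1) = 1 := by rw [hj]; exact inv_mul_cancel₀ hab'
    -- Both double roots go to the coordinate axes and the quartic becomes a multiple of `x²y²`; `ε`
    -- is the sign of that multiple.
    refine ⟨a.2 * j, - a.1 * j, b.2, - b.1, ε, by linear_combination hj1, hε, ?_⟩
    obtain ⟨c0, c1, c2, c3, c4⟩ := quartic_coeff (ψ := quarticAct ψ (a.2 * j) (- a.1 * j) b.2 (- b.1))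
      (a₀ := 0) (a₁ := 0) (a₂ := k * (a.1 * b.2 - a.2 * b.1) ^ 2) (a₃ := 0) (a₄ := 0) fun x y => by
        rw [quartic_quarticAct, H]
        have e1 : lin a (x * (a.2 * j) + y * b.2) (x * (- a.1 * j) + y * - b.1)
            = y * (a.1 * b.2 - a.2 * b.1) := by unfold lin; ring
        have e2 : lin b (x * (a.2 * j) + y * b.2) (x * (- a.1 * j) + y * - b.1) = - x := by
          unfold lin; linear_combination - x * hj1
        rw [e1, e2]; ring
    have e2 : 0 < ε * quarticAct ψ (a.2 * j) (- a.1 * j) b.2 (- b.1) 2 := by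
      have : 0 < ε * k * (a.1 * b.2 - a.2 * b.1) ^ 2 := mul_pos hεk (sq_pos_of_ne_zero hab')
      rw [mul_assoc, ← c2] at this
      linarith
    have e1 : quarticAct ψ (a.2 * j) (- a.1 * j) b.2 (- b.1) 1 = 0 := by linarith
    have hne : quarticAct ψ (a.2 * j) (- a.1 * j) b.2 (- b.1) 2 ≠ 0 := right_ne_zero_of_mul e2.ne'
    generalize quarticAct ψ (a.2 * j) (- a.1 * j) b.2 (- b.1) = φ at *
    have hφ := sq_pos_of_ne_zero hne
    have hm : 0 < midD ε φ := by
      unfold midD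
      have := Real.sqrt_nonneg (radD φ)
      linarith
    refine ⟨e2, ?_, ?_, ?_⟩
    · rw [c0, zero_mul]; exact hφ
    · unfold radD; rw [e1]; linarith
    · rw [e1]; simpa using pow_pos hm 2

/-- Otherwise only `Ψ₂` could survive, the quartic would be a multiple of `x²y²`, and the covariant
of the double root would vanish, though for exactly one double root it is a nonzero multiple of a
fourth power. -/
theorem OneDouble.ne_zero {ψ : Fin 5 → ℝ} (h : OneDouble ψ) (h0 : ψ 0 = 0) (h1 : ψ 1 = 0)
    (h3 : ψ 3 = 0) : ψ 4 ≠ 0 := by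
  intro h4
  obtain ⟨a₁, a₂, p, q, r, ha, hd, hr, e0, e1, e2, e3, e4⟩ := h
  obtain ⟨c1, -, c2⟩ := OneDouble.dblCov e0 e1 e2 e3 e4
  simp [PKE.dblCov, h0, h1, h3, h4, hd, hr] at c1 c2
  rcases ha with h | h
  · exact h c2
  · exact h c1

/-- A change of frame between two normalized quartics with one double root is diagonal. -/
theorem OneDouble.unique {ψ : Fin 5 → ℝ} (h : OneDouble ψ) (h0 : ψ 0 = 0) (h1 : ψ 1 = 0)
    (h2 : ψ 2 ≠ 0) (h3 : ψ 3 = 0) {p q r s : ℝ} (hD : p * s - q * r ≠ 0)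
    (k0 : quarticAct ψ p q r s 0 = 0) (k1 : quarticAct ψ p q r s 1 = 0)
    (k3 : quarticAct ψ p q r s 3 = 0) : q = 0 ∧ r = 0 := by
  have h4 := h.ne_zero h0 h1 h3
  simp only [quarticAct, Matrix.cons_val, h0, h1, h3] at k0 k1 k3
  have hq : q = 0 := by
    by_contra hq
    have e1 : q ^ 2 * (ψ 4 * q ^ 2 + 6 * ψ 2 * p ^ 2) = 0 := by linear_combination k0
    have e2 := (mul_eq_zero.1 e1).resolve_left (pow_ne_zero 2 hq)
    have e3 : (3 * q * ψ 2 * (p * s - q * r)) * p = 0 := by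
      linear_combination s * q * e2 - k1
    have hp : p = 0 := (mul_eq_zero.1 e3).resolve_left
      (mul_ne_zero (mul_ne_zero (mul_ne_zero three_ne_zero hq) h2) hD)
    rw [hp] at e2
    have e4 : ψ 4 * q ^ 2 = 0 := by linear_combination e2
    exact (mul_ne_zero h4 (pow_ne_zero 2 hq)) e4
  subst hq
  refine ⟨rfl, ?_⟩
  have hp : p * s ≠ 0 := by simpa using hD
  have e : (3 * ψ 2 * s * (p * s)) * r = 0 := by linear_combination k3
  exact (mul_eq_zero.1 e).resolve_left
    (mul_ne_zero (mul_ne_zero (mul_ne_zero three_ne_zero h2) (right_ne_zero_of_mul hp)) hp)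

/-- A change of frame between two normalized quartics with a triple root is diagonal. -/
theorem triple_unique {ψ : Fin 5 → ℝ} (h0 : ψ 0 = 0) (h1 : ψ 1 = 0) (h2 : ψ 2 = 0) (h3 : ψ 3 ≠ 0)
    (h4 : ψ 4 = 0) {p q r s : ℝ} (hD : p * s - q * r ≠ 0) (k0 : quarticAct ψ p q r s 0 = 0)
    (k1 : quarticAct ψ p q r s 1 = 0) (k4 : quarticAct ψ p q r s 4 = 0) : q = 0 ∧ r = 0 := by
  simp only [quarticAct, Matrix.cons_val, h0, h1, h2, h4] at k0 k1 k4
  have hq : q = 0 := by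
    by_contra hq
    have e1 : (ψ 3 * q ^ 3) * p = 0 := by linear_combination k0 / 4
    have hp : p = 0 := (mul_eq_zero.1 e1).resolve_left (mul_ne_zero h3 (pow_ne_zero 3 hq))
    subst hp
    have e2 : (ψ 3 * q ^ 3) * r = 0 := by linear_combination k1
    have hr : r = 0 := (mul_eq_zero.1 e2).resolve_left (mul_ne_zero h3 (pow_ne_zero 3 hq))
    exact hD (by rw [hr]; ring)
  subst hq
  refine ⟨rfl, ?_⟩
  have hp : p * s ≠ 0 := by simpa using hD
  have e : (ψ 3 * s ^ 3) * r = 0 := by linear_combination k4 / 4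
  exact (mul_eq_zero.1 e).resolve_left (mul_ne_zero h3 (pow_ne_zero 3 (right_ne_zero_of_mul hp)))

end Normalization

/-! ### Leibniz rules for multiples of one-forms -/

section ConstSmul

variable {E : Type} [NormedAddCommGroup E] [NormedSpace ℝ E] [FiniteDimensional ℝ E]
  {N : Type u} [TopologicalSpace N] [ChartedSpace E N] [IsManifold 𝓘(ℝ, E) ∞ N]

theorem SmoothFormAt.const_smul {β : N → E →L[ℝ] ℝ} {q : N} (hβ : SmoothFormAt β q) (k : ℝ) :
    SmoothFormAt (fun x => k • β x) q := SmoothFormAt.smul contMDiffAt_const hβ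

theorem xD_const_smul {β : N → E →L[ℝ] ℝ} {q : N} (hβ : SmoothFormAt β q) (k : ℝ) (v w : E) :
    xD (fun x => k • β x) q v w = k * xD β q v w := by
  have h1 : SmoothAt E (fun _ : N => k) q := contMDiffAt_const
  have h2 := xD_smul h1 hβ v w
  have h3 : dForm E (fun _ : N => k) = fun _ => 0 :=
    funext fun x => by unfold dForm; exact mder_const (E := E) (E' := ℝ) k x
  rw [h3] at h2
  rw [h2]
  simp [wdg]

theorem dWdg_smul_left {f : N → ℝ} {β γ : N → E →L[ℝ] ℝ} {q : N} (hf : SmoothAt E f q)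
    (hβ : SmoothFormAt β q) (u v w : E) :
    dWdg (fun x => f x • β x) γ q u v w = wdg (dForm E f) β q u v * γ q w
      + wdg (dForm E f) β q v w * γ q u + wdg (dForm E f) β q w u * γ q v
      + f q * dWdg β γ q u v w := by
  simp only [dWdg, xD_smul hf hβ, _root_.smul_apply, smul_eq_mul]
  ring

theorem dWdg_const_smul_left {β γ : N → E →L[ℝ] ℝ} {q : N} (k : ℝ)
    (hβ : SmoothFormAt β q) (u v w : E) :
    dWdg (fun x => k • β x) γ q u v w = k * dWdg β γ q u v w := by
  simp only [dWdg, xD_const_smul hβ, _root_.smul_apply, smul_eq_mul]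
  ring

end ConstSmul

/-! ### Consequences of `d² = 0` for the second structure equations -/

section Bianchi

variable {M : Type u} [TopologicalSpace M] [ChartedSpace E4 M] [IsManifold (𝓡 4) ∞ M]
  {g : BilinField M} {K : EndField M} {e : CoframeField M} {V : Set M} {c : ℝ}
  {γ : Fin 2 → Fin 2 → M → E4 →L[ℝ] ℝ}

/-- The second Bianchi identities are obtained as `d² = 0` for single connection forms, here for
`Γ²₁` and in the next two lemmas for `Γ²₂` and `Γ¹₂`. They are left as sums of derivatives of wedge
products, ready for evaluation on frame vectors. -/
theorem LocalStructure.d_conn₁₀ (L : LocalStructure g K c e γ V)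
    (h0 : ∀ q ∈ V, psi g (toCoframe e q) 0 = 0) (h1 : ∀ q ∈ V, psi g (toCoframe e q) 1 = 0)
    {q : M} (hq : q ∈ V) (u v w : E4) :
    dWdg (γ 0 0) (γ 1 0) q u v w + dWdg (γ 1 0) (γ 1 1) q u v w
      + dWdg (fun x => (psi g (toCoframe e x) 2 - c) • frm e 1 x) (frm e 2) q u v w = 0 := by
  have hs : ∀ q ∈ V, SmoothAt E4 (fun x => psi g (toCoframe e x) 2 - c) q :=
    fun q hq => (L.smooth_psi q hq 2).sub contMDiffAt_const
  have := sum_dWdg_eq_zero (s := (Finset.univ : Finset (Fin 3))) (α := γ 1 0)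
    (β := ![γ 0 0, γ 1 0, fun x => (psi g (toCoframe e x) 2 - c) • frm e 1 x])
    (γ := ![γ 1 0, γ 1 1, frm e 2]) L.isOpen (fun q hq => L.smooth_γ q hq 1 0) ?_ ?_ ?_ hq u v w
  · simpa [Fin.sum_univ_three] using this
  · intro i _ q hq
    fin_cases i
    exacts [L.smooth_γ q hq 0 0, L.smooth_γ q hq 1 0, (L.smooth_e q hq 1).smul (hs q hq)]
  · intro i _ q hq
    fin_cases i
    exacts [L.smooth_γ q hq 1 0, L.smooth_γ q hq 1 1, L.smooth_e q hq 2]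
  · intro q hq v w
    rw [(L.second q hq).d10, h0 q hq, h1 q hq]
    simp [Fin.sum_univ_three, wdg]
    ring

theorem LocalStructure.d_conn₁₁ (L : LocalStructure g K c e γ V)
    (h1 : ∀ q ∈ V, psi g (toCoframe e q) 1 = 0) (h2 : ∀ q ∈ V, psi g (toCoframe e q) 2 = 0)
    (h3 : ∀ q ∈ V, psi g (toCoframe e q) 3 = 0) {q : M} (hq : q ∈ V) (u v w : E4) :
    dWdg (γ 0 1) (γ 1 0) q u v w + dWdg (fun x => (-c) • frm e 0 x) (frm e 2) q u v w
      + dWdg (fun x => (-2 * c) • frm e 1 x) (frm e 3) q u v w = 0 := by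
  have := sum_dWdg_eq_zero (s := (Finset.univ : Finset (Fin 3))) (α := γ 1 1)
    (β := ![γ 0 1, fun x => (-c) • frm e 0 x, fun x => (-2 * c) • frm e 1 x])
    (γ := ![γ 1 0, frm e 2, frm e 3]) L.isOpen (fun q hq => L.smooth_γ q hq 1 1) ?_ ?_ ?_ hq u v w
  · simpa [Fin.sum_univ_three] using this
  · intro i _ q hq
    fin_cases i
    exacts [L.smooth_γ q hq 0 1, (L.smooth_e q hq 0).const_smul _, (L.smooth_e q hq 1).const_smul _]
  · intro i _ q hq
    fin_cases i
    exacts [L.smooth_γ q hq 1 0, L.smooth_e q hq 2, L.smooth_e q hq 3]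
  · intro q hq v w
    rw [(L.second q hq).d11, h1 q hq, h2 q hq, h3 q hq]
    simp [Fin.sum_univ_three, wdg]
    ring

theorem LocalStructure.d_conn₀₁ (L : LocalStructure g K c e γ V)
    (h2 : ∀ q ∈ V, psi g (toCoframe e q) 2 = 0)
    (h3 : ∀ q ∈ V, psi g (toCoframe e q) 3 = 0) {q : M} (hq : q ∈ V) (u v w : E4) :
    dWdg (fun x => (-1 : ℝ) • γ 0 0 x) (γ 0 1) q u v w
      + dWdg (fun x => (-1 : ℝ) • γ 0 1 x) (γ 1 1) q u v w
      + dWdg (fun x => (-c) • frm e 0 x) (frm e 3) q u v w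
      + dWdg (fun x => psi g (toCoframe e x) 4 • ((-1 : ℝ) • frm e 1 x)) (frm e 2) q u v w = 0 := by
  have := sum_dWdg_eq_zero (s := (Finset.univ : Finset (Fin 4))) (α := γ 0 1)
    (β := ![fun x => (-1 : ℝ) • γ 0 0 x, fun x => (-1 : ℝ) • γ 0 1 x, fun x => (-c) • frm e 0 x,
      fun x => psi g (toCoframe e x) 4 • ((-1 : ℝ) • frm e 1 x)])
    (γ := ![γ 0 1, γ 1 1, frm e 3, frm e 2]) L.isOpen (fun q hq => L.smooth_γ q hq 0 1)
    ?_ ?_ ?_ hq u v w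
  · simpa [Fin.sum_univ_four] using this
  · intro i _ q hq
    fin_cases i
    exacts [(L.smooth_γ q hq 0 0).const_smul _, (L.smooth_γ q hq 0 1).const_smul _,
      (L.smooth_e q hq 0).const_smul _, ((L.smooth_e q hq 1).const_smul _).smul (L.smooth_psi q hq 4)]
  · intro i _ q hq
    fin_cases i
    exacts [L.smooth_γ q hq 0 1, L.smooth_γ q hq 1 1, L.smooth_e q hq 3, L.smooth_e q hq 2]
  · intro q hq v w
    rw [(L.second q hq).d01, h2 q hq, h3 q hq]
    simp [Fin.sum_univ_four, wdg]
    ring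

/-- For a coframe field with the repeated root at zero, `Γ²₁ = J₁ α² + J₂ ᾱ¹`. -/
theorem LocalStructure.reduced {t : PetrovType} (L : LocalStructure g K c e γ V)
    (h : ∀ q ∈ V, RootAtZero t (psi g (toCoframe e q))) {q : M} (hq : q ∈ V) :
    γ 1 0 q (vec e 0 q) = 0 ∧ γ 1 0 q (vec e 3 q) = 0 := by
  have h0 := fun q hq => (h q hq).1
  have h1 := fun q hq => (h q hq).2.1
  have f := L.first q hq
  have s := L.second q hq
  have hs : SmoothAt E4 (fun x => psi g (toCoframe e x) 2 - c) q :=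
    (L.smooth_psi q hq 2).sub contMDiffAt_const
  have B := L.d_conn₁₀ h0 h1 hq
  simp only [dWdg_smul_left hs (L.smooth_e q hq 1)] at B
  simp only [dWdg, f.d0, f.d1, f.d2, f.d3, s.d00, s.d01, s.d10, s.d11, wdg] at B
  -- The form `α² ∧ ᾱ¹` contracts to zero against any form on the first two triples, so the
  -- derivative of `Ψ₂` is absent there and `Ψ₂ Γ²₁` is isolated. The last two triples serve type
  -- III.
  have b1 := B (vec e 0 q) (vec e 2 q) (vec e 3 q)
  have b2 := B (vec e 0 q) (vec e 1 q) (vec e 3 q)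
  have b3 := B (vec e 0 q) (vec e 1 q) (vec e 2 q)
  have b4 := B (vec e 1 q) (vec e 2 q) (vec e 3 q)
  simp [frm_vec, h0 q hq, h1 q hq] at b1 b2 b3 b4
  have dbl : psi g (toCoframe e q) 2 ≠ 0 → γ 1 0 q (vec e 0 q) = 0 ∧ γ 1 0 q (vec e 3 q) = 0 := by
    intro h2
    exact ⟨(mul_eq_zero.1 (show psi g (toCoframe e q) 2 * γ 1 0 q (vec e 0 q) = 0 by
      linarith)).resolve_left h2, (mul_eq_zero.1 (show psi g (toCoframe e q) 2
        * γ 1 0 q (vec e 3 q) = 0 by linarith)).resolve_left h2⟩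
  have h' := (h q hq).2.2
  cases t with
  | IIr => exact dbl h'
  | IIc => exact dbl h'
  | D => exact dbl h'
  | III =>
    have h2 : ∀ q ∈ V, psi g (toCoframe e q) 2 = 0 := fun q hq => (h q hq).2.2.1
    have h3 := h'.2
    -- Since `Ψ₂` vanishes on a whole neighbourhood, its differential drops out and only `Ψ₃ Γ²₁`
    -- remains.
    have hd : dForm E4 (fun x => psi g (toCoframe e x) 2 - c) q = 0 := by
      have e1 : (fun x => psi g (toCoframe e x) 2 - c) =ᶠ[𝓝 q] fun _ => -c := by
        filter_upwards [L.isOpen.mem_nhds hq] with x hx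
        rw [h2 x hx, zero_sub]
      exact (mder_congr e1).trans (mder_const (-c) q)
    simp [hd, h2 q hq] at b3 b4
    exact ⟨(mul_eq_zero.1 (show psi g (toCoframe e q) 3 * γ 1 0 q (vec e 0 q) = 0 by
      linarith)).resolve_left h3, (mul_eq_zero.1 (show psi g (toCoframe e q) 3
        * γ 1 0 q (vec e 3 q) = 0 by linarith)).resolve_left h3⟩
  | N =>
    have h2 : ∀ q ∈ V, psi g (toCoframe e q) 2 = 0 := fun q hq => (h q hq).2.2.1
    have h3 : ∀ q ∈ V, psi g (toCoframe e q) 3 = 0 := fun q hq => (h q hq).2.2.2.1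
    have h4 := h'.2.2
    -- `Ψ₄` occurs only in `dΓ¹₂`, and `Γ¹₂` does not appear linearly in the equation of `Γ²₁` after
    -- substitution. The equation of `Γ²₂` contains `Γ¹₂ ∧ Γ²₁`, whose derivative brings in `Ψ₄
    -- Γ²₁`.
    have B := L.d_conn₁₁ h1 h2 h3 hq
    simp only [dWdg_const_smul_left _ (L.smooth_e q hq _)] at B
    simp only [dWdg, f.d0, f.d1, f.d2, f.d3, s.d00, s.d01, s.d10, s.d11, wdg] at B
    have b1 := B (vec e 0 q) (vec e 1 q) (vec e 2 q)
    have b2 := B (vec e 1 q) (vec e 2 q) (vec e 3 q)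
    simp [frm_vec, h0 q hq, h1 q hq, h2 q hq, h3 q hq] at b1 b2
    exact ⟨(mul_eq_zero.1 (show psi g (toCoframe e q) 4 * γ 1 0 q (vec e 0 q) = 0 by
      linarith)).resolve_left h4, (mul_eq_zero.1 (show psi g (toCoframe e q) 4
        * γ 1 0 q (vec e 3 q) = 0 by linarith)).resolve_left h4⟩

/-- For a quadruple root, `Ψ₄₄ = J₂ Ψ₄`. -/
theorem LocalStructure.psi44_eq (L : LocalStructure g K c e γ V)
    (h : ∀ q ∈ V, RootAtZero .N (psi g (toCoframe e q))) {q : M} (hq : q ∈ V) :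
    psi44 g (toCoframe e q) = γ 1 0 q (vec e 2 q) * psi g (toCoframe e q) 4 := by
  have h0 := fun q hq => (h q hq).1
  have h1 := fun q hq => (h q hq).2.1
  have h2 : ∀ q ∈ V, psi g (toCoframe e q) 2 = 0 := fun q hq => (h q hq).2.2.1
  have h3 : ∀ q ∈ V, psi g (toCoframe e q) 3 = 0 := fun q hq => (h q hq).2.2.2.1
  obtain ⟨r1, r2⟩ := L.reduced h hq
  have f := L.first q hq
  have s := L.second q hq
  have B := L.d_conn₀₁ h2 h3 hq
  simp only [dWdg_smul_left (L.smooth_psi q hq 4) ((L.smooth_e q hq 1).const_smul _)] at B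
  simp only [dWdg_const_smul_left _ (L.smooth_e q hq _),
    dWdg_const_smul_left _ (L.smooth_γ q hq _ _)] at B
  simp only [dWdg, f.d0, f.d1, f.d2, f.d3, s.d00, s.d01, s.d10, s.d11, wdg] at B
  -- On this triple `dΨ₄` enters through its value on the last frame vector, which is what the
  -- covariant derivative `Ψ₄₄` requires.
  have b := B (vec e 1 q) (vec e 2 q) (vec e 3 q)
  simp [frm_vec, h0 q hq, h1 q hq, h2 q hq, h3 q hq, r1, r2] at b
  have hc : psi44 g (toCoframe e q) = _ := L.cov q hq 3
  rw [hc, h3 q hq]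
  linarith

end Bianchi

/-! ### Special linear frame changes and normalized coframe fields -/

section FrameChange

/-- The change of coframes that belongs to the change `e₀' = p e₀ + q e₁`, `e₁' = r e₀ + s e₁` of
the frame. -/
noncomputable def sl2Equiv (p q r s : ℝ) (h : p * s - q * r = 1) :
    (Fin 4 → ℝ) ≃L[ℝ] (Fin 4 → ℝ) :=
  LinearEquiv.toContinuousLinearEquiv
    { toFun := fun v => ![s * v 0 - r * v 1, p * v 1 - q * v 0, p * v 2 + q * v 3,
        r * v 2 + s * v 3]
      map_add' := fun v w => by
        funext a; fin_cases a <;> simp <;> ring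
      map_smul' := fun k v => by
        funext a; fin_cases a <;> simp <;> ring
      invFun := fun v => ![p * v 0 + r * v 1, q * v 0 + s * v 1, s * v 2 - q * v 3,
        p * v 3 - r * v 2]
      left_inv := fun v => by
        funext a
        fin_cases a <;> simp
        · linear_combination v 0 * h
        · linear_combination v 1 * h
        · linear_combination v 2 * h
        · linear_combination v 3 * h
      right_inv := fun v => by
        funext a
        fin_cases a <;> simp
        · linear_combination v 0 * h
        · linear_combination v 1 * h
        · linear_combination v 2 * h
        · linear_combination v 3 * h }

theorem sl2Equiv_apply {p q r s : ℝ} (h : p * s - q * r = 1) (v : Fin 4 → ℝ) :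
    sl2Equiv p q r s h v = ![s * v 0 - r * v 1, p * v 1 - q * v 0, p * v 2 + q * v 3,
      r * v 2 + s * v 3] := rfl

theorem fvec_sl2Equiv (f : E4 ≃L[ℝ] (Fin 4 → ℝ)) {p q r s : ℝ} (h : p * s - q * r = 1) :
    fvec (f.trans (sl2Equiv p q r s h)) 0 = p • fvec f 0 + q • fvec f 1 ∧
    fvec (f.trans (sl2Equiv p q r s h)) 1 = r • fvec f 0 + s • fvec f 1 ∧
    fvec (f.trans (sl2Equiv p q r s h)) 2 = s • fvec f 2 + (-r) • fvec f 3 ∧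
    fvec (f.trans (sl2Equiv p q r s h)) 3 = (-q) • fvec f 2 + p • fvec f 3 := by
  refine ⟨?_, ?_, ?_, ?_⟩ <;>
  · apply (f.trans (sl2Equiv p q r s h)).injective
    funext a
    rw [apply_fvec, ContinuousLinearEquiv.trans_apply, sl2Equiv_apply]
    fin_cases a <;> simp [apply_fvec] <;>
      first | linear_combination h | linear_combination -h | ring

theorem AdaptedAt.trans_sl2Equiv {G : E4 →L[ℝ] E4 →L[ℝ] ℝ} {L : E4 →L[ℝ] E4}
    {f : E4 ≃L[ℝ] (Fin 4 → ℝ)} (hf : AdaptedAt G L f) {p q r s : ℝ} (h : p * s - q * r = 1) :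
    AdaptedAt G L (f.trans (sl2Equiv p q r s h)) := by
  constructor
  · intro v w
    rw [hf.1]
    simp only [ContinuousLinearEquiv.trans_apply, sl2Equiv_apply, Matrix.cons_val]
    linear_combination (-(f v 0 * f w 2 + f v 2 * f w 0 + f v 1 * f w 3 + f v 3 * f w 1)) * h
  · intro v
    simp only [ContinuousLinearEquiv.trans_apply, sl2Equiv_apply, Matrix.cons_val, hf.2]
    funext a
    fin_cases a <;> simp <;> ring

variable {M : Type u} [TopologicalSpace M] [ChartedSpace E4 M] [IsManifold (𝓡 4) ∞ M]
  {g : BilinField M} {K : EndField M} {e : CoframeField M} {V : Set M} {c : ℝ} {t : PetrovType}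

theorem psi_sl2 (h : IsParaKahlerEinstein g K)
    (hc : ∀ θ : Coframe M, Adapted g K θ → psi2' g θ = c) {x : M} {f : E4 ≃L[ℝ] (Fin 4 → ℝ)}
    (hf : AdaptedAt (g x) (K x) f) {p q r s : ℝ} (hD : p * s - q * r = 1) :
    psi g ⟨x, f.trans (sl2Equiv p q r s hD)⟩ = quarticAct (psi g ⟨x, f⟩) p q r s := by
  obtain ⟨h0, h1, h2, h3⟩ := fvec_sl2Equiv f hD
  have := psi_change h hc hf (f' := f.trans (sl2Equiv p q r s hD)) (p := p) (q := q) (r := r)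
    (s := s) (by rw [hD]; exact one_ne_zero) h0 h1 (by rw [hD, div_one, div_one]; exact h2)
    (by rw [hD, div_one, div_one]; exact h3)
  rw [this, hD]
  simp

/-- The change of a coframe field by a function with values in `SL₂`. -/
noncomputable def sl2Field (e : CoframeField M) (p q r s : M → ℝ)
    (h : ∀ x, p x * s x - q x * r x = 1) : CoframeField M := fun x =>
  (e x).trans (sl2Equiv (p x) (q x) (r x) (s x) (h x))

theorem frm_sl2Field (e : CoframeField M) {p q r s : M → ℝ}
    (h : ∀ x, p x * s x - q x * r x = 1) :
    (frm (sl2Field e p q r s h) 0 = fun x => s x • frm e 0 x - r x • frm e 1 x) ∧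
    (frm (sl2Field e p q r s h) 1 = fun x => p x • frm e 1 x - q x • frm e 0 x) ∧
    (frm (sl2Field e p q r s h) 2 = fun x => p x • frm e 2 x + q x • frm e 3 x) ∧
    (frm (sl2Field e p q r s h) 3 = fun x => r x • frm e 2 x + s x • frm e 3 x) :=
  ⟨rfl, rfl, rfl, rfl⟩

theorem IsAdaptedField.sl2Field (he : IsAdaptedField g K e V) {p q r s : M → ℝ}
    (h : ∀ x, p x * s x - q x * r x = 1) (hp : ∀ x ∈ V, SmoothAt E4 p x)
    (hq : ∀ x ∈ V, SmoothAt E4 q x) (hr : ∀ x ∈ V, SmoothAt E4 r x)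
    (hs : ∀ x ∈ V, SmoothAt E4 s x) : IsAdaptedField g K (sl2Field e p q r s h) V := by
  refine ⟨he.isOpen, fun x hx a => ?_, fun x hx => (he.adapted x hx).trans_sl2Equiv (h x)⟩
  obtain ⟨f0, f1, f2, f3⟩ := frm_sl2Field e h
  have S := he.smooth_e x hx
  fin_cases a
  · exact f0 ▸ ((S 0).smul (hs x hx)).sub ((S 1).smul (hr x hx))
  · exact f1 ▸ ((S 1).smul (hp x hx)).sub ((S 0).smul (hq x hx))
  · exact f2 ▸ ((S 2).smul (hp x hx)).add ((S 3).smul (hq x hx))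
  · exact f3 ▸ ((S 2).smul (hr x hx)).add ((S 3).smul (hs x hx))

theorem IsAdaptedField.mono (he : IsAdaptedField g K e V) {U : Set M} (hU : IsOpen U) (h : U ⊆ V) :
    IsAdaptedField g K e U :=
  ⟨hU, fun x hx => he.smooth_e x (h hx), fun x hx => he.adapted x (h hx)⟩

/-- The type is exhibited in one adapted coframe only; any other one differs by `GL₂`, under which
the root type is invariant. -/
theorem HasPetrovType.rootType (h : IsParaKahlerEinstein g K)
    (hc : ∀ θ : Coframe M, Adapted g K θ → psi2' g θ = c) {x : M} (ht : HasPetrovType g K x t)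
    {f : E4 ≃L[ℝ] (Fin 4 → ℝ)} (hf : AdaptedAt (g x) (K x) f) : RootType (psi g ⟨x, f⟩) t := by
  obtain ⟨⟨x', f₀⟩, hx, h₀, hr⟩ := ht
  obtain rfl : x' = x := hx
  have h₀' : AdaptedAt (g x') (K x') f₀ := h₀
  obtain ⟨p, q, r, s, hD, h0, h1, h2, h3⟩ := h₀'.exists_change hf
  rw [psi_change h hc h₀' hD h0 h1 h2 h3]
  exact hr.change hD (inv_ne_zero (pow_ne_zero 2 hD))

theorem mem_F7_iff {θ : Coframe M} :
    θ ∈ F7 g K t ↔ Adapted g K θ ∧ RootAtZero t (psi g θ) := by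
  cases t <;> exact Iff.rfl

theorem SmoothAt.comp_contDiffAt {ψ : M → Fin 5 → ℝ} {x : M} {F : (Fin 5 → ℝ) → ℝ}
    (hF : ContDiffAt ℝ ∞ F (ψ x)) (hψ : ∀ i, SmoothAt E4 (fun y => ψ y i) x) :
    SmoothAt E4 (fun y => F (ψ y)) x :=
  hF.comp_contMDiffAt (contMDiffAt_pi_space.2 hψ)

theorem continuousAt_psi (L : LocalStructure g K c e (conn e) V) {x : M} (hx : x ∈ V) :
    ContinuousAt (fun y => psi g (toCoframe e y)) x :=
  (contMDiffAt_pi_space.2 (L.smooth_psi x hx)).continuousAt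

/-- Around each point there is a smooth field of coframes with the repeated root at zero. -/
theorem exists_field_F7 (h : IsParaKahlerEinstein g K)
    (hc : ∀ θ : Coframe M, Adapted g K θ → psi2' g θ = c) (ht : ∀ p : M, HasPetrovType g K p t)
    (x : M) : ∃ (e : CoframeField M) (V : Set M), IsAdaptedField g K e V ∧ x ∈ V ∧
      ∀ y ∈ V, toCoframe e y ∈ F7 g K t := by
  obtain ⟨⟨x', f₀⟩, hx, h₀, hr⟩ := ht x
  obtain rfl : x' = x := hx
  have h₀' : AdaptedAt (g x') (K x') f₀ := h₀
  obtain ⟨p, q, r, s, ε, hD, hε, hdom⟩ := hr.exists_mem_rootDom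
  -- A constant change of frame first puts the quartic at the given point in the open domain of
  -- `rootFun`. It stays there nearby, and the root function then supplies the varying change of
  -- frame.
  obtain ⟨e, V, he, hx, hex⟩ := exists_adaptedField h (h₀'.trans_sl2Equiv hD)
  have L := he.localStructure h hc
  have hdx : psi g (toCoframe e x') ∈ rootDom t ε := by
    unfold toCoframe
    rw [hex, psi_sl2 h hc h₀' hD]
    exact hdom
  obtain ⟨U, hU, hUo, hxU⟩ := eventually_nhds_iff.1
    (((continuousAt_psi L hx).eventually ((isOpen_rootDom t ε).mem_nhds hdx)).and
      (he.isOpen.mem_nhds hx))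
  have he' := he.mono hUo fun y hy => (hU y hy).2
  have hsm : ∀ y ∈ U, SmoothAt E4 (fun y => rootFun t ε (psi g (toCoframe e y))) y := fun y hy =>
    SmoothAt.comp_contDiffAt (ψ := fun y => psi g (toCoframe e y))
      (contDiffAt_rootFun (hU y hy).1) (L.smooth_psi y (hU y hy).2)
  refine ⟨sl2Field e (fun _ => 1) (fun y => rootFun t ε (psi g (toCoframe e y))) (fun _ => 0)
    (fun _ => 1) (fun _ => by ring), U, he'.sl2Field _ (fun _ _ => contMDiffAt_const) hsm
    (fun _ _ => contMDiffAt_const) (fun _ _ => contMDiffAt_const), hxU, fun y hy => ?_⟩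
  have hy' := he'.adapted y hy
  refine mem_F7_iff.2 ⟨hy'.trans_sl2Equiv _, ?_⟩
  have := (HasPetrovType.rootType h hc (ht y) hy').rootAtZero hε (hU y hy).1
  rwa [← psi_sl2 h hc hy' (by ring)] at this

/-- The shear `e₁' = e₁ + b e₀`. -/
noncomputable def shearField (e : CoframeField M) (b : M → ℝ) : CoframeField M :=
  sl2Field e (fun _ => 1) (fun _ => 0) b (fun _ => 1) (fun _ => by ring)

theorem IsAdaptedField.shearField (he : IsAdaptedField g K e V) {b : M → ℝ}
    (hb : ∀ x ∈ V, SmoothAt E4 b x) : IsAdaptedField g K (shearField e b) V :=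
  he.sl2Field _ (fun _ _ => contMDiffAt_const) (fun _ _ => contMDiffAt_const) hb
    (fun _ _ => contMDiffAt_const)

theorem psi_shearField (h : IsParaKahlerEinstein g K)
    (hc : ∀ θ : Coframe M, Adapted g K θ → psi2' g θ = c) {x : M}
    (he : AdaptedAt (g x) (K x) (e x)) (b : M → ℝ) :
    psi g (toCoframe (PKE.shearField e b) x) = quarticAct (psi g (toCoframe e x)) 1 0 (b x) 1 :=
  psi_sl2 h hc he _

theorem rootAtZero_shear {ψ : Fin 5 → ℝ} (h : RootAtZero t ψ) (b : ℝ) :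
    RootAtZero t (quarticAct ψ 1 0 b 1) := by
  obtain ⟨h0, h1, h2⟩ := h
  cases t <;> simp [RootAtZero, quarticAct, h0, h1] at h2 ⊢
  · exact h2
  · exact h2
  · simp [h2.1, h2.2]
  · exact h2
  · simp [h2.1, h2.2]

/-- The condition on `Ψ` in the further normalization, for the types other than `N`. -/
def Subnormal (t : PetrovType) (ψ : Fin 5 → ℝ) : Prop :=
  match t with
  | .III => ψ 4 = 0
  | _ => ψ 3 = 0

theorem mem_F6_iff {θ : Coframe M} (ht : t ≠ .N) :
    θ ∈ F6 g K t ↔ θ ∈ F7 g K t ∧ Subnormal t (psi g θ) := by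
  cases t
  · exact Iff.rfl
  · exact Iff.rfl
  · exact Iff.rfl
  · exact Iff.rfl
  · exact absurd rfl ht

/-- Around each point there is a smooth field of normalized coframes, unless the type is `N`. -/
theorem exists_field_F6 (h : IsParaKahlerEinstein g K)
    (hc : ∀ θ : Coframe M, Adapted g K θ → psi2' g θ = c) (ht : ∀ p : M, HasPetrovType g K p t)
    (hN : t ≠ .N) (x : M) : ∃ (e : CoframeField M) (V : Set M), IsAdaptedField g K e V ∧ x ∈ V ∧
      ∀ y ∈ V, toCoframe e y ∈ F6 g K t := by
  obtain ⟨e, V, he, hx, hF⟩ := exists_field_F7 h hc ht x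
  have L := he.localStructure h hc
  have hR : ∀ y ∈ V, RootAtZero t (psi g (toCoframe e y)) := fun y hy => (mem_F7_iff.1 (hF y hy)).2
  obtain ⟨b, hb, hb6⟩ : ∃ b : M → ℝ, (∀ y ∈ V, SmoothAt E4 b y) ∧ ∀ y ∈ V,
      Subnormal t (quarticAct (psi g (toCoframe e y)) 1 0 (b y) 1) := by
    have dbl : (∀ y ∈ V, psi g (toCoframe e y) 0 = 0 ∧ psi g (toCoframe e y) 1 = 0 ∧
        psi g (toCoframe e y) 2 ≠ 0) → ∃ b : M → ℝ, (∀ y ∈ V, SmoothAt E4 b y) ∧ ∀ y ∈ V,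
        quarticAct (psi g (toCoframe e y)) 1 0 (b y) 1 3 = 0 := by
      intro H
      -- A shear with parameter `b` adds `3bΨ₂` to `Ψ₃` when `Ψ₀ = Ψ₁ = 0`.
      refine ⟨fun y => - psi g (toCoframe e y) 3 / (3 * psi g (toCoframe e y) 2), fun y hy =>
        SmoothAt.comp_contDiffAt (ψ := fun y => psi g (toCoframe e y))
        (F := fun ψ => - ψ 3 / (3 * ψ 2)) ?_ (L.smooth_psi y hy), fun y hy => ?_⟩
      · have hc := contDiffAt_coord (psi g (toCoframe e y))
        exact ContDiffAt.div (by fun_prop) (by fun_prop) (mul_ne_zero three_ne_zero (H y hy).2.2)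
      · obtain ⟨h0, h1, h2⟩ := H y hy
        simp only [quarticAct, Matrix.cons_val, h0, h1]
        field_simp
        ring
    cases t with
    | IIr => exact dbl hR
    | IIc => exact dbl hR
    | D => exact dbl hR
    | N => exact absurd rfl hN
    | III =>
      -- For a triple root the same shear adds `4bΨ₃` to `Ψ₄`.
      refine ⟨fun y => - psi g (toCoframe e y) 4 / (4 * psi g (toCoframe e y) 3), fun y hy =>
        SmoothAt.comp_contDiffAt (ψ := fun y => psi g (toCoframe e y))
        (F := fun ψ => - ψ 4 / (4 * ψ 3)) ?_ (L.smooth_psi y hy), fun y hy => ?_⟩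
      · have hc := contDiffAt_coord (psi g (toCoframe e y))
        exact ContDiffAt.div (by fun_prop) (by fun_prop) (mul_ne_zero four_ne_zero (hR y hy).2.2.2)
      · obtain ⟨h0, h1, h2, h3⟩ := hR y hy
        simp only [Subnormal, quarticAct, Matrix.cons_val, h0, h1, h2]
        field_simp
        ring
  have he' := he.shearField hb
  refine ⟨shearField e b, V, he', hx, fun y hy => (mem_F6_iff hN).2 ⟨mem_F7_iff.2
    ⟨he'.adapted y hy, ?_⟩, ?_⟩⟩
  · rw [psi_shearField h hc (he.adapted y hy)]
    exact rootAtZero_shear (hR y hy) _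
  · rw [psi_shearField h hc (he.adapted y hy)]
    exact hb6 y hy

/-- Forms `δ` with `δᴬ_B ∧ αᴮ = 0` and `δᴮ_A ∧ ᾱ_B = 0` vanish. -/
theorem connection_unique {E : Type*} [AddCommGroup E] [Module ℝ E] {α : Fin 4 → E →ₗ[ℝ] ℝ}
    {X : Fin 4 → E} (hX : ∀ a b, α a (X b) = if a = b then 1 else 0)
    {δ : Fin 2 → Fin 2 → E →ₗ[ℝ] ℝ}
    (h0 : ∀ v w, δ 0 0 v * α 0 w - δ 0 0 w * α 0 v + (δ 0 1 v * α 1 w - δ 0 1 w * α 1 v) = 0)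
    (h1 : ∀ v w, δ 1 0 v * α 0 w - δ 1 0 w * α 0 v + (δ 1 1 v * α 1 w - δ 1 1 w * α 1 v) = 0)
    (h2 : ∀ v w, δ 0 0 v * α 2 w - δ 0 0 w * α 2 v + (δ 1 0 v * α 3 w - δ 1 0 w * α 3 v) = 0)
    (h3 : ∀ v w, δ 0 1 v * α 2 w - δ 0 1 w * α 2 v + (δ 1 1 v * α 3 w - δ 1 1 w * α 3 v) = 0)
    (A B : Fin 2) : δ A B = 0 := by
  have k0 := fun v => h0 v (X 0)
  have k1 := fun v => h0 v (X 1)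
  have k2 := fun v => h1 v (X 0)
  have k3 := fun v => h1 v (X 1)
  have l0 := fun v => h2 v (X 2)
  have l1 := fun v => h3 v (X 2)
  have l2 := fun v => h2 v (X 3)
  have l3 := fun v => h3 v (X 3)
  simp [hX] at k0 k1 k2 k3 l0 l1 l2 l3
  have m00 := k0 (X 2); have n00 := k0 (X 3); have o00 := l0 (X 0); have p00 := l0 (X 1)
  have m01 := k1 (X 2); have n01 := k1 (X 3); have o01 := l1 (X 0); have p01 := l1 (X 1)
  have m10 := k2 (X 2); have n10 := k2 (X 3); have o10 := l2 (X 0); have p10 := l2 (X 1)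
  have m11 := k3 (X 2); have n11 := k3 (X 3); have o11 := l3 (X 0); have p11 := l3 (X 1)
  simp [hX] at m00 n00 o00 p00 m01 n01 o01 p01 m10 n10 o10 p10 m11 n11 o11 p11
  ext v
  have q0 := k0 v; have q1 := k1 v; have q2 := k2 v; have q3 := k3 v
  simp [m00, n00, o00, p00, m01, n01, o01, p01, m10, n10, o10, p10, m11, n11, o11, p11]
    at q0 q1 q2 q3
  fin_cases A <;> fin_cases B <;> simp [q0, q1, q2, q3]

theorem FirstStructure.unique {γ γ' : Fin 2 → Fin 2 → M → E4 →L[ℝ] ℝ} {q : M}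
    (h : FirstStructure e γ q) (h' : FirstStructure e γ' q) (A B : Fin 2) :
    γ A B q = γ' A B q := by
  have := connection_unique (α := fun a => (frm e a q : E4 →ₗ[ℝ] ℝ)) (X := fun a => vec e a q)
    (fun a b => frm_vec e a b q) (δ := fun A B => ((γ A B q - γ' A B q : E4 →L[ℝ] ℝ) : E4 →ₗ[ℝ] ℝ))
    (fun v w => ?_) (fun v w => ?_) (fun v w => ?_) (fun v w => ?_) A B
  · exact sub_eq_zero.1 (ContinuousLinearMap.coe_injective this)
  · have := (h.d0 v w).symm.trans (h'.d0 v w)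
    simp only [wdg] at this
    simp only [ContinuousLinearMap.coe_coe, _root_.sub_apply]
    linear_combination -this
  · have := (h.d1 v w).symm.trans (h'.d1 v w)
    simp only [wdg] at this
    simp only [ContinuousLinearMap.coe_coe, _root_.sub_apply]
    linear_combination -this
  · have := (h.d2 v w).symm.trans (h'.d2 v w)
    simp only [wdg] at this
    simp only [ContinuousLinearMap.coe_coe, _root_.sub_apply]
    linear_combination this
  · have := (h.d3 v w).symm.trans (h'.d3 v w)
    simp only [wdg] at this
    simp only [ContinuousLinearMap.coe_coe, _root_.sub_apply]
    linear_combination this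

/-- The effect of a constant shear on the connection forms. -/
theorem FirstStructure.shear {γ : Fin 2 → Fin 2 → M → E4 →L[ℝ] ℝ} {q : M}
    (h : FirstStructure e γ q) (hs : ∀ a, SmoothFormAt (frm e a) q) (b : ℝ) :
    FirstStructure (PKE.shearField e fun _ => b)
      (![![fun x => γ 0 0 x - b • γ 1 0 x,
          fun x => γ 0 1 x - b • γ 1 1 x + b • γ 0 0 x - b ^ 2 • γ 1 0 x],
        ![γ 1 0, fun x => γ 1 1 x + b • γ 1 0 x]]) q := by
  have f0 : frm (PKE.shearField e fun _ => b) 0 = fun x => frm e 0 x + (-b) • frm e 1 x := by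
    funext x; ext v
    have : frm (PKE.shearField e fun _ => b) 0 x v = 1 * frm e 0 x v - b * frm e 1 x v := rfl
    rw [this]; simp [sub_eq_add_neg]
  have f1 : frm (PKE.shearField e fun _ => b) 1 = frm e 1 := by
    funext x; ext v
    have : frm (PKE.shearField e fun _ => b) 1 x v = 1 * frm e 1 x v - 0 * frm e 0 x v := rfl
    rw [this]; simp
  have f2 : frm (PKE.shearField e fun _ => b) 2 = frm e 2 := by
    funext x; ext v
    have : frm (PKE.shearField e fun _ => b) 2 x v = 1 * frm e 2 x v + 0 * frm e 3 x v := rfl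
    rw [this]; simp
  have f3 : frm (PKE.shearField e fun _ => b) 3 = fun x => frm e 3 x + b • frm e 2 x := by
    funext x; ext v
    have : frm (PKE.shearField e fun _ => b) 3 x v = b * frm e 2 x v + 1 * frm e 3 x v := rfl
    rw [this]; simp [add_comm]
  constructor <;> intro v w
  · rw [f0, f1, xD_add (hs 0) ((hs 1).const_smul _), xD_const_smul (hs 1), h.d0, h.d1]
    simp [wdg]; ring
  · rw [f0, f1, h.d1]
    simp [wdg]; ring
  · rw [f2, f3, h.d2]
    simp [wdg]; ring
  · rw [f2, f3, xD_add (hs 3) ((hs 2).const_smul _), xD_const_smul (hs 2), h.d2, h.d3]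
    simp [wdg]; ring

end FrameChange

/-! ### The torus action on coframes and uniqueness of the normalization -/

section Torus

variable {M : Type u} [TopologicalSpace M] [ChartedSpace E4 M] [IsManifold (𝓡 4) ∞ M]
  {g : BilinField M} {K : EndField M} {e : CoframeField M} {V : Set M} {c : ℝ} {t : PetrovType}

/-- The linear coframe `T(h) f`. -/
noncomputable def scaleEquiv (h : T2) (f : E4 ≃L[ℝ] (Fin 4 → ℝ)) : E4 ≃L[ℝ] (Fin 4 → ℝ) :=
  f.trans (ContinuousLinearEquiv.piCongrRight
    fun a => ContinuousLinearEquiv.unitsEquivAut ℝ (torusWeight h a))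

theorem scaleEquiv_apply (h : T2) (f : E4 ≃L[ℝ] (Fin 4 → ℝ)) (v : E4) (a : Fin 4) :
    scaleEquiv h f v a = f v a * torusWeight h a := rfl

theorem ext_fvec {f f' : E4 ≃L[ℝ] (Fin 4 → ℝ)} (h : ∀ a, fvec f a = fvec f' a) : f = f' := by
  refine ContinuousLinearEquiv.ext (funext fun v => ?_)
  have h1 := sum_smul_fvec f' v
  simp only [← h] at h1
  have h2 := congrArg f h1
  rw [map_sum] at h2
  rw [← h2]
  funext b
  simp [apply_fvec]

theorem fvec_scaleEquiv (h : T2) (f : E4 ≃L[ℝ] (Fin 4 → ℝ)) (a : Fin 4) :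
    fvec (scaleEquiv h f) a = ((torusWeight h a)⁻¹ : ℝˣ) • fvec f a := by
  apply (scaleEquiv h f).injective
  funext b
  rw [apply_fvec, scaleEquiv_apply, Units.smul_def, map_smul, Pi.smul_apply, apply_fvec]
  by_cases hb : b = a
  · subst hb; simp
  · simp [hb]

theorem torusWeight_mul (h h' : T2) (a : Fin 4) :
    torusWeight (h * h') a = torusWeight h a * torusWeight h' a := by
  fin_cases a <;> simp [torusWeight, mul_comm]

theorem torusWeight_one (a : Fin 4) : torusWeight 1 a = 1 := by
  fin_cases a <;> simp [torusWeight]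

theorem torusWeight_inv (h : T2) (a : Fin 4) : torusWeight h⁻¹ a = (torusWeight h a)⁻¹ := by
  fin_cases a <;> simp [torusWeight]

theorem scaleEquiv_mul (h h' : T2) (f : E4 ≃L[ℝ] (Fin 4 → ℝ)) :
    scaleEquiv h (scaleEquiv h' f) = scaleEquiv (h * h') f := by
  ext v a
  simp only [scaleEquiv_apply, torusWeight_mul, Units.val_mul]
  ring

theorem scaleEquiv_one (f : E4 ≃L[ℝ] (Fin 4 → ℝ)) : scaleEquiv 1 f = f := by
  ext v a
  simp [scaleEquiv_apply, torusWeight_one]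

theorem scale_mul (h h' : T2) (θ : Coframe M) : (θ.scale h').scale h = θ.scale (h * h') :=
  congrArg (fun f => (⟨θ.pt, f⟩ : Coframe M)) (scaleEquiv_mul h h' θ.form)

theorem scale_one (θ : Coframe M) : θ.scale 1 = θ :=
  congrArg (fun f => (⟨θ.pt, f⟩ : Coframe M)) (scaleEquiv_one θ.form)

theorem AdaptedAt.scaleEquiv {G : E4 →L[ℝ] E4 →L[ℝ] ℝ} {L : E4 →L[ℝ] E4}
    {f : E4 ≃L[ℝ] (Fin 4 → ℝ)} (hf : AdaptedAt G L f) (h : T2) :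
    AdaptedAt G L (PKE.scaleEquiv h f) := by
  constructor
  · intro v w
    rw [hf.1]
    simp only [scaleEquiv_apply, torusWeight, Matrix.cons_val, Units.val_inv_eq_inv_val]
    have h1 := h.1.ne_zero
    have h2 := h.2.ne_zero
    field_simp
  · intro v
    funext a
    rw [scaleEquiv_apply, hf.2]
    fin_cases a <;> simp [scaleEquiv_apply, torusWeight]

theorem dual_scale (θ : Coframe M) (h : T2) (a i : Fin 4) :
    (θ.scale h).dual a i = ((torusWeight h a : ℝˣ) : ℝ)⁻¹ * θ.dual a i := by
  obtain ⟨q, f⟩ := θ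
  have e1 : ((⟨q, f⟩ : Coframe M).scale h).dual a i = fvec (scaleEquiv h f) a i :=
    dual_mk q (scaleEquiv h f) a i
  have e2 : fvec (scaleEquiv h f) a i = ((torusWeight h a : ℝˣ) : ℝ)⁻¹ * fvec (f : E4 ≃L[ℝ] _) a i :=
    (congrArg (fun v : E4 => v i) (fvec_scaleEquiv h f a)).trans (by simp [Units.smul_def])
  exact e1.trans (e2.trans (congrArg (_ * ·) (dual_mk q f a i).symm))

theorem weylComp_scale (θ : Coframe M) (h : T2) (a b c d : Fin 4) :
    weylComp g (θ.scale h) a b c d = (((torusWeight h a : ℝˣ) : ℝ)⁻¹ * ((torusWeight h b : ℝˣ) : ℝ)⁻¹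
      * ((torusWeight h c : ℝˣ) : ℝ)⁻¹ * ((torusWeight h d : ℝˣ) : ℝ)⁻¹) * weylComp g θ a b c d := by
  simp only [weylComp, dual_scale, Finset.mul_sum]
  refine Finset.sum_congr rfl fun i _ => Finset.sum_congr rfl fun j _ =>
    Finset.sum_congr rfl fun k _ => Finset.sum_congr rfl fun l _ => ?_
  show _ * weyl g θ.pt i j k l (extChartAt (𝓡 4) θ.pt θ.pt) = _
  ring

theorem covWeylComp_scale (θ : Coframe M) (h : T2) (m a b c d : Fin 4) :
    covWeylComp g (θ.scale h) m a b c d = (((torusWeight h m : ℝˣ) : ℝ)⁻¹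
      * ((torusWeight h a : ℝˣ) : ℝ)⁻¹ * ((torusWeight h b : ℝˣ) : ℝ)⁻¹
      * ((torusWeight h c : ℝˣ) : ℝ)⁻¹ * ((torusWeight h d : ℝˣ) : ℝ)⁻¹) * covWeylComp g θ m a b c d := by
  simp only [covWeylComp, dual_scale, Finset.mul_sum]
  refine Finset.sum_congr rfl fun n _ => Finset.sum_congr rfl fun i _ =>
    Finset.sum_congr rfl fun j _ =>
    Finset.sum_congr rfl fun k _ => Finset.sum_congr rfl fun l _ => ?_
  show _ * covWeyl g θ.pt n i j k l (extChartAt (𝓡 4) θ.pt θ.pt) = _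
  ring

theorem psi_scale_eq_zero (θ : Coframe M) (h : T2) (i : Fin 5) :
    psi g (θ.scale h) i = 0 ↔ psi g θ i = 0 := by
  fin_cases i <;> simp [psi, weylComp_scale]

theorem psi43_scale_eq_zero (θ : Coframe M) (h : T2) :
    psi43 g (θ.scale h) = 0 ↔ psi43 g θ = 0 := by
  simp [psi43, covWeylComp_scale]

theorem RootAtZero.congr {ψ φ : Fin 5 → ℝ} (h : RootAtZero t ψ) (hφ : ∀ i, φ i = 0 ↔ ψ i = 0) :
    RootAtZero t φ := by
  cases t <;> simpa [RootAtZero, hφ] using h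

theorem adapted_scale {θ : Coframe M} (hθ : Adapted g K θ) (h : T2) : Adapted g K (θ.scale h) :=
  AdaptedAt.scaleEquiv (G := g θ.pt) (L := K θ.pt) (f := θ.form) hθ h

theorem scale_mem_F7 {θ : Coframe M} (hθ : θ ∈ F7 g K t) (h : T2) : θ.scale h ∈ F7 g K t := by
  rw [mem_F7_iff] at hθ ⊢
  exact ⟨adapted_scale hθ.1 h, hθ.2.congr fun i => psi_scale_eq_zero θ h i⟩

theorem scale_mem_F6 {θ : Coframe M} (hθ : θ ∈ F6 g K t) (h : T2) : θ.scale h ∈ F6 g K t := by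
  refine ⟨scale_mem_F7 hθ.1 h, ?_⟩
  have h2 := hθ.2
  cases t
  · exact (psi_scale_eq_zero θ h 3).2 h2
  · exact (psi_scale_eq_zero θ h 3).2 h2
  · exact (psi_scale_eq_zero θ h 4).2 h2
  · exact (psi_scale_eq_zero θ h 3).2 h2
  · exact (psi43_scale_eq_zero θ h).2 h2

/-- A diagonal change of coframe is the action of an element of the torus. -/
theorem exists_scaleEquiv {f f' : E4 ≃L[ℝ] (Fin 4 → ℝ)} {p s : ℝ} (hD : p * s ≠ 0)
    (h0 : fvec f' 0 = p • fvec f 0) (h1 : fvec f' 1 = s • fvec f 1)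
    (h2 : fvec f' 2 = p⁻¹ • fvec f 2) (h3 : fvec f' 3 = s⁻¹ • fvec f 3) :
    ∃ h : T2, f' = scaleEquiv h f := by
  have hp := left_ne_zero_of_mul hD
  have hs := right_ne_zero_of_mul hD
  refine ⟨(Units.mk0 p⁻¹ (inv_ne_zero hp), Units.mk0 s⁻¹ (inv_ne_zero hs)), ext_fvec fun a => ?_⟩
  rw [fvec_scaleEquiv, Units.smul_def]
  fin_cases a <;> simp [torusWeight, h0, h1, h2, h3]

/-- The effect of a shear on `Ψ₄₃`, for a quadruple root. -/
theorem psi43_shearField (h : IsParaKahlerEinstein g K)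
    (hc : ∀ θ : Coframe M, Adapted g K θ → psi2' g θ = c) (he : IsAdaptedField g K e V)
    (hR : ∀ y ∈ V, RootAtZero .N (psi g (toCoframe e y))) {q : M} (hq : q ∈ V) (b : M → ℝ) :
    psi43 g (toCoframe (shearField e b) q)
      = psi43 g (toCoframe e q) - 5 * b q * psi44 g (toCoframe e q) := by
  have L := he.localStructure h hc
  -- `Ψ₄₃` at `q` is a tensor component, so it depends on the coframe at `q` alone and `b` may be
  -- replaced by the constant `b q`. No smoothness of `b` is then needed.
  have he' := he.shearField (b := fun _ => b q) fun _ _ => contMDiffAt_const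
  have L' := he'.localStructure h hc
  have hc0 : ∀ A B, _ := (L'.first q hq).unique ((L.first q hq).shear (he.smooth_e q hq) (b q))
  have c00 := hc0 0 0
  have c11 := hc0 1 1
  simp only [Matrix.cons_val] at c00 c11
  have hψ : ∀ y ∈ V, psi g (toCoframe (shearField e fun _ => b q) y) 3 = 0 ∧
      psi g (toCoframe (shearField e fun _ => b q) y) 4 = psi g (toCoframe e y) 4 := by
    intro y hy
    obtain ⟨h0, h1, h2, h3, h4⟩ := hR y hy
    rw [psi_shearField h hc (he.adapted y hy)]
    simp [quarticAct, h0, h1, h2, h3]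
  have hd : dForm E4 (fun y => psi g (toCoframe (shearField e fun _ => b q) y) 4) q
      = dForm E4 (fun y => psi g (toCoframe e y) 4) q := by
    refine mder_congr ?_
    filter_upwards [he.isOpen.mem_nhds hq] with y hy using (hψ y hy).2
  have hv : vec (shearField e fun _ => b q) 2 q = vec e 2 q + (- b q) • vec e 3 q := by
    have := (fvec_sl2Equiv (e q) (p := 1) (q := 0) (r := b q) (s := 1) (by ring)).2.2.1
    rw [one_smul] at this
    exact this
  have e1 : psi43 g (toCoframe (shearField e fun _ => b q) q) = _ := L'.cov q hq 2
  have e2 : psi43 g (toCoframe e q) = _ := L.cov q hq 2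
  have e3 : psi44 g (toCoframe e q) = _ := L.cov q hq 3
  have e4 := L.psi44_eq hR hq
  obtain ⟨r1, r2⟩ := L.reduced hR hq
  have hb : psi43 g (toCoframe (shearField e b) q)
      = psi43 g (toCoframe (shearField e fun _ => b q) q) := by
    have hT : toCoframe (shearField e b) q = toCoframe (shearField e fun _ => b q) q :=
      congrArg (Coframe.mk q) (show shearField e b q = shearField e (fun _ => b q) q from rfl)
    rw [hT]
  rw [hb, e1, (hψ q hq).1, (hψ q hq).2, hd, hv, c00, c11]
  have h3 := (hR q hq).2.2.2.1
  rw [h3] at e2 e3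
  simp only [map_add, map_smul, _root_.add_apply, _root_.sub_apply, _root_.smul_apply, smul_eq_mul,
    r2]
  -- Of the five multiples of `Ψ₄₄`, one comes from the change of the direction of differentiation.
  -- Four come from the change of `Γ²₂ - Γ¹₁` by `2b Γ²₁`, through `Ψ₄₄ = J₂Ψ₄`.
  linear_combination - e2 + b q * e3 + 4 * b q * e4

theorem LocalStructure.smooth_cov (L : LocalStructure g K c e (conn e) V) {q : M} (hq : q ∈ V)
    (m : Fin 4) : SmoothAt E4 (fun y => covWeylComp g (toCoframe e y) m 1 2 1 2) q := by
  have s := L.smooth_psi q hq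
  have a : ∀ {β : M → E4 →L[ℝ] ℝ}, SmoothFormAt β q → SmoothAt E4 (fun y => β y (vec e m y)) q :=
    fun hβ => smoothAt_apply_vec hβ (L.smooth_e q hq) m
  have g := L.smooth_γ q hq
  have key : SmoothAt E4 (fun y => dForm E4 (fun x => psi _ (toCoframe e x) 4) y (vec e m y)
      - 4 * conn e 0 1 y (vec e m y) * psi _ (toCoframe e y) 3
      - 2 * (conn e 1 1 y (vec e m y) - conn e 0 0 y (vec e m y)) * psi _ (toCoframe e y) 4) q :=
    ((a (s 4).dForm).sub ((contMDiffAt_const.mul (a (g 0 1))).mul (s 3))).sub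
      ((contMDiffAt_const.mul ((a (g 1 1)).sub (a (g 0 0)))).mul (s 4))
  refine key.congr_of_eventuallyEq ?_
  filter_upwards [L.isOpen.mem_nhds hq] with y hy using L.cov y hy m

/-- Around each point there is a smooth field of normalized coframes, for type `N` with
`Ψ₄₄ ≠ 0`. -/
theorem exists_field_F6_of_psi44 (h : IsParaKahlerEinstein g K)
    (hc : ∀ θ : Coframe M, Adapted g K θ → psi2' g θ = c) (ht : ∀ p : M, HasPetrovType g K p .N)
    (h44 : ∀ θ ∈ F7 g K .N, psi44 g θ ≠ 0) (x : M) :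
    ∃ (e : CoframeField M) (V : Set M), IsAdaptedField g K e V ∧ x ∈ V ∧
      ∀ y ∈ V, toCoframe e y ∈ F6 g K .N := by
  obtain ⟨e, V, he, hx, hF⟩ := exists_field_F7 h hc ht x
  have L := he.localStructure h hc
  have hR : ∀ y ∈ V, RootAtZero .N (psi g (toCoframe e y)) :=
    fun y hy => (mem_F7_iff.1 (hF y hy)).2
  have hb : ∀ y ∈ V, SmoothAt E4
      (fun y => psi43 g (toCoframe e y) / (5 * psi44 g (toCoframe e y))) y := fun y hy =>
    (L.smooth_cov hy 2).div₀ (contMDiffAt_const.mul (L.smooth_cov hy 3))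
      (mul_ne_zero (by norm_num) (h44 _ (hF y hy)))
  have he' := he.shearField hb
  refine ⟨_, V, he', hx, fun y hy => ⟨mem_F7_iff.2 ⟨he'.adapted y hy, ?_⟩, ?_⟩⟩
  · rw [psi_shearField h hc (he.adapted y hy)]
    exact rootAtZero_shear (hR y hy) _
  · show psi43 g _ = 0
    rw [psi43_shearField h hc he hR hy]
    have := h44 _ (hF y hy)
    field_simp
    ring

/-- The coframes of `F6` at a point form an orbit of the torus, where the normalization determines
the coframe. -/
theorem F6_unique (h : IsParaKahlerEinstein g K)
    (hc : ∀ θ : Coframe M, Adapted g K θ → psi2' g θ = c) (ht : ∀ p : M, HasPetrovType g K p t)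
    (hN : t = .IIr ∨ t = .IIc ∨ t = .III ∨ (t = .N ∧ ∀ θ ∈ F7 g K t, psi44 g θ ≠ 0))
    {θ θ' : Coframe M} (hθ : θ ∈ F6 g K t) (hθ' : θ' ∈ F6 g K t) (hpt : θ.pt = θ'.pt) :
    ∃ k, θ' = θ.scale k := by
  obtain ⟨x, f⟩ := θ
  obtain ⟨x', f'⟩ := θ'
  obtain rfl : x = x' := hpt
  have a : AdaptedAt (g x) (K x) f := (mem_F7_iff.1 hθ.1).1
  have a' : AdaptedAt (g x) (K x) f' := (mem_F7_iff.1 hθ'.1).1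
  have R := (mem_F7_iff.1 hθ.1).2
  have R' := (mem_F7_iff.1 hθ'.1).2
  -- Only the vanishing of components matters, so the scalar factor in the transformation of the
  -- `Ψᵢ` is irrelevant; a frame change with `q = r = 0` is an element of the torus.
  have diag : (∀ p q r s : ℝ, p * s - q * r ≠ 0 →
      (∀ i, psi g ⟨x, f'⟩ i = 0 ↔ quarticAct (psi g ⟨x, f⟩) p q r s i = 0) → q = 0 ∧ r = 0) →
      ∃ k, (⟨x, f'⟩ : Coframe M) = (⟨x, f⟩ : Coframe M).scale k := by
    intro H
    obtain ⟨p, q, r, s, hD, h0, h1, h2, h3⟩ := a.exists_change a'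
    have hψ := psi_change h hc a hD h0 h1 h2 h3
    obtain ⟨rfl, rfl⟩ := H p q r s hD fun i => by
      rw [hψ, Pi.smul_apply, smul_eq_zero, inv_eq_zero]
      simp [hD]
    have hps : p * s ≠ 0 := by simpa using hD
    have hp := left_ne_zero_of_mul hps
    have hs := right_ne_zero_of_mul hps
    obtain ⟨k, hk⟩ := exists_scaleEquiv (f := f) (f' := f') (p := p) (s := s) hps
      (by rw [h0]; simp) (by rw [h1]; simp)
      (by rw [h2, show s / (p * s - 0 * 0) = p⁻¹ by field_simp; ring]; simp)
      (by rw [h3, show p / (p * s - 0 * 0) = s⁻¹ by field_simp; ring]; simp)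
    exact ⟨k, congrArg (Coframe.mk x) hk⟩
  have T := HasPetrovType.rootType h hc (ht x) a
  have dbl : OneDouble (psi g ⟨x, f⟩) → psi g ⟨x, f⟩ 2 ≠ 0 → psi g ⟨x, f⟩ 3 = 0 →
      psi g ⟨x, f'⟩ 3 = 0 → ∃ k, (⟨x, f'⟩ : Coframe M) = (⟨x, f⟩ : Coframe M).scale k :=
    fun O h2 h3 h3' => diag fun p q r s hD hi => O.unique R.1 R.2.1 h2 h3 hD ((hi 0).1 R'.1)
      ((hi 1).1 R'.2.1) ((hi 3).1 h3')
  rcases hN with rfl | rfl | rfl | ⟨rfl, h44⟩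
  · exact dbl T.oneDouble_real R.2.2 hθ.2 hθ'.2
  · exact dbl T.oneDouble_complex R.2.2 hθ.2 hθ'.2
  · exact diag fun p q r s hD hi => triple_unique R.1 R.2.1 R.2.2.1 R.2.2.2 hθ.2 hD
      ((hi 0).1 R'.1) ((hi 1).1 R'.2.1) ((hi 4).1 hθ'.2)
  · obtain ⟨e, V, he, hx, hF⟩ := exists_field_F7 h hc ht x
    have hR : ∀ y ∈ V, RootAtZero .N (psi g (toCoframe e y)) :=
      fun y hy => (mem_F7_iff.1 (hF y hy)).2
    -- For type N the condition involves a derivative, so both coframes are compared with a smooth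
    -- reference field: `Ψ₀ = 0` makes the change triangular, and `Ψ₄₃ = 0` determines the shear
    -- because `Ψ₄₄ ≠ 0`.
    have key : ∀ f : E4 ≃L[ℝ] (Fin 4 → ℝ), (⟨x, f⟩ : Coframe M) ∈ F6 g K .N →
        ∃ k, f = scaleEquiv k ((e x).trans (sl2Equiv 1 0
          (psi43 g (toCoframe e x) / (5 * psi44 g (toCoframe e x))) 1 (by ring))) := by
      intro f hf
      obtain ⟨p, q, r, s, hD, h0, h1, h2, h3⟩ :=
        (he.adapted x hx).exists_change (mem_F7_iff.1 hf.1).1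
      have hψ := psi_change h hc (he.adapted x hx) hD h0 h1 h2 h3
      obtain ⟨z0, z1, z2, z3, z4⟩ := hR x hx
      unfold toCoframe at z0 z1 z2 z3 z4
      have w0 := (mem_F7_iff.1 hf.1).2.1
      rw [hψ, Pi.smul_apply, smul_eq_zero] at w0
      have w := w0.resolve_left (inv_ne_zero (pow_ne_zero 2 hD))
      simp only [quarticAct, Matrix.cons_val, z0, z1, z2, z3] at w
      have w' : psi g ⟨x, e x⟩ 4 * q ^ 4 = 0 := by linarith
      have hq : q = 0 := pow_eq_zero_iff (n := 4) (by norm_num) |>.1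
        ((mul_eq_zero.1 w').resolve_left z4)
      subst hq
      have hps : p * s ≠ 0 := by simpa using hD
      have hp := left_ne_zero_of_mul hps
      have hs := right_ne_zero_of_mul hps
      obtain ⟨b, hb⟩ : ∃ b, b = r / s := ⟨_, rfl⟩
      have hrs : r = s * b := by rw [hb]; field_simp
      rw [show p * s - 0 * r = p * s by ring] at h2 h3
      obtain ⟨g0, g1, g2, g3⟩ := fvec_sl2Equiv (e x) (p := 1) (q := 0) (r := b) (s := 1) (by ring)
      obtain ⟨k, hk⟩ := exists_scaleEquiv
        (f := (e x).trans (sl2Equiv 1 0 b 1 (by ring))) (f' := f) (p := p) (s := s) hps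
        (by rw [h0, g0]; simp) (by rw [h1, g1, hrs, smul_add, smul_smul, smul_smul, mul_one])
        (by
          rw [h2, g2, hrs, smul_add, smul_smul, smul_smul]
          congr 2 <;> field_simp)
        (by
          rw [h3, g3, smul_add, smul_smul, smul_smul]
          congr 2
          · simp
          · field_simp)
      have h5 : psi43 g (⟨x, f⟩ : Coframe M) = 0 := hf.2
      have h6 : (⟨x, f⟩ : Coframe M) = (toCoframe (shearField e fun _ => b) x).scale k := by
        rw [hk]; rfl
      rw [h6, psi43_scale_eq_zero, psi43_shearField h hc he hR hx] at h5
      have h7 := h44 _ (hF x hx)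
      have h8 : b = psi43 g (toCoframe e x) / (5 * psi44 g (toCoframe e x)) := by
        rw [eq_div_iff (mul_ne_zero (by norm_num) h7)]; linarith
      subst h8
      exact ⟨k, hk⟩
    obtain ⟨k, hk⟩ := key f hθ
    obtain ⟨k', hk'⟩ := key f' hθ'
    refine ⟨k' * k⁻¹, ?_⟩
    refine congrArg (Coframe.mk x) (hk'.trans (Eq.trans ?_ (congrArg (scaleEquiv _) hk.symm)))
    rw [scaleEquiv_mul, inv_mul_cancel_right]

end Torus

/-! ### The total space of a torus bundle of coframes -/

section Bundle

variable {M : Type u} [TopologicalSpace M] [ChartedSpace E4 M] [IsManifold (𝓡 4) ∞ M]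

/-- Sets of coframes that are locally the torus orbits of smooth fields of coframes. -/
class IsTorusBundle (F : Set (Coframe M)) : Prop where
  scale_mem : ∀ θ ∈ F, ∀ h, θ.scale h ∈ F
  transitive : ∀ θ ∈ F, ∀ θ' ∈ F, θ.pt = θ'.pt → ∃ h, θ' = θ.scale h
  exists_section : ∀ θ ∈ F, ∃ (e : CoframeField M) (V : Set M), IsOpen V ∧ θ.pt ∈ V ∧
    (∀ q ∈ V, ∀ a, SmoothFormAt (frm e a) q) ∧ ∀ q ∈ V, toCoframe e q ∈ F

/-- The total space of a torus bundle of coframes. -/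
def Total (F : Set (Coframe M)) : Type u := ↥F

/-- The base point of an element of the total space. -/
def Total.pt {F : Set (Coframe M)} (u : Total F) : M := u.1.pt

/-- A local section of a torus bundle of coframes, with a chart of its domain. -/
structure LocalSection (F : Set (Coframe M)) where
  e : CoframeField M
  V : Set M
  p : M
  base : Total F
  isOpen : IsOpen V
  subset : V ⊆ (ch E4 p).source
  smooth_e : ∀ q ∈ V, ∀ a, SmoothFormAt (frm e a) q
  mem : ∀ q ∈ V, toCoframe e q ∈ F

variable {F : Set (Coframe M)}

theorem exists_localSection [hF : IsTorusBundle F] (u : Total F) :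
    ∃ S : LocalSection F, u.pt ∈ S.V := by
  obtain ⟨e, V, hV, hu, he, hm⟩ := hF.exists_section u.1 u.2
  exact ⟨⟨e, V ∩ (ch E4 u.pt).source, u.pt, u, hV.inter (isOpen_extChartAt_source _),
    inter_subset_right, fun q hq => he q hq.1, fun q hq => hm q hq.1⟩, hu, mem_extChartAt_source _⟩

/-- The unit of `ℝ` with a given nonzero value. -/
noncomputable def unitOf (x : ℝ) : ℝˣ := if h : x ≠ 0 then Units.mk0 x h else 1

theorem val_unitOf {x : ℝ} (hx : x ≠ 0) : (unitOf x : ℝ) = x := by simp [unitOf, hx]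

theorem unitOf_val (x : ℝˣ) : unitOf (x : ℝ) = x := Units.ext (val_unitOf x.ne_zero)

/-- The element of the torus with given nonzero coordinates. -/
noncomputable def torusOf (z : ℝ × ℝ) : T2 := (unitOf z.1, unitOf z.2)

namespace LocalSection

variable (S : LocalSection F)

/-- The fibre coordinates with respect to a local section. -/
noncomputable def fib (u : Total F) : ℝ × ℝ :=
  ((u.1.form : E4 ≃L[ℝ] (Fin 4 → ℝ)) (vec S.e 2 u.pt) 2,
    (u.1.form : E4 ≃L[ℝ] (Fin 4 → ℝ)) (vec S.e 3 u.pt) 3)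

variable [hF : IsTorusBundle F]

open Classical in
/-- The translate of a local section. -/
noncomputable def point (x : M) (h : T2) : Total F :=
  if hx : x ∈ S.V then ⟨(toCoframe S.e x).scale h⁻¹, hF.scale_mem _ (S.mem x hx) _⟩ else S.base

variable {S}

theorem point_val {x : M} (hx : x ∈ S.V) (h : T2) :
    (S.point x h).1 = (toCoframe S.e x).scale h⁻¹ :=
  congrArg Subtype.val (dif_pos hx : S.point x h = ⟨_, hF.scale_mem _ (S.mem x hx) _⟩)

theorem point_pt {x : M} (hx : x ∈ S.V) (h : T2) : (S.point x h).pt = x :=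
  congrArg Coframe.pt (point_val hx h)

/-- The right action by `h` is `T(h)⁻¹`, which multiplies the barred forms by the coordinates of `h`
themselves. This is why the fibre coordinates are read from the last two forms. -/
theorem fib_of_val (S' : LocalSection F) {u : Total F} {x : M} {h : T2}
    (hu : u.1 = (toCoframe S.e x).scale h⁻¹) :
    S'.fib u = (h.1 * frm S.e 2 x (vec S'.e 2 x), h.2 * frm S.e 3 x (vec S'.e 3 x)) := by
  obtain ⟨θ, hθ⟩ := u
  obtain rfl : θ = ⟨x, scaleEquiv h⁻¹ (S.e x)⟩ := hu
  show (scaleEquiv h⁻¹ (S.e x) (vec S'.e 2 x) 2, scaleEquiv h⁻¹ (S.e x) (vec S'.e 3 x) 3) = _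
  simp only [scaleEquiv_apply, torusWeight, frm_apply]
  simp [mul_comm]

theorem fib_point (S' : LocalSection F) {x : M} (hx : x ∈ S.V) (h : T2) :
    S'.fib (S.point x h) = (h.1 * frm S.e 2 x (vec S'.e 2 x), h.2 * frm S.e 3 x (vec S'.e 3 x)) :=
  fib_of_val S' (point_val hx h)

theorem fib_point_self {x : M} (hx : x ∈ S.V) (h : T2) :
    S.fib (S.point x h) = (((h.1 : ℝˣ) : ℝ), ((h.2 : ℝˣ) : ℝ)) := by
  rw [fib_point S hx, frm_vec, frm_vec]
  simp

theorem exists_eq_point {u : Total F} (hu : u.pt ∈ S.V) : ∃ h, u = S.point u.pt h := by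
  obtain ⟨k, hk⟩ := hF.transitive _ (S.mem _ hu) _ u.2 rfl
  exact ⟨k⁻¹, Subtype.ext (by rw [point_val hu, inv_inv]; exact hk)⟩

theorem fib_ne_zero {u : Total F} (hu : u.pt ∈ S.V) : (S.fib u).1 ≠ 0 ∧ (S.fib u).2 ≠ 0 := by
  obtain ⟨h, hh⟩ := exists_eq_point hu
  rw [hh, fib_point_self hu]
  exact ⟨h.1.ne_zero, h.2.ne_zero⟩

theorem torusOf_fib_point {x : M} (hx : x ∈ S.V) (h : T2) : torusOf (S.fib (S.point x h)) = h := by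
  rw [fib_point_self hx]
  exact Prod.ext (unitOf_val _) (unitOf_val _)

theorem point_torusOf_fib {u : Total F} (hu : u.pt ∈ S.V) : S.point u.pt (torusOf (S.fib u)) = u := by
  obtain ⟨h, hh⟩ := exists_eq_point hu
  conv_lhs => rw [hh, point_pt hu, torusOf_fib_point hu]
  exact hh.symm

variable (S)

/-- The chart of the total space given by a local section. -/
noncomputable def chart : PartialEquiv (Total F) E6 where
  toFun u := (ch E4 S.p u.pt, S.fib u)
  invFun z := S.point ((ch E4 S.p).symm z.1) (torusOf z.2)
  source := {u | u.pt ∈ S.V}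
  target := {z | z.1 ∈ chSet S.p S.V ∧ z.2.1 ≠ 0 ∧ z.2.2 ≠ 0}
  map_source' u hu := by
    have h1 : (ch E4 S.p).symm (ch E4 S.p u.pt) = u.pt := (ch E4 S.p).left_inv (S.subset hu)
    exact ⟨⟨(ch E4 S.p).map_source (S.subset hu), by rwa [h1]⟩, fib_ne_zero hu⟩
  map_target' z hz := by
    show (S.point _ _).pt ∈ S.V
    rw [point_pt hz.1.2]
    exact hz.1.2
  left_inv' u hu := by
    rw [(ch E4 S.p).left_inv (S.subset hu)]
    exact point_torusOf_fib hu
  right_inv' z hz := by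
    rw [point_pt hz.1.2, fib_point_self hz.1.2, (ch E4 S.p).right_inv hz.1.1]
    exact Prod.ext rfl (Prod.ext (val_unitOf hz.2.1) (val_unitOf hz.2.2))

theorem isOpen_chart_target : IsOpen S.chart.target :=
  ((isOpen_chSet S.p S.isOpen).preimage continuous_fst).inter
    ((isOpen_ne.preimage (continuous_fst.comp continuous_snd)).inter
      (isOpen_ne.preimage (continuous_snd.comp continuous_snd)))

theorem chart_trans_source (S' : LocalSection F) :
    (S.chart.symm.trans S'.chart).source = {z | z.1 ∈ chSet S.p (S.V ∩ S'.V) ∧ z.2.1 ≠ 0 ∧ z.2.2 ≠ 0} := by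
  ext z
  simp only [PartialEquiv.trans_source, PartialEquiv.symm_source, mem_inter_iff, mem_preimage, chart,
    PartialEquiv.coe_symm_mk, mem_ofPred_eq, chSet]
  constructor
  · rintro ⟨⟨⟨h1, h2⟩, h3⟩, h4⟩
    rw [point_pt h2] at h4
    exact ⟨⟨h1, h2, h4⟩, h3⟩
  · rintro ⟨⟨h1, h2, h4⟩, h3⟩
    exact ⟨⟨⟨h1, h2⟩, h3⟩, by rwa [point_pt h2]⟩

theorem isOpen_chart_trans_source (S' : LocalSection F) : IsOpen (S.chart.symm.trans S'.chart).source := by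
  rw [chart_trans_source]
  exact ((isOpen_chSet S.p (S.isOpen.inter S'.isOpen)).preimage continuous_fst).inter
    ((isOpen_ne.preimage (continuous_fst.comp continuous_snd)).inter
      (isOpen_ne.preimage (continuous_snd.comp continuous_snd)))

/-- Two local sections differ by a torus-valued function. A transition map is thus a change of chart
on the base, with each fibre coordinate multiplied by a smooth function on the base. -/
theorem contDiffOn_chart_trans (S' : LocalSection F) :
    ContDiffOn ℝ ∞ (S.chart.symm.trans S'.chart) (S.chart.symm.trans S'.chart).source := by
  rw [chart_trans_source]
  rintro ⟨y, r⟩ ⟨⟨hy, hyV, hyV'⟩, hr⟩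
  set x := (ch E4 S.p).symm y with hx
  have hxy : ch E4 S.p x = y := (ch E4 S.p).right_inv hy
  have hxs : x ∈ (ch E4 S.p).source := (ch E4 S.p).map_target hy
  have hρ : ∀ a, ContDiffAt ℝ ∞ (fun z : E6 => frm S.e a ((ch E4 S.p).symm z.1)
      (vec S'.e a ((ch E4 S.p).symm z.1))) (y, r) := by
    intro a
    have h1 := (smoothAt_apply_vec (S.smooth_e x hyV a) (S'.smooth_e x hyV') a).chart hxs
    rw [hxy] at h1
    exact ContDiffAt.comp (y, r) h1 contDiffAt_fst
  have hφ : ContDiffAt ℝ ∞ (fun z : E6 => ch E4 S'.p ((ch E4 S.p).symm z.1)) (y, r) := by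
    have h1 : ContMDiffAt 𝓘(ℝ, E4) 𝓘(ℝ, E4) ∞ (ch E4 S'.p ∘ (ch E4 S.p).symm) y :=
      (contMDiffAt_chart (S'.subset hyV')).comp y (contMDiffAt_chart_symm hy)
    have h2 : ContDiffAt ℝ ∞ (ch E4 S'.p ∘ (ch E4 S.p).symm) y := contMDiffAt_iff_contDiffAt.1 h1
    exact ContDiffAt.comp (g := ch E4 S'.p ∘ (ch E4 S.p).symm) (f := Prod.fst) (y, r) h2 contDiffAt_fst
  have key : ContDiffAt ℝ ∞ (fun z : E6 => ((ch E4 S'.p ((ch E4 S.p).symm z.1),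
      (z.2.1 * frm S.e 2 ((ch E4 S.p).symm z.1) (vec S'.e 2 ((ch E4 S.p).symm z.1)),
        z.2.2 * frm S.e 3 ((ch E4 S.p).symm z.1) (vec S'.e 3 ((ch E4 S.p).symm z.1)))) : E6)) (y, r) :=
    hφ.prodMk (((contDiffAt_fst.comp _ contDiffAt_snd).mul (hρ 2)).prodMk
      ((contDiffAt_snd.comp _ contDiffAt_snd).mul (hρ 3)))
  refine ContDiffWithinAt.congr key.contDiffWithinAt ?_ ?_
  · rintro z ⟨⟨h1, h2, h3⟩, h4, h5⟩
    show (ch E4 S'.p (S.point _ _).pt, S'.fib (S.point _ _)) = _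
    rw [point_pt h2, fib_point S' h2]
    simp only [torusOf, val_unitOf h4, val_unitOf h5]
  · show (ch E4 S'.p (S.point _ _).pt, S'.fib (S.point _ _)) = _
    rw [point_pt hyV, fib_point S' hyV]
    simp only [torusOf, val_unitOf hr.1, val_unitOf hr.2, hx]

end LocalSection

variable (F) [hF : IsTorusBundle F]

/-- The atlas of the total space given by the local sections. -/
noncomputable def totalCore : ChartedSpaceCore E6 (Total F) where
  atlas := range fun S : LocalSection F => S.chart
  chartAt u := (exists_localSection u).choose.chart
  mem_chart_source u := (exists_localSection u).choose_spec
  chart_mem_atlas u := ⟨_, rfl⟩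
  open_source := by
    rintro _ _ ⟨S, rfl⟩ ⟨S', rfl⟩
    exact S.isOpen_chart_trans_source S'
  continuousOn_toFun := by
    rintro _ _ ⟨S, rfl⟩ ⟨S', rfl⟩
    exact (S.contDiffOn_chart_trans S').continuousOn

noncomputable instance : TopologicalSpace (Total F) := (totalCore F).toTopologicalSpace

noncomputable instance : ChartedSpace E6 (Total F) := (totalCore F).toChartedSpace

instance : IsManifold 𝓘(ℝ, E6) ∞ (Total F) := by
  refine isManifold_of_contDiffOn _ _ _ fun e e' he he' => ?_
  obtain ⟨_, ⟨_, rfl⟩, _, ⟨⟨S, rfl⟩, rfl⟩, rfl⟩ := he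
  obtain ⟨_, ⟨_, rfl⟩, _, ⟨⟨S', rfl⟩, rfl⟩, rfl⟩ := he'
  simp only [modelWithCornersSelf_coe, range_id, inter_univ]
  exact S.contDiffOn_chart_trans S'

end Bundle

/-! ### Smoothness of the action and existence of the bundles -/

section Bundle

variable {M : Type u} [TopologicalSpace M] [ChartedSpace E4 M] [IsManifold (𝓡 4) ∞ M]
  {F : Set (Coframe M)} [hF : IsTorusBundle F]

/-- The manifold structure of `ℝˣ` comes from its open embedding in `ℝ`, and away from zero `unitOf`
is the inverse of that embedding. -/
theorem contMDiffAt_unitOf {x : ℝ} (hx : x ≠ 0) : ContMDiffAt 𝓘(ℝ, ℝ) 𝓘(ℝ, ℝ) ∞ unitOf x := by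
  have h := (contMDiffOn_isOpenEmbedding_symm (I := 𝓘(ℝ, ℝ)) (n := ∞)
    (Units.isOpenEmbedding_val (R := ℝ)))
  have hr : ∀ y : ℝ, y ≠ 0 → y ∈ range (Units.val : ℝˣ → ℝ) := fun y hy => ⟨Units.mk0 y hy, rfl⟩
  have h1 := h.contMDiffAt (x := x) (Units.isOpenEmbedding_val.isOpen_range.mem_nhds (hr x hx))
  refine ContMDiffAt.congr_of_eventuallyEq h1 ?_
  filter_upwards [isOpen_ne.mem_nhds hx] with y hy
  obtain ⟨z, rfl⟩ := hr y hy
  rw [unitOf_val]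
  exact (Topology.IsOpenEmbedding.toOpenPartialHomeomorph_left_inv _ Units.isOpenEmbedding_val).symm

theorem contMDiffAt_torusOf {z : ℝ × ℝ} (h1 : z.1 ≠ 0) (h2 : z.2 ≠ 0) :
    ContMDiffAt 𝓘(ℝ, ℝ × ℝ) IT2 ∞ torusOf z := by
  refine ContMDiffAt.prodMk ?_ ?_
  · exact (contMDiffAt_unitOf h1).comp z (contMDiffAt_iff_contDiffAt.2 contDiffAt_fst)
  · exact (contMDiffAt_unitOf h2).comp z (contMDiffAt_iff_contDiffAt.2 contDiffAt_snd)

/-- The coordinates of an element of the torus. -/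
def torusVal (h : T2) : ℝ × ℝ := (h.1, h.2)

theorem contMDiff_torusVal : ContMDiff IT2 𝓘(ℝ, ℝ × ℝ) ∞ torusVal :=
  (Units.contMDiff_val.comp contMDiff_fst).prodMk_space (Units.contMDiff_val.comp contMDiff_snd)

theorem torusOf_torusVal (h : T2) : torusOf (torusVal h) = h :=
  Prod.ext (unitOf_val _) (unitOf_val _)

namespace LocalSection

variable (S : LocalSection F)

theorem chart_mem_maximalAtlas :
    (totalCore F).openPartialHomeomorph S.chart ⟨S, rfl⟩ ∈
      IsManifold.maximalAtlas 𝓘(ℝ, E6) ∞ (Total F) :=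
  IsManifold.subset_maximalAtlas (mem_iUnion₂.2 ⟨S.chart, ⟨S, rfl⟩, rfl⟩)

theorem isOpen_domain : IsOpen {u : Total F | u.pt ∈ S.V} :=
  (totalCore F).open_source' (e := S.chart) ⟨S, rfl⟩

variable {S}

theorem contMDiffAt_chart {u : Total F} (hu : u.pt ∈ S.V) :
    ContMDiffAt 𝓘(ℝ, E6) 𝓘(ℝ, E6) ∞ S.chart u :=
  (contMDiffOn_of_mem_maximalAtlas S.chart_mem_maximalAtlas).contMDiffAt (S.isOpen_domain.mem_nhds hu)

theorem contMDiffAt_chart_symm {z : E6} (hz : z ∈ S.chart.target) :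
    ContMDiffAt 𝓘(ℝ, E6) 𝓘(ℝ, E6) ∞ S.chart.symm z :=
  (contMDiffOn_symm_of_mem_maximalAtlas S.chart_mem_maximalAtlas).contMDiffAt
    (S.isOpen_chart_target.mem_nhds hz)

theorem contMDiffAt_fib {u : Total F} (hu : u.pt ∈ S.V) :
    ContMDiffAt 𝓘(ℝ, E6) 𝓘(ℝ, ℝ × ℝ) ∞ S.fib u :=
  ContMDiffAt.comp (g := (Prod.snd : E6 → ℝ × ℝ)) u (contMDiffAt_iff_contDiffAt.2 contDiffAt_snd)
    (contMDiffAt_chart hu)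

theorem contMDiffAt_torusOf_fib {u : Total F} (hu : u.pt ∈ S.V) :
    ContMDiffAt 𝓘(ℝ, E6) IT2 ∞ (fun v => torusOf (S.fib v)) u :=
  (contMDiffAt_torusOf (fib_ne_zero hu).1 (fib_ne_zero hu).2).comp u (contMDiffAt_fib hu)

theorem contMDiffAt_point {x : M} (hx : x ∈ S.V) (h : T2) :
    ContMDiffAt ((𝓡 4).prod IT2) 𝓘(ℝ, E6) ∞ (fun z : M × T2 => S.point z.1 z.2) (x, h) := by
  have h1 : ContMDiffAt ((𝓡 4).prod IT2) 𝓘(ℝ, E6) ∞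
      (fun z : M × T2 => ((ch E4 S.p z.1, torusVal z.2) : E6)) (x, h) :=
    ContMDiffAt.prodMk_space
      ((PKE.contMDiffAt_chart (S.subset hx)).comp (x, h) contMDiffAt_fst)
      (contMDiff_torusVal.contMDiffAt.comp (x, h) contMDiffAt_snd)
  have hz : ((ch E4 S.p x, torusVal h) : E6) ∈ S.chart.target :=
    ⟨⟨(ch E4 S.p).map_source (S.subset hx),
      by show (ch E4 S.p).symm (ch E4 S.p x) ∈ S.V; rwa [(ch E4 S.p).left_inv (S.subset hx)]⟩,
      h.1.ne_zero, h.2.ne_zero⟩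
  have h2 := ContMDiffAt.comp (x, h) (contMDiffAt_chart_symm hz) h1
  refine h2.congr_of_eventuallyEq ?_
  filter_upwards [(S.isOpen.preimage continuous_fst).mem_nhds hx] with z hz
  show _ = S.point ((ch E4 S.p).symm (ch E4 S.p z.1)) (torusOf (torusVal z.2))
  rw [(ch E4 S.p).left_inv (S.subset hz), torusOf_torusVal]

end LocalSection

theorem contMDiff_pt : ContMDiff 𝓘(ℝ, E6) (𝓡 4) ∞ (Total.pt (F := F)) := by
  intro u
  obtain ⟨S, hu⟩ := exists_localSection u
  have h1 : ContMDiffAt 𝓘(ℝ, E6) 𝓘(ℝ, E4) ∞ (fun v => (S.chart v).1) u :=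
    ContMDiffAt.comp (g := (Prod.fst : E6 → E4)) u (contMDiffAt_iff_contDiffAt.2 contDiffAt_fst)
      (LocalSection.contMDiffAt_chart hu)
  have h2 := ContMDiffAt.comp u (contMDiffAt_chart_symm (p := S.p)
    ((ch E4 S.p).map_source (S.subset hu))) h1
  refine h2.congr_of_eventuallyEq ?_
  filter_upwards [S.isOpen_domain.mem_nhds hu] with v hv
  exact ((ch E4 S.p).left_inv (S.subset hv)).symm

/-- The action of the torus on the total space. -/
noncomputable def Total.act (u : Total F) (h : T2) : Total F := ⟨u.1.scale h⁻¹, hF.scale_mem _ u.2 _⟩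

theorem point_act {S : LocalSection F} {x : M} (hx : x ∈ S.V) (h k : T2) :
    (S.point x h).act k = S.point x (h * k) := by
  apply Subtype.ext
  show (S.point x h).1.scale k⁻¹ = (S.point x (h * k)).1
  rw [LocalSection.point_val hx, LocalSection.point_val hx, scale_mul, mul_inv_rev]

/-- In a local section the action is multiplication in the torus, with the base point fixed. -/
theorem contMDiff_act : ContMDiff (𝓘(ℝ, E6).prod IT2) 𝓘(ℝ, E6) ∞
    (fun x : Total F × T2 => x.1.act x.2) := by
  rintro ⟨u, h⟩
  obtain ⟨S, hu⟩ := exists_localSection u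
  have h1 : ContMDiffAt (𝓘(ℝ, E6).prod IT2) ((𝓡 4).prod IT2) ∞
      (fun x : Total F × T2 => (x.1.pt, torusOf (S.fib x.1) * x.2)) (u, h) := by
    refine ContMDiffAt.prodMk (contMDiff_pt.contMDiffAt.comp (u, h) contMDiffAt_fst) ?_
    have h2 : ContMDiffAt (𝓘(ℝ, E6).prod IT2) IT2 ∞
      (fun x : Total F × T2 => torusOf (S.fib x.1)) (u, h) :=
      (LocalSection.contMDiffAt_torusOf_fib hu).comp (u, h) contMDiffAt_fst
    exact h2.mul contMDiffAt_snd
  have h2 := ContMDiffAt.comp (u, h) (LocalSection.contMDiffAt_point hu _) h1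
  refine h2.congr_of_eventuallyEq ?_
  filter_upwards [(S.isOpen_domain.preimage continuous_fst).mem_nhds hu] with x hx
  show _ = S.point x.1.pt (torusOf (S.fib x.1) * x.2)
  rw [← point_act hx, LocalSection.point_torusOf_fib hx]

/-- The linear coframe underlying a coframe. -/
def Coframe.lin (θ : Coframe M) : E4 ≃L[ℝ] (Fin 4 → ℝ) := θ.form

/-- The forms of a coframe, composed with a linear map. -/
noncomputable def Coframe.comp (θ : Coframe M) (D : E6 →L[ℝ] E4) (a : Fin 4) : E6 →L[ℝ] ℝ :=
  (ContinuousLinearMap.proj (R := ℝ) (φ := fun _ : Fin 4 => ℝ) a).comp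
    ((θ.lin : E4 →L[ℝ] (Fin 4 → ℝ)).comp D)

theorem comp_scale (e : CoframeField M) (x : M) (h : T2) (D : E6 →L[ℝ] E4) (a : Fin 4) :
    ((toCoframe e x).scale h).comp D a = ((torusWeight h a : ℝˣ) : ℝ) • (frm e a x).comp D := by
  refine ContinuousLinearMap.ext fun v => ?_
  show scaleEquiv h (e x) (D v) a = ((torusWeight h a : ℝˣ) : ℝ) * frm e a x (D v)
  rw [scaleEquiv_apply, mul_comm, frm_apply]

/-- The tautological forms on the total space. -/
noncomputable def totalTaut (F : Set (Coframe M)) [IsTorusBundle F] (a : Fin 4) :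
    Total F → E6 →L[ℝ] ℝ := fun u => u.1.comp (mder E6 E4 Total.pt u) a

/-- Over the domain of a local section the tautological forms are the pulled back forms of the
section, rescaled by weights of the fibre coordinates. -/
theorem smoothFormAt_totalTaut (a : Fin 4) (u : Total F) : SmoothFormAt (totalTaut F a) u := by
  obtain ⟨S, hu⟩ := exists_localSection u
  have hw : SmoothAt E6 (fun v => ((torusWeight (torusOf (S.fib v))⁻¹ a : ℝˣ) : ℝ)) u := by
    have h1 := LocalSection.contMDiffAt_torusOf_fib hu
    have h2 : ∀ a, ContMDiff IT2 𝓘(ℝ, ℝ) ∞ (fun h : T2 => torusWeight h a) := by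
      intro a
      fin_cases a
      · exact contMDiff_fst
      · exact contMDiff_snd
      · exact contMDiff_fst.inv
      · exact contMDiff_snd.inv
    exact Units.contMDiff_val.contMDiffAt.comp u (((h2 a).comp
      (contMDiff_id.inv)).contMDiffAt.comp u h1)
  refine ((SmoothFormAt.pullback (S.smooth_e u.pt hu a) (contMDiff_pt u)).smul hw).congr ?_
  filter_upwards [S.isOpen_domain.mem_nhds hu] with v hv
  have h1 := (congrArg Subtype.val (LocalSection.point_torusOf_fib hv)).symm.trans
    (LocalSection.point_val hv _)
  exact (congrArg (fun θ => θ.comp (mder E6 E4 Total.pt v) a) h1).trans (comp_scale S.e v.pt _ _ a)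

variable (F) in
theorem nonempty_torusReduction : Nonempty (TorusReduction F) :=
  ⟨{ P := Total F
     frame := Subtype.val
     frame_injective := Subtype.val_injective
     range_frame := Subtype.range_val
     smooth_proj := contMDiff_pt
     smooth_taut := fun a => smoothForm_iff.2 fun u => smoothFormAt_totalTaut a u
     act := Total.act
     frame_act := fun _ _ => rfl
     smooth_act := contMDiff_act
     transitive := fun u u' hu => by
       obtain ⟨h, hh⟩ := hF.transitive _ u.2 _ u'.2 hu
       exact ⟨h⁻¹, Subtype.ext (by rw [hh]; show _ = u.1.scale h⁻¹⁻¹; rw [inv_inv])⟩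
     locally_trivial := fun u => by
       obtain ⟨S, hu⟩ := exists_localSection u
       refine ⟨S.V, fun x => S.point x 1, fun v => torusOf (S.fib v), S.isOpen, hu, ?_,
         fun x hx => LocalSection.point_pt hx 1,
         fun v hv => (LocalSection.contMDiffAt_torusOf_fib hv).contMDiffWithinAt, ?_⟩
       · intro x hx
         exact ((LocalSection.contMDiffAt_point hx 1).comp x
           (contMDiffAt_id.prodMk contMDiffAt_const)).contMDiffWithinAt
       · intro v hv
         refine (LocalSection.point_torusOf_fib hv).symm.trans ?_
         exact (congrArg _ (one_mul _).symm).trans (point_act hv _ _).symm }⟩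

/-- The orbits of a single coframe field form a bundle whether or not a normalization singles them
out; this covers type D and all cases of type N locally. -/
theorem isTorusBundle_orbits {e : CoframeField M} {V : Set M} (hV : IsOpen V)
    (he : ∀ q ∈ V, ∀ a, SmoothFormAt (frm e a) q) :
    IsTorusBundle {θ : Coframe M | ∃ q ∈ V, ∃ h, θ = (toCoframe e q).scale h} where
  scale_mem := by
    rintro _ ⟨q, hq, h, rfl⟩ k
    exact ⟨q, hq, _, scale_mul _ _ _⟩
  transitive := by
    rintro _ ⟨q, hq, h, rfl⟩ _ ⟨q', hq', h', rfl⟩ hpt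
    obtain rfl : q = q' := hpt
    exact ⟨h' * h⁻¹, by rw [scale_mul, inv_mul_cancel_right]⟩
  exists_section := by
    rintro _ ⟨q, hq, h, rfl⟩
    exact ⟨e, V, hV, hq, he, fun x hx => ⟨x, hx, 1, (scale_one _).symm⟩⟩

variable {g : BilinField M} {K : EndField M} {c : ℝ} {t : PetrovType}

theorem exists_torusReduction (h : IsParaKahlerEinstein g K)
    (hc : ∀ θ : Coframe M, Adapted g K θ → psi2' g θ = c) (ht : ∀ p : M, HasPetrovType g K p t)
    (p : M) : ∃ F ⊆ F7 g K t, (t ≠ .N → F ⊆ F6 g K t) ∧ (∃ θ ∈ F, θ.pt = p) ∧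
      Nonempty (TorusReduction F) := by
  have key : ∃ (e : CoframeField M) (V : Set M), IsAdaptedField g K e V ∧ p ∈ V ∧
      (∀ y ∈ V, toCoframe e y ∈ F7 g K t) ∧ (t ≠ .N → ∀ y ∈ V, toCoframe e y ∈ F6 g K t) := by
    by_cases hN : t = .N
    · obtain ⟨e, V, he, hp, hm⟩ := exists_field_F7 h hc ht p
      exact ⟨e, V, he, hp, hm, fun h => absurd hN h⟩
    · obtain ⟨e, V, he, hp, hm⟩ := exists_field_F6 h hc ht hN p
      exact ⟨e, V, he, hp, fun y hy => (hm y hy).1, fun _ => hm⟩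
  obtain ⟨e, V, he, hp, h7, h6⟩ := key
  have := isTorusBundle_orbits he.isOpen he.smooth_e
  refine ⟨{θ : Coframe M | ∃ q ∈ V, ∃ h, θ = (toCoframe e q).scale h}, ?_, fun hN => ?_,
    ⟨toCoframe e p, ⟨p, hp, 1, (scale_one _).symm⟩, rfl⟩, nonempty_torusReduction _⟩
  · rintro _ ⟨q, hq, k, rfl⟩
    exact scale_mem_F7 (h7 q hq) k
  · rintro _ ⟨q, hq, k, rfl⟩
    exact scale_mem_F6 (h6 hN q hq) k

theorem nonempty_torusReduction_F6 (h : IsParaKahlerEinstein g K)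
    (hc : ∀ θ : Coframe M, Adapted g K θ → psi2' g θ = c) (ht : ∀ p : M, HasPetrovType g K p t)
    (hN : t = .IIr ∨ t = .IIc ∨ t = .III ∨ (t = .N ∧ ∀ θ ∈ F7 g K t, psi44 g θ ≠ 0)) :
    (∀ p : M, ∃ θ ∈ F6 g K t, θ.pt = p) ∧ Nonempty (TorusReduction (F6 g K t)) := by
  have key : ∀ p : M, ∃ (e : CoframeField M) (V : Set M), IsAdaptedField g K e V ∧ p ∈ V ∧
      (∀ y ∈ V, toCoframe e y ∈ F6 g K t) := by
    intro p
    by_cases hN' : t = .N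
    · subst hN'
      rcases hN with h1 | h1 | h1 | ⟨-, h44⟩
      · cases h1
      · cases h1
      · cases h1
      · exact exists_field_F6_of_psi44 h hc ht h44 p
    · exact exists_field_F6 h hc ht hN' p
  have : IsTorusBundle (F6 g K t) :=
    { scale_mem := fun θ hθ k => scale_mem_F6 hθ k
      transitive := fun θ hθ θ' hθ' hpt => F6_unique h hc ht hN hθ hθ' hpt
      exists_section := fun θ _ => by
        obtain ⟨e, V, he, hp, hm⟩ := key θ.pt
        exact ⟨e, V, he.isOpen, hp, he.smooth_e, hm⟩ }
  refine ⟨fun p => ?_, nonempty_torusReduction _⟩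
  obtain ⟨e, V, he, hp, hm⟩ := key p
  exact ⟨toCoframe e p, hm p hp, rfl⟩

end Bundle

/-! ### Logarithmic differentials -/

section LogDerivative

variable {N : Type u} [TopologicalSpace N] [ChartedSpace E6 N]

theorem dForm_comp {f : N → ℝ} {u : N} (hf : SmoothAt E6 f u) {φ : ℝ → ℝ} {d : ℝ}
    (hφ : HasDerivAt φ d (f u)) : dForm E6 (fun v => φ (f v)) u = d • dForm E6 f u := by
  have h := mder_comp (E := E6) (E' := ℝ) (E'' := ℝ) (G := φ) u
    hφ.differentiableAt.mdifferentiableAt (hf.mdifferentiableAt (by simp))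
  refine h.trans ?_
  rw [mder_eq_fderiv, hφ.hasFDerivAt.fderiv]
  refine ContinuousLinearMap.ext fun v => ?_
  simp [mul_comm, dForm]

/-- The logarithmic differential of a nonvanishing function. -/
noncomputable def dLog (f : N → ℝ) : N → E6 →L[ℝ] ℝ := dForm E6 fun v => Real.log (f v)

variable {f : N → ℝ} {u : N}

theorem SmoothAt.log (hf : SmoothAt E6 f u) (h0 : f u ≠ 0) :
    SmoothAt E6 (fun v => Real.log (f v)) u :=
  ContMDiffAt.comp (g := Real.log) u (contMDiffAt_iff_contDiffAt.2 (Real.contDiffAt_log.2 h0)) hf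

theorem SmoothAt.inv' (hf : SmoothAt E6 f u) (h0 : f u ≠ 0) : SmoothAt E6 (fun v => (f v)⁻¹) u :=
  ContMDiffAt.comp (g := fun x : ℝ => x⁻¹) u (contMDiffAt_iff_contDiffAt.2 (contDiffAt_inv ℝ h0)) hf

/-- `Real.log` is the logarithm of the absolute value, so both components of `ℝˣ` are treated at
once. -/
theorem dLog_eq (hf : SmoothAt E6 f u) (h0 : f u ≠ 0) : dLog f u = (f u)⁻¹ • dForm E6 f u :=
  dForm_comp hf (Real.hasDerivAt_log h0)

theorem dForm_eq_dLog (hf : SmoothAt E6 f u) (h0 : f u ≠ 0) : dForm E6 f u = f u • dLog f u := by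
  rw [dLog_eq hf h0, smul_smul, mul_inv_cancel₀ h0, one_smul]

theorem dForm_inv (hf : SmoothAt E6 f u) (h0 : f u ≠ 0) :
    dForm E6 (fun v => (f v)⁻¹) u = -(f u)⁻¹ • dLog f u := by
  rw [dLog_eq hf h0, smul_smul]
  refine (dForm_comp hf (hasDerivAt_inv h0)).trans ?_
  congr 1
  field_simp

end LogDerivative

/-! ### Structure equations of pulled back and rescaled coframes -/

section Scaling

variable {M : Type u} [TopologicalSpace M] [ChartedSpace E4 M] [IsManifold (𝓡 4) ∞ M]
  {N : Type u} [TopologicalSpace N] [ChartedSpace E6 N] [IsManifold 𝓘(ℝ, E6) ∞ N]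

/-- The forms of a coframe field on `M`, pulled back and rescaled by functions on `N`. -/
noncomputable def scaledForm (π : N → M) (x : Fin 2 → N → ℝ) (e : CoframeField M) (a : Fin 4) :
    N → E6 →L[ℝ] ℝ :=
  (![fun v => (x 0 v)⁻¹ • pull E6 π (frm e 0) v, fun v => (x 1 v)⁻¹ • pull E6 π (frm e 1) v,
    fun v => x 0 v • pull E6 π (frm e 2) v, fun v => x 1 v • pull E6 π (frm e 3) v] :
    Fin 4 → N → E6 →L[ℝ] ℝ) a

/-- The connection forms of the rescaled coframe. -/
noncomputable def scaledConn (π : N → M) (x : Fin 2 → N → ℝ) (γ : Fin 2 → Fin 2 → M → E4 →L[ℝ] ℝ) :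
    Fin 2 → Fin 2 → N → E6 →L[ℝ] ℝ :=
  ![![fun v => pull E6 π (γ 0 0) v + dLog (x 0) v,
      fun v => x 1 v • (x 0 v)⁻¹ • pull E6 π (γ 0 1) v],
    ![fun v => x 0 v • (x 1 v)⁻¹ • pull E6 π (γ 1 0) v,
      fun v => pull E6 π (γ 1 1) v + dLog (x 1) v]]

/-- The components of `Weyl⁻` in the rescaled coframe. -/
noncomputable def scaledPsi (x y : ℝ) (ψ : Fin 5 → ℝ) : Fin 5 → ℝ :=
  ![(x / y) ^ 2 * ψ 0, (x / y) * ψ 1, ψ 2, (y / x) * ψ 3, (y / x) ^ 2 * ψ 4]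

/-- The first structure equations for forms on a six-dimensional manifold. -/
structure FirstEquations (α : Fin 4 → N → E6 →L[ℝ] ℝ) (Γ : Fin 2 → Fin 2 → N → E6 →L[ℝ] ℝ)
    (u : N) : Prop where
  d0 : ∀ v w, xD (α 0) u v w = - wdg (Γ 0 0) (α 0) u v w - wdg (Γ 0 1) (α 1) u v w
  d1 : ∀ v w, xD (α 1) u v w = - wdg (Γ 1 0) (α 0) u v w - wdg (Γ 1 1) (α 1) u v w
  d2 : ∀ v w, xD (α 2) u v w = wdg (Γ 0 0) (α 2) u v w + wdg (Γ 1 0) (α 3) u v w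
  d3 : ∀ v w, xD (α 3) u v w = wdg (Γ 0 1) (α 2) u v w + wdg (Γ 1 1) (α 3) u v w

/-- The second structure equations for forms on a six-dimensional manifold. -/
structure SecondEquations (α : Fin 4 → N → E6 →L[ℝ] ℝ) (Γ : Fin 2 → Fin 2 → N → E6 →L[ℝ] ℝ)
    (c : ℝ) (ψ : Fin 5 → ℝ) (u : N) : Prop where
  d00 : ∀ v w, xD (Γ 0 0) u v w = - wdg (Γ 0 1) (Γ 1 0) u v w
    + (-2 * c - ψ 2) * wdg (α 0) (α 2) u v w + ψ 1 * wdg (α 0) (α 3) u v w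
    - ψ 3 * wdg (α 1) (α 2) u v w + (ψ 2 - c) * wdg (α 1) (α 3) u v w
  d01 : ∀ v w, xD (Γ 0 1) u v w = - wdg (Γ 0 0) (Γ 0 1) u v w - wdg (Γ 0 1) (Γ 1 1) u v w
    - ψ 3 * wdg (α 0) (α 2) u v w + (ψ 2 - c) * wdg (α 0) (α 3) u v w
    - ψ 4 * wdg (α 1) (α 2) u v w + ψ 3 * wdg (α 1) (α 3) u v w
  d10 : ∀ v w, xD (Γ 1 0) u v w = wdg (Γ 0 0) (Γ 1 0) u v w + wdg (Γ 1 0) (Γ 1 1) u v w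
    + ψ 1 * wdg (α 0) (α 2) u v w - ψ 0 * wdg (α 0) (α 3) u v w
    + (ψ 2 - c) * wdg (α 1) (α 2) u v w - ψ 1 * wdg (α 1) (α 3) u v w
  d11 : ∀ v w, xD (Γ 1 1) u v w = wdg (Γ 0 1) (Γ 1 0) u v w
    + (ψ 2 - c) * wdg (α 0) (α 2) u v w - ψ 1 * wdg (α 0) (α 3) u v w
    + ψ 3 * wdg (α 1) (α 2) u v w + (-2 * c - ψ 2) * wdg (α 1) (α 3) u v w

variable {π : N → M} {x : Fin 2 → N → ℝ} {e : CoframeField M} {u : N}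
  {γ : Fin 2 → Fin 2 → M → E4 →L[ℝ] ℝ}

theorem smoothFormAt_scaledForm (hπ : ContMDiffAt 𝓘(ℝ, E6) 𝓘(ℝ, E4) ∞ π u)
    (hx : ∀ i, SmoothAt E6 (x i) u) (h0 : ∀ i, x i u ≠ 0) (he : ∀ a, SmoothFormAt (frm e a) (π u))
    (a : Fin 4) : SmoothFormAt (scaledForm π x e a) u := by
  fin_cases a
  exacts [((he 0).pullback hπ).smul ((hx 0).inv' (h0 0)), ((he 1).pullback hπ).smul ((hx 1).inv' (h0 1)),
    ((he 2).pullback hπ).smul (hx 0), ((he 3).pullback hπ).smul (hx 1)]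

theorem smoothFormAt_scaledConn (hπ : ContMDiffAt 𝓘(ℝ, E6) 𝓘(ℝ, E4) ∞ π u)
    (hx : ∀ i, SmoothAt E6 (x i) u) (h0 : ∀ i, x i u ≠ 0)
    (hγ : ∀ A B, SmoothFormAt (γ A B) (π u)) (A B : Fin 2) :
    SmoothFormAt (scaledConn π x γ A B) u := by
  fin_cases A <;> fin_cases B
  exacts [((hγ 0 0).pullback hπ).add ((hx 0).log (h0 0)).dForm,
    (((hγ 0 1).pullback hπ).smul ((hx 0).inv' (h0 0))).smul (hx 1),
    (((hγ 1 0).pullback hπ).smul ((hx 1).inv' (h0 1))).smul (hx 0),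
    ((hγ 1 1).pullback hπ).add ((hx 1).log (h0 1)).dForm]

/-- A gauge transformation by a diagonal matrix: the off-diagonal connection forms are multiplied by
weights, and the diagonal ones absorb the logarithmic differentials of the scaling functions. -/
theorem FirstStructure.scaled (h : FirstStructure e γ (π u))
    (hπ : ContMDiffAt 𝓘(ℝ, E6) 𝓘(ℝ, E4) ∞ π u)
    (hx : ∀ i, SmoothAt E6 (x i) u) (h0 : ∀ i, x i u ≠ 0) (he : ∀ a, SmoothFormAt (frm e a) (π u)) :
    FirstEquations (scaledForm π x e) (scaledConn π x γ) u := by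
  have e0 := h0 0
  have e1 := h0 1
  constructor
  · intro v w
    refine (xD_smul ((hx 0).inv' e0) ((he 0).pullback hπ) v w).trans ?_
    rw [xD_pull (he 0) hπ, h.d0]
    simp only [wdg, dForm_inv (hx 0) e0, scaledForm, scaledConn, Matrix.cons_val, _root_.add_apply,
      _root_.smul_apply, smul_eq_mul, pull, ContinuousLinearMap.comp_apply]
    field_simp
    ring
  · intro v w
    refine (xD_smul ((hx 1).inv' e1) ((he 1).pullback hπ) v w).trans ?_
    rw [xD_pull (he 1) hπ, h.d1]
    simp only [wdg, dForm_inv (hx 1) e1, scaledForm, scaledConn, Matrix.cons_val, _root_.add_apply,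
      _root_.smul_apply, smul_eq_mul, pull, ContinuousLinearMap.comp_apply]
    field_simp
    ring
  · intro v w
    refine (xD_smul (hx 0) ((he 2).pullback hπ) v w).trans ?_
    rw [xD_pull (he 2) hπ, h.d2]
    simp only [wdg, dForm_eq_dLog (hx 0) e0, scaledForm, scaledConn, Matrix.cons_val, _root_.add_apply,
      _root_.smul_apply, smul_eq_mul, pull, ContinuousLinearMap.comp_apply]
    field_simp
    ring
  · intro v w
    refine (xD_smul (hx 1) ((he 3).pullback hπ) v w).trans ?_
    rw [xD_pull (he 3) hπ, h.d3]
    simp only [wdg, dForm_eq_dLog (hx 1) e1, scaledForm, scaledConn, Matrix.cons_val, _root_.add_apply,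
      _root_.smul_apply, smul_eq_mul, pull, ContinuousLinearMap.comp_apply]
    field_simp
    ring

/-- Logarithmic differentials are closed, so the curvature changes only by the weights, which are
those of the components `Ψᵢ`. -/
theorem SecondStructure.scaled {c : ℝ} {ψ : Fin 5 → ℝ} (h : SecondStructure e γ c ψ (π u))
    (hπ : ContMDiffAt 𝓘(ℝ, E6) 𝓘(ℝ, E4) ∞ π u)
    (hx : ∀ i, SmoothAt E6 (x i) u) (h0 : ∀ i, x i u ≠ 0)
    (hγ : ∀ A B, SmoothFormAt (γ A B) (π u)) :
    SecondEquations (scaledForm π x e) (scaledConn π x γ) c (scaledPsi (x 0 u) (x 1 u) ψ) u := by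
  have e0 := h0 0
  have e1 := h0 1
  constructor
  · intro v w
    refine (xD_add ((hγ 0 0).pullback hπ) ((hx 0).log e0).dForm v w).trans ?_
    rw [xD_pull (hγ 0 0) hπ, h.d00, xD_dForm ((hx 0).log e0)]
    simp only [wdg, scaledForm, scaledConn, scaledPsi, Matrix.cons_val, _root_.add_apply,
      _root_.smul_apply, smul_eq_mul, pull, ContinuousLinearMap.comp_apply]
    field_simp
    ring
  · intro v w
    refine (xD_smul (hx 1) (((hγ 0 1).pullback hπ).smul ((hx 0).inv' e0)) v w).trans ?_
    rw [xD_smul ((hx 0).inv' e0) ((hγ 0 1).pullback hπ), xD_pull (hγ 0 1) hπ, h.d01]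
    simp only [wdg, dForm_inv (hx 0) e0, dForm_eq_dLog (hx 1) e1, scaledForm, scaledConn, scaledPsi,
      Matrix.cons_val, _root_.add_apply,
      _root_.smul_apply, smul_eq_mul, pull, ContinuousLinearMap.comp_apply]
    field_simp
    ring
  · intro v w
    refine (xD_smul (hx 0) (((hγ 1 0).pullback hπ).smul ((hx 1).inv' e1)) v w).trans ?_
    rw [xD_smul ((hx 1).inv' e1) ((hγ 1 0).pullback hπ), xD_pull (hγ 1 0) hπ, h.d10]
    simp only [wdg, dForm_inv (hx 1) e1, dForm_eq_dLog (hx 0) e0, scaledForm, scaledConn, scaledPsi,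
      Matrix.cons_val, _root_.add_apply,
      _root_.smul_apply, smul_eq_mul, pull, ContinuousLinearMap.comp_apply]
    field_simp
    ring
  · intro v w
    refine (xD_add ((hγ 1 1).pullback hπ) ((hx 1).log e1).dForm v w).trans ?_
    rw [xD_pull (hγ 1 1) hπ, h.d11, xD_dForm ((hx 1).log e1)]
    simp only [wdg, scaledForm, scaledConn, scaledPsi, Matrix.cons_val, _root_.add_apply,
      _root_.smul_apply, smul_eq_mul, pull, ContinuousLinearMap.comp_apply]
    field_simp
    ring

theorem FirstEquations.unique {α : Fin 4 → N → E6 →L[ℝ] ℝ}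
    {Γ Γ' : Fin 2 → Fin 2 → N → E6 →L[ℝ] ℝ} (h : FirstEquations α Γ u) (h' : FirstEquations α Γ' u)
    {X : Fin 4 → E6} (hX : ∀ a b, α a u (X b) = if a = b then 1 else 0) (A B : Fin 2) :
    Γ A B u = Γ' A B u := by
  have := connection_unique (α := fun a => (α a u : E6 →ₗ[ℝ] ℝ)) (X := X) hX
    (δ := fun A B => ((Γ A B u - Γ' A B u : E6 →L[ℝ] ℝ) : E6 →ₗ[ℝ] ℝ))
    (fun v w => ?_) (fun v w => ?_) (fun v w => ?_) (fun v w => ?_) A B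
  · exact sub_eq_zero.1 (ContinuousLinearMap.coe_injective this)
  · have := (h.d0 v w).symm.trans (h'.d0 v w)
    simp only [wdg] at this
    simp only [ContinuousLinearMap.coe_coe, _root_.sub_apply]
    linear_combination -this
  · have := (h.d1 v w).symm.trans (h'.d1 v w)
    simp only [wdg] at this
    simp only [ContinuousLinearMap.coe_coe, _root_.sub_apply]
    linear_combination -this
  · have := (h.d2 v w).symm.trans (h'.d2 v w)
    simp only [wdg] at this
    simp only [ContinuousLinearMap.coe_coe, _root_.sub_apply]
    linear_combination this
  · have := (h.d3 v w).symm.trans (h'.d3 v w)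
    simp only [wdg] at this
    simp only [ContinuousLinearMap.coe_coe, _root_.sub_apply]
    linear_combination this

/-- Only the forms `α` are differentiated here, so they must agree near the point, while the
connection forms need agree only at it. -/
theorem FirstEquations.congr {α β : Fin 4 → N → E6 →L[ℝ] ℝ} {Γ Γ' : Fin 2 → Fin 2 → N → E6 →L[ℝ] ℝ}
    (h : FirstEquations α Γ u) (hα : ∀ a, SmoothFormAt (α a) u) (hβ : ∀ a, β a =ᶠ[𝓝 u] α a)
    (hΓ : ∀ A B, Γ' A B u = Γ A B u) : FirstEquations β Γ' u := by
  have hβ' : ∀ a, β a u = α a u := fun a => (hβ a).eq_of_nhds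
  constructor <;> intro v w <;> rw [xD_congr (hα _) (hβ _)] <;> simp only [wdg, hβ', hΓ]
  exacts [h.d0 v w, h.d1 v w, h.d2 v w, h.d3 v w]

theorem SecondEquations.congr {α β : Fin 4 → N → E6 →L[ℝ] ℝ} {Γ Γ' : Fin 2 → Fin 2 → N → E6 →L[ℝ] ℝ}
    {c : ℝ} {ψ φ : Fin 5 → ℝ} (h : SecondEquations α Γ c ψ u) (hΓ : ∀ A B, SmoothFormAt (Γ A B) u)
    (hβ : ∀ a, β a u = α a u) (hΓ' : ∀ A B, Γ' A B =ᶠ[𝓝 u] Γ A B) (hφ : φ = ψ) :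
    SecondEquations β Γ' c φ u := by
  subst hφ
  have hΓu : ∀ A B, Γ' A B u = Γ A B u := fun A B => (hΓ' A B).eq_of_nhds
  constructor <;> intro v w <;> rw [xD_congr (hΓ _ _) (hΓ' _ _)] <;> simp only [wdg, hβ, hΓu]
  exacts [h.d00 v w, h.d01 v w, h.d10 v w, h.d11 v w]

variable {g : BilinField M}

theorem psi_scale (q : M) (h : T2) :
    psi g ((toCoframe e q).scale h⁻¹) = scaledPsi h.1 h.2 (psi g (toCoframe e q)) := by
  have h1 := h.1.ne_zero
  have h2 := h.2.ne_zero
  funext i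
  fin_cases i <;>
    simp [psi, scaledPsi, weylComp_scale, torusWeight, -mul_eq_mul_left_iff] <;> field_simp <;> simp

theorem psi44_scale (q : M) (h : T2) :
    psi44 g ((toCoframe e q).scale h⁻¹)
      = (((h.2 : ℝˣ) : ℝ))⁻¹ * (h.2 / h.1) ^ 2 * psi44 g (toCoframe e q) := by
  have h1 := h.1.ne_zero
  have h2 := h.2.ne_zero
  simp [psi44, covWeylComp_scale, torusWeight, -mul_eq_mul_right_iff]
  field_simp

end Scaling

/-! ### Connection forms on an arbitrary torus reduction -/

section Reduction

variable {M : Type u} [TopologicalSpace M] [ChartedSpace E4 M] [IsManifold (𝓡 4) ∞ M]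
  {F : Set (Coframe M)}

theorem scale_injective (θ : Coframe M) : Function.Injective fun h => θ.scale h := by
  obtain ⟨q, f⟩ := θ
  intro h h' hh
  have h1 : scaleEquiv h (f : E4 ≃L[ℝ] _) = scaleEquiv h' (f : E4 ≃L[ℝ] _) :=
    congrArg Coframe.lin hh
  have key : ∀ a, torusWeight h a = torusWeight h' a := by
    intro a
    have h2 := congrArg (fun f' : E4 ≃L[ℝ] (Fin 4 → ℝ) => f' (fvec (f : E4 ≃L[ℝ] _) a) a) h1
    have h3 : (f : E4 ≃L[ℝ] _) (fvec (f : E4 ≃L[ℝ] _) a) a * ((torusWeight h a : ℝˣ) : ℝ)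
      = (f : E4 ≃L[ℝ] _) (fvec (f : E4 ≃L[ℝ] _) a) a * ((torusWeight h' a : ℝˣ) : ℝ) := h2
    have h4 : (f : E4 ≃L[ℝ] _) (fvec (f : E4 ≃L[ℝ] _) a) a = 1 := (apply_fvec _ _ _).trans (if_pos rfl)
    exact Units.ext (mul_left_cancel₀ (h4.trans_ne one_ne_zero) h3)
  exact Prod.ext (key 0) (key 1)

namespace TorusReduction

variable (R : TorusReduction F)

/-- The base point. -/
def pt (u : R.P) : M := (R.frame u).pt

theorem smooth_pt : ContMDiff 𝓘(ℝ, E6) 𝓘(ℝ, E4) ∞ R.pt := R.smooth_proj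

/-- The tautological forms, as functions with values in the dual of the model space. -/
noncomputable def ta (a : Fin 4) : R.P → E6 →L[ℝ] ℝ := R.taut a

theorem smoothFormAt_ta (a : Fin 4) (u : R.P) : SmoothFormAt (R.ta a) u :=
  smoothForm_iff.1 (R.smooth_taut a) u

theorem pt_act (u : R.P) (h : T2) : R.pt (R.act u h) = R.pt u := by
  have h1 := congrArg Coframe.pt (R.frame_act u h)
  exact h1

theorem act_act (u : R.P) (h k : T2) : R.act (R.act u h) k = R.act u (h * k) :=
  R.frame_injective (by rw [R.frame_act, R.frame_act, R.frame_act, scale_mul, mul_inv_rev])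

theorem act_injective (u : R.P) : Function.Injective (R.act u) := fun h k hk =>
  inv_injective (scale_injective (R.frame u)
    ((R.frame_act u h).symm.trans ((congrArg R.frame hk).trans (R.frame_act u k))))

theorem contMDiff_act_left (h : T2) : ContMDiff 𝓘(ℝ, E6) 𝓘(ℝ, E6) ∞ fun u => R.act u h :=
  R.smooth_act.comp (contMDiff_id.prodMk contMDiff_const)

theorem contMDiff_torusExp (c : ℝ × ℝ) : ContMDiff 𝓘(ℝ, ℝ) IT2 ∞ fun s : ℝ => torusExp (s • c) := by
  have h : ∀ k : ℝ, ContMDiff 𝓘(ℝ, ℝ) 𝓘(ℝ, ℝ) ∞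
      (fun s : ℝ => Units.mk0 (Real.exp (s * k)) (Real.exp_ne_zero _)) := by
    intro k
    apply ContMDiff.of_comp_isOpenEmbedding Units.isOpenEmbedding_val
    exact contMDiff_iff_contDiff.2 (Real.contDiff_exp.comp (contDiff_id.mul contDiff_const))
  exact (h c.1).prodMk (h c.2)

theorem contMDiff_orbit (u : R.P) (c : ℝ × ℝ) :
    ContMDiff 𝓘(ℝ, ℝ) 𝓘(ℝ, E6) ∞ fun s : ℝ => R.act u (torusExp (s • c)) :=
  R.smooth_act.comp (contMDiff_const.prodMk (contMDiff_torusExp c))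

/-- A local trivialization. -/
structure Triv where
  V : Set M
  s : M → R.P
  τ : R.P → T2
  isOpen : IsOpen V
  smooth_s : ContMDiffOn (𝓡 4) 𝓘(ℝ, E6) ∞ s V
  pt_s : ∀ x ∈ V, R.pt (s x) = x
  smooth_τ : ContMDiffOn 𝓘(ℝ, E6) IT2 ∞ τ {u | R.pt u ∈ V}
  eq_act : ∀ u, R.pt u ∈ V → u = R.act (s (R.pt u)) (τ u)

theorem exists_triv (u : R.P) : ∃ T : R.Triv, R.pt u ∈ T.V := by
  obtain ⟨V, s, τ, h1, h2, h3, h4, h5, h6⟩ := R.locally_trivial u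
  exact ⟨⟨V, s, τ, h1, h3, h4, h5, h6⟩, h2⟩

namespace Triv

variable {R} (T : R.Triv)

/-- The coframe field given by the local section. -/
def e : CoframeField M := fun q => (R.frame (T.s q)).lin

/-- The fibre coordinates, with values in `ℝ`. -/
def x : Fin 2 → R.P → ℝ := ![fun u => ((T.τ u).1 : ℝ), fun u => ((T.τ u).2 : ℝ)]

theorem x_ne_zero (i : Fin 2) (u : R.P) : T.x i u ≠ 0 := by
  fin_cases i
  exacts [(T.τ u).1.ne_zero, (T.τ u).2.ne_zero]

variable {T}

theorem isOpen_domain : IsOpen {u | R.pt u ∈ T.V} := T.isOpen.preimage R.smooth_proj.continuous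

theorem smoothAt_x {u : R.P} (hu : R.pt u ∈ T.V) (i : Fin 2) : SmoothAt E6 (T.x i) u := by
  have h := T.smooth_τ.contMDiffAt (isOpen_domain.mem_nhds hu)
  fin_cases i
  · exact Units.contMDiff_val.contMDiffAt.comp u (contMDiffAt_fst.comp u h)
  · exact Units.contMDiff_val.contMDiffAt.comp u (contMDiffAt_snd.comp u h)

theorem toCoframe_e {q : M} (hq : q ∈ T.V) : toCoframe T.e q = R.frame (T.s q) := by
  have h : ∀ θ : Coframe M, θ.pt = q → (⟨q, θ.lin⟩ : Coframe M) = θ := by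
    rintro ⟨x, f⟩ rfl
    rfl
  exact h _ (T.pt_s q hq)

theorem frame_eq {u : R.P} (hu : R.pt u ∈ T.V) :
    R.frame u = (toCoframe T.e (R.pt u)).scale (T.τ u)⁻¹ := by
  rw [toCoframe_e hu, ← R.frame_act, ← T.eq_act u hu]

theorem smoothAt_s {q : M} (hq : q ∈ T.V) : ContMDiffAt 𝓘(ℝ, E4) 𝓘(ℝ, E6) ∞ T.s q :=
  T.smooth_s.contMDiffAt (T.isOpen.mem_nhds hq)

theorem mder_pt_s {q : M} (hq : q ∈ T.V) :
    (mder E6 E4 R.pt (T.s q)).comp (mder E4 E6 T.s q) = ContinuousLinearMap.id ℝ E4 := by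
  rw [← mder_comp q ((R.smooth_pt _).mdifferentiableAt (by simp))
    ((smoothAt_s hq).mdifferentiableAt (by simp)), ← mder_id q]
  apply mder_congr
  filter_upwards [T.isOpen.mem_nhds hq] with y hy
  exact T.pt_s y hy

/-- The section is a right inverse of the projection, so pulling back the tautological forms along
it returns its own coframe. Smoothness of that coframe field follows from smoothness of the
tautological forms. -/
theorem frm_e {q : M} (hq : q ∈ T.V) (a : Fin 4) : frm T.e a q = pull E4 T.s (R.ta a) q := by
  refine ContinuousLinearMap.ext fun v => ?_
  have h := congrArg (fun D : E4 →L[ℝ] E4 => (R.frame (T.s q)).lin (D v) a) (mder_pt_s hq)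
  exact h.symm

theorem smooth_e {q : M} (hq : q ∈ T.V) (a : Fin 4) : SmoothFormAt (frm T.e a) q := by
  refine ((R.smoothFormAt_ta a (T.s q)).pullback (smoothAt_s hq)).congr ?_
  filter_upwards [T.isOpen.mem_nhds hq] with y hy
  exact frm_e hy a

theorem ta_eq_scaled {u : R.P} (hu : R.pt u ∈ T.V) (a : Fin 4) :
    R.ta a u = scaledForm R.pt T.x T.e a u := by
  have h := (congrArg (fun θ : Coframe M => θ.comp (mder E6 E4 R.pt u) a) (frame_eq hu)).trans
    (comp_scale T.e (R.pt u) _ _ a)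
  refine h.trans ?_
  fin_cases a <;> simp [torusWeight, scaledForm, x, pull]

theorem ta_eventuallyEq {u : R.P} (hu : R.pt u ∈ T.V) (a : Fin 4) :
    R.ta a =ᶠ[𝓝 u] scaledForm R.pt T.x T.e a := by
  filter_upwards [isOpen_domain.mem_nhds hu] with v hv
  exact ta_eq_scaled hv a

theorem τ_act {u : R.P} (hu : R.pt u ∈ T.V) (h : T2) : T.τ (R.act u h) = T.τ u * h := by
  apply R.act_injective (T.s (R.pt u))
  have h1 := T.eq_act (R.act u h) (by rwa [pt_act])
  rw [pt_act] at h1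
  rw [← act_act, ← T.eq_act u hu, ← h1]

end Triv

/-- Tangent vectors of the total space dual to the tautological forms exist. -/
theorem exists_dual (u : R.P) : ∃ X : Fin 4 → E6, ∀ a b, R.ta a u (X b) = if a = b then 1 else 0 := by
  obtain ⟨T, hu⟩ := R.exists_triv u
  set q := R.pt u with hq
  -- The local section is translated so as to pass through `u`; its derivative lifts the dual frame
  -- from the base.
  let G : M → R.P := fun y => R.act (T.s y) (T.τ u)
  have hG : ContMDiffAt 𝓘(ℝ, E4) 𝓘(ℝ, E6) ∞ G q :=
    (R.contMDiff_act_left (T.τ u) _).comp q (Triv.smoothAt_s hu)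
  have hGq : G q = u := (T.eq_act u hu).symm
  have h1 : (mder E6 E4 R.pt (G q)).comp (mder E4 E6 G q) = ContinuousLinearMap.id ℝ E4 := by
    rw [← mder_comp q ((R.smooth_pt _).mdifferentiableAt (by simp))
      (hG.mdifferentiableAt (by simp)), ← mder_id q]
    apply mder_congr
    filter_upwards [T.isOpen.mem_nhds hu] with y hy
    exact (pt_act R _ _).trans (T.pt_s y hy)
  rw [hGq] at h1
  refine ⟨fun b => mder E4 E6 G q (fvec (R.frame u).lin b), fun a b => ?_⟩
  have h2 := congrArg (fun D : E4 →L[ℝ] E4 => (R.frame u).lin (D (fvec (R.frame u).lin b)) a) h1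
  refine h2.trans ?_
  exact apply_fvec _ _ _

/-- Tangent vectors of the total space dual to the tautological forms. -/
noncomputable def dual (u : R.P) : Fin 4 → E6 := (R.exists_dual u).choose

theorem ta_dual (u : R.P) (a b : Fin 4) : R.ta a u (R.dual u b) = if a = b then 1 else 0 :=
  (R.exists_dual u).choose_spec a b

/-- A local trivialization around a point. -/
noncomputable def triv (u : R.P) : R.Triv := (R.exists_triv u).choose

theorem mem_triv (u : R.P) : R.pt u ∈ (R.triv u).V := (R.exists_triv u).choose_spec

/-- The connection forms. -/
noncomputable def Γ (A B : Fin 2) : R.P → E6 →L[ℝ] ℝ := fun u =>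
  scaledConn R.pt (R.triv u).x (conn (R.triv u).e) A B u

/-- The invariants `J`. -/
noncomputable def J (i : Fin 6) (u : R.P) : ℝ :=
  ![R.Γ 1 0 u (R.dual u 1), R.Γ 1 0 u (R.dual u 2), - R.Γ 0 1 u (R.dual u 0),
    R.Γ 0 1 u (R.dual u 3), R.Γ 0 1 u (R.dual u 2), R.Γ 0 1 u (R.dual u 1)] i

section Structure

variable {R} {g : BilinField M} {K : EndField M} {c : ℝ} {t : PetrovType}

theorem Triv.isAdaptedField (hF : F ⊆ F7 g K t) (T : R.Triv) : IsAdaptedField g K T.e T.V where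
  isOpen := T.isOpen
  smooth_e _ hq a := Triv.smooth_e hq a
  adapted q hq := by
    have h : toCoframe T.e q ∈ F7 g K t := by
      rw [Triv.toCoframe_e hq]
      exact hF (R.range_frame.subset (mem_range_self _))
    exact (mem_F7_iff.1 h).1

theorem Triv.rootAtZero (hF : F ⊆ F7 g K t) (T : R.Triv) (q : M) (hq : q ∈ T.V) :
    RootAtZero t (psi g (toCoframe T.e q)) := by
  have h : toCoframe T.e q ∈ F7 g K t := by
    rw [Triv.toCoframe_e hq]
    exact hF (R.range_frame.subset (mem_range_self _))
  exact (mem_F7_iff.1 h).2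

variable (h : IsParaKahlerEinstein g K) (hc : ∀ θ : Coframe M, Adapted g K θ → psi2' g θ = c)
  (hF : F ⊆ F7 g K t)
include h hc hF

theorem Triv.localStructure (T : R.Triv) : LocalStructure g K c T.e (conn T.e) T.V :=
  (T.isAdaptedField hF).localStructure h hc

theorem Triv.firstEquations (T : R.Triv) {u : R.P} (hu : R.pt u ∈ T.V) :
    FirstEquations R.ta (scaledConn R.pt T.x (conn T.e)) u :=
  (((T.localStructure h hc hF).first _ hu).scaled (R.smooth_proj u) (Triv.smoothAt_x hu)
    (fun i => T.x_ne_zero i u) (fun a => Triv.smooth_e hu a)).congr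
    (fun a => smoothFormAt_scaledForm (R.smooth_proj u) (Triv.smoothAt_x hu)
      (fun i => T.x_ne_zero i u) (fun a => Triv.smooth_e hu a) a)
    (Triv.ta_eventuallyEq hu) fun _ _ => rfl

/-- `Γ` is defined at each point through a trivialization chosen for that point. The first structure
equations determine the connection forms, so every trivialization containing the point gives the
same value; smoothness and differentiation near a point rest on this. -/
theorem Triv.Γ_eq (T : R.Triv) {u : R.P} (hu : R.pt u ∈ T.V) (A B : Fin 2) :
    R.Γ A B u = scaledConn R.pt T.x (conn T.e) A B u :=
  ((R.triv u).firstEquations h hc hF (R.mem_triv u)).unique (T.firstEquations h hc hF hu)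
    (R.ta_dual u) A B

theorem Triv.Γ_eventuallyEq (T : R.Triv) {u : R.P} (hu : R.pt u ∈ T.V) (A B : Fin 2) :
    R.Γ A B =ᶠ[𝓝 u] scaledConn R.pt T.x (conn T.e) A B := by
  filter_upwards [Triv.isOpen_domain.mem_nhds hu] with v hv
  exact T.Γ_eq h hc hF hv A B

theorem Triv.smoothFormAt_scaledConn (T : R.Triv) {u : R.P} (hu : R.pt u ∈ T.V) (A B : Fin 2) :
    SmoothFormAt (scaledConn R.pt T.x (conn T.e) A B) u :=
  PKE.smoothFormAt_scaledConn (R.smooth_proj u) (Triv.smoothAt_x hu) (fun i => T.x_ne_zero i u)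
    ((T.localStructure h hc hF).smooth_γ _ hu) A B

theorem smoothFormAt_Γ (A B : Fin 2) (u : R.P) : SmoothFormAt (R.Γ A B) u :=
  ((R.triv u).smoothFormAt_scaledConn h hc hF (R.mem_triv u) A B).congr
    ((R.triv u).Γ_eventuallyEq h hc hF (R.mem_triv u) A B)

theorem firstEquations (u : R.P) : FirstEquations R.ta R.Γ u :=
  ((R.triv u).firstEquations h hc hF (R.mem_triv u)).congr (fun a => R.smoothFormAt_ta a u)
    (fun _ => EventuallyEq.rfl) fun A B => (R.triv u).Γ_eq h hc hF (R.mem_triv u) A B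

theorem secondEquations (u : R.P) : SecondEquations R.ta R.Γ c (psi g (R.frame u)) u := by
  have hu := R.mem_triv u
  have L := (R.triv u).localStructure h hc hF
  refine ((L.second _ hu).scaled (R.smooth_proj u) (Triv.smoothAt_x hu)
    (fun i => (R.triv u).x_ne_zero i u) (L.smooth_γ _ hu)).congr
    ((R.triv u).smoothFormAt_scaledConn h hc hF hu) (fun a => Triv.ta_eq_scaled hu a)
    ((R.triv u).Γ_eventuallyEq h hc hF hu) ?_
  rw [Triv.frame_eq hu, psi_scale]
  rfl

end Structure

end TorusReduction

end Reduction

/-! ### The invariants `J` and the torus action on the connection forms -/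

section Reduction

variable {M : Type u} [TopologicalSpace M] [ChartedSpace E4 M] [IsManifold (𝓡 4) ∞ M]
  {F : Set (Coframe M)}

namespace TorusReduction

variable {R : TorusReduction F}

/-- The inverse weights of the tautological forms in the fibre coordinates. -/
noncomputable def Triv.weight (T : R.Triv) (a : Fin 4) (u : R.P) : ℝ :=
  ![T.x 0 u, T.x 1 u, (T.x 0 u)⁻¹, (T.x 1 u)⁻¹] a

/-- The coefficients of the pullback of a 1-form on the base. -/
noncomputable def Triv.coef (T : R.Triv) (β : M → E4 →L[ℝ] ℝ) (a : Fin 4) (u : R.P) : ℝ :=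
  T.weight a u * β (R.pt u) (vec T.e a (R.pt u))

/-- Pulled back forms are horizontal, hence combinations of the tautological forms; the weights undo
the rescaling by the fibre coordinates. -/
theorem Triv.pull_eq (T : R.Triv) (β : M → E4 →L[ℝ] ℝ) {u : R.P} (hu : R.pt u ∈ T.V) :
    pull E6 R.pt β u = ∑ a, T.coef β a u • R.ta a u := by
  refine ContinuousLinearMap.ext fun v => ?_
  have h0 := T.x_ne_zero 0 u
  have h1 := T.x_ne_zero 1 u
  have h2 := congrArg (β (R.pt u)) (sum_frm_smul_vec T.e (R.pt u) (mder E6 E4 R.pt u v))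
  rw [map_sum] at h2
  refine h2.symm.trans ?_
  rw [_root_.sum_apply]
  refine Finset.sum_congr rfl fun a _ => ?_
  rw [map_smul, _root_.smul_apply, Triv.ta_eq_scaled hu]
  fin_cases a <;> simp [Triv.coef, Triv.weight, scaledForm, pull] <;> field_simp

theorem Triv.smoothAt_coef (T : R.Triv) {β : M → E4 →L[ℝ] ℝ} {u : R.P} (hu : R.pt u ∈ T.V)
    (hβ : SmoothFormAt β (R.pt u)) (a : Fin 4) : SmoothAt E6 (T.coef β a) u := by
  have hx := Triv.smoothAt_x hu
  have hw : SmoothAt E6 (T.weight a) u := by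
    fin_cases a
    exacts [hx 0, hx 1, (hx 0).inv' (T.x_ne_zero 0 u), (hx 1).inv' (T.x_ne_zero 1 u)]
  have h1 := smoothAt_apply_vec hβ (fun a => Triv.smooth_e hu a) a
  exact hw.mul (ContMDiffAt.comp (g := fun x => β x (vec T.e a x)) u h1 (R.smooth_pt u))

variable {g : BilinField M} {K : EndField M} {c : ℝ} {t : PetrovType}
  (h : IsParaKahlerEinstein g K) (hc : ∀ θ : Coframe M, Adapted g K θ → psi2' g θ = c)
  (hF : F ⊆ F7 g K t)
include h hc hF

theorem Triv.Γ01_eq (T : R.Triv) {u : R.P} (hu : R.pt u ∈ T.V) :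
    R.Γ 0 1 u = ∑ a, (T.x 1 u * (T.x 0 u)⁻¹ * T.coef (conn T.e 0 1) a u) • R.ta a u := by
  refine (T.Γ_eq h hc hF hu 0 1).trans ?_
  show T.x 1 u • (T.x 0 u)⁻¹ • pull E6 R.pt (conn T.e 0 1) u = _
  rw [T.pull_eq _ hu, Finset.smul_sum, Finset.smul_sum]
  simp only [smul_smul, mul_assoc]

theorem Triv.Γ10_eq (T : R.Triv) {u : R.P} (hu : R.pt u ∈ T.V) :
    R.Γ 1 0 u = ∑ a, (T.x 0 u * (T.x 1 u)⁻¹ * T.coef (conn T.e 1 0) a u) • R.ta a u := by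
  refine (T.Γ_eq h hc hF hu 1 0).trans ?_
  show T.x 0 u • (T.x 1 u)⁻¹ • pull E6 R.pt (conn T.e 1 0) u = _
  rw [T.pull_eq _ hu, Finset.smul_sum, Finset.smul_sum]
  simp only [smul_smul, mul_assoc]

theorem Triv.Γ01_dual (T : R.Triv) {u : R.P} (hu : R.pt u ∈ T.V) (a : Fin 4) :
    R.Γ 0 1 u (R.dual u a) = T.x 1 u * (T.x 0 u)⁻¹ * T.coef (conn T.e 0 1) a u := by
  rw [T.Γ01_eq h hc hF hu, _root_.sum_apply]
  simp [ta_dual]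

theorem Triv.Γ10_dual (T : R.Triv) {u : R.P} (hu : R.pt u ∈ T.V) (a : Fin 4) :
    R.Γ 1 0 u (R.dual u a) = T.x 0 u * (T.x 1 u)⁻¹ * T.coef (conn T.e 1 0) a u := by
  rw [T.Γ10_eq h hc hF hu, _root_.sum_apply]
  simp [ta_dual]

/-- The dual vectors are chosen pointwise without any continuity. Their choice does not matter,
because `Γ¹₂` is a combination of the tautological forms with smooth coefficients. -/
theorem smoothAt_Γ01_dual (u : R.P) (a : Fin 4) :
    SmoothAt E6 (fun v => R.Γ 0 1 v (R.dual v a)) u := by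
  have hu := R.mem_triv u
  have hx := Triv.smoothAt_x hu
  have L := (R.triv u).localStructure h hc hF
  refine ContMDiffAt.congr_of_eventuallyEq (((hx 1).mul ((hx 0).inv' ((R.triv u).x_ne_zero 0 u))).mul
    ((R.triv u).smoothAt_coef hu (L.smooth_γ _ hu 0 1) a)) ?_
  filter_upwards [Triv.isOpen_domain.mem_nhds hu] with v hv
  exact (R.triv u).Γ01_dual h hc hF hv a

theorem smoothAt_Γ10_dual (u : R.P) (a : Fin 4) :
    SmoothAt E6 (fun v => R.Γ 1 0 v (R.dual v a)) u := by
  have hu := R.mem_triv u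
  have hx := Triv.smoothAt_x hu
  have L := (R.triv u).localStructure h hc hF
  refine ContMDiffAt.congr_of_eventuallyEq (((hx 0).mul ((hx 1).inv' ((R.triv u).x_ne_zero 1 u))).mul
    ((R.triv u).smoothAt_coef hu (L.smooth_γ _ hu 1 0) a)) ?_
  filter_upwards [Triv.isOpen_domain.mem_nhds hu] with v hv
  exact (R.triv u).Γ10_dual h hc hF hv a

theorem smooth_J (i : Fin 6) : ContMDiff 𝓘(ℝ, E6) 𝓘(ℝ, ℝ) ∞ (R.J i) := by
  intro u
  have h1 := smoothAt_Γ10_dual h hc hF u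
  have h2 := smoothAt_Γ01_dual h hc hF u
  fin_cases i
  exacts [h1 1, h1 2, (h2 0).neg, h2 3, h2 2, h2 1]

theorem reducedForms : R.ReducedForms R.Γ R.J := by
  intro u
  have hu := R.mem_triv u
  have L := (R.triv u).localStructure h hc hF
  obtain ⟨r0, r3⟩ := L.reduced ((R.triv u).rootAtZero hF) hu
  have e0 := (R.triv u).Γ10_eq h hc hF hu
  have e1 := (R.triv u).Γ01_eq h hc hF hu
  simp only [← (R.triv u).Γ10_dual h hc hF hu, ← (R.triv u).Γ01_dual h hc hF hu] at e0 e1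
  have z0 : R.Γ 1 0 u (R.dual u 0) = 0 := by
    rw [(R.triv u).Γ10_dual h hc hF hu]; simp [Triv.coef, r0]
  have z3 : R.Γ 1 0 u (R.dual u 3) = 0 := by
    rw [(R.triv u).Γ10_dual h hc hF hu]; simp [Triv.coef, r3]
  constructor
  · refine e0.trans ?_
    show _ = R.Γ 1 0 u (R.dual u 1) • R.ta 1 u + R.Γ 1 0 u (R.dual u 2) • R.ta 2 u
    rw [Fin.sum_univ_four, z0, z3]
    simp
  · refine e1.trans ?_
    show _ = - -R.Γ 0 1 u (R.dual u 0) • R.ta 0 u + R.Γ 0 1 u (R.dual u 1) • R.ta 1 u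
      + R.Γ 0 1 u (R.dual u 2) • R.ta 2 u + R.Γ 0 1 u (R.dual u 3) • R.ta 3 u
    rw [Fin.sum_univ_four, neg_neg]

omit hF in
theorem psi44_eq (hF : F ⊆ F7 g K .N) (u : R.P) :
    psi44 g (R.frame u) = R.J 1 u * psi g (R.frame u) 4 := by
  have hu := R.mem_triv u
  have L := (R.triv u).localStructure h hc hF
  have h0 := (R.triv u).x_ne_zero 0 u
  have h1 := (R.triv u).x_ne_zero 1 u
  have hJ : R.J 1 u = _ := (R.triv u).Γ10_dual h hc hF hu 2
  rw [hJ, Triv.frame_eq hu, psi44_scale, psi_scale, L.psi44_eq ((R.triv u).rootAtZero hF) hu]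
  show ((R.triv u).x 1 u)⁻¹ * ((R.triv u).x 1 u / (R.triv u).x 0 u) ^ 2 * _
    = (R.triv u).x 0 u * ((R.triv u).x 1 u)⁻¹ * (((R.triv u).x 0 u)⁻¹ * _)
      * (((R.triv u).x 1 u / (R.triv u).x 0 u) ^ 2 * _)
  field_simp

theorem structureEquations : R.StructureEquations g R.Γ := by
  have hpsi : ∀ u, psi2' g (R.frame u) = c := fun u =>
    hc _ (hF (R.range_frame.subset (mem_range_self _))).1
  have h1 := fun u => firstEquations (R := R) h hc hF u
  have h2 := fun u => secondEquations (R := R) h hc hF u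
  constructor <;> intro u v w
  · exact (h1 u).d0 v w
  · exact (h1 u).d1 v w
  · exact (h1 u).d2 v w
  · exact (h1 u).d3 v w
  · rw [hpsi]; exact (h2 u).d00 v w
  · rw [hpsi]; exact (h2 u).d01 v w
  · rw [hpsi]; exact (h2 u).d10 v w
  · rw [hpsi]; exact (h2 u).d11 v w

/-! ### The action of the torus on the connection forms -/

omit h hc hF in
theorem ta_act (a : Fin 4) (u : R.P) (k : T2) (v : E6) :
    R.ta a (R.act u k) (mder E6 E6 (fun x => R.act x k) u v)
      = ((torusWeight k⁻¹ a : ℝˣ) : ℝ) * R.ta a u v := by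
  have h1 : (mder E6 E4 R.pt (R.act u k)).comp (mder E6 E6 (fun x => R.act x k) u)
      = mder E6 E4 R.pt u := by
    rw [← mder_comp u ((R.smooth_pt _).mdifferentiableAt (by simp))
      ((R.contMDiff_act_left k u).mdifferentiableAt (by simp))]
    exact mder_congr (Eventually.of_forall fun x => R.pt_act x k)
  have h2 : R.ta a (R.act u k) (mder E6 E6 (fun x => R.act x k) u v)
      = (R.frame (R.act u k)).lin (mder E6 E4 R.pt u v) a :=
    congrArg (fun D : E6 →L[ℝ] E4 => (R.frame (R.act u k)).lin (D v) a) h1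
  refine h2.trans ?_
  rw [R.frame_act]
  exact mul_comm _ _

omit h hc hF in
theorem mder_pt_act (u : R.P) (k : T2) (v : E6) :
    mder E6 E4 R.pt (R.act u k) (mder E6 E6 (fun x => R.act x k) u v) = mder E6 E4 R.pt u v := by
  have h1 : (mder E6 E4 R.pt (R.act u k)).comp (mder E6 E6 (fun x => R.act x k) u)
      = mder E6 E4 R.pt u := by
    rw [← mder_comp u ((R.smooth_pt _).mdifferentiableAt (by simp))
      ((R.contMDiff_act_left k u).mdifferentiableAt (by simp))]
    exact mder_congr (Eventually.of_forall fun x => R.pt_act x k)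
  exact congrArg (fun D : E6 →L[ℝ] E4 => D v) h1

omit h hc hF in
theorem mder_pt_orbit (u : R.P) (k : ℝ × ℝ) :
    mder E6 E4 R.pt (R.act u (torusExp ((0 : ℝ) • k)))
      (mder ℝ E6 (fun s : ℝ => R.act u (torusExp (s • k))) 0 1) = 0 := by
  have h1 := mder_comp (E := ℝ) (G := R.pt) (F := fun s : ℝ => R.act u (torusExp (s • k))) 0
    ((R.smooth_pt _).mdifferentiableAt (by simp))
    ((R.contMDiff_orbit u k 0).mdifferentiableAt (by simp))
  have h2 : mder ℝ E4 (fun s : ℝ => R.pt (R.act u (torusExp (s • k)))) 0 = 0 := by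
    simp only [pt_act]
    exact mder_const _ _
  exact (congrArg (fun D : ℝ →L[ℝ] E4 => D 1) (h1.symm.trans h2))

omit h hc hF in
-- The action multiplies the fibre coordinate by a constant, which only adds a constant to its
-- logarithm.
theorem Triv.dLog_act (T : R.Triv) {u : R.P} (hu : R.pt u ∈ T.V) (k : T2) (v : E6) (i : Fin 2) :
    dLog (T.x i) (R.act u k) (mder E6 E6 (fun x => R.act x k) u v) = dLog (T.x i) u v := by
  have hu' : R.pt (R.act u k) ∈ T.V := by rwa [pt_act]
  have h1 := mder_comp (E := E6) (G := fun v => Real.log (T.x i v)) (F := fun x => R.act x k) u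
    (((Triv.smoothAt_x hu' i).log (T.x_ne_zero i _)).mdifferentiableAt (by simp))
    ((R.contMDiff_act_left k u).mdifferentiableAt (by simp))
  have h2 : mder E6 ℝ (fun z => Real.log (T.x i (R.act z k))) u = dLog (T.x i) u := by
    obtain ⟨κ, hκ⟩ : ∃ κ : ℝ, ∀ z, R.pt z ∈ T.V →
        Real.log (T.x i (R.act z k)) = Real.log (T.x i z) + κ := by
      fin_cases i
      · refine ⟨Real.log k.1, fun z hz => ?_⟩
        show Real.log ((T.τ (R.act z k)).1 : ℝ) = Real.log ((T.τ z).1 : ℝ) + _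
        rw [Triv.τ_act hz, Prod.fst_mul, Units.val_mul, Real.log_mul (Units.ne_zero _) (Units.ne_zero _)]
      · refine ⟨Real.log k.2, fun z hz => ?_⟩
        show Real.log ((T.τ (R.act z k)).2 : ℝ) = Real.log ((T.τ z).2 : ℝ) + _
        rw [Triv.τ_act hz, Prod.snd_mul, Units.val_mul, Real.log_mul (Units.ne_zero _) (Units.ne_zero _)]
    have h3 : (fun z => Real.log (T.x i (R.act z k))) =ᶠ[𝓝 u] fun z => Real.log (T.x i z) + κ := by
      filter_upwards [Triv.isOpen_domain.mem_nhds hu] with z hz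
      exact hκ z hz
    rw [mder_congr h3]
    have h4 := dForm_comp ((Triv.smoothAt_x hu i).log (T.x_ne_zero i u))
      ((hasDerivAt_id _).add_const κ)
    exact h4.trans (one_smul _ _)
  exact congrArg (fun D : E6 →L[ℝ] ℝ => D v) (h1.symm.trans h2)

/-- The diagonal forms are a pullback from the base plus a logarithmic differential, and both parts
are invariant; this reflects that the torus is abelian. -/
theorem Γ_act (A : Fin 2) (u : R.P) (k : T2) (v : E6) :
    R.Γ A A (R.act u k) (mder E6 E6 (fun x => R.act x k) u v) = R.Γ A A u v := by
  have hu := R.mem_triv u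
  have hu' : R.pt (R.act u k) ∈ (R.triv u).V := by rwa [pt_act]
  rw [(R.triv u).Γ_eq h hc hF hu, (R.triv u).Γ_eq h hc hF hu']
  fin_cases A
  · show conn (R.triv u).e 0 0 (R.pt (R.act u k)) (mder E6 E4 R.pt (R.act u k) _)
      + dLog ((R.triv u).x 0) (R.act u k) _
      = conn (R.triv u).e 0 0 (R.pt u) (mder E6 E4 R.pt u v) + dLog ((R.triv u).x 0) u v
    rw [mder_pt_act, (R.triv u).dLog_act hu, pt_act]
  · show conn (R.triv u).e 1 1 (R.pt (R.act u k)) (mder E6 E4 R.pt (R.act u k) _)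
      + dLog ((R.triv u).x 1) (R.act u k) _
      = conn (R.triv u).e 1 1 (R.pt u) (mder E6 E4 R.pt u v) + dLog ((R.triv u).x 1) u v
    rw [mder_pt_act, (R.triv u).dLog_act hu, pt_act]

omit h hc hF in
theorem ta_orbit (a : Fin 4) (u : R.P) (k : ℝ × ℝ) :
    R.ta a (R.act u (torusExp ((0 : ℝ) • k)))
      (mder ℝ E6 (fun s : ℝ => R.act u (torusExp (s • k))) 0 1) = 0 := by
  have h1 := congrArg (fun w => (R.frame (R.act u (torusExp ((0 : ℝ) • k)))).lin w a)
    (mder_pt_orbit u k)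
  refine h1.trans ?_
  simp

omit h hc hF in
theorem Triv.dLog_orbit (T : R.Triv) {u : R.P} (hu : R.pt u ∈ T.V) (k : ℝ × ℝ) (i : Fin 2) :
    dLog (T.x i) (R.act u (torusExp ((0 : ℝ) • k)))
      (mder ℝ E6 (fun s : ℝ => R.act u (torusExp (s • k))) 0 1) = ![k.1, k.2] i := by
  have hu' : R.pt (R.act u (torusExp ((0 : ℝ) • k))) ∈ T.V := by rwa [pt_act]
  have h1 := mder_comp (E := ℝ) (G := fun v => Real.log (T.x i v))
    (F := fun s : ℝ => R.act u (torusExp (s • k))) 0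
    (((Triv.smoothAt_x hu' i).log (T.x_ne_zero i _)).mdifferentiableAt (by simp))
    ((R.contMDiff_orbit u k 0).mdifferentiableAt (by simp))
  have h2 : (fun s : ℝ => Real.log (T.x i (R.act u (torusExp (s • k)))))
      = fun s => Real.log (T.x i u) + s * ![k.1, k.2] i := by
    funext s
    fin_cases i
    · show Real.log ((T.τ (R.act u _)).1 : ℝ) = Real.log ((T.τ u).1 : ℝ) + _
      rw [Triv.τ_act hu, Prod.fst_mul, Units.val_mul, Real.log_mul (Units.ne_zero _) (Units.ne_zero _)]
      simp [torusExp]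
    · show Real.log ((T.τ (R.act u _)).2 : ℝ) = Real.log ((T.τ u).2 : ℝ) + _
      rw [Triv.τ_act hu, Prod.snd_mul, Units.val_mul, Real.log_mul (Units.ne_zero _) (Units.ne_zero _)]
      simp [torusExp]
  have h3 : HasDerivAt (fun s : ℝ => Real.log (T.x i u) + s * ![k.1, k.2] i) (![k.1, k.2] i) 0 := by
    simpa using ((hasDerivAt_id (0 : ℝ)).mul_const (![k.1, k.2] i)).const_add (Real.log (T.x i u))
  rw [h2, mder_eq_fderiv, h3.hasFDerivAt.fderiv] at h1
  have h4 := congrArg (fun D : ℝ →L[ℝ] ℝ => D 1) h1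
  refine h4.symm.trans ?_
  simp

/-- The part pulled back from the base vanishes along an orbit, and the logarithm of the fibre
coordinate grows linearly with the exponential parameter. -/
theorem Γ_orbit (A : Fin 2) (u : R.P) (k : ℝ × ℝ) :
    R.Γ A A (R.act u (torusExp ((0 : ℝ) • k)))
      (mder ℝ E6 (fun s : ℝ => R.act u (torusExp (s • k))) 0 1) = ![k.1, k.2] A := by
  have hu := R.mem_triv u
  have hu' : R.pt (R.act u (torusExp ((0 : ℝ) • k))) ∈ (R.triv u).V := by rwa [pt_act]
  rw [(R.triv u).Γ_eq h hc hF hu', ← (R.triv u).dLog_orbit hu k A]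
  fin_cases A
  · show conn (R.triv u).e 0 0 _ (mder E6 E4 R.pt (R.act u _) _)
      + dLog ((R.triv u).x 0) (R.act u _) _ = dLog ((R.triv u).x 0) _ _
    rw [mder_pt_orbit, map_zero, zero_add]
  · show conn (R.triv u).e 1 1 _ (mder E6 E4 R.pt (R.act u _) _)
      + dLog ((R.triv u).x 1) (R.act u _) _ = dLog ((R.triv u).x 1) _ _
    rw [mder_pt_orbit, map_zero, zero_add]

end TorusReduction

end Reduction

/-! ### The Cartan connection and its curvature -/

section Cartan

variable {M : Type u} [TopologicalSpace M] [ChartedSpace E4 M] [IsManifold (𝓡 4) ∞ M]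
  {F : Set (Coframe M)}

namespace TorusReduction

variable {R : TorusReduction F}

/-- The matrix of forms `ℬ`, with entries in the dual of the model space. -/
noncomputable def cB (R : TorusReduction F) (c σ : ℝ) : Fin 4 → Fin 4 → R.P → E6 →L[ℝ] ℝ :=
  R.cartanB R.Γ c σ

/-- The length scale of the model. -/
noncomputable def rad (c : ℝ) : ℝ := Real.sqrt (3 / 2 * |c|)

theorem rad_ne_zero {c : ℝ} (hc : c ≠ 0) : rad c ≠ 0 :=
  (Real.sqrt_pos.2 (by have := abs_pos.2 hc; positivity)).ne'

/-- Here the condition that `σ` is the sign of `Ψ₂'` enters: it turns the absolute value under the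
square root into `c`. -/
theorem rad_sq {c σ : ℝ} (hσ : σ = 1 ∨ σ = -1) (hp : 0 < σ * c) : σ * rad c ^ 2 = 3 / 2 * c := by
  rw [rad, Real.sq_sqrt (by positivity)]
  rcases hσ with rfl | rfl
  · rw [abs_of_pos (by linarith)]; ring
  · rw [abs_of_neg (by linarith)]; ring

theorem matrixValue_cartanB (c σ : ℝ) (u : R.P) (v : E6) :
    matrixValue (R.cartanB R.Γ c σ) u v =
      !![1 / 2 * R.Γ 0 0 u v, rad c * R.ta 0 u v, 0, 0;
        σ * rad c * R.ta 2 u v, -1 / 2 * R.Γ 0 0 u v, 0, 0;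
        0, 0, 1 / 2 * R.Γ 1 1 u v, rad c * R.ta 1 u v;
        0, 0, σ * rad c * R.ta 3 u v, -1 / 2 * R.Γ 1 1 u v] := by
  ext i j
  fin_cases i <;> fin_cases j <;> rfl

theorem torusAd_inv (k : T2) (a b a' b' p q p' q' : ℝ) :
    torusAd k⁻¹ !![a, b, 0, 0; p, q, 0, 0; 0, 0, a', b'; 0, 0, p', q'] =
      !![a, ((k.1⁻¹ : ℝˣ) : ℝ) * b, 0, 0; k.1 * p, q, 0, 0; 0, 0, a', ((k.2⁻¹ : ℝˣ) : ℝ) * b';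
        0, 0, k.2 * p', q'] := by
  have h1 := k.1.ne_zero
  have h2 := k.2.ne_zero
  ext i j
  fin_cases i <;> fin_cases j <;>
    simp [torusAd, Matrix.mul_apply, Fin.sum_univ_four, Matrix.diagonal, Matrix.vecMul] <;>
    (try field_simp)

variable {g : BilinField M} {K : EndField M} {c : ℝ} {t : PetrovType}
  (h : IsParaKahlerEinstein g K) (hc : ∀ θ : Coframe M, Adapted g K θ → psi2' g θ = c)
  (hF : F ⊆ F7 g K t)
include h hc hF

theorem exists_vertical (u : R.P) (k : ℝ × ℝ) :
    ∃ ξ : E6, (∀ a, R.ta a u ξ = 0) ∧ R.Γ 0 0 u ξ = k.1 ∧ R.Γ 1 1 u ξ = k.2 := by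
  have hw : R.act u (torusExp ((0 : ℝ) • k)) = u := by
    apply R.frame_injective
    have h1 : torusExp ((0 : ℝ) • k) = 1 := by
      refine Prod.ext (Units.ext ?_) (Units.ext ?_) <;> simp [torusExp]
    rw [R.frame_act, h1, inv_one, scale_one]
  have h1 := fun a => ta_orbit a u k
  have h2 := Γ_orbit h hc hF 0 u k
  have h3 := Γ_orbit h hc hF 1 u k
  rw [hw] at h2 h3
  simp only [hw] at h1
  exact ⟨_, h1, h2, h3⟩

/-- The tautological forms separate horizontal directions and the diagonal connection forms separate
vertical ones. So the map is onto, and both spaces have dimension six. -/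
theorem bijective_forms (u : R.P) :
    Function.Bijective (fun v : E6 => ((fun a => R.ta a u v, (R.Γ 0 0 u v, R.Γ 1 1 u v)) :
      (Fin 4 → ℝ) × (ℝ × ℝ))) := by
  let L : E6 →ₗ[ℝ] (Fin 4 → ℝ) × (ℝ × ℝ) :=
    (LinearMap.pi fun a => (R.ta a u : E6 →ₗ[ℝ] ℝ)).prod
      ((R.Γ 0 0 u : E6 →ₗ[ℝ] ℝ).prod (R.Γ 1 1 u : E6 →ₗ[ℝ] ℝ))
  have hs : Function.Surjective L := by
    rintro ⟨p, k⟩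
    set v₀ : E6 := ∑ a, p a • R.dual u a with hv₀
    have h0 : ∀ a, R.ta a u v₀ = p a := fun a => by
      rw [hv₀, map_sum]
      simp [ta_dual]
    obtain ⟨ξ, h1, h2, h3⟩ := exists_vertical h hc hF u
      (k.1 - R.Γ 0 0 u v₀, k.2 - R.Γ 1 1 u v₀)
    refine ⟨v₀ + ξ, ?_⟩
    show ((fun a => R.ta a u (v₀ + ξ)), (R.Γ 0 0 u (v₀ + ξ), R.Γ 1 1 u (v₀ + ξ))) = (p, k)
    simp only [map_add, h0, h1, h2, h3, add_zero, add_sub_cancel]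
  have hd : Module.finrank ℝ E6 = Module.finrank ℝ ((Fin 4 → ℝ) × (ℝ × ℝ)) := by simp [E6, E4]
  exact ⟨(LinearMap.injective_iff_surjective_of_finrank_eq_finrank hd).2 hs, hs⟩

theorem isCartanConnection (hc0 : c ≠ 0) {σ : ℝ} (hσ : σ = 1 ∨ σ = -1) :
    R.IsCartanConnection (R.cartanB R.Γ c σ) := by
  have hr := rad_ne_zero hc0
  have hs0 : σ ≠ 0 := by rcases hσ with rfl | rfl <;> norm_num
  have hsr : σ * rad c ≠ 0 := mul_ne_zero hs0 hr
  refine ⟨fun i j => ?_, fun u => ⟨?_, ?_, ?_⟩, fun u k v => ?_, fun u k => ?_⟩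
  · have hΓ := fun A u => smoothFormAt_Γ (R := R) h hc hF A A u
    have hz : SmoothForm (E := E6) (N := R.P) (0 : Form1 E6 R.P) :=
      smoothForm_iff.2 fun u => SmoothFormAt.zero
    fin_cases i <;> fin_cases j
    exacts [smoothForm_iff.2 fun u => (hΓ 0 u).const_smul _,
      smoothForm_iff.2 fun u => (R.smoothFormAt_ta 0 u).const_smul _, hz, hz,
      smoothForm_iff.2 fun u => (R.smoothFormAt_ta 2 u).const_smul _,
      smoothForm_iff.2 fun u => (hΓ 0 u).const_smul _, hz, hz, hz, hz,
      smoothForm_iff.2 fun u => (hΓ 1 u).const_smul _,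
      smoothForm_iff.2 fun u => (R.smoothFormAt_ta 1 u).const_smul _, hz, hz,
      smoothForm_iff.2 fun u => (R.smoothFormAt_ta 3 u).const_smul _,
      smoothForm_iff.2 fun u => (hΓ 1 u).const_smul _]
  · intro v _
    have hv := matrixValue_cartanB (R := R) c σ u v
    refine Set.mem_of_eq_of_mem hv ⟨?_, ?_, ?_⟩
    · intro i j hij
      fin_cases i <;> fin_cases j <;> simp at hij ⊢
    · simp; ring
    · simp; ring
  · intro v _ w _ hvw
    have h1 := (matrixValue_cartanB (R := R) c σ u v).symm.trans
      (hvw.trans (matrixValue_cartanB (R := R) c σ u w))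
    apply (bijective_forms h hc hF u).1
    have a0 := congrFun (congrFun h1 0) 1
    have a1 := congrFun (congrFun h1 2) 3
    have a2 := congrFun (congrFun h1 1) 0
    have a3 := congrFun (congrFun h1 3) 2
    have b0 := congrFun (congrFun h1 0) 0
    have b1 := congrFun (congrFun h1 2) 2
    simp at a0 a1 a2 a3 b0 b1
    refine Prod.ext (funext fun a => ?_) (Prod.ext ?_ ?_)
    · fin_cases a
      exacts [a0.resolve_right hr, a1.resolve_right hr,
        a2.resolve_right (not_or.2 ⟨hs0, hr⟩), a3.resolve_right (not_or.2 ⟨hs0, hr⟩)]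
    · exact b0
    · exact b1
  · rintro X ⟨hX, hX1, hX2⟩
    obtain ⟨v, hv⟩ := (bijective_forms h hc hF u).2
      (![X 0 1 / rad c, X 2 3 / rad c, X 1 0 / (σ * rad c), X 3 2 / (σ * rad c)],
        (2 * X 0 0, 2 * X 2 2))
    refine ⟨v, mem_univ _, (matrixValue_cartanB (R := R) c σ u v).trans ?_⟩
    have a : ∀ a, R.ta a u v = _ := congrFun (congrArg Prod.fst hv)
    have b0 : R.Γ 0 0 u v = _ := congrArg (fun z => z.2.1) hv
    have b1 : R.Γ 1 1 u v = _ := congrArg (fun z => z.2.2) hv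
    rw [a, a, a, a, b0, b1]
    ext i j
    fin_cases i <;> fin_cases j <;> simp [hX]
    · field_simp
    · field_simp
    · linarith
    · field_simp
    · field_simp
    · linarith
  · refine (matrixValue_cartanB (R := R) c σ _ _).trans ?_
    refine Eq.trans ?_ (congrArg (torusAd k⁻¹) (matrixValue_cartanB (R := R) c σ u v)).symm
    rw [torusAd_inv]
    have t0 := ta_act (R := R) 0 u k v
    have t1 := ta_act (R := R) 1 u k v
    have t2 := ta_act (R := R) 2 u k v
    have t3 := ta_act (R := R) 3 u k v
    have g0 := Γ_act (R := R) h hc hF 0 u k v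
    have g1 := Γ_act (R := R) h hc hF 1 u k v
    simp only [torusWeight_inv, torusWeight, Matrix.cons_val, inv_inv] at t0 t1 t2 t3
    erw [t0, t1, t2, t3, g0, g1]
    ext i j
    fin_cases i <;> fin_cases j <;> simp [mul_left_comm]
  · refine (matrixValue_cartanB (R := R) c σ _ _).trans ?_
    have t := fun a => ta_orbit (R := R) a u k
    have g0 := Γ_orbit (R := R) h hc hF 0 u k
    have g1 := Γ_orbit (R := R) h hc hF 1 u k
    erw [t 0, t 1, t 2, t 3, g0, g1]
    ext i j
    fin_cases i <;> fin_cases j <;> simp [torusLie, Matrix.diagonal] <;> ring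

/-- The curvature of `ℬ`. -/
theorem cartan_curvature (σ : ℝ) (u : R.P) (v w : E6) (i j : Fin 4) :
    xD (R.cB c σ i j) u v w + ∑ k, wdg (R.cB c σ i k) (R.cB c σ k j) u v w =
      (!![1 / 2 * xD (R.Γ 0 0) u v w + σ * rad c ^ 2 * wdg (R.ta 0) (R.ta 2) u v w,
          - rad c * wdg (R.Γ 0 1) (R.ta 1) u v w, 0, 0;
        σ * rad c * wdg (R.Γ 1 0) (R.ta 3) u v w,
          - (1 / 2 * xD (R.Γ 0 0) u v w + σ * rad c ^ 2 * wdg (R.ta 0) (R.ta 2) u v w), 0, 0;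
        0, 0, 1 / 2 * xD (R.Γ 1 1) u v w + σ * rad c ^ 2 * wdg (R.ta 1) (R.ta 3) u v w,
          - rad c * wdg (R.Γ 1 0) (R.ta 0) u v w;
        0, 0, σ * rad c * wdg (R.Γ 0 1) (R.ta 2) u v w,
          - (1 / 2 * xD (R.Γ 1 1) u v w + σ * rad c ^ 2 * wdg (R.ta 1) (R.ta 3) u v w)] :
        Matrix (Fin 4) (Fin 4) ℝ) i j := by
  -- In an off-diagonal entry the product terms cancel the diagonal part of the first structure
  -- equation and leave its torsion-like term, such as `Γ¹₂ ∧ α²`. In a diagonal entry they add a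
  -- multiple of `αᴬ ∧ ᾱᴬ` to `½ dΓᴬ_A`.
  have E := firstEquations (R := R) h hc hF u
  have d : ∀ a k, xD (fun x => k • R.ta a x) u v w = k * xD (R.ta a) u v w := fun a k =>
    xD_const_smul (R.smoothFormAt_ta a u) k v w
  have d' : ∀ A k, xD (fun x => k • R.Γ A A x) u v w = k * xD (R.Γ A A) u v w := fun A k =>
    xD_const_smul (smoothFormAt_Γ h hc hF A A u) k v w
  have z : xD (fun _ : R.P => (0 : E6 →L[ℝ] ℝ)) u v w = 0 := xD_zero u v w
  have hB : R.cB c σ = (!![fun x => (1 / 2 : ℝ) • R.Γ 0 0 x, fun x => rad c • R.ta 0 x, fun _ => 0, fun _ => 0;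
     fun x => (σ * rad c) • R.ta 2 x, fun x => (-1 / 2 : ℝ) • R.Γ 0 0 x, fun _ => 0, fun _ => 0;
     fun _ => 0, fun _ => 0, fun x => (1 / 2 : ℝ) • R.Γ 1 1 x, fun x => rad c • R.ta 1 x;
     fun _ => 0, fun _ => 0, fun x => (σ * rad c) • R.ta 3 x, fun x => (-1 / 2 : ℝ) • R.Γ 1 1 x] :
     Matrix (Fin 4) (Fin 4) (R.P → E6 →L[ℝ] ℝ)) := rfl
  rw [hB, Fin.sum_univ_four]
  fin_cases i <;> fin_cases j <;>
    simp only [Fin.mk_zero, Fin.mk_one, Fin.reduceFinMk, Fin.isValue, Fin.zero_eta, Matrix.of_apply, Matrix.cons_val, d, d', z, E.d0, E.d1, E.d2, E.d3, wdg, _root_.smul_apply,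
      _root_.zero_apply, smul_eq_mul] <;> ring

end TorusReduction

end Cartan

/-! ### Flatness of the Cartan connection -/

section Flatness

variable {M : Type u} [TopologicalSpace M] [ChartedSpace E4 M] [IsManifold (𝓡 4) ∞ M]
  {F : Set (Coframe M)}

namespace TorusReduction

variable {R : TorusReduction F} {g : BilinField M} {K : EndField M} {c : ℝ} {t : PetrovType}
  (h : IsParaKahlerEinstein g K) (hc : ∀ θ : Coframe M, Adapted g K θ → psi2' g θ = c)
  (hF : F ⊆ F7 g K t)
include h hc hF

omit h hc in
theorem psi_eq_zero (u : R.P) : psi g (R.frame u) 0 = 0 ∧ psi g (R.frame u) 1 = 0 :=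
  ⟨(hF (R.range_frame.subset (mem_range_self u))).2.1,
    (hF (R.range_frame.subset (mem_range_self u))).2.2.1⟩

theorem Γ_eq_zero_of_J (hJ : ∀ u i, R.J i u = 0) : R.Γ 1 0 = (fun _ => 0) ∧ R.Γ 0 1 = fun _ => 0 := by
  have hr := reducedForms (R := R) h hc hF
  have h1 : ∀ u, R.Γ 1 0 u = R.J 0 u • R.ta 1 u + R.J 1 u • R.ta 2 u := fun u => (hr u).1
  have h2 : ∀ u, R.Γ 0 1 u = - R.J 2 u • R.ta 0 u + R.J 5 u • R.ta 1 u + R.J 4 u • R.ta 2 u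
      + R.J 3 u • R.ta 3 u := fun u => (hr u).2
  simp only [hJ, neg_zero, zero_smul, add_zero] at h1 h2
  exact ⟨funext h1, funext h2⟩

theorem flat_iff_curvature (σ : ℝ) : Flat (R.cartanB R.Γ c σ) ↔ ∀ (u : R.P) (v w : E6),
    1 / 2 * xD (R.Γ 0 0) u v w + σ * rad c ^ 2 * wdg (R.ta 0) (R.ta 2) u v w = 0 ∧
    1 / 2 * xD (R.Γ 1 1) u v w + σ * rad c ^ 2 * wdg (R.ta 1) (R.ta 3) u v w = 0 ∧
    rad c * wdg (R.Γ 0 1) (R.ta 1) u v w = 0 ∧ σ * rad c * wdg (R.Γ 1 0) (R.ta 3) u v w = 0 ∧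
    rad c * wdg (R.Γ 1 0) (R.ta 0) u v w = 0 ∧ σ * rad c * wdg (R.Γ 0 1) (R.ta 2) u v w = 0 := by
  have hC := cartan_curvature (R := R) h hc hF σ
  constructor
  · intro hf u v w
    have hf' := fun i j => (hC u v w i j).symm.trans (hf u v w i j)
    refine ⟨hf' 0 0, hf' 2 2, ?_, hf' 1 0, ?_, hf' 3 2⟩
    · simpa using hf' 0 1
    · simpa using hf' 2 3
  · intro hf u v w i j
    refine (hC u v w i j).trans ?_
    obtain ⟨h1, h2, h3, h4, h5, h6⟩ := hf u v w
    rw [h1, h2, h4, h6, neg_mul, neg_mul, h3, h5]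
    fin_cases i <;> fin_cases j <;> simp

/-- Flatness off the diagonal makes `Γ¹₂` and `Γ²₁` have zero wedge products with enough
tautological forms to annihilate every `Jᵢ`. Then `Γ¹₂ = 0`, so its structure equation gives `Ψ₄ =
0`. The coefficient of `α¹ ∧ ᾱ¹` in the first diagonal entry is `½(-2c - Ψ₂) + 3c/2`, which vanishes
for `Ψ₂ = c`. -/
theorem flat_iff (hc0 : c ≠ 0) {σ : ℝ} (hσ : σ = 1 ∨ σ = -1) (hp : 0 < σ * c) :
    Flat (R.cartanB R.Γ c σ) ↔ ∀ u, (∀ i, R.J i u = 0) ∧ psi g (R.frame u) 4 = 0 ∧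
      psi g (R.frame u) 2 = c := by
  have hr := rad_ne_zero hc0
  have hs0 : σ ≠ 0 := by rcases hσ with rfl | rfl <;> norm_num
  have hsq := rad_sq hσ hp
  have hS := secondEquations (R := R) h hc hF
  have hd := R.ta_dual
  rw [flat_iff_curvature h hc hF]
  constructor
  · intro hf
    have hJ : ∀ u i, R.J i u = 0 := by
      intro u
      have k1 := fun v w => (mul_eq_zero.1 (hf u v w).2.2.1).resolve_left hr
      have k2 := fun v w => (mul_eq_zero.1 (hf u v w).2.2.2.1).resolve_left (mul_ne_zero hs0 hr)
      have k3 := fun v w => (mul_eq_zero.1 (hf u v w).2.2.2.2.2).resolve_left (mul_ne_zero hs0 hr)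
      have a0 := k2 (R.dual u 1) (R.dual u 3)
      have a1 := k2 (R.dual u 2) (R.dual u 3)
      have a2 := k1 (R.dual u 0) (R.dual u 1)
      have a3 := k1 (R.dual u 3) (R.dual u 1)
      have a4 := k1 (R.dual u 2) (R.dual u 1)
      have a5 := k3 (R.dual u 1) (R.dual u 2)
      simp [wdg, hd] at a0 a1 a2 a3 a4 a5
      intro i
      fin_cases i
      exacts [a0, a1, neg_eq_zero.2 a2, a3, a4, a5]
    obtain ⟨z1, z2⟩ := Γ_eq_zero_of_J h hc hF hJ
    intro u
    refine ⟨hJ u, ?_, ?_⟩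
    · have h1 := (hS u).d01 (R.dual u 1) (R.dual u 2)
      rw [z2, xD_zero] at h1
      simp [wdg, hd] at h1
      exact h1
    · have h1 := (hS u).d00 (R.dual u 0) (R.dual u 2)
      have h2 := (hf u (R.dual u 0) (R.dual u 2)).1
      rw [h1, z1, z2, hsq] at h2
      simp [wdg, hd] at h2
      linarith
  · intro hf u v w
    obtain ⟨z1, z2⟩ := Γ_eq_zero_of_J h hc hF fun u => (hf u).1
    have p1 := (psi_eq_zero (R := R) hF u).2
    obtain ⟨-, p4, p2⟩ := hf u
    -- The vanishing of `Ψ₃` is not assumed: it is the coefficient of `α¹ ∧ ᾱ¹`, up to sign, in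
    -- `dΓ¹₂ = 0`.
    have p3 : psi g (R.frame u) 3 = 0 := by
      have h1 := (hS u).d01 (R.dual u 0) (R.dual u 2)
      rw [z2, xD_zero] at h1
      simp [wdg, hd] at h1
      exact h1
    rw [(hS u).d00, (hS u).d11, hsq, z1, z2, p1, p2, p3]
    refine ⟨?_, ?_, ?_, ?_, ?_, ?_⟩ <;> simp [wdg] <;> ring

/-- Only `Ψ₂ = c` survives, so the quartic is `6c x²y²`, with its double roots on the two axes. -/
theorem hasPetrovType_of_flat (hc0 : c ≠ 0) {σ : ℝ} (hσ : σ = 1 ∨ σ = -1) (hp : 0 < σ * c)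
    (hf : Flat (R.cartanB R.Γ c σ)) (u : R.P) : HasPetrovType g K (R.frame u).pt .D := by
  obtain ⟨-, p4, p2⟩ := (flat_iff h hc hF hc0 hσ hp).1 hf u
  obtain ⟨p0, p1⟩ := psi_eq_zero (R := R) hF u
  have hS := secondEquations (R := R) h hc hF
  obtain ⟨z1, z2⟩ := Γ_eq_zero_of_J h hc hF fun u => ((flat_iff h hc hF hc0 hσ hp).1 hf u).1
  have p3 : psi g (R.frame u) 3 = 0 := by
    have h1 := (hS u).d01 (R.dual u 0) (R.dual u 2)
    rw [z2, xD_zero] at h1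
    simp [wdg, R.ta_dual] at h1
    exact h1
  refine ⟨R.frame u, rfl, (hF (R.range_frame.subset (mem_range_self u))).1, 6 * c, (1, 0), (0, 1),
    mul_ne_zero (by norm_num) hc0, by simp [Indep], fun x y => ?_⟩
  simp only [quartic, lin, p0, p1, p2, p3, p4]
  ring

end TorusReduction

end Flatness

/-! ### The model algebra and its maximal torus -/

section Model

attribute [local instance] LieRing.ofAssociativeRing LieAlgebra.ofAssociativeAlgebra

/-- A block-diagonal matrix with traceless blocks. -/
def blockMat (x : Fin 6 → ℝ) : Matrix (Fin 4) (Fin 4) ℝ :=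
  !![x 0, x 1, 0, 0; x 2, -x 0, 0, 0; 0, 0, x 3, x 4; 0, 0, x 5, -x 3]

/-- The corresponding skew-adjoint matrix. -/
def skewMat (x : Fin 6 → ℝ) : Matrix (Fin 4) (Fin 4) ℝ :=
  !![x 0 + x 3, x 1, 0, x 4; x 2, -x 0 + x 3, -x 4, 0; 0, -x 5, -x 0 - x 3, -x 2;
    x 5, 0, -x 1, x 0 - x 3]

theorem blockMat_mem (x : Fin 6 → ℝ) : blockMat x ∈ blockAlg := by
  refine ⟨fun i j hij => ?_, ?_, ?_⟩
  · fin_cases i <;> fin_cases j <;> simp [blockMat] at hij ⊢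
  · simp [blockMat]
  · simp [blockMat]

theorem skewMat_mem (x : Fin 6 → ℝ) :
    skewMat x ∈ skewAdjointMatricesLieSubalgebra splitMetric := by
  rw [mem_skewAdjointMatricesLieSubalgebra, mem_skewAdjointMatricesSubmodule]
  show _ * _ = _ * _
  ext i j
  fin_cases i <;> fin_cases j <;>
    simp [skewMat, splitMetric, Matrix.mul_apply, Fin.sum_univ_four] <;> ring

/-- The coordinates of a block-diagonal matrix. -/
def blockCoord (X : Matrix (Fin 4) (Fin 4) ℝ) : Fin 6 → ℝ :=
  ![X 0 0, X 0 1, X 1 0, X 2 2, X 2 3, X 3 2]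

/-- The coordinates of a skew-adjoint matrix. -/
noncomputable def skewCoord (Y : Matrix (Fin 4) (Fin 4) ℝ) : Fin 6 → ℝ :=
  ![(Y 0 0 - Y 1 1) / 2, Y 0 1, Y 1 0, (Y 0 0 + Y 1 1) / 2, Y 0 3, Y 3 0]

theorem blockMat_blockCoord {X : Matrix (Fin 4) (Fin 4) ℝ} (hX : X ∈ blockAlg) :
    blockMat (blockCoord X) = X := by
  obtain ⟨h0, h1, h2⟩ := hX
  ext i j
  fin_cases i <;> fin_cases j <;> simp [blockMat, blockCoord, h0]
  · linarith
  · linarith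

theorem skewMat_skewCoord {Y : Matrix (Fin 4) (Fin 4) ℝ}
    (hY : Y ∈ skewAdjointMatricesLieSubalgebra splitMetric) : skewMat (skewCoord Y) = Y := by
  rw [mem_skewAdjointMatricesLieSubalgebra, mem_skewAdjointMatricesSubmodule] at hY
  have h : Yᵀ * splitMetric = splitMetric * -Y := hY
  have e : ∀ i j, (Yᵀ * splitMetric) i j = (splitMetric * -Y) i j := fun i j => by rw [h]
  have e00 := e 0 0; have e01 := e 0 1; have e02 := e 0 2; have e03 := e 0 3
  have e11 := e 1 1; have e12 := e 1 2; have e13 := e 1 3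
  have e22 := e 2 2; have e23 := e 2 3; have e33 := e 3 3
  simp [splitMetric, Matrix.mul_apply, Fin.sum_univ_four] at e00 e01 e02 e03 e11 e12 e13 e22 e23 e33
  ext i j
  fin_cases i <;> fin_cases j <;> simp [skewMat, skewCoord] <;> linarith

/-- The Lie bracket of `𝔰𝔩₂ ⊕ 𝔰𝔩₂` in coordinates. -/
def lieCoord (x y : Fin 6 → ℝ) : Fin 6 → ℝ :=
  ![x 1 * y 2 - y 1 * x 2, 2 * (x 0 * y 1 - y 0 * x 1), 2 * (x 2 * y 0 - x 0 * y 2),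
    x 4 * y 5 - y 4 * x 5, 2 * (x 3 * y 4 - y 3 * x 4), 2 * (x 5 * y 3 - x 3 * y 5)]

theorem lie_blockMat (x y : Fin 6 → ℝ) : ⁅blockMat x, blockMat y⁆ = blockMat (lieCoord x y) := by
  rw [Ring.lie_def]
  ext i j
  rw [Matrix.sub_apply, Matrix.mul_apply, Matrix.mul_apply, Fin.sum_univ_four, Fin.sum_univ_four]
  fin_cases i <;> fin_cases j <;> simp [blockMat, lieCoord] <;> ring

/-- The first summand is `sl₂` inside `gl₂` acting by `diag(A, -Aᵀ)`. The second is spanned by the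
scalar part of `gl₂` and the two skew off-diagonal blocks. The two summands commute, so the brackets
have the same coordinates as for block-diagonal matrices. -/
theorem lie_skewMat (x y : Fin 6 → ℝ) : ⁅skewMat x, skewMat y⁆ = skewMat (lieCoord x y) := by
  rw [Ring.lie_def]
  ext i j
  rw [Matrix.sub_apply, Matrix.mul_apply, Matrix.mul_apply, Fin.sum_univ_four, Fin.sum_univ_four]
  fin_cases i <;> fin_cases j <;> simp [skewMat, lieCoord] <;> ring

theorem blockCoord_blockMat (x : Fin 6 → ℝ) : blockCoord (blockMat x) = x := by
  funext i
  fin_cases i <;> rfl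

/-- The isomorphism `𝔰𝔩₂ ⊕ 𝔰𝔩₂ ≅ 𝔰𝔬₂,₂`. -/
noncomputable def blockEquiv : blockAlg ≃ₗ⁅ℝ⁆ skewAdjointMatricesLieSubalgebra splitMetric where
  toFun X := ⟨skewMat (blockCoord X), skewMat_mem _⟩
  invFun Y := ⟨blockMat (skewCoord Y), blockMat_mem _⟩
  map_add' X Y := by
    apply Subtype.ext
    ext i j
    fin_cases i <;> fin_cases j <;> simp [skewMat, blockCoord] <;> ring
  map_smul' k X := by
    apply Subtype.ext
    ext i j
    fin_cases i <;> fin_cases j <;> simp [skewMat, blockCoord] <;> ring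
  map_lie' := by
    intro X Y
    apply Subtype.ext
    obtain ⟨X, hX⟩ := X
    obtain ⟨Y, hY⟩ := Y
    obtain ⟨x, rfl⟩ : ∃ x, X = blockMat x := ⟨_, (blockMat_blockCoord hX).symm⟩
    obtain ⟨y, rfl⟩ : ∃ y, Y = blockMat y := ⟨_, (blockMat_blockCoord hY).symm⟩
    show skewMat (blockCoord ⁅blockMat x, blockMat y⁆)
      = ⁅skewMat (blockCoord (blockMat x)), skewMat (blockCoord (blockMat y))⁆
    rw [lie_blockMat, blockCoord_blockMat, blockCoord_blockMat, blockCoord_blockMat, lie_skewMat]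
  left_inv X := by
    apply Subtype.ext
    refine Eq.trans ?_ (blockMat_blockCoord X.2)
    refine congrArg blockMat (funext fun i => ?_)
    fin_cases i <;> simp [skewMat, skewCoord, blockCoord]
    ring
  right_inv Y := by
    apply Subtype.ext
    refine Eq.trans ?_ (skewMat_skewCoord Y.2)
    refine congrArg skewMat (funext fun i => ?_)
    fin_cases i <;> simp [blockMat, skewCoord, blockCoord]

theorem torusModel : TorusModel := by
  refine ⟨fun h => ⟨?_, ?_⟩, fun h h' hh => ?_, fun h h' => ?_, fun X hX hXc => ?_, blockEquiv, fun X => ?_⟩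
  · ext i j
    fin_cases i <;> fin_cases j <;>
      simp [torusMatrix, splitMetric, torusWeight, Matrix.mul_apply, Fin.sum_univ_four,
        Matrix.diagonal]
  · rw [torusMatrix, Matrix.det_diagonal, Fin.prod_univ_four]
    have h1 := h.1.ne_zero
    have h2 := h.2.ne_zero
    simp [torusWeight]
    field_simp
  · have h1 := congrFun (congrFun hh 0) 0
    have h2 := congrFun (congrFun hh 1) 1
    simp [torusMatrix, torusWeight] at h1 h2
    exact Prod.ext (Units.ext h1) (Units.ext h2)
  · rw [torusMatrix, torusMatrix, torusMatrix, Matrix.diagonal_mul_diagonal]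
    congr 1
    funext a
    rw [torusWeight_mul, Units.val_mul]
  · have hd : ∀ i j, i ≠ j → X i j = 0 := by
      intro i j hij
      -- The weights `2, 3, 1/2, 1/3` of this element are distinct, so whatever commutes with it is
      -- diagonal.
      have h1 := congrFun (congrFun (hXc (Units.mk0 2 two_ne_zero, Units.mk0 3 three_ne_zero)) i) j
      rw [torusMatrix, Matrix.mul_diagonal, Matrix.diagonal_mul] at h1
      fin_cases i <;> fin_cases j <;> simp [torusWeight] at hij h1 ⊢ <;> linarith
    have e : ∀ i j, (Xᵀ * splitMetric * X) i j = splitMetric i j := fun i j => by rw [hX.1]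
    have e02 := e 0 2
    have e13 := e 1 3
    -- For a diagonal matrix, preserving the split metric means that opposite entries are mutually
    -- inverse.
    simp [splitMetric, Matrix.mul_apply, Fin.sum_univ_four, hd] at e02 e13
    refine ⟨(Units.mkOfMulEqOne _ _ e02, Units.mkOfMulEqOne _ _ e13), ?_⟩
    ext i j
    by_cases hij : i = j
    · subst hij
      fin_cases i <;> simp [torusMatrix, torusWeight, Units.mkOfMulEqOne]
    · rw [hd i j hij, torusMatrix, Matrix.diagonal_apply_ne _ hij]
  · have hX := blockMat_blockCoord X.2
    constructor
    · rintro ⟨k, hk⟩ i j hij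
      show skewMat (blockCoord X) i j = 0
      rw [hk]
      fin_cases i <;> fin_cases j <;> simp [skewMat, blockCoord, torusLie] at hij ⊢
    · intro hD
      have hD' : ∀ i j, i ≠ j → skewMat (blockCoord X) i j = 0 := fun i j hij => hD hij
      have h01 : (X : Matrix (Fin 4) (Fin 4) ℝ) 0 1 = 0 := hD' 0 1 (show (0 : Fin 4) ≠ 1 by decide)
      have h10 : (X : Matrix (Fin 4) (Fin 4) ℝ) 1 0 = 0 := hD' 1 0 (show (1 : Fin 4) ≠ 0 by decide)
      have h23 : (X : Matrix (Fin 4) (Fin 4) ℝ) 2 3 = 0 := hD' 0 3 (show (0 : Fin 4) ≠ 3 by decide)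
      have h32 : (X : Matrix (Fin 4) (Fin 4) ℝ) 3 2 = 0 := hD' 3 0 (show (3 : Fin 4) ≠ 0 by decide)
      refine ⟨(2 * (X : Matrix (Fin 4) (Fin 4) ℝ) 0 0, 2 * (X : Matrix (Fin 4) (Fin 4) ℝ) 2 2), ?_⟩
      rw [← hX]
      ext i j
      fin_cases i <;> fin_cases j <;>
        simp [blockMat, blockCoord, torusLie, h01, h10, h23, h32] <;> ring

end Model

end PKE

theorem mainTheorem9 {M : Type u} [TopologicalSpace M] [T2Space M] [SecondCountableTopology M]
    [ChartedSpace PKE.E4 M] [IsManifold (𝓡 4) ∞ M]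
    (g : PKE.BilinField M) (K : PKE.EndField M) (hgK : PKE.IsParaKahlerEinstein g K)
    (c : ℝ) (hc : c ≠ 0) (hΨ : ∀ θ : PKE.Coframe M, PKE.Adapted g K θ → PKE.psi2' g θ = c)
    (t : PKE.PetrovType) (ht : ∀ p : M, PKE.HasPetrovType g K p t) :
    PKE.TorusModel ∧
    -- local existence of the principal `T²`-bundle of normalized adapted coframes
    (∀ p : M, ∃ F ⊆ PKE.F7 g K t, (t ≠ .N → F ⊆ PKE.F6 g K t) ∧ (∃ θ ∈ F, θ.pt = p) ∧
      Nonempty (PKE.TorusReduction F)) ∧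
    -- global existence where the normalization determines the bundle
    (t = .IIr ∨ t = .IIc ∨ t = .III ∨ (t = .N ∧ ∀ θ ∈ PKE.F7 g K t, PKE.psi44 g θ ≠ 0) →
      (∀ p : M, ∃ θ ∈ PKE.F6 g K t, θ.pt = p) ∧ Nonempty (PKE.TorusReduction (PKE.F6 g K t))) ∧
    -- structure equations, Cartan connection and flatness
    (∀ F ⊆ PKE.F7 g K t, ∀ R : PKE.TorusReduction F,
      ∃ (Γ : Fin 2 → Fin 2 → PKE.Form1 PKE.E6 R.P) (J : Fin 6 → R.P → ℝ),
        (∀ A B, PKE.SmoothForm (Γ A B)) ∧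
        (∀ i, ContMDiff 𝓘(ℝ, PKE.E6) 𝓘(ℝ, ℝ) ∞ (J i)) ∧
        R.StructureEquations g Γ ∧ R.ReducedForms Γ J ∧
        (t = .N → ∀ u, PKE.psi44 g (R.frame u) = J 1 u * PKE.psi g (R.frame u) 4) ∧
        (∀ σ : ℝ, σ = 1 ∨ σ = -1 → R.IsCartanConnection (R.cartanB Γ c σ)) ∧
        (∀ σ : ℝ, σ = 1 ∨ σ = -1 → 0 < σ * c →
          (PKE.Flat (R.cartanB Γ c σ) ↔
            ∀ u, (∀ i, J i u = 0) ∧ PKE.psi g (R.frame u) 4 = 0 ∧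
              PKE.psi g (R.frame u) 2 = c) ∧
          (PKE.Flat (R.cartanB Γ c σ) →
            ∀ u, PKE.HasPetrovType g K (R.frame u).pt .D))) := by
  refine ⟨PKE.torusModel, fun p => PKE.exists_torusReduction hgK hΨ ht p,
    fun hN => PKE.nonempty_torusReduction_F6 hgK hΨ ht hN, fun F hF R => ?_⟩
  -- One choice of connection forms and invariants serves all the assertions and both signs `σ`.
  refine ⟨R.Γ, R.J,
    fun A B => PKE.smoothForm_iff.2 fun u => PKE.TorusReduction.smoothFormAt_Γ hgK hΨ hF A B u,
    PKE.TorusReduction.smooth_J hgK hΨ hF, PKE.TorusReduction.structureEquations hgK hΨ hF,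
    PKE.TorusReduction.reducedForms hgK hΨ hF, ?_,
    fun σ hσ => PKE.TorusReduction.isCartanConnection hgK hΨ hF hc hσ, fun σ hσ hp =>
      ⟨PKE.TorusReduction.flat_iff hgK hΨ hF hc hσ hp,
        PKE.TorusReduction.hasPetrovType_of_flat hgK hΨ hF hc hσ hp⟩⟩
  rintro rfl
  exact PKE.TorusReduction.psi44_eq hgK hΨ hF
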